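/- **Setting.** Let $d\in\{1,2,3\}$, $\alpha\in(0,1)$, $m\in(d-2\alpha,d)$, $t\in(\frac{d-m}{2},\alpha)$ and $\epsilon>0$. For $s,\delta\in\mathbb R$ let $\|\phi\|_{H^s_\delta}=\|\langle\cdot\rangle^{\delta}(I-\Delta)^{s/2}\phi\|_{L^2(\mathbb R^d)}$, $\langle x\rangle=(1+|x|^2)^{1/2}$, and let $H^s_\delta=H^s_\delta(\mathbb R^d)$ be the space of distributions for which this norm is finite. For $k>0$ let $$G^k(x)=\frac{1}{(2\pi)^{d}}\,\mathrm{p.v.}\!\int_{\mathbb R^d}\frac{e^{\mathrm i x\cdot\xi}}{|\xi|^{2\alpha}-k^{2\alpha}}\,d\xi+\widetilde C_{k,d,\alpha}\,G^{k,0}(x)$$ be the radiating fundamental solution of $(-\Delta)^\alpha-k^{2\alpha}$, where $G^{k,0}(x)=\cos(k|x|),\ J_0(k|x|),\ \frac{\sin(k|x|)}{|x|}$ and $\widetilde C_{k,d,\alpha}=\frac{\mathrm i k^{1-2\alpha}}{2\alpha},\ \frac{\mathrm i k^{2-2\alpha}}{4\alpha},\ \frac{\mathrm i k^{2-2\alpha}}{4\pi\alpha}$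 for $d=1,2,3$ respectively. For a distribution $\varphi$ of compact support put $\mathcal H_k\varphi=\int G^k(\cdot-z)\varphi(z)\,dz$, and put $\mathcal K_k\varphi=\int G^k(\cdot-z)q(z)\varphi(z)\,dz$, where $q\in L^2(U)$ is a (deterministic) potential, extended by zero, and $U\subset\mathbb R^d$ is a bounded open set. Let $D\subset\mathbb R^d$ be a bounded open set and let $f$ be a centered complex-valued generalized Gaussian random field on a probability space $(\Omega,\mathcal F,P)$, almost surely compactly supported in $D$ and microlocally isotropic of order $-m$ in $D$: the covariance operator $(\mathfrak C\varphi)(\psi)=\mathbb E(\langle\overline f,\varphi\rangle\langle f,\psi\rangle)$ and the relation operator $(\mathfrak R\varphi)(\psi)=\mathbb E(\langle f,\varphi\rangle\langle f,\psi\rangle)$ are pseudo-differential operators whose symbols lie in $S^{-m}(\mathbb R^d\times\mathbb R^d)$ and have the form $\mu(x)|\xi|^{-m}+O(|\xi|^{-m-1})$ as $|\xi|\to\infty$, with some nonnegative $\mu\in C_0^\infty(D)$ (one for each operator). **Theorem.** If the wavenumber $k>0$ is such that $\|\mathcal K_k\|_{\mathcal L(H^t_{-1/2-\epsilon})}<1$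 (in particular $\mathcal K_k$ maps $H^t_{-1/2-\epsilon}$ into itself), then there is a stochastic process $u:\mathbb R^d\to\mathbb C$, jointly measurable in $(x,\omega)$, such that almost surely $u(\cdot,\omega)\in H^t_{-1/2-\epsilon}$ is the unique solution in $H^t_{-1/2-\epsilon}$ of the Lippmann--Schwinger equation $$(I+\mathcal K_k)u=\mathcal H_kf .$$ Moreover, almost surely $f\in H^{-t}_{1/2+\epsilon}$ and $$\|u\|_{H^t_{-1/2-\epsilon}}\le C\,\|f\|_{H^{-t}_{1/2+\epsilon}} .$$ Here $C$ does not depend on $f$, on $\omega\in\Omega$ or on $q$; and for any $0<k_0\le k_1$ and $\rho<1$ the constant can be chosen the same for all $k\in[k_0,k_1]$ and all $q$ with $\|\mathcal K_k\|_{\mathcal L(H^t_{-1/2-\epsilon})}\le\rho$. -/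

import Mathlib

open MeasureTheory Filter Topology Set
open ProbabilityTheory (HasGaussianLaw)
open scoped SchwartzMap ENNReal NNReal InnerProductSpace

noncomputable section

namespace FracHelmholtz

/-- The Euclidean space `ℝ^d`. -/
abbrev Space (d : ℕ) := EuclideanSpace ℝ (Fin d)

variable {d : ℕ}

/-! ### Weighted Sobolev spaces -/

/-- The Japanese bracket `⟨x⟩ = (1 + |x|²)^{1/2}`. -/
def bracket (x : Space d) : ℝ := Real.sqrt (1 + ‖x‖ ^ 2)

/-- The distribution `T` is (given by integration against) the locally integrable function `g`. -/
def IsRepresentedBy (T : 𝓢'(Space d, ℂ)) (g : Space d → ℂ) : Prop :=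
  LocallyIntegrable g volume ∧
    ∀ ψ : 𝓢(Space d, ℂ), HasCompactSupport ψ → T ψ = ∫ x, g x * ψ x

/-- The operator `(I - Δ)^{s/2}`. In Mathlib's normalisation of the Fourier transform (`e^{-2πi x·η}`)
its symbol is `(1 + |2πη|²)^{s/2}`. -/
def besselOp (s : ℝ) : 𝓢'(Space d, ℂ) →L[ℂ] 𝓢'(Space d, ℂ) :=
  TemperedDistribution.fourierMultiplierCLM ℂ
    (fun η : Space d ↦ (((1 + ‖(2 * Real.pi) • η‖ ^ 2) ^ (s / 2) : ℝ) : ℂ))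

/-- The norm `‖T‖_{H^s_δ} = ‖⟨·⟩^δ (I - Δ)^{s/2} T‖_{L²}`, equal to `∞` if `(I - Δ)^{s/2} T` is not a
locally integrable function. (The representing function is unique almost everywhere, so that the
infimum is over a single value.) The space `H^s_δ` consists of the `T` of finite norm. -/
def sobolevNorm (s δ : ℝ) (T : 𝓢'(Space d, ℂ)) : ℝ≥0∞ :=
  ⨅ (g : Space d → ℂ) (_ : IsRepresentedBy (besselOp s T) g),
    eLpNorm (fun x ↦ ((bracket x ^ δ : ℝ) : ℂ) * g x) 2 volume

/-! ### The radiating Green's function -/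

/-- The Fourier transform `φ̂(ξ) = ∫ e^{-i x·ξ} φ(x) dx`. -/
def ft (φ : Space d → ℂ) (ξ : Space d) : ℂ :=
  ∫ x, Complex.exp (-(Complex.I * (⟪x, ξ⟫_ℝ : ℂ))) * φ x

/-- The Bessel function `J_0`. -/
def besselJZero (z : ℝ) : ℝ := ∑' n : ℕ, (-1 : ℝ) ^ n * (z ^ 2 / 4) ^ n / (n.factorial : ℝ) ^ 2

/-- The solution `G^{k,0}` of the homogeneous equation: `cos(k|x|)`, `J_0(k|x|)`, `sin(k|x|)/|x|`
in dimension 1, 2, 3. -/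
def greenHom (k : ℝ) (x : Space d) : ℝ :=
  match d with
  | 1 => Real.cos (k * ‖x‖)
  | 2 => besselJZero (k * ‖x‖)
  | _ => Real.sin (k * ‖x‖) / ‖x‖

/-- The constant in front of `G^{k,0}`, in dimension 1, 2, 3, that cancels the incoming wave. -/
def greenConst (d : ℕ) (α k : ℝ) : ℂ :=
  match d with
  | 1 => Complex.I * ((k ^ (1 - 2 * α) / (2 * α) : ℝ) : ℂ)
  | 2 => Complex.I * ((k ^ (2 - 2 * α) / (4 * α) : ℝ) : ℂ)
  | _ => Complex.I * ((k ^ (2 - 2 * α) / (4 * Real.pi * α) : ℝ) : ℂ)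

/-- The pairing of a Schwartz function `ψ` with
`G^{k,δ}(x) = (2π)^{-d} p.v. ∫ e^{i x·ξ} / (|ξ|^{2α} - k^{2α}) dξ`
(principal value at the sphere `|ξ| = k`). -/
def greenPV (α k : ℝ) (ψ : 𝓢(Space d, ℂ)) : ℂ :=
  (((2 * Real.pi) ^ d : ℝ) : ℂ)⁻¹ *
    limUnder (𝓝[>] (0 : ℝ)) (fun r ↦
      ∫ ξ in {ξ : Space d | r < |‖ξ‖ - k|},
        ft ψ (-ξ) / ((‖ξ‖ ^ (2 * α) - k ^ (2 * α) : ℝ) : ℂ))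

/-- The pairing `⟨G^k, ψ⟩ = ∫ G^k(x) ψ(x) dx`, where `G^k = G^{k,δ} + C̃_{k,d,α} G^{k,0}` is the
radiating fundamental solution of `(-Δ)^α - k^{2α}`. -/
def green (α k : ℝ) (ψ : 𝓢(Space d, ℂ)) : ℂ :=
  greenPV α k ψ + greenConst d α k * ∫ x, (greenHom k x : ℂ) * ψ x

/-! ### The operators `H_k` and `K_k` -/

/-- `v = ∫ G^k(· - z) T(z) dz`, the convolution of `G^k` with the distribution `T` of compact support:
`⟨v, ψ⟩ = ⟨T_z, ⟨G^k, ψ(z + ·)⟩⟩`. The smooth function `z ↦ ⟨G^k, ψ(z + ·)⟩` is replaced by a Schwartz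
function `η` which equals it in a neighbourhood of the support of `T`. -/
def IsGreenConvolution (α k : ℝ) (T v : 𝓢'(Space d, ℂ)) : Prop :=
  ∀ ψ : 𝓢(Space d, ℂ), ∃ η : 𝓢(Space d, ℂ),
    (∃ V : Set (Space d), IsOpen V ∧ Distribution.dsupport T ⊆ V ∧
      ∀ z ∈ V, η z = green α k (ψ.compSubConstCLM ℂ (-z))) ∧
    v ψ = T η

open Classical in
/-- The resolvent operator `H_k T = ∫ G^k(· - z) T(z) dz`, for distributions `T` of compact support. -/
def resolventOp (α k : ℝ) (T : 𝓢'(Space d, ℂ)) : 𝓢'(Space d, ℂ) :=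
  if h : ∃ v, IsGreenConvolution α k T v then h.choose else 0

open Classical in
/-- The product `q φ` of a function `q` with a distribution `φ` which is a function `g` such that
`q g` is integrable. -/
def mulFun (q : Space d → ℂ) (φ : 𝓢'(Space d, ℂ)) : 𝓢'(Space d, ℂ) :=
  if h : ∃ g : Space d → ℂ, IsRepresentedBy φ g ∧ Integrable (fun x ↦ q x * g x) volume then
    Lp.toTemperedDistribution (h.choose_spec.2.toL1 (fun x ↦ q x * h.choose x))
  else 0

/-- The operator `K_k φ = ∫ G^k(· - z) q(z) φ(z) dz`. -/
def potentialOp (α k : ℝ) (q : Space d → ℂ) (φ : 𝓢'(Space d, ℂ)) : 𝓢'(Space d, ℂ) :=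
  resolventOp α k (mulFun q φ)

/-- The operator norm of `K_k` on `H^s_δ` (infinite if `K_k` does not map `H^s_δ` boundedly into
itself). -/
def potentialOpNorm (α k : ℝ) (q : Space d → ℂ) (s δ : ℝ) : ℝ≥0∞ :=
  ⨆ (φ : 𝓢'(Space d, ℂ)) (_ : sobolevNorm s δ φ ≤ 1), sobolevNorm s δ (potentialOp α k q φ)

/-- `u` is a solution in `H^s_δ` of the Lippmann--Schwinger equation `(I + K_k) u = H_k f`. -/
def IsLippmannSchwingerSolution (α k : ℝ) (q : Space d → ℂ) (s δ : ℝ)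
    (f u : 𝓢'(Space d, ℂ)) : Prop :=
  sobolevNorm s δ u < ∞ ∧ u + potentialOp α k q u = resolventOp α k f

/-! ### Generalized microlocally isotropic Gaussian random fields -/

/-- The complex conjugate of a test function. -/
def conjTest (φ : 𝓢(Space d, ℂ)) : 𝓢(Space d, ℂ) :=
  φ.postcompCLM (𝕜 := ℝ) (Complex.conjCLE : ℂ →L[ℝ] ℂ)

/-- The symbol class `S^r(ℝ^d × ℝ^d)`: smooth functions `σ(x, ξ)` whose derivatives of order `i` in `x`
and `j` in `ξ` are bounded by a multiple of `(1 + |ξ|)^{r - j}`. -/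
def IsSymbol (r : ℝ) (σ : Space d → Space d → ℂ) : Prop :=
  ContDiff ℝ ((⊤ : ℕ∞) : WithTop ℕ∞) (Function.uncurry σ) ∧
    ∀ i j : ℕ, ∃ C : ℝ, ∀ x ξ : Space d,
      ‖iteratedFDeriv ℝ i (fun x' ↦ iteratedFDeriv ℝ j (σ x') ξ) x‖ ≤ C * (1 + ‖ξ‖) ^ (r - j)

/-- The symbol `σ` in `S^{-m}` has the form `μ(x) |ξ|^{-m} + O(|ξ|^{-m-1})` with a nonnegative
`μ ∈ C_0^∞(D)`. -/
def IsIsotropicSymbol (D : Set (Space d)) (m : ℝ) (σ : Space d → Space d → ℂ) : Prop :=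
  IsSymbol (-m) σ ∧
    ∃ μ : Space d → ℝ, ContDiff ℝ ((⊤ : ℕ∞) : WithTop ℕ∞) μ ∧ HasCompactSupport μ ∧ tsupport μ ⊆ D ∧ (∀ x, 0 ≤ μ x) ∧
      ∃ C : ℝ, ∀ x ξ : Space d, 1 ≤ ‖ξ‖ →
        ‖σ x ξ - ((μ x * ‖ξ‖ ^ (-m) : ℝ) : ℂ)‖ ≤ C * ‖ξ‖ ^ (-m - 1)

/-- The pseudo-differential operator with symbol `σ`:
`(Op(σ) φ)(x) = (2π)^{-d} ∫ e^{i x·ξ} σ(x, ξ) φ̂(ξ) dξ`. -/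
def pseudoDiff (σ : Space d → Space d → ℂ) (φ : Space d → ℂ) (x : Space d) : ℂ :=
  (((2 * Real.pi) ^ d : ℝ) : ℂ)⁻¹ *
    ∫ ξ, Complex.exp (Complex.I * (⟪x, ξ⟫_ℝ : ℂ)) * σ x ξ * ft φ ξ

variable {Ω : Type*} [MeasurableSpace Ω]

/-- `h` is a centered complex-valued generalized Gaussian random field which is microlocally isotropic
of order `-m` in `D`: all pairings with test functions are centered complex Gaussian variables (the
real and the imaginary part are jointly Gaussian), and the covariance operator
`(C φ)(ψ) = E(⟨h̄, φ⟩ ⟨h, ψ⟩)` and the relation operator `(R φ)(ψ) = E(⟨h, φ⟩ ⟨h, ψ⟩)` are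
pseudo-differential operators of order `-m` with isotropic principal symbol, where
`⟨h̄, φ⟩` is the conjugate of `⟨h, φ̄⟩`. -/
structure IsGMIGField (P : Measure Ω) (D : Set (Space d)) (m : ℝ)
    (h : Ω → 𝓢'(Space d, ℂ)) : Prop where
  gaussian : ∀ ψ : 𝓢(Space d, ℂ), HasCompactSupport ψ → HasGaussianLaw (fun ω ↦ h ω ψ) P
  centered : ∀ ψ : 𝓢(Space d, ℂ), HasCompactSupport ψ → ∫ ω, h ω ψ ∂P = 0
  covariance : ∃ σ : Space d → Space d → ℂ, IsIsotropicSymbol D m σ ∧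
    ∀ φ ψ : 𝓢(Space d, ℂ), HasCompactSupport φ → HasCompactSupport ψ →
      ∫ ω, (starRingEnd ℂ) (h ω (conjTest φ)) * h ω ψ ∂P = ∫ x, pseudoDiff σ φ x * ψ x
  relation : ∃ σ : Space d → Space d → ℂ, IsIsotropicSymbol D m σ ∧
    ∀ φ ψ : 𝓢(Space d, ℂ), HasCompactSupport φ → HasCompactSupport ψ →
      ∫ ω, h ω φ * h ω ψ ∂P = ∫ x, pseudoDiff σ φ x * ψ x

end FracHelmholtz

end

open FracHelmholtz

/-!
The theorem combines three facts about the weighted spaces `H^s_δ`. Their elements are parametrised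
by `L²` through the isometry `sobolevMap`, and membership is detected by duality with Schwartz
functions (`exists_sobolevMap_of_bound`).

*The limiting absorption principle.* The Green's function pairs with a test function as the
principal value of an integral of its Fourier transform against `1 / (|ξ|^{2α} - k^{2α})`, plus a
mean over the sphere `|ξ| = k`. After multiplication by `⟨ξ⟩^{2t}` with `t ≤ α`, the symbol is a
bounded function of `ρ = |ξ|` plus a multiple of the pole `1 / (ρ - k)`
(`exists_regularPart_bound`). The bounded part is controlled by Plancherel's theorem. For the pole,
a product of Fourier transforms of two functions in `L²` with a weight of order `s > 1/2` has
Hölder continuous restrictions to lines, by the one-dimensional Sobolev embedding; writing `1 = ∑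
ξ_j² / |ξ|²` and changing variables along lines in the coordinate directions, this gives enough
regularity in the radial variable to pair with `1 / (ρ - k)` and with a point mass at `ρ = k`
(`exists_norm_integral_radial_le`). The result is the form bound `exists_norm_green_le`, which is
locally uniform in `k`; by mollification and duality, `φ ↦ ∫ G^k(· - z) φ(z) dz` is bounded from
the compactly supported elements of `H^{-t}_s` to `H^t_{-s}` (`exists_isGreenConvolution`).

*Regularity of the field.* By the symbol bound on the covariance operator, the second moments of
the Fourier transform of a localisation of `f` decay like `⟨ξ⟩^{-m}`. As `2t + m > d`, the
localisation is almost surely in `H^{-t}`. The same applies to its products with powers of the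
coordinates, and commuting these with the Bessel potential gives `f ∈ H^{-t}_s`
(`IsGMIGField.ae_exists_sobolevMap`).

*The Neumann series.* Elements of `H^t_{-s}` with `t ≥ 0` are functions, so that the potential
operator is linear on `H^t_{-s}`, and by hypothesis it is a contraction there
(`exists_potentialOp_eq`). Hence `I + K_k` is invertible with inverse bounded by `(1 - ρ)⁻¹`, which
gives existence, uniqueness and the estimate. Pairings of the solution with test functions are
random variables, and a weakly measurable random element of `L²` has a jointly measurable version,
the limit of its mollifications (`exists_measurable_uncurry_ae_eq`).
-/


set_option maxSynthPendingDepth 3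

noncomputable section

namespace FracHelmholtz

variable {d : ℕ}

section

open FourierTransform TemperedDistribution

/-! ### Weights and Bessel potentials -/

theorem bracket_pos (x : Space d) : 0 < bracket x := Real.sqrt_pos.2 (by positivity)

theorem one_le_bracket (x : Space d) : 1 ≤ bracket x :=
  Real.one_le_sqrt.2 (by nlinarith [sq_nonneg ‖x‖])

theorem bracket_rpow (δ : ℝ) (x : Space d) : bracket x ^ δ = (1 + ‖x‖ ^ 2) ^ (δ / 2) := by
  rw [bracket, Real.sqrt_eq_rpow, ← Real.rpow_mul (by positivity)]
  congr 1
  ring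

/-- The weight `⟨x⟩^δ` as a complex-valued function. -/
def weight (δ : ℝ) (x : Space d) : ℂ := ((bracket x ^ δ : ℝ) : ℂ)

@[fun_prop]
theorem weight_hasTemperateGrowth (δ : ℝ) : (weight δ : Space d → ℂ).HasTemperateGrowth := by
  have : (weight δ : Space d → ℂ) = fun x ↦ (((1 + ‖x‖ ^ 2) ^ (δ / 2) : ℝ) : ℂ) := by
    ext x; rw [weight, bracket_rpow]
  rw [this]
  fun_prop

theorem weight_continuous (δ : ℝ) : Continuous (weight δ : Space d → ℂ) :=
  (weight_hasTemperateGrowth δ).1.continuous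

theorem weight_mul_weight (δ δ' : ℝ) (x : Space d) :
    weight δ x * weight δ' x = weight (δ + δ') x := by
  rw [weight, weight, weight, Real.rpow_add (bracket_pos x), Complex.ofReal_mul]

@[simp]
theorem weight_zero (x : Space d) : weight 0 x = 1 := by simp [weight]

theorem norm_weight (δ : ℝ) (x : Space d) : ‖weight δ x‖ = bracket x ^ δ := by
  rw [weight, Complex.norm_real, Real.norm_of_nonneg (Real.rpow_nonneg (bracket_pos x).le _)]

/-- The symbol `(1 + |2πη|²)^{s/2}` of `(I - Δ)^{s/2}`. -/
def besselSymbol (s : ℝ) (η : Space d) : ℂ := (((1 + ‖(2 * Real.pi) • η‖ ^ 2) ^ (s / 2) : ℝ) : ℂ)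

theorem besselSymbol_eq (s : ℝ) (η : Space d) :
    besselSymbol s η = weight s ((2 * Real.pi) • η) := by
  rw [besselSymbol, weight, bracket_rpow]

@[fun_prop]
theorem besselSymbol_hasTemperateGrowth (s : ℝ) :
    (besselSymbol s : Space d → ℂ).HasTemperateGrowth := by
  have : (besselSymbol s : Space d → ℂ) =
      weight s ∘ ((2 * Real.pi) • ContinuousLinearMap.id ℝ (Space d)) := by
    ext x; simp [besselSymbol_eq]
  rw [this]
  exact (weight_hasTemperateGrowth s).comp (ContinuousLinearMap.hasTemperateGrowth _)

theorem besselSymbol_neg_arg (s : ℝ) (η : Space d) : besselSymbol s (-η) = besselSymbol s η := by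
  simp [besselSymbol]

theorem besselSymbol_mul (s s' : ℝ) :
    (besselSymbol s : Space d → ℂ) * besselSymbol s' = besselSymbol (s + s') := by
  ext η
  simp [besselSymbol_eq, weight_mul_weight]

@[simp]
theorem besselSymbol_zero : (besselSymbol 0 : Space d → ℂ) = fun _ ↦ 1 := by
  ext η; simp [besselSymbol_eq]

/-- The Bessel potential `(I - Δ)^{s/2}` on Schwartz functions. -/
def besselS (s : ℝ) : 𝓢(Space d, ℂ) →L[ℂ] 𝓢(Space d, ℂ) :=
  SchwartzMap.fourierMultiplierCLM ℂ (besselSymbol s)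

theorem schwartz_fourier_eq_fourierInv_neg (φ : 𝓢(Space d, ℂ)) (x : Space d) :
    (𝓕 φ) x = (𝓕⁻ φ) (-x) := by
  rw [SchwartzMap.fourier_coe, SchwartzMap.fourierInv_coe, Real.fourierInv_eq_fourier_neg, neg_neg]

/-- A Fourier multiplier on tempered distributions is the transpose of the multiplier with the
reflected symbol. -/
theorem fourierMultiplierCLM_apply_eq {m : Space d → ℂ} (hm : m.HasTemperateGrowth)
    (T : 𝓢'(Space d, ℂ)) (ψ : 𝓢(Space d, ℂ)) :
    TemperedDistribution.fourierMultiplierCLM ℂ m T ψ =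
      T (SchwartzMap.fourierMultiplierCLM ℂ (fun η ↦ m (-η)) ψ) := by
  rw [TemperedDistribution.fourierMultiplierCLM_apply_apply]
  congr 1
  have hm' : (fun η ↦ m (-η)).HasTemperateGrowth :=
    hm.comp (f := fun η : Space d ↦ -η) (by fun_prop)
  ext x
  rw [SchwartzMap.fourierMultiplierCLM_apply, SchwartzMap.fourier_coe, SchwartzMap.fourierInv_coe,
    Real.fourier_eq, Real.fourierInv_eq, ← integral_neg_eq_self]
  congr 1
  ext η
  rw [SchwartzMap.smulLeftCLM_apply_apply hm, SchwartzMap.smulLeftCLM_apply_apply hm',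
    schwartz_fourier_eq_fourierInv_neg]
  simp

theorem besselOp_apply (s : ℝ) (T : 𝓢'(Space d, ℂ)) (ψ : 𝓢(Space d, ℂ)) :
    besselOp s T ψ = T (besselS s ψ) := by
  rw [besselS, show besselOp s T = TemperedDistribution.fourierMultiplierCLM ℂ (besselSymbol s) T
    from rfl, fourierMultiplierCLM_apply_eq (by fun_prop)]
  simp_rw [besselSymbol_neg_arg]

theorem besselS_besselS (s s' : ℝ) (ψ : 𝓢(Space d, ℂ)) :
    besselS s (besselS s' ψ) = besselS (s + s') ψ := by
  rw [besselS, besselS, SchwartzMap.fourierMultiplierCLM_fourierMultiplierCLM_apply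
    (by fun_prop) (by fun_prop), besselSymbol_mul]
  rfl

@[simp]
theorem besselS_zero (ψ : 𝓢(Space d, ℂ)) : besselS 0 ψ = ψ := by
  simp [besselS]

theorem besselOp_besselOp (s s' : ℝ) (T : 𝓢'(Space d, ℂ)) :
    besselOp s (besselOp s' T) = besselOp (s + s') T := by
  ext ψ
  simp only [besselOp_apply, besselS_besselS, add_comm]

@[simp]
theorem besselOp_zero (T : 𝓢'(Space d, ℂ)) : besselOp 0 T = T := by
  ext ψ
  simp [besselOp_apply]

/-! ### Density of compactly supported test functions -/

/-- A smooth compactly supported function which is `1` near a compact set. -/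
theorem exists_smooth_cutoff {K U : Set (Space d)} (hK : IsCompact K) (hU : IsOpen U)
    (hKU : K ⊆ U) : ∃ χ : 𝓢(Space d, ℂ), HasCompactSupport χ ∧ tsupport χ ⊆ U ∧
      (∃ V, IsOpen V ∧ K ⊆ V ∧ ∀ x ∈ V, χ x = 1) ∧ ∀ x, ‖χ x‖ ≤ 1 := by
  obtain ⟨L, hL, hKL, hLU⟩ := exists_compact_between hK hU hKU
  obtain ⟨f, hf1, hf0, hf⟩ := exists_contMDiffMap_one_nhds_of_subset_interior
    (n := ((⊤ : ℕ∞) : ℕ∞)) (modelWithCornersSelf ℝ (Space d)) hK.isClosed hKL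
  have hfs : tsupport f ⊆ L := by
    refine closure_minimal (fun x hx ↦ ?_) hL.isClosed
    by_contra h
    exact hx (hf0 x h)
  have hfc : HasCompactSupport f := HasCompactSupport.of_support_subset_isCompact hL
    ((subset_tsupport f).trans hfs)
  have hg1 : HasCompactSupport (Complex.ofRealCLM ∘ f) := hfc.comp_left rfl
  have hg2 : ContDiff ℝ ((⊤ : ℕ∞) : WithTop ℕ∞) (Complex.ofRealCLM ∘ f) :=
    Complex.ofRealCLM.contDiff.comp f.contMDiff.contDiff
  obtain ⟨V, hV, hKV, hV1⟩ := mem_nhdsSet_iff_exists.1 hf1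
  refine ⟨hg1.toSchwartzMap hg2, hg1, (tsupport_comp_subset (g := Complex.ofRealCLM) (map_zero _)
    f).trans (hfs.trans hLU),
    ⟨V, hV, hKV, fun x hx ↦ ?_⟩, fun x ↦ ?_⟩
  · have : f x = 1 := hV1 hx
    simp [this]
  · have := hf x
    simp [abs_le]
    exact ⟨by linarith [this.1], this.2⟩

theorem tendsto_schwartz_of_seminorm {ι : Type*} {l : Filter ι} {u : ι → 𝓢(Space d, ℂ)}
    {φ : 𝓢(Space d, ℂ)}
    (h : ∀ k n : ℕ, Tendsto (fun i ↦ SchwartzMap.seminorm ℂ k n (u i - φ)) l (𝓝 0)) :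
    Tendsto u l (𝓝 φ) := by
  rw [(schwartz_withSeminorms ℂ (Space d) ℂ).tendsto_nhds]
  intro p ε hε
  exact (h p.1 p.2).eventually_lt_const hε

theorem continuous_temperedDistribution (T : 𝓢'(Space d, ℂ)) : Continuous T :=
  T.cont

/-- Compactly supported test functions are dense: every Schwartz function is the limit of its
products with a sequence of cutoffs. -/
theorem exists_compactSupport_tendsto (φ : 𝓢(Space d, ℂ)) :
    ∃ χ : ℕ → 𝓢(Space d, ℂ), (∀ N, HasCompactSupport (χ N)) ∧
      Tendsto (fun N ↦ SchwartzMap.smulLeftCLM ℂ (χ N) φ) atTop (𝓝 φ) := by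
  obtain ⟨χ, hχc, -, ⟨V, hV, hKV, hV1⟩, hχb⟩ := exists_smooth_cutoff (d := d)
    (isCompact_closedBall (0 : Space d) 1) isOpen_univ (subset_univ _)
  have hc : ∀ N : ℕ, HasCompactSupport (fun x ↦ χ (((N : ℝ) + 1)⁻¹ • x)) := fun N ↦ by
    refine hχc.comp_homeomorph (Homeomorph.smulOfNeZero (((N : ℝ) + 1)⁻¹) (by positivity))
  have hs : ∀ N : ℕ, ContDiff ℝ ((⊤ : ℕ∞) : WithTop ℕ∞) (fun x ↦ χ (((N : ℝ) + 1)⁻¹ • x)) :=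
    fun N ↦ (χ.smooth ⊤).comp (by fun_prop)
  refine ⟨fun N ↦ (hc N).toSchwartzMap (hs N), hc, tendsto_schwartz_of_seminorm fun k n ↦ ?_⟩
  -- the derivatives of `1 - χ_N` are bounded uniformly in `N`, and vanish on the ball of radius `N`
  have hbd : ∀ i : ℕ, ∃ C : ℝ, 0 ≤ C ∧ ∀ (N : ℕ) (x : Space d),
      ‖iteratedFDeriv ℝ i (fun x ↦ χ (((N : ℝ) + 1)⁻¹ • x) - 1) x‖ ≤ C := by
    intro i
    have hχ1 : ContDiff ℝ i (fun x ↦ χ x - 1) := ((χ.smooth i).sub contDiff_const)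
    refine ⟨SchwartzMap.seminorm ℂ 0 i χ + 1, by positivity, fun N x ↦ ?_⟩
    rw [iteratedFDeriv_comp_const_smul (f := fun x ↦ χ x - 1) _ hχ1]
    have h1 : ‖(((N : ℝ) + 1)⁻¹) ^ i‖ ≤ 1 := by
      rw [norm_pow, Real.norm_of_nonneg (by positivity)]
      exact pow_le_one₀ (by positivity) (inv_le_one_of_one_le₀
        (by linarith [(Nat.cast_nonneg N : (0:ℝ) ≤ N)]))
    rw [norm_smul]
    refine (mul_le_of_le_one_left (norm_nonneg _) h1).trans ?_
    rcases Nat.eq_zero_or_pos i with rfl | hi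
    · rw [norm_iteratedFDeriv_zero]
      refine (norm_sub_le _ _).trans ?_
      rw [norm_one]
      gcongr
      exact SchwartzMap.norm_le_seminorm ℂ χ _
    · have : iteratedFDeriv ℝ i (fun x ↦ χ x - 1) = iteratedFDeriv ℝ i χ := by
        ext1 y
        change iteratedFDeriv ℝ i (⇑χ - fun _ ↦ 1) y = _
        rw [iteratedFDeriv_sub_apply (χ.contDiffAt i) contDiffAt_const]
        simp [iteratedFDeriv_const_of_ne hi.ne']
      rw [this]
      linarith [SchwartzMap.norm_iteratedFDeriv_le_seminorm ℂ χ i ((((N : ℝ) + 1)⁻¹) • x)]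
  have hzero : ∀ (i N : ℕ) (x : Space d), ‖x‖ ≤ N + 1 →
      iteratedFDeriv ℝ i (fun x ↦ χ (((N : ℝ) + 1)⁻¹ • x) - 1) x = 0 := by
    intro i N x hx
    have : (fun x ↦ χ (((N : ℝ) + 1)⁻¹ • x) - 1) =ᶠ[𝓝 x] fun _ ↦ 0 := by
      have hx' : ((N : ℝ) + 1)⁻¹ • x ∈ V := hKV (by
        rw [mem_closedBall_zero_iff, norm_smul, norm_inv, Real.norm_of_nonneg (by positivity)]
        rw [inv_mul_le_iff₀ (by positivity)]; linarith)
      have hc : ContinuousAt (fun x : Space d ↦ ((N : ℝ) + 1)⁻¹ • x) x := by fun_prop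
      filter_upwards [hc.preimage_mem_nhds (hV.mem_nhds hx')] with y hy
      rw [hV1 _ hy, sub_self]
    rw [(this.iteratedFDeriv ℝ i).self_of_nhds]
    exact congrFun (iteratedFDeriv_fun_zero (𝕜 := ℝ) (E := Space d) (F := ℂ)) x
  choose C hC0 hC using hbd
  let B : ℝ := ∑ i ∈ Finset.range (n + 1), (n.choose i : ℝ) * C i *
    SchwartzMap.seminorm ℂ (k + 1) (n - i) φ
  have hB : 0 ≤ B := Finset.sum_nonneg fun i _ ↦ mul_nonneg (mul_nonneg (by positivity) (hC0 i))
    (apply_nonneg _ _)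
  -- where `χ_N - 1` does not vanish, one more power of `|x| ≥ N + 1` gives the decay in `N`
  have hle : ∀ N : ℕ, SchwartzMap.seminorm ℂ k n
      (SchwartzMap.smulLeftCLM ℂ ((hc N).toSchwartzMap (hs N)) φ - φ) ≤ B / ((N : ℝ) + 1) := by
    intro N
    refine SchwartzMap.seminorm_le_bound ℂ k n _ (by positivity) fun x ↦ ?_
    have heq : ⇑(SchwartzMap.smulLeftCLM ℂ ((hc N).toSchwartzMap (hs N)) φ - φ) =
        fun x ↦ (χ (((N : ℝ) + 1)⁻¹ • x) - 1) * φ x := by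
      ext y
      rw [sub_apply, SchwartzMap.smulLeftCLM_apply_apply (SchwartzMap.hasTemperateGrowth _)]
      simp [sub_mul]
    rw [heq]
    rcases le_or_gt ‖x‖ (N + 1) with hx | hx
    · have : iteratedFDeriv ℝ n (fun x ↦ (χ (((N : ℝ) + 1)⁻¹ • x) - 1) * φ x) x = 0 := by
        rw [← norm_le_zero_iff]
        refine (norm_iteratedFDeriv_mul_le (N := n) (((hs N).of_le (by exact_mod_cast le_top)).sub
          contDiff_const)
          (φ.smooth n) x le_rfl).trans ?_
        refine (Finset.sum_eq_zero fun i _ ↦ ?_).le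
        rw [hzero i N x hx]; simp
      rw [this]; simp; positivity
    · refine (mul_le_mul_of_nonneg_left (norm_iteratedFDeriv_mul_le (N := n)
        (((hs N).of_le (by exact_mod_cast le_top)).sub contDiff_const) (φ.smooth n) x le_rfl)
          (by positivity)).trans ?_
      rw [Finset.mul_sum, Finset.sum_div]
      refine Finset.sum_le_sum fun i _ ↦ ?_
      rw [le_div_iff₀ (by positivity)]
      calc ‖x‖ ^ k * (n.choose i * ‖iteratedFDeriv ℝ i (fun x ↦ χ (((N : ℝ) + 1)⁻¹ • x) - 1) x‖ *
            ‖iteratedFDeriv ℝ (n - i) φ x‖) * ((N : ℝ) + 1)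
          ≤ ‖x‖ ^ k * (n.choose i * C i * ‖iteratedFDeriv ℝ (n - i) φ x‖) * ‖x‖ := by
            have := hC0 i
            gcongr
            exact hC i N x
        _ = n.choose i * C i * (‖x‖ ^ (k + 1) * ‖iteratedFDeriv ℝ (n - i) φ x‖) := by ring
        _ ≤ _ := by
            gcongr
            · exact mul_nonneg (by positivity) (hC0 i)
            · exact SchwartzMap.le_seminorm ℂ (k + 1) (n - i) φ x
  refine squeeze_zero (fun N ↦ apply_nonneg _ _) hle ?_
  have := (tendsto_one_div_add_atTop_nhds_zero_nat (𝕜 := ℝ)).const_mul B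
  simpa [div_eq_mul_inv] using this

/-- A tempered distribution is determined by its values on compactly supported test functions. -/
theorem temperedDistribution_ext_of_compactSupport {T S : 𝓢'(Space d, ℂ)}
    (h : ∀ ψ : 𝓢(Space d, ℂ), HasCompactSupport ψ → T ψ = S ψ) : T = S := by
  ext φ
  obtain ⟨χ, hχ, hlim⟩ := exists_compactSupport_tendsto φ
  refine tendsto_nhds_unique (((continuous_temperedDistribution T).tendsto φ).comp hlim) ?_
  refine (((continuous_temperedDistribution S).tendsto φ).comp hlim).congr fun N ↦ ?_
  refine (h _ ?_).symm
  rw [SchwartzMap.smulLeftCLM_apply (SchwartzMap.hasTemperateGrowth _)]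
  exact (hχ N).smul_right

end

section

open FourierTransform TemperedDistribution

/-! ### Weighted Sobolev spaces as images of `L²` -/

theorem IsRepresentedBy.ae_eq {T : 𝓢'(Space d, ℂ)} {g g' : Space d → ℂ}
    (h : IsRepresentedBy T g) (h' : IsRepresentedBy T g') : g =ᵐ[volume] g' := by
  refine ae_eq_of_integral_contDiff_smul_eq h.1 h'.1 fun φ hφ hc ↦ ?_
  have hg1 : HasCompactSupport (Complex.ofRealCLM ∘ φ) := hc.comp_left rfl
  have hg2 : ContDiff ℝ ((⊤ : ℕ∞) : WithTop ℕ∞) (Complex.ofRealCLM ∘ φ) :=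
    Complex.ofRealCLM.contDiff.comp hφ
  have := (h.2 (hg1.toSchwartzMap hg2) hg1).symm.trans (h'.2 (hg1.toSchwartzMap hg2) hg1)
  simpa [mul_comm] using this

theorem IsRepresentedBy.congr_ae {T : 𝓢'(Space d, ℂ)} {g g' : Space d → ℂ}
    (h : IsRepresentedBy T g) (h' : g =ᵐ[volume] g') : IsRepresentedBy T g' := by
  refine ⟨h.1.congr h', fun ψ hψ ↦ (h.2 ψ hψ).trans (integral_congr_ae ?_)⟩
  filter_upwards [h'] with x hx
  rw [hx]

theorem integrable_mul_schwartz {g : Space d → ℂ} (hg : LocallyIntegrable g)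
    {ψ : 𝓢(Space d, ℂ)} (hψ : HasCompactSupport ψ) : Integrable (fun x ↦ g x * ψ x) := by
  simpa [mul_comm] using hg.integrable_smul_left_of_hasCompactSupport ψ.continuous hψ

theorem hasCompactSupport_smulLeft {m : Space d → ℂ} {ψ : 𝓢(Space d, ℂ)}
    (hψ : HasCompactSupport ψ) : HasCompactSupport (SchwartzMap.smulLeftCLM ℂ m ψ) :=
  hψ.mono' ((subset_tsupport _).trans
    ((SchwartzMap.tsupport_smulLeftCLM_subset m ψ).trans inter_subset_left))

theorem IsRepresentedBy.smulLeft {T : 𝓢'(Space d, ℂ)} {g m : Space d → ℂ}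
    (h : IsRepresentedBy T g) (hm : m.HasTemperateGrowth) :
    IsRepresentedBy (TemperedDistribution.smulLeftCLM ℂ m T) (fun x ↦ m x * g x) := by
  refine ⟨?_, fun ψ hψ ↦ ?_⟩
  · simpa [mul_comm] using h.1.smul_continuous hm.1.continuous
  · rw [TemperedDistribution.smulLeftCLM_apply_apply, h.2 _ (hasCompactSupport_smulLeft hψ)]
    congr 1; ext x
    rw [SchwartzMap.smulLeftCLM_apply_apply hm, smul_eq_mul]; ring

theorem isRepresentedBy_Lp (h : Lp ℂ 2 (volume : Measure (Space d))) :
    IsRepresentedBy (h : 𝓢'(Space d, ℂ)) h :=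
  ⟨(Lp.memLp h).locallyIntegrable (by norm_num), fun ψ _ ↦ by
    simp [Lp.toTemperedDistribution_apply, mul_comm]⟩

theorem IsRepresentedBy.eq_of_memLp {T : 𝓢'(Space d, ℂ)} {g : Space d → ℂ}
    (h : IsRepresentedBy T g) (δ : ℝ) (hg : MemLp (fun x ↦ weight δ x * g x) 2 volume) :
    T = TemperedDistribution.smulLeftCLM ℂ (weight (-δ)) (hg.toLp _ : 𝓢'(Space d, ℂ)) := by
  have h2 := (isRepresentedBy_Lp (hg.toLp _)).smulLeft (weight_hasTemperateGrowth (-δ))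
  have h3 : (fun x ↦ weight (-δ) x * hg.toLp _ x) =ᵐ[volume] g := by
    filter_upwards [hg.coeFn_toLp] with x hx
    rw [hx, ← mul_assoc, weight_mul_weight]; simp
  have h4 := h2.congr_ae h3
  exact temperedDistribution_ext_of_compactSupport fun ψ hψ ↦ (h.2 ψ hψ).trans (h4.2 ψ hψ).symm

/-- The isometric parametrisation `h ↦ (I - Δ)^{-s/2} (⟨·⟩^{-δ} h)` of `H^s_δ` by `L²`. -/
def sobolevMap (s δ : ℝ) : Lp ℂ 2 (volume : Measure (Space d)) →L[ℂ] 𝓢'(Space d, ℂ) :=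
  besselOp (-s) ∘L TemperedDistribution.smulLeftCLM ℂ (weight (-δ)) ∘L
    Lp.toTemperedDistributionCLM ℂ volume 2

theorem sobolevMap_apply (s δ : ℝ) (h : Lp ℂ 2 (volume : Measure (Space d)))
    (ψ : 𝓢(Space d, ℂ)) :
    sobolevMap s δ h ψ = ∫ x, h x * (weight (-δ) x * besselS (-s) ψ x) := by
  change besselOp (-s) (TemperedDistribution.smulLeftCLM ℂ (weight (-δ))
    (h : 𝓢'(Space d, ℂ))) ψ = _
  rw [besselOp_apply, TemperedDistribution.smulLeftCLM_apply_apply,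
    Lp.toTemperedDistribution_apply]
  congr 1; ext x
  rw [SchwartzMap.smulLeftCLM_apply_apply (by fun_prop), smul_eq_mul, smul_eq_mul, mul_comm]

theorem besselOp_sobolevMap (s δ : ℝ) (h : Lp ℂ 2 (volume : Measure (Space d))) :
    besselOp s (sobolevMap s δ h) =
      TemperedDistribution.smulLeftCLM ℂ (weight (-δ)) (h : 𝓢'(Space d, ℂ)) := by
  change besselOp s (besselOp (-s) (TemperedDistribution.smulLeftCLM ℂ (weight (-δ))
    (h : 𝓢'(Space d, ℂ)))) = _
  rw [besselOp_besselOp]; simp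

theorem besselOp_sobolevMap_isRepresentedBy (s δ : ℝ) (h : Lp ℂ 2 (volume : Measure (Space d))) :
    IsRepresentedBy (besselOp s (sobolevMap s δ h)) (fun x ↦ weight (-δ) x * h x) := by
  rw [besselOp_sobolevMap]
  exact (isRepresentedBy_Lp h).smulLeft (by fun_prop)

theorem sobolevNorm_eq_eLpNorm {s δ : ℝ} {T : 𝓢'(Space d, ℂ)} {g : Space d → ℂ}
    (hg : IsRepresentedBy (besselOp s T) g) :
    sobolevNorm s δ T = eLpNorm (fun x ↦ weight δ x * g x) 2 volume := by
  refine le_antisymm (iInf₂_le g hg) (le_iInf₂ fun g' hg' ↦ ?_)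
  refine (eLpNorm_congr_ae ?_).le
  filter_upwards [hg.ae_eq hg'] with x hx
  rw [hx]; rfl

theorem sobolevNorm_sobolevMap (s δ : ℝ) (h : Lp ℂ 2 (volume : Measure (Space d))) :
    sobolevNorm s δ (sobolevMap s δ h) = ‖h‖ₑ := by
  rw [sobolevNorm_eq_eLpNorm (besselOp_sobolevMap_isRepresentedBy s δ h), Lp.enorm_def]
  congr 1; ext x
  rw [← mul_assoc, weight_mul_weight]; simp

theorem exists_sobolevMap_of_sobolevNorm_lt_top {s δ : ℝ} {T : 𝓢'(Space d, ℂ)}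
    (hT : sobolevNorm s δ T < ∞) : ∃ h, T = sobolevMap s δ h := by
  obtain ⟨g, hg, hlt⟩ : ∃ g, ∃ _ : IsRepresentedBy (besselOp s T) g,
      eLpNorm (fun x ↦ weight δ x * g x) 2 volume < ∞ := by
    simpa [sobolevNorm, iInf_lt_iff, weight] using hT
  have hm : MemLp (fun x ↦ weight δ x * g x) 2 volume :=
    ⟨(weight_continuous δ).aestronglyMeasurable.mul hg.1.aestronglyMeasurable, hlt⟩
  refine ⟨hm.toLp _, ?_⟩
  have := hg.eq_of_memLp δ hm
  rw [← besselOp_sobolevMap s δ] at this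
  have h2 := congrArg (besselOp (-s)) this
  simpa [besselOp_besselOp] using h2

theorem sobolevMap_injective (s δ : ℝ) :
    Function.Injective (sobolevMap s δ : Lp ℂ 2 (volume : Measure (Space d)) → 𝓢'(Space d, ℂ)) := by
  refine (injective_iff_map_eq_zero _).2 fun h hh ↦ ?_
  have h1 := sobolevNorm_sobolevMap s δ h
  have h2 := sobolevNorm_sobolevMap s δ (0 : Lp ℂ 2 (volume : Measure (Space d)))
  rw [hh] at h1
  rw [map_zero] at h2
  rw [h1] at h2
  simpa using h2

end

section

open FourierTransform TemperedDistribution LineDeriv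

/-! ### Translates of a test function under a tempered distribution -/

theorem two_add_le_infty (n : ℕ) : (2 + n : WithTop ℕ∞) ≤ ((⊤ : ℕ∞) : WithTop ℕ∞) := by
  have h : (((2 + n : ℕ) : ℕ∞) : WithTop ℕ∞) ≤ ((⊤ : ℕ∞) : WithTop ℕ∞) := WithTop.coe_le_coe.2
    le_top
  simpa using h

/-- The derivatives of order `n` commute with directional derivatives. -/
theorem iteratedFDeriv_fderiv_apply {F : Type*} [NormedAddCommGroup F] [NormedSpace ℝ F]
    {f : Space d → F} (hf : ContDiff ℝ ((⊤ : ℕ∞) : WithTop ℕ∞) f) (n : ℕ) (x y : Space d) :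
    iteratedFDeriv ℝ n (fun x ↦ fderiv ℝ f x y) x = fderiv ℝ (iteratedFDeriv ℝ n f) x y := by
  induction n generalizing x with
  | zero =>
    rw [iteratedFDeriv_zero_eq_comp, iteratedFDeriv_zero_eq_comp, LinearIsometryEquiv.comp_fderiv]
    rfl
  | succ n ih =>
    have hn : ContDiff ℝ 2 (iteratedFDeriv ℝ n f) :=
      hf.iteratedFDeriv_right (m := 2)
        (two_add_le_infty n)
    rw [iteratedFDeriv_succ_eq_comp_left, iteratedFDeriv_succ_eq_comp_left,
      LinearIsometryEquiv.comp_fderiv, Function.comp_apply, funext ih]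
    simp only [ContinuousLinearMap.comp_apply]
    refine congrArg (continuousMultilinearCurryLeftEquiv ℝ (fun _ ↦ Space d) F).symm ?_
    ext1 v
    have h1 : DifferentiableAt ℝ (fderiv ℝ (iteratedFDeriv ℝ n f)) x :=
      ((hn.fderiv_right (m := 1) (by norm_num)).differentiable (by norm_num)) x
    have h2 := (hn.contDiffAt (x := x)).isSymmSndFDerivAt (by simp)
    rw [fderiv_clm_apply h1 (differentiableAt_const y)]
    simp only [fderiv_fun_const, Pi.zero_apply, ContinuousLinearMap.comp_zero, zero_add,
      ContinuousLinearMap.flip_apply]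
    exact h2 v y

/-- The difference quotients of translations converge in the Schwartz space, quantitatively. -/
theorem exists_seminorm_translate_sub_le (ψ : 𝓢(Space d, ℂ)) (k n : ℕ) : ∃ C, ∀ y : Space d,
    ‖y‖ ≤ 1 → SchwartzMap.seminorm ℂ k n
      (ψ.compSubConstCLM ℂ (-y) - ψ - ∂_{y} ψ) ≤ C * ‖y‖ ^ 2 := by
  set M := 2 ^ k * ((Finset.Iic (k, n + 2)).sup fun m ↦ SchwartzMap.seminorm ℂ m.1 m.2) ψ with hM
  have hM0 : 0 ≤ M := mul_nonneg (by positivity) (apply_nonneg _ _)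
  have hψ := ψ.smooth ⊤
  refine ⟨2 ^ k * M, fun y hy ↦ SchwartzMap.seminorm_le_bound ℂ k n _ (by positivity) fun x ↦ ?_⟩
  set g := iteratedFDeriv ℝ n ψ with hg
  have hgs : ContDiff ℝ 2 g := hψ.iteratedFDeriv_right (m := 2)
    (two_add_le_infty n)
  have hD : iteratedFDeriv ℝ n (ψ.compSubConstCLM ℂ (-y) - ψ - ∂_{y} ψ : 𝓢(Space d, ℂ)) x =
      g (x + y) - g x - fderiv ℝ g x (x + y - x) := by
    have e1 : ⇑(ψ.compSubConstCLM ℂ (-y) - ψ - ∂_{y} ψ : 𝓢(Space d, ℂ)) =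
        ((fun x ↦ ψ (x + y)) - ψ) - fun x ↦ fderiv ℝ ψ x y := by
      ext z
      simp [SchwartzMap.lineDerivOp_apply_eq_fderiv]
    have c1 : ContDiff ℝ n (fun x ↦ ψ (x + y)) := (ψ.smooth n).comp (by fun_prop)
    have c2 : ContDiff ℝ n (fun x ↦ fderiv ℝ ψ x y) :=
      ((hψ.fderiv_right (m := n) (by exact_mod_cast le_top))).clm_apply contDiff_const
    rw [e1, iteratedFDeriv_sub_apply (f := (fun x ↦ ψ (x + y)) - ⇑ψ)
      (c1.sub (ψ.smooth n)).contDiffAt c2.contDiffAt,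
      iteratedFDeriv_sub_apply c1.contDiffAt (ψ.smooth n).contDiffAt,
      iteratedFDeriv_comp_add_right, iteratedFDeriv_fderiv_apply hψ, add_sub_cancel_left]
  -- a second order Taylor expansion of `D^n ψ` at `x`: its second derivative on the unit ball
  -- around `x` decays like `⟨x⟩^{-k}`
  have hB : ∀ z ∈ Metric.closedBall x 1,
      ‖fderiv ℝ (fderiv ℝ g) z‖ ≤ 2 ^ k * M / (1 + ‖x‖) ^ k := by
    intro z hz
    have e2 : ‖fderiv ℝ (fderiv ℝ g) z‖ = ‖iteratedFDeriv ℝ (n + 2) ψ z‖ := by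
      rw [← norm_fderiv_iteratedFDeriv, iteratedFDeriv_succ_eq_comp_left,
        LinearIsometryEquiv.comp_fderiv]
      exact (LinearIsometry.norm_toContinuousLinearMap_comp
        (continuousMultilinearCurryLeftEquiv ℝ (fun _ ↦ Space d) ℂ).symm.toLinearIsometry).symm
    have h1 := SchwartzMap.one_add_le_sup_seminorm_apply (𝕜 := ℂ) (m := (k, n + 2)) (k := k)
      (n := n + 2) le_rfl le_rfl ψ z
    have hxz : ‖x - z‖ ≤ 1 := by
      rw [mem_closedBall_iff_norm'] at hz; exact hz
    have h2 : 1 + ‖x‖ ≤ 2 * (1 + ‖z‖) := by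
      have := norm_sub_norm_le x z
      nlinarith [norm_nonneg z]
    rw [e2, le_div_iff₀ (by positivity)]
    calc ‖iteratedFDeriv ℝ (n + 2) ψ z‖ * (1 + ‖x‖) ^ k
        ≤ ‖iteratedFDeriv ℝ (n + 2) ψ z‖ * (2 * (1 + ‖z‖)) ^ k := by gcongr
      _ = 2 ^ k * ((1 + ‖z‖) ^ k * ‖iteratedFDeriv ℝ (n + 2) ψ z‖) := by rw [mul_pow]; ring
      _ ≤ 2 ^ k * M := by gcongr
  set B := 2 ^ k * M / (1 + ‖x‖) ^ k with hBdef
  have hL : ∀ z ∈ Metric.closedBall x ‖y‖, ‖fderiv ℝ g z - fderiv ℝ g x‖ ≤ B * ‖y‖ := by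
    intro z hz
    have h1 : DifferentiableOn ℝ (fderiv ℝ g) (Metric.closedBall x 1) :=
      ((hgs.fderiv_right (m := 1) (by norm_num)).differentiable (by norm_num)).differentiableOn
    refine ((convex_closedBall x 1).norm_image_sub_le_of_norm_fderiv_le (𝕜 := ℝ)
      (fun z hz ↦ ((hgs.fderiv_right (m := 1) (by norm_num)).differentiable (by norm_num)) z) hB
      (Metric.mem_closedBall_self (by norm_num))
      (Metric.closedBall_subset_closedBall hy hz)).trans ?_
    rw [mem_closedBall_iff_norm] at hz
    gcongr
  have hT := (convex_closedBall x ‖y‖).norm_image_sub_le_of_norm_fderiv_le' (𝕜 := ℝ) (f := g)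
    (φ := fderiv ℝ g x) (fun z _ ↦ (hgs.differentiable (by norm_num)) z) hL
    (x := x) (y := x + y) (Metric.mem_closedBall_self (norm_nonneg _))
    (by simp)
  rw [hD]
  rw [add_sub_cancel_left] at hT ⊢
  calc ‖x‖ ^ k * ‖g (x + y) - g x - fderiv ℝ g x y‖ ≤ (1 + ‖x‖) ^ k * (B * ‖y‖ * ‖y‖) := by
        gcongr
        linarith [norm_nonneg x]
    _ = 2 ^ k * M * ‖y‖ ^ 2 := by
        rw [hBdef]; field_simp

theorem exists_seminorm_bound (T : 𝓢'(Space d, ℂ)) : ∃ (s : Finset (ℕ × ℕ)) (C : ℝ), 0 ≤ C ∧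
    ∀ φ, ‖T φ‖ ≤ C * (s.sup (schwartzSeminormFamily ℂ (Space d) ℂ)) φ := by
  have hc : Continuous ((normSeminorm ℂ ℂ).comp (T : 𝓢(Space d, ℂ) →ₗ[ℂ] ℂ)) :=
    continuous_norm.comp (continuous_temperedDistribution T)
  obtain ⟨s, C, -, h⟩ := Seminorm.bound_of_continuous
    (schwartz_withSeminorms ℂ (Space d) ℂ) _ hc
  exact ⟨s, C, C.2, fun φ ↦ h φ⟩

theorem exists_sum_seminorm_bound (T : 𝓢'(Space d, ℂ)) : ∃ (s : Finset (ℕ × ℕ)) (C : ℝ), 0 ≤ C ∧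
    ∀ φ, ‖T φ‖ ≤ C * ∑ p ∈ s, SchwartzMap.seminorm ℂ p.1 p.2 φ := by
  obtain ⟨s, C, hC, h⟩ := exists_seminorm_bound T
  refine ⟨s, C, hC, fun φ ↦ (h φ).trans ?_⟩
  gcongr
  refine Seminorm.finset_sup_apply_le (Finset.sum_nonneg fun _ _ ↦ apply_nonneg _ _) fun p hp ↦ ?_
  exact Finset.single_le_sum (f := fun p : ℕ × ℕ ↦ SchwartzMap.seminorm ℂ p.1 p.2 φ)
    (fun _ _ ↦ apply_nonneg _ _) hp

theorem translate_translate (ψ : 𝓢(Space d, ℂ)) (y z : Space d) :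
    ψ.compSubConstCLM ℂ (-(z + y)) = (ψ.compSubConstCLM ℂ (-y)).compSubConstCLM ℂ (-z) := by
  ext x
  simp

/-- The derivative of `z ↦ T(ψ(· + z))` in the direction `y` is the pairing of `T` with the
translate of `∂_y ψ`, which has the same form; hence the function is smooth. -/
theorem hasFDerivAt_apply_translate (T : 𝓢'(Space d, ℂ)) (ψ : 𝓢(Space d, ℂ)) (z : Space d) :
    ∃ L : Space d →L[ℝ] ℂ, (∀ y, L y = T ((∂_{y} ψ : 𝓢(Space d, ℂ)).compSubConstCLM ℂ (-z))) ∧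
      HasFDerivAt (fun z ↦ T (ψ.compSubConstCLM ℂ (-z))) L z := by
  let S : 𝓢'(Space d, ℂ) := PointwiseConvergenceCLM.precomp ℂ (SchwartzMap.compSubConstCLM ℂ (-z)) T
  have hS : ∀ φ, S φ = T (φ.compSubConstCLM ℂ (-z)) := fun φ ↦ rfl
  let L : Space d →ₗ[ℝ] ℂ :=
    { toFun := fun y ↦ S (∂_{y} ψ)
      map_add' := fun y y' ↦ by rw [lineDerivOp_left_add, map_add]
      map_smul' := fun c y ↦ by
        rw [lineDerivOp_left_smul, ← Complex.coe_smul c (∂_{y} ψ : 𝓢(Space d, ℂ)), map_smul]; simp }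
  refine ⟨LinearMap.toContinuousLinearMap L, fun y ↦ rfl, ?_⟩
  rw [hasFDerivAt_iff_isLittleO_nhds_zero]
  obtain ⟨s, C, hC0, hC⟩ := exists_sum_seminorm_bound S
  choose A hA using fun p : ℕ × ℕ ↦ exists_seminorm_translate_sub_le ψ p.1 p.2
  refine Asymptotics.IsBigO.trans_isLittleO (g := fun y : Space d ↦ ‖y‖ ^ 2)
    (Asymptotics.IsBigO.of_bound (C * ∑ p ∈ s, A p) ?_) ?_
  · filter_upwards [Metric.closedBall_mem_nhds (0 : Space d) one_pos] with y hy
    rw [mem_closedBall_zero_iff] at hy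
    have : T (ψ.compSubConstCLM ℂ (-(z + y))) - T (ψ.compSubConstCLM ℂ (-z)) -
        LinearMap.toContinuousLinearMap L y = S (ψ.compSubConstCLM ℂ (-y) - ψ - ∂_{y} ψ) := by
      rw [translate_translate, ← hS, ← hS, map_sub, map_sub]
      rfl
    rw [this, norm_pow, norm_norm, mul_assoc, Finset.sum_mul]
    refine (hC _).trans ?_
    gcongr with p hp
    exact hA p y hy
  · exact Asymptotics.isLittleO_norm_pow_id one_lt_two

/-- The function `z ↦ ⟨T, ψ(z + ·)⟩` is smooth. -/
theorem contDiff_apply_translate (T : 𝓢'(Space d, ℂ)) (ψ : 𝓢(Space d, ℂ)) :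
    ContDiff ℝ ((⊤ : ℕ∞) : WithTop ℕ∞) (fun z ↦ T (ψ.compSubConstCLM ℂ (-z))) := by
  rw [contDiff_infty]
  intro n
  induction n generalizing ψ with
  | zero =>
    refine contDiff_zero.2 (continuous_iff_continuousAt.2 fun z ↦ ?_)
    obtain ⟨L, -, hL⟩ := hasFDerivAt_apply_translate T ψ z
    exact hL.continuousAt
  | succ n ih =>
    rw [Nat.cast_succ]
    refine contDiff_succ_iff_fderiv_apply.2 ⟨fun z ↦ ?_, fun h ↦ absurd h (by simp), fun y ↦ ?_⟩
    · obtain ⟨L, -, hL⟩ := hasFDerivAt_apply_translate T ψ z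
      exact hL.differentiableAt
    · have : (fun z ↦ fderiv ℝ (fun z ↦ T (ψ.compSubConstCLM ℂ (-z))) z y) =
          fun z ↦ T ((∂_{y} ψ : 𝓢(Space d, ℂ)).compSubConstCLM ℂ (-z)) := by
        ext z
        obtain ⟨L, hL', hL⟩ := hasFDerivAt_apply_translate T ψ z
        rw [hL.fderiv, hL']
      rw [this]
      exact ih (∂_{y} ψ)

/-- Translations act continuously on the Schwartz space. -/
theorem continuous_translate (ψ : 𝓢(Space d, ℂ)) :
    Continuous (fun z ↦ ψ.compSubConstCLM ℂ z) := by
  have h0 : ∀ φ : 𝓢(Space d, ℂ), Tendsto (fun y ↦ φ.compSubConstCLM ℂ (-y)) (𝓝 0) (𝓝 φ) := by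
    intro φ
    refine tendsto_schwartz_of_seminorm fun k n ↦ ?_
    obtain ⟨C, hC⟩ := exists_seminorm_translate_sub_le φ k n
    let L : Space d →ₗ[ℝ] 𝓢(Space d, ℂ) :=
      { toFun := fun y ↦ ∂_{y} φ
        map_add' := fun y y' ↦ lineDerivOp_left_add _ _ _
        map_smul' := fun c y ↦ lineDerivOp_left_smul _ _ _ }
    have hL : Continuous L := L.continuous_of_finiteDimensional
    have hs : Continuous (SchwartzMap.seminorm ℂ k n : 𝓢(Space d, ℂ) → ℝ) :=
      (schwartz_withSeminorms ℂ (Space d) ℂ).continuous_seminorm (k, n)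
    have h1 : Tendsto (fun y : Space d ↦ C * ‖y‖ ^ 2 + SchwartzMap.seminorm ℂ k n (L y)) (𝓝 0)
        (𝓝 0) := by
      have : Continuous fun y : Space d ↦ C * ‖y‖ ^ 2 + SchwartzMap.seminorm ℂ k n (L y) := by
        fun_prop
      simpa using this.tendsto 0
    refine tendsto_of_tendsto_of_tendsto_of_le_of_le' tendsto_const_nhds h1
      (Eventually.of_forall fun y ↦ apply_nonneg _ _) ?_
    filter_upwards [Metric.closedBall_mem_nhds (0 : Space d) one_pos] with y hy
    rw [mem_closedBall_zero_iff] at hy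
    calc _ = SchwartzMap.seminorm ℂ k n ((φ.compSubConstCLM ℂ (-y) - φ - ∂_{y} φ) + ∂_{y} φ) := by
          congr 1; abel
      _ ≤ _ := (map_add_le_add _ _ _).trans (add_le_add_left (hC y hy) _)
  rw [continuous_iff_continuousAt]
  intro z
  have h1 : Tendsto (fun x : Space d ↦ z - x) (𝓝 z) (𝓝 0) := by
    have : Continuous fun x : Space d ↦ z - x := by fun_prop
    simpa using this.tendsto z
  refine ((h0 (ψ.compSubConstCLM ℂ z)).comp h1).congr fun x ↦ ?_
  ext v
  simp

/-! ### Convolution of a tempered distribution with test functions -/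

/-- The convolution `x ↦ ∫ ψ(ξ) κ(x - ξ) dξ` of two Schwartz functions. -/
def conv (ψ κ : 𝓢(Space d, ℂ)) : 𝓢(Space d, ℂ) :=
  SchwartzMap.convolution (ContinuousLinearMap.mul ℂ ℂ) ψ κ

theorem conv_apply (ψ κ : 𝓢(Space d, ℂ)) (x : Space d) :
    conv ψ κ x = ∫ ξ, ψ ξ * κ (x - ξ) := by
  rw [conv, SchwartzMap.convolution_apply]; rfl

theorem iteratedFDeriv_conv (ψ κ : 𝓢(Space d, ℂ)) (n : ℕ) (x : Space d) :
    iteratedFDeriv ℝ n (conv ψ κ) x = ∫ ξ, ψ ξ • iteratedFDeriv ℝ n κ (x - ξ) := by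
  induction n generalizing x with
  | zero =>
    rw [iteratedFDeriv_zero_eq_comp, iteratedFDeriv_zero_eq_comp, Function.comp_apply, conv_apply]
    exact ((continuousMultilinearCurryFin0 ℝ (Space d)
      ℂ).symm.toContinuousLinearEquiv.integral_comp_comm fun ξ ↦ ψ ξ * κ (x - ξ)).symm
  | succ n ih =>
    have hs : ContDiff ℝ 2 (iteratedFDeriv ℝ n κ) :=
      (κ.smooth ⊤).iteratedFDeriv_right (m := 2) (two_add_le_infty n)
    have hc1 : Continuous (fderiv ℝ (iteratedFDeriv ℝ n κ)) :=
      (hs.fderiv_right (m := 1) (by norm_num)).continuous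
    have hbd : ∀ z, ‖fderiv ℝ (iteratedFDeriv ℝ n κ) z‖ ≤ SchwartzMap.seminorm ℂ 0 (n + 1) κ :=
      fun z ↦ by
        rw [norm_fderiv_iteratedFDeriv]; exact SchwartzMap.norm_iteratedFDeriv_le_seminorm ℂ κ _ z
    have := secondCountableTopologyEither_of_left (Space d)
      (Space d →L[ℝ] Space d [×n]→L[ℝ] ℂ)
    have hi1 : Integrable (fun ξ ↦ ψ ξ • fderiv ℝ (iteratedFDeriv ℝ n κ) (x - ξ)) :=
      ψ.integrable.smul_bdd (SchwartzMap.seminorm ℂ 0 (n + 1) κ)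
        (Continuous.aestronglyMeasurable (by fun_prop)) (Eventually.of_forall fun ξ ↦ hbd _)
    have hd : HasFDerivAt (iteratedFDeriv ℝ n (conv ψ κ))
        (∫ ξ, ψ ξ • fderiv ℝ (iteratedFDeriv ℝ n κ) (x - ξ)) x := by
      rw [funext ih]
      refine hasFDerivAt_integral_of_dominated_of_fderiv_le (𝕜 := ℝ) (s := univ)
        (F := fun x ξ ↦ ψ ξ • iteratedFDeriv ℝ n κ (x - ξ))
        (F' := fun x ξ ↦ ψ ξ • fderiv ℝ (iteratedFDeriv ℝ n κ) (x - ξ))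
        (bound := fun ξ ↦ ‖ψ ξ‖ * SchwartzMap.seminorm ℂ 0 (n + 1) κ)
        univ_mem (Eventually.of_forall fun y ↦ ?_) ?_ hi1.aestronglyMeasurable
        (Eventually.of_forall fun ξ y _ ↦ ?_) (ψ.integrable.norm.mul_const _)
        (Eventually.of_forall fun ξ y _ ↦ ?_)
      · have := hs.continuous
        exact Continuous.aestronglyMeasurable (by fun_prop)
      · have := hs.continuous
        exact ψ.integrable.smul_bdd (SchwartzMap.seminorm ℂ 0 n κ)
          (Continuous.aestronglyMeasurable (by fun_prop))
          (Eventually.of_forall fun ξ ↦ SchwartzMap.norm_iteratedFDeriv_le_seminorm ℂ κ _ _)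
      · rw [norm_smul]; gcongr; exact hbd _
      · have h1 : HasFDerivAt (iteratedFDeriv ℝ n κ) (fderiv ℝ (iteratedFDeriv ℝ n κ) (y - ξ))
            (y - ξ) := ((hs.differentiable (by norm_num)) _).hasFDerivAt
        exact (h1.comp y ((hasFDerivAt_id y).sub_const ξ)).const_smul (ψ ξ)
    rw [iteratedFDeriv_succ_eq_comp_left, iteratedFDeriv_succ_eq_comp_left, Function.comp_apply,
      hd.fderiv]
    exact ((continuousMultilinearCurryLeftEquiv ℝ (fun _ : Fin (n + 1) ↦ Space d)
      ℂ).symm.toContinuousLinearEquiv.integral_comp_comm fun ξ ↦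
        ψ ξ • fderiv ℝ (iteratedFDeriv ℝ n κ) (x - ξ)).symm

/-- The map `φ ↦ |x|^k D^n φ` into bounded continuous functions, whose norm is the seminorm
`(k, n)` of the Schwartz space. -/
def weightedDerivBCF (p : ℕ × ℕ) :
    𝓢(Space d, ℂ) →L[ℂ] BoundedContinuousFunction (Space d) (Space d [×p.2]→L[ℝ] ℂ) :=
  SchwartzMap.mkCLMtoNormedSpace
    (fun φ ↦ BoundedContinuousFunction.ofNormedAddCommGroup
      (fun x ↦ (‖x‖ ^ p.1 : ℝ) • iteratedFDeriv ℝ p.2 φ x)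
      (by
        have : Continuous (iteratedFDeriv ℝ p.2 φ) :=
          (φ.smooth ⊤).continuous_iteratedFDeriv (by exact_mod_cast le_top)
        fun_prop)
      (SchwartzMap.seminorm ℂ p.1 p.2 φ) fun x ↦ by
        rw [norm_smul, norm_pow, norm_norm]
        exact SchwartzMap.le_seminorm ℂ _ _ _ _)
    (fun φ φ' ↦ by
      ext1 x
      simp only [BoundedContinuousFunction.coe_ofNormedAddCommGroup,
        BoundedContinuousFunction.coe_add, Pi.add_apply, ← smul_add]
      congr 1
      exact iteratedFDeriv_add_apply (φ.smooth _).contDiffAt (φ'.smooth _).contDiffAt)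
    (fun a φ ↦ by
      ext1 x
      simp only [BoundedContinuousFunction.coe_ofNormedAddCommGroup,
        BoundedContinuousFunction.coe_smul, RingHom.id_apply]
      rw [smul_comm]
      congr 1
      exact iteratedFDeriv_const_smul_apply (φ.smooth _).contDiffAt)
    ⟨{p}, 1, zero_le_one, fun φ ↦ by
      rw [Finset.sup_singleton, one_mul]
      refine (BoundedContinuousFunction.norm_le (apply_nonneg _ _)).2 fun x ↦ ?_
      simp only [BoundedContinuousFunction.coe_ofNormedAddCommGroup, norm_smul, norm_pow, norm_norm]
      exact SchwartzMap.le_seminorm ℂ _ _ _ _⟩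

theorem weightedDerivBCF_apply (p : ℕ × ℕ) (φ : 𝓢(Space d, ℂ)) (x : Space d) :
    weightedDerivBCF p φ x = (‖x‖ ^ p.1 : ℝ) • iteratedFDeriv ℝ p.2 φ x := rfl

theorem seminorm_le_norm_weightedDerivBCF (p : ℕ × ℕ) (φ : 𝓢(Space d, ℂ)) :
    SchwartzMap.seminorm ℂ p.1 p.2 φ ≤ ‖weightedDerivBCF p φ‖ := by
  refine SchwartzMap.seminorm_le_bound ℂ _ _ _ (norm_nonneg _) fun x ↦ ?_
  refine le_trans (le_of_eq ?_) ((weightedDerivBCF p φ).norm_coe_le_norm x)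
  rw [weightedDerivBCF_apply, norm_smul, norm_pow, norm_norm]

/-- A tempered distribution factors through a continuous map into a Banach space of bounded
continuous functions. This turns statements on vector-valued integrals of test functions into
statements on Bochner integrals. -/
theorem exists_factorization (T : 𝓢'(Space d, ℂ)) : ∃ (s : Finset (ℕ × ℕ))
    (ℓ : ((p : s) → BoundedContinuousFunction (Space d) (Space d [×p.1.2]→L[ℝ] ℂ)) →L[ℂ] ℂ),
    ∀ φ, T φ = ℓ (fun p ↦ weightedDerivBCF p.1 φ) := by
  obtain ⟨s, C, hC0, hC⟩ := exists_sum_seminorm_bound T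
  let E := (p : s) → BoundedContinuousFunction (Space d) (Space d [×p.1.2]→L[ℝ] ℂ)
  let ι : 𝓢(Space d, ℂ) →ₗ[ℂ] E := LinearMap.pi fun p ↦ (weightedDerivBCF p.1).toLinearMap
  have hb : ∀ φ, ‖T φ‖ ≤ C * s.card * ‖ι φ‖ := by
    intro φ
    refine (hC φ).trans ?_
    rw [mul_assoc, ← nsmul_eq_mul]
    gcongr
    refine Finset.sum_le_card_nsmul _ _ _ fun p hp ↦ ?_
    exact (seminorm_le_norm_weightedDerivBCF p φ).trans (norm_le_pi_norm (ι φ) ⟨p, hp⟩)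
  have hker : LinearMap.ker ι ≤ LinearMap.ker (T : 𝓢(Space d, ℂ) →ₗ[ℂ] ℂ) := by
    intro φ hφ
    rw [LinearMap.mem_ker] at hφ ⊢
    have := hb φ
    rw [hφ, norm_zero, mul_zero] at this
    exact norm_le_zero_iff.1 this
  let q : LinearMap.range ι →ₗ[ℂ] ℂ :=
    ((LinearMap.ker ι).liftQ (T : 𝓢(Space d, ℂ) →ₗ[ℂ] ℂ) hker).comp
      ι.quotKerEquivRange.symm.toLinearMap
  have hq : ∀ φ, q ⟨ι φ, LinearMap.mem_range_self ι φ⟩ = T φ := by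
    intro φ
    have : ι.quotKerEquivRange.symm ⟨ι φ, LinearMap.mem_range_self ι φ⟩ =
        (LinearMap.ker ι).mkQ φ := by
      rw [LinearEquiv.symm_apply_eq]; rfl
    simp only [q, LinearMap.comp_apply, LinearEquiv.coe_coe, this]
    rfl
  let q' : StrongDual ℂ (LinearMap.range ι) := q.mkContinuous (C * s.card) (by
    rintro ⟨_, φ, rfl⟩
    rw [hq φ]
    exact hb φ)
  obtain ⟨ℓ, hℓ, -⟩ := exists_extension_norm_eq (LinearMap.range ι) q'
  exact ⟨s, ℓ, fun φ ↦ ((hℓ ⟨ι φ, LinearMap.mem_range_self ι φ⟩).trans (hq φ)).symm⟩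

/-- Fubini's theorem for a tempered distribution and a convolution of test functions. -/
theorem apply_conv (T : 𝓢'(Space d, ℂ)) (ψ κ : 𝓢(Space d, ℂ)) (hψ : HasCompactSupport ψ) :
    T (conv ψ κ) = ∫ ξ, ψ ξ * T (κ.compSubConstCLM ℂ ξ) := by
  obtain ⟨s, ℓ, hℓ⟩ := exists_factorization T
  let E := (p : s) → BoundedContinuousFunction (Space d) (Space d [×p.1.2]→L[ℝ] ℂ)
  let ι : 𝓢(Space d, ℂ) → E := fun φ p ↦ weightedDerivBCF p.1 φ
  have hc : Continuous fun ξ ↦ ψ ξ • ι (κ.compSubConstCLM ℂ ξ) := by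
    refine ψ.continuous.smul (continuous_pi fun p ↦ ?_)
    exact (weightedDerivBCF p.1).continuous.comp (continuous_translate κ)
  have hi : Integrable (fun ξ ↦ ψ ξ • ι (κ.compSubConstCLM ℂ ξ)) :=
    hc.integrable_of_hasCompactSupport hψ.smul_right
  -- evaluation at a point turns the Bochner integral into the integral which defines the
  -- convolution
  have hint : ι (conv ψ κ) = ∫ ξ, ψ ξ • ι (κ.compSubConstCLM ℂ ξ) := by
    ext1 p
    ext1 x
    have h1 := (ContinuousLinearMap.proj (R := ℂ) (φ := fun p : s ↦
      BoundedContinuousFunction (Space d) (Space d [×p.1.2]→L[ℝ] ℂ)) p).integral_comp_comm hi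
    have hi2 : Integrable (fun ξ ↦ ψ ξ • weightedDerivBCF p.1 (κ.compSubConstCLM ℂ ξ)) :=
      (ContinuousLinearMap.proj (R := ℂ) (φ := fun p : s ↦
      BoundedContinuousFunction (Space d) (Space d [×p.1.2]→L[ℝ] ℂ)) p).integrable_comp hi
    have h2 := (BoundedContinuousFunction.evalCLM ℂ x).integral_comp_comm hi2
    have e1 : (∫ ξ, ψ ξ • ι (κ.compSubConstCLM ℂ ξ)) p =
      ∫ ξ, ψ ξ • weightedDerivBCF p.1 (κ.compSubConstCLM ℂ ξ) := h1.symm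
    have e2 : (∫ ξ, ψ ξ • weightedDerivBCF p.1 (κ.compSubConstCLM ℂ ξ)) x =
      ∫ ξ, ψ ξ • (weightedDerivBCF p.1 (κ.compSubConstCLM ℂ ξ)) x := h2.symm
    rw [e1, e2]
    simp only [ι, weightedDerivBCF_apply, iteratedFDeriv_conv]
    rw [← integral_smul]
    refine integral_congr_ae (Eventually.of_forall fun ξ ↦ ?_)
    have e3 : ⇑(κ.compSubConstCLM ℂ ξ) = fun x ↦ κ (x - ξ) := by ext; simp
    simp only [e3]
    rw [iteratedFDeriv_comp_sub, smul_comm]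
  rw [hℓ]
  refine (congrArg ℓ hint).trans ?_
  rw [← ℓ.integral_comp_comm hi]
  refine integral_congr_ae (Eventually.of_forall fun ξ ↦ ?_)
  simp only [map_smul, smul_eq_mul, hℓ]
  rfl

end

section

open FourierTransform TemperedDistribution LineDeriv

/-! ### The support of a tempered distribution -/

theorem tsupport_smulLeftCLM_left {g : Space d → ℂ} (φ : 𝓢(Space d, ℂ)) :
    tsupport (SchwartzMap.smulLeftCLM ℂ g φ) ⊆ tsupport φ :=
  (SchwartzMap.tsupport_smulLeftCLM_subset g φ).trans inter_subset_left

theorem schwartz_smulLeft_apply (χ φ : 𝓢(Space d, ℂ)) (x : Space d) :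
    SchwartzMap.smulLeftCLM ℂ χ φ x = χ x * φ x := by
  rw [SchwartzMap.smulLeftCLM_apply_apply χ.hasTemperateGrowth, smul_eq_mul]

/-- A distribution which vanishes on two open sets vanishes on their union, by a partition of
unity. -/
theorem vanishes_union {T : 𝓢'(Space d, ℂ)} {W₁ W₂ : Set (Space d)} (h₁ : IsOpen W₁)
    (h₂ : IsOpen W₂)
    (hT₁ : ∀ φ : 𝓢(Space d, ℂ), HasCompactSupport φ → tsupport φ ⊆ W₁ → T φ = 0)
    (hT₂ : ∀ φ : 𝓢(Space d, ℂ), HasCompactSupport φ → tsupport φ ⊆ W₂ → T φ = 0)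
    (φ : 𝓢(Space d, ℂ)) (hφ : HasCompactSupport φ) (hs : tsupport φ ⊆ W₁ ∪ W₂) : T φ = 0 := by
  obtain ⟨K₁, K₂, hK₁, hK₂, hKW₁, hKW₂, hK⟩ := hφ.isCompact.binary_compact_cover h₁ h₂ hs
  obtain ⟨χ, -, hχW, ⟨V, hV, hKV, hV1⟩, -⟩ := exists_smooth_cutoff hK₁ h₁ hKW₁
  set φ₁ := SchwartzMap.smulLeftCLM ℂ χ φ
  have hc : HasCompactSupport φ₁ := hasCompactSupport_smulLeft hφ
  have e₁ : T φ₁ = 0 := hT₁ _ hc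
    (((SchwartzMap.tsupport_smulLeftCLM_subset χ φ).trans inter_subset_right).trans hχW)
  have hsub : tsupport (φ - φ₁ : 𝓢(Space d, ℂ)) ⊆ K₂ := by
    have h0 : Function.support (φ - φ₁ : 𝓢(Space d, ℂ)) ⊆ tsupport φ ∩ Vᶜ := by
      intro x hx
      rw [Function.mem_support, sub_apply, schwartz_smulLeft_apply] at hx
      refine ⟨subset_tsupport _ fun h ↦ hx (by simp [h]), fun hxV ↦ hx (by simp [hV1 x hxV])⟩
    refine (closure_minimal h0 ((isClosed_tsupport _).inter hV.isClosed_compl)).trans ?_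
    rintro x ⟨hx, hxV⟩
    rw [hK] at hx
    exact hx.resolve_left fun h ↦ hxV (hKV h)
  have e₂ : T (φ - φ₁) = 0 := hT₂ _ (hK₂.of_isClosed_subset (isClosed_tsupport _) hsub)
    (hsub.trans hKW₂)
  rwa [map_sub, e₁, sub_zero] at e₂

/-- A distribution vanishes on all test functions supported away from its support: for compactly
supported ones by a finite cover and a partition of unity, in general by density. -/
theorem apply_eq_zero_of_tsupport_disjoint (T : 𝓢'(Space d, ℂ)) (φ : 𝓢(Space d, ℂ))
    (h : tsupport φ ⊆ (Distribution.dsupport T)ᶜ) : T φ = 0 := by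
  have key : ∀ φ : 𝓢(Space d, ℂ), HasCompactSupport φ →
      tsupport φ ⊆ (Distribution.dsupport T)ᶜ → T φ = 0 := by
    intro φ hφ h
    obtain ⟨W, hW, hφW, hTW⟩ : ∃ W, IsOpen W ∧ tsupport φ ⊆ W ∧
        ∀ φ : 𝓢(Space d, ℂ), HasCompactSupport φ → tsupport φ ⊆ W → T φ = 0 := by
      refine hφ.isCompact.induction_on (p := fun s ↦ ∃ W, IsOpen W ∧ s ⊆ W ∧
        ∀ φ : 𝓢(Space d, ℂ), HasCompactSupport φ → tsupport φ ⊆ W → T φ = 0) ?_ ?_ ?_ ?_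
      · refine ⟨∅, isOpen_empty, subset_rfl, fun φ _ hs ↦ ?_⟩
        rw [subset_empty_iff, tsupport_eq_empty_iff] at hs
        rw [show φ = 0 from SchwartzMap.ext fun x ↦ congrFun hs x, map_zero]
      · rintro s s' hss ⟨W, hW, hsW, hTW⟩
        exact ⟨W, hW, hss.trans hsW, hTW⟩
      · rintro s s' ⟨W, hW, hsW, hTW⟩ ⟨W', hW', hsW', hTW'⟩
        exact ⟨W ∪ W', hW.union hW', union_subset_union hsW hsW',
          vanishes_union hW hW' hTW hTW'⟩
      · intro x hx
        obtain ⟨s, hs, hso, hxs⟩ := (Distribution.notMem_dsupport_iff x).1 (h hx)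
        exact ⟨s, mem_nhdsWithin_of_mem_nhds (hso.mem_nhds hxs), s, hso, subset_rfl,
          fun φ _ hφ ↦ hs φ hφ⟩
    exact hTW φ hφ hφW
  obtain ⟨χ, hχc, hχ⟩ := exists_compactSupport_tendsto φ
  have h0 : ∀ N, T (SchwartzMap.smulLeftCLM ℂ (χ N) φ) = 0 := fun N ↦ by
    refine key _ ?_ ((tsupport_smulLeftCLM_left φ).trans h)
    exact (hχc N).of_isClosed_subset (isClosed_tsupport _)
      ((SchwartzMap.tsupport_smulLeftCLM_subset _ φ).trans inter_subset_right)
  have h1 := ((continuous_temperedDistribution T).tendsto φ).comp hχ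
  exact tendsto_nhds_unique h1 (by simp [Function.comp_def, h0])

/-- A distribution only sees the values of a test function near its support. -/
theorem apply_congr_of_eqOn {T : 𝓢'(Space d, ℂ)} {φ φ' : 𝓢(Space d, ℂ)} {V : Set (Space d)}
    (hV : IsOpen V) (hTV : Distribution.dsupport T ⊆ V) (h : ∀ x ∈ V, φ x = φ' x) :
    T φ = T φ' := by
  rw [← sub_eq_zero, ← map_sub]
  refine apply_eq_zero_of_tsupport_disjoint T _ ?_
  have h0 : Function.support (φ - φ' : 𝓢(Space d, ℂ)) ⊆ Vᶜ := fun x hx hxV ↦ by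
    rw [Function.mem_support, sub_apply, h x hxV, sub_self] at hx
    exact hx rfl
  exact (closure_minimal h0 hV.isClosed_compl).trans (compl_subset_compl.2 hTV)

theorem isCompact_dsupport {T : 𝓢'(Space d, ℂ)}
    (hT : Bornology.IsBounded (Distribution.dsupport T)) :
    IsCompact (Distribution.dsupport T) :=
  Metric.isCompact_of_isClosed_isBounded Distribution.isClosed_dsupport hT

/-- A smooth function cut off to a Schwartz function. -/
theorem exists_schwartz_eqOn {K : Set (Space d)} (hK : IsCompact K) {w : Space d → ℂ}
    (hw : ContDiff ℝ ((⊤ : ℕ∞) : WithTop ℕ∞) w) : ∃ η : 𝓢(Space d, ℂ), HasCompactSupport η ∧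
      ∃ V, IsOpen V ∧ K ⊆ V ∧ ∀ x ∈ V, η x = w x := by
  obtain ⟨χ, hχ, -, ⟨V, hV, hKV, hV1⟩, -⟩ := exists_smooth_cutoff hK isOpen_univ (subset_univ _)
  have hc : HasCompactSupport fun x ↦ χ x * w x := hχ.mul_right
  refine ⟨hc.toSchwartzMap ((χ.smooth ⊤).mul hw), hc, V, hV, hKV, fun x hx ↦ ?_⟩
  change χ x * w x = w x
  rw [hV1 x hx, one_mul]

/-- The distribution `∫ G^k(· - z) T(z) dz` is determined by its defining property. -/
theorem IsGreenConvolution.unique {α k : ℝ} {T v v' : 𝓢'(Space d, ℂ)}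
    (h : IsGreenConvolution α k T v) (h' : IsGreenConvolution α k T v') : v = v' := by
  ext ψ
  obtain ⟨η, ⟨V, hV, hTV, hη⟩, e⟩ := h ψ
  obtain ⟨η', ⟨V', hV', hTV', hη'⟩, e'⟩ := h' ψ
  rw [e, e']
  exact apply_congr_of_eqOn (hV.inter hV') (subset_inter hTV hTV')
    fun x hx ↦ (hη x hx.1).trans (hη' x hx.2).symm

theorem IsGreenConvolution.resolventOp_eq {α k : ℝ} {T v : 𝓢'(Space d, ℂ)}
    (h : IsGreenConvolution α k T v) : resolventOp α k T = v := by
  have h' : ∃ v, IsGreenConvolution α k T v := ⟨v, h⟩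
  rw [resolventOp, dif_pos h']
  exact h'.choose_spec.unique h

end

/-! ### Slicing the Euclidean space -/

theorem integrable_of_bounded_of_support {X E : Type*} [MeasurableSpace X] [NormedAddCommGroup E]
    {μ : Measure X} {f : X → E} (hf : AEStronglyMeasurable f μ) {M : ℝ} (hM : ∀ x, ‖f x‖ ≤ M)
    {s : Set X} (hs : μ s < ∞) (h0 : ∀ x ∉ s, f x = 0) : Integrable f μ := by
  refine (integrableOn_iff_integrable_of_support_subset (s := s) fun x hx ↦ ?_).1
    (Measure.integrableOn_of_bounded hs.ne hf (Eventually.of_forall hM))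
  by_contra h
  exact hx (h0 x h)

/-- The identification of `ℝ × ℝⁿ` with `ℝⁿ⁺¹` which inserts the first component as the `j`-th
coordinate. -/
def slice {n : ℕ} (j : Fin (n + 1)) : ℝ × Space n ≃ᵐ Space (n + 1) :=
  ((MeasurableEquiv.refl ℝ).prodCongr (MeasurableEquiv.toLp 2 (Fin n → ℝ)).symm).trans
    ((MeasurableEquiv.piFinSuccAbove (fun _ ↦ ℝ) j).symm.trans
      (MeasurableEquiv.toLp 2 (Fin (n + 1) → ℝ)))

theorem slice_apply_self {n : ℕ} (j : Fin (n + 1)) (p : ℝ × Space n) : slice j p j = p.1 := by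
  change (Fin.insertNth j p.1 (WithLp.ofLp p.2) : Fin (n + 1) → ℝ) j = p.1
  simp

theorem slice_apply_succAbove {n : ℕ} (j : Fin (n + 1)) (p : ℝ × Space n) (i : Fin n) :
    slice j p (j.succAbove i) = p.2 i := by
  change (Fin.insertNth j p.1 (WithLp.ofLp p.2) : Fin (n + 1) → ℝ) (j.succAbove i) = _
  simp

theorem measurePreserving_slice {n : ℕ} (j : Fin (n + 1)) :
    MeasurePreserving (slice j : ℝ × Space n → Space (n + 1)) volume volume :=
  (PiLp.volume_preserving_toLp (Fin (n + 1))).comp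
    ((volume_preserving_piFinSuccAbove (fun _ ↦ ℝ) j).symm.comp
      ((MeasurePreserving.id volume).prod (PiLp.volume_preserving_ofLp (Fin n))))

theorem norm_slice_sq {n : ℕ} (j : Fin (n + 1)) (p : ℝ × Space n) :
    ‖slice j p‖ ^ 2 = p.1 ^ 2 + ‖p.2‖ ^ 2 := by
  rw [EuclideanSpace.norm_sq_eq, EuclideanSpace.norm_sq_eq, Fin.sum_univ_succAbove _ j,
    slice_apply_self]
  simp [slice_apply_succAbove]

theorem norm_slice {n : ℕ} (j : Fin (n + 1)) (p : ℝ × Space n) :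
    ‖slice j p‖ = Real.sqrt (p.1 ^ 2 + ‖p.2‖ ^ 2) := by
  rw [← norm_slice_sq, Real.sqrt_sq (norm_nonneg _)]

theorem inner_slice {n : ℕ} (j : Fin (n + 1)) (p q : ℝ × Space n) :
    ⟪slice j p, slice j q⟫_ℝ = p.1 * q.1 + ⟪p.2, q.2⟫_ℝ := by
  rw [PiLp.inner_apply, PiLp.inner_apply, Fin.sum_univ_succAbove _ j, slice_apply_self,
    slice_apply_self]
  simp [slice_apply_succAbove, mul_comm]

theorem continuous_slice {n : ℕ} (j : Fin (n + 1)) :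
    Continuous (slice j : ℝ × Space n → Space (n + 1)) := by
  refine (PiLp.continuous_toLp 2 _).comp (continuous_pi fun i ↦ ?_)
  change Continuous fun p : ℝ × Space n ↦
    (Fin.insertNth j p.1 (WithLp.ofLp p.2) : Fin (n + 1) → ℝ) i
  rcases Fin.eq_self_or_eq_succAbove j i with rfl | ⟨i, rfl⟩
  · simpa using continuous_fst
  · have : Continuous fun p : ℝ × Space n ↦ p.2 i := by fun_prop
    simpa using this

/-- The substitution `ρ = (τ² + b²)^{1/2}`. -/
theorem integral_Ioi_sqrt_substitution {E : Type*} [NormedAddCommGroup E] [NormedSpace ℝ E]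
    {b : ℝ} (hb : 0 ≤ b) (g : ℝ → E) :
    ∫ ρ in Ioi b, g ρ =
      ∫ τ in Ioi (0 : ℝ), (τ / Real.sqrt (τ ^ 2 + b ^ 2)) • g (Real.sqrt (τ ^ 2 + b ^ 2)) := by
  have him : (fun τ : ℝ ↦ Real.sqrt (τ ^ 2 + b ^ 2)) '' Ioi 0 = Ioi b := by
    ext ρ
    constructor
    · rintro ⟨τ, hτ, rfl⟩
      exact (Real.lt_sqrt hb).2 (by have : (0 : ℝ) < τ := hτ; nlinarith)
    · intro hρ
      have h1 : 0 < ρ ^ 2 - b ^ 2 := by have : b < ρ := hρ; nlinarith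
      refine ⟨Real.sqrt (ρ ^ 2 - b ^ 2), Real.sqrt_pos.2 h1, ?_⟩
      simp only [Real.sq_sqrt h1.le, sub_add_cancel]
      exact Real.sqrt_sq (hb.trans (le_of_lt hρ))
  rw [← him, integral_image_eq_integral_abs_deriv_smul measurableSet_Ioi
    (f' := fun τ ↦ τ / Real.sqrt (τ ^ 2 + b ^ 2))]
  · refine setIntegral_congr_fun measurableSet_Ioi fun τ hτ ↦ ?_
    rw [abs_of_nonneg (div_nonneg (le_of_lt hτ) (Real.sqrt_nonneg _))]
  · intro τ hτ
    have hτ' : (0 : ℝ) < τ := hτ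
    have h1 : HasDerivAt (fun τ : ℝ ↦ τ ^ 2 + b ^ 2) (2 * τ) τ := by
      simpa using (hasDerivAt_pow 2 τ).add_const (b ^ 2)
    have h2 := h1.sqrt (by positivity)
    refine (h2.congr_deriv ?_).hasDerivWithinAt
    rw [mul_div_mul_left _ _ two_ne_zero]
  · intro τ hτ τ' hτ' h
    have h1 : (0 : ℝ) < τ := hτ
    have h2 : (0 : ℝ) < τ' := hτ'
    have h3 := (Real.sqrt_inj (by positivity) (by positivity)).1 h
    have h4 : τ ^ 2 = τ' ^ 2 := by linarith
    exact (pow_left_inj₀ h1.le h2.le two_ne_zero).1 h4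

theorem integral_eq_integral_Ioi_add_neg {E : Type*} [NormedAddCommGroup E] [NormedSpace ℝ E]
    {g : ℝ → E} (hg : Integrable g) : ∫ τ, g τ = ∫ τ in Ioi (0 : ℝ), (g τ + g (-τ)) := by
  have h1 : IntegrableOn (fun τ ↦ g (-τ)) (Ioi 0) := hg.comp_neg.integrableOn
  rw [integral_add hg.integrableOn h1, integral_comp_neg_Ioi, neg_zero, add_comm,
    intervalIntegral.integral_Iic_add_Ioi hg.integrableOn hg.integrableOn]

/-! ### The integral representation of the Bessel function -/

/-- The Wallis product in the integrals of even powers of the sine, in terms of factorials. -/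
theorem prod_odd_div_even (n : ℕ) : ∏ i ∈ Finset.range n, ((2 * i + 1 : ℝ) / (2 * i + 2)) =
    (2 * n).factorial / (4 ^ n * (n.factorial : ℝ) ^ 2) := by
  induction n with
  | zero => simp
  | succ n ih =>
    rw [Finset.prod_range_succ, ih, show 2 * (n + 1) = 2 * n + 1 + 1 by ring, Nat.factorial_succ,
      Nat.factorial_succ, Nat.factorial_succ]
    push_cast
    have := Nat.factorial_ne_zero n
    field_simp
    ring

/-- Poisson's integral for `J_0`, by integrating the power series of the cosine termwise. -/
theorem integral_cos_mul_sin (z : ℝ) :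
    ∫ θ in (0 : ℝ)..Real.pi, Real.cos (z * Real.sin θ) = Real.pi * besselJZero z := by
  have hs := intervalIntegral.hasSum_integral_of_dominated_convergence (μ := volume)
    (a := 0) (b := Real.pi)
    (F := fun (n : ℕ) θ ↦ (-1) ^ n * (z * Real.sin θ) ^ (2 * n) / ((2 * n).factorial : ℝ))
    (f := fun θ ↦ Real.cos (z * Real.sin θ))
    (fun n _ ↦ |z| ^ (2 * n) / ((2 * n).factorial : ℝ))
    (fun n ↦ Continuous.aestronglyMeasurable (by fun_prop))
    (fun n ↦ Eventually.of_forall fun θ _ ↦ ?_)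
    (Eventually.of_forall fun θ _ ↦
      (Real.hasSum_cosh |z|).summable)
    (intervalIntegrable_const) (Eventually.of_forall fun θ _ ↦ Real.hasSum_cos _)
  · rw [besselJZero, ← tsum_mul_left, ← hs.tsum_eq]
    congr 1
    ext n
    simp only [mul_pow, intervalIntegral.integral_div, intervalIntegral.integral_const_mul,
      integral_sin_pow_even, prod_odd_div_even, div_pow]
    rw [pow_mul z]
    field_simp
  · rw [norm_div, norm_mul, norm_pow, norm_neg, norm_one, one_pow, one_mul, norm_pow, norm_mul,
      Real.norm_natCast]
    gcongr
    exact mul_le_of_le_one_right (abs_nonneg _) (Real.abs_sin_le_one _)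

theorem abs_besselJZero_le (z : ℝ) : |besselJZero z| ≤ 1 := by
  have h := intervalIntegral.norm_integral_le_of_norm_le_const (a := 0) (b := Real.pi) (C := 1)
    (f := fun θ ↦ Real.cos (z * Real.sin θ)) fun θ _ ↦ Real.abs_cos_le_one _
  rw [integral_cos_mul_sin, norm_mul, Real.norm_eq_abs, Real.norm_eq_abs, sub_zero, one_mul] at h
  exact le_of_mul_le_mul_left (h.trans_eq (mul_one _).symm) (by simp [Real.pi_ne_zero])

theorem abs_cos_sub_cos_le (x y : ℝ) : |Real.cos x - Real.cos y| ≤ |x - y| := by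
  have := Real.lipschitzWith_cos.dist_le_mul x y
  simpa [Real.dist_eq] using this

theorem abs_sin_sub_sin_le (x y : ℝ) : |Real.sin x - Real.sin y| ≤ |x - y| := by
  have := Real.lipschitzWith_sin.dist_le_mul x y
  simpa [Real.dist_eq] using this

theorem abs_besselJZero_sub_le (z z' : ℝ) : |besselJZero z - besselJZero z'| ≤ |z - z'| := by
  have h := intervalIntegral.norm_integral_le_of_norm_le_const (a := 0) (b := Real.pi)
    (C := |z - z'|)
    (f := fun θ ↦ Real.cos (z * Real.sin θ) - Real.cos (z' * Real.sin θ)) fun θ _ ↦ by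
      refine (abs_cos_sub_cos_le _ _).trans ?_
      rw [← sub_mul, abs_mul]
      exact mul_le_of_le_one_right (abs_nonneg _) (Real.abs_sin_le_one _)
  rw [intervalIntegral.integral_sub (Continuous.intervalIntegrable (by fun_prop) _ _)
    (Continuous.intervalIntegrable (by fun_prop) _ _), integral_cos_mul_sin, integral_cos_mul_sin,
    ← mul_sub, norm_mul, Real.norm_eq_abs, Real.norm_eq_abs, sub_zero, mul_comm |z - z'|] at h
  exact le_of_mul_le_mul_left h (by simp [Real.pi_ne_zero])

theorem besselJZero_zero : besselJZero 0 = 1 := by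
  have := integral_cos_mul_sin 0
  simp only [zero_mul, Real.cos_zero, intervalIntegral.integral_const, sub_zero, smul_eq_mul,
    mul_one] at this
  exact (mul_left_cancel₀ Real.pi_pos.ne' (by rw [← this, mul_one])).symm

/-- The integral of `e^{i z cos}` over a period, in terms of `J_0`. -/
theorem integral_exp_cos_sub (z φ : ℝ) :
    ∫ θ in (-Real.pi)..Real.pi, Complex.exp (Complex.I * ((z * Real.cos (θ - φ) : ℝ) : ℂ)) =
      ((2 * Real.pi * besselJZero z : ℝ) : ℂ) := by
  set g : ℝ → ℂ := fun θ ↦ Complex.exp (Complex.I * ((z * Real.sin θ : ℝ) : ℂ)) with hg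
  have hgp : Function.Periodic g (2 * Real.pi) := fun θ ↦ by
    simp only [hg, Real.sin_add_two_pi]
  have hgc : Continuous g := by fun_prop
  have e1 : (fun θ ↦ Complex.exp (Complex.I * ((z * Real.cos (θ - φ) : ℝ) : ℂ))) =
      fun θ ↦ g (θ + (Real.pi / 2 - φ)) := by
    ext θ
    simp only [hg]
    rw [← Real.sin_add_pi_div_two]
    congr 5
    ring
  rw [e1, intervalIntegral.integral_comp_add_right]
  have e2 : Real.pi + (Real.pi / 2 - φ) = -Real.pi + (Real.pi / 2 - φ) + 2 * Real.pi := by ring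
  rw [e2, hgp.intervalIntegral_add_eq _ (-Real.pi), show -Real.pi + 2 * Real.pi = Real.pi by ring,
    ← intervalIntegral.integral_add_adjacent_intervals (hgc.intervalIntegrable _ 0)
      (hgc.intervalIntegrable 0 _)]
  have e3 : ∫ θ in (-Real.pi)..0, g θ = ∫ θ in (0 : ℝ)..Real.pi, g (-θ) := by
    rw [intervalIntegral.integral_comp_neg]; simp
  have hgn : Continuous fun θ ↦ g (-θ) := hgc.comp continuous_neg
  rw [e3, ← intervalIntegral.integral_add (hgn.intervalIntegrable _ _)
    (hgc.intervalIntegrable _ _)]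
  have e4 : (fun θ ↦ g (-θ) + g θ) = fun θ ↦ ((2 * Real.cos (z * Real.sin θ) : ℝ) : ℂ) := by
    ext θ
    simp only [hg, Real.sin_neg, mul_neg]
    push_cast
    rw [Complex.cos]
    ring_nf
  rw [e4, intervalIntegral.integral_ofReal, intervalIntegral.integral_const_mul,
    integral_cos_mul_sin]
  congr 1
  ring

/-! ### Fourier integrals of radial functions -/

/-- The factor `2`, `2πρ`, `4πρ` in dimension 1, 2, 3 by which the solution `G^{ρ,0}` has to be
multiplied to become the Fourier integral over the sphere of radius `ρ`. -/
def sphereConst (d : ℕ) (ρ : ℝ) : ℝ :=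
  match d with
  | 1 => 2
  | 2 => 2 * Real.pi * ρ
  | _ => 4 * Real.pi * ρ

theorem integrable_radial {w : ℝ → ℂ} (hw : Measurable w) {M : ℝ} (hM : ∀ ρ, ‖w ρ‖ ≤ M) {b : ℝ}
    (hb : ∀ ρ, b < ρ → w ρ = 0) {e : Space d → ℂ} (he : Continuous e) (he1 : ∀ ξ, ‖e ξ‖ ≤ 1) :
    Integrable (fun ξ : Space d ↦ e ξ * w ‖ξ‖) := by
  refine integrable_of_bounded_of_support (M := M) (s := Metric.closedBall 0 b)
    (he.measurable.mul (hw.comp measurable_norm)).aestronglyMeasurable (fun ξ ↦ ?_)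
    measure_closedBall_lt_top fun ξ hξ ↦ ?_
  · rw [norm_mul]
    exact (mul_le_of_le_one_left (norm_nonneg _) (he1 ξ)).trans (hM _)
  · rw [hb, mul_zero]
    simpa using hξ

theorem norm_exp_I_mul_ofReal (x : ℝ) : ‖Complex.exp (Complex.I * (x : ℂ))‖ = 1 := by
  rw [mul_comm]; exact Complex.norm_exp_ofReal_mul_I x

theorem integral_exp_radial_one {w : ℝ → ℂ} (hw : Measurable w) {M : ℝ} (hM : ∀ ρ, ‖w ρ‖ ≤ M)
    {b : ℝ} (hb : ∀ ρ, b < ρ → w ρ = 0) (x : Space 1) :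
    ∫ ξ, Complex.exp (Complex.I * (⟪x, ξ⟫_ℝ : ℂ)) * w ‖ξ‖ =
      ∫ ρ in Ioi (0 : ℝ), w ρ * ((sphereConst 1 ρ * greenHom ρ x : ℝ) : ℂ) := by
  let e : ℝ ≃ᵐ Space 1 := (MeasurableEquiv.funUnique (Fin 1) ℝ).symm.trans
    (MeasurableEquiv.toLp 2 (Fin 1 → ℝ))
  have he : MeasurePreserving e volume volume :=
    (PiLp.volume_preserving_toLp (Fin 1)).comp (volume_preserving_funUnique (Fin 1) ℝ).symm
  have h0 : ∀ t, e t 0 = t := fun t ↦ rfl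
  have hn : ∀ y : Space 1, ‖y‖ = |y 0| := fun y ↦ by
    rw [EuclideanSpace.norm_eq]; simp [Real.sqrt_sq_eq_abs]
  have hin : ∀ t, ⟪x, e t⟫_ℝ = x 0 * t := fun t ↦ by
    rw [PiLp.inner_apply]; simp [h0, mul_comm]
  have hi := he.integrable_comp_of_integrable (integrable_radial hw hM hb
    (e := fun ξ ↦ Complex.exp (Complex.I * (⟪x, ξ⟫_ℝ : ℂ))) (by fun_prop)
    fun ξ ↦ (norm_exp_I_mul_ofReal _).le)
  rw [← he.integral_comp']
  refine (integral_eq_integral_Ioi_add_neg hi).trans ?_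
  refine setIntegral_congr_fun measurableSet_Ioi fun t ht ↦ ?_
  have ht' : |t| = t := abs_of_pos ht
  simp only [Function.comp_apply, hin, hn, h0, abs_neg, ht', greenHom, sphereConst]
  have hc : Real.cos (t * |x 0|) = Real.cos (x 0 * t) := by
    rw [← ht', ← abs_mul, Real.cos_abs, ht', mul_comm]
  rw [hc]
  push_cast
  rw [Complex.cos]
  ring_nf

/-- In dimension 2 the formula follows from polar coordinates and the integral representation of
`J_0`. -/
theorem integral_exp_radial_two {w : ℝ → ℂ} (hw : Measurable w) {M : ℝ} (hM : ∀ ρ, ‖w ρ‖ ≤ M)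
    {b : ℝ} (hb : ∀ ρ, b < ρ → w ρ = 0) (x : Space 2) :
    ∫ ξ, Complex.exp (Complex.I * (⟪x, ξ⟫_ℝ : ℂ)) * w ‖ξ‖ =
      ∫ ρ in Ioi (0 : ℝ), w ρ * ((sphereConst 2 ρ * greenHom ρ x : ℝ) : ℂ) := by
  let e : ℝ × ℝ ≃ᵐ Space 2 := MeasurableEquiv.finTwoArrow.symm.trans
    (MeasurableEquiv.toLp 2 (Fin 2 → ℝ))
  have he : MeasurePreserving e volume volume :=
    (PiLp.volume_preserving_toLp (Fin 2)).comp (volume_preserving_finTwoArrow ℝ).symm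
  have h0 : ∀ p, e p 0 = p.1 := fun t ↦ rfl
  have h1 : ∀ p, e p 1 = p.2 := fun t ↦ rfl
  have hn : ∀ p : ℝ × ℝ, ‖e p‖ = Real.sqrt (p.1 ^ 2 + p.2 ^ 2) := fun y ↦ by
    rw [EuclideanSpace.norm_eq]; simp [h0, h1, Fin.sum_univ_two]
  have hin : ∀ p, ⟪x, e p⟫_ℝ = x 0 * p.1 + x 1 * p.2 := fun t ↦ by
    rw [PiLp.inner_apply]; simp [h0, h1, mul_comm, Fin.sum_univ_two]
  obtain ⟨φ, hφ0, hφ1⟩ : ∃ φ, x 0 = ‖x‖ * Real.cos φ ∧ x 1 = ‖x‖ * Real.sin φ := by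
    have hz : ‖(⟨x 0, x 1⟩ : ℂ)‖ = ‖x‖ := by
      rw [EuclideanSpace.norm_eq, Complex.norm_def, Complex.normSq_mk]
      simp [Fin.sum_univ_two, sq]
    refine ⟨Complex.arg ⟨x 0, x 1⟩, ?_, ?_⟩
    · rw [← hz, Complex.norm_mul_cos_arg]
    · rw [← hz, Complex.norm_mul_sin_arg]
  rw [← he.integral_comp', ← integral_comp_polarCoord_symm]
  have hcongr : ∀ p ∈ polarCoord.target, p.1 • (Complex.exp (Complex.I *
      (⟪x, e (polarCoord.symm p)⟫_ℝ : ℂ)) * w ‖e (polarCoord.symm p)‖) =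
      p.1 * w p.1 * Complex.exp (Complex.I *
        ((p.1 * ‖x‖ * Real.cos (p.2 - φ) : ℝ) : ℂ)) := by
    intro p hp
    rw [polarCoord_target] at hp
    have hp1 : 0 < p.1 := hp.1
    have e1 : ⟪x, e (polarCoord.symm p)⟫_ℝ = p.1 * ‖x‖ * Real.cos (p.2 - φ) := by
      rw [hin, polarCoord_symm_apply, Real.cos_sub, hφ0, hφ1]; ring
    have e2 : ‖e (polarCoord.symm p)‖ = p.1 := by
      rw [hn, polarCoord_symm_apply]
      simp only [mul_pow]
      rw [← mul_add, Real.cos_sq_add_sin_sq, mul_one, Real.sqrt_sq hp1.le]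
    rw [e1, e2, Complex.real_smul]
    ring
  rw [setIntegral_congr_fun polarCoord.open_target.measurableSet hcongr, polarCoord_target,
    Measure.volume_eq_prod, setIntegral_prod]
  · refine setIntegral_congr_fun measurableSet_Ioi fun ρ hρ ↦ ?_
    simp only
    rw [integral_const_mul, ← integral_Ioc_eq_integral_Ioo,
      ← intervalIntegral.integral_of_le (by linarith [Real.pi_pos])]
    have := integral_exp_cos_sub (ρ * ‖x‖) φ
    rw [this]
    simp only [sphereConst, greenHom]
    push_cast
    ring
  · have hfm : Measurable fun p : ℝ × ℝ ↦ p.1 * w p.1 * Complex.exp (Complex.I *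
        ((p.1 * ‖x‖ * Real.cos (p.2 - φ) : ℝ) : ℂ)) := by fun_prop
    refine IntegrableOn.of_forall_sdiff_eq_zero (s := Icc 0 b ×ˢ Icc (-Real.pi) Real.pi) ?_
      (measurableSet_Ioi.prod measurableSet_Ioo) ?_
    · refine Measure.integrableOn_of_bounded (M := |b| * M)
        (isCompact_Icc.prod isCompact_Icc).measure_lt_top.ne
        hfm.aestronglyMeasurable ?_
      refine (ae_restrict_iff' (measurableSet_Icc.prod measurableSet_Icc)).2
        (Eventually.of_forall fun p hp ↦ ?_)
      rw [norm_mul, norm_exp_I_mul_ofReal, mul_one, norm_mul, Complex.norm_real, Real.norm_eq_abs,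
        abs_of_nonneg hp.1.1]
      exact mul_le_mul (hp.1.2.trans (le_abs_self b)) (hM _) (norm_nonneg _) (abs_nonneg _)
    · rintro p ⟨hp, hp'⟩
      have : b < p.1 := by
        by_contra h
        exact hp' ⟨⟨le_of_lt hp.1, not_lt.1 h⟩, Ioo_subset_Icc_self hp.2⟩
      rw [hb _ this, mul_zero, zero_mul]

theorem integral_exp_I_mul (r : ℝ) (hr : r ≠ 0) (ρ : ℝ) :
    ∫ τ in (-ρ)..ρ, Complex.exp (Complex.I * ((r * τ : ℝ) : ℂ)) =
      ((2 * (Real.sin (ρ * r) / r) : ℝ) : ℂ) := by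
  have h : Complex.I * (r : ℂ) ≠ 0 := mul_ne_zero Complex.I_ne_zero (by exact_mod_cast hr)
  have e : (fun τ : ℝ ↦ Complex.exp (Complex.I * ((r * τ : ℝ) : ℂ))) =
      fun τ : ℝ ↦ Complex.exp (Complex.I * (r : ℂ) * τ) := by
    ext τ; push_cast; ring_nf
  rw [e, integral_exp_mul_complex h]
  push_cast
  rw [Complex.sin, div_eq_iff h]
  have hr' : (r : ℂ) ≠ 0 := by exact_mod_cast hr
  field_simp
  ring_nf
  simp only [Complex.I_sq]
  ring_nf

/-- In dimension 3 the integral over the planes orthogonal to the first axis reduces, by the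
two-dimensional formula at frequency zero, to an integral over `ρ > |τ|`; the order of integration
in `τ` and `ρ` is then exchanged. -/
theorem integral_exp_radial_three_aux {w : ℝ → ℂ} (hw : Measurable w) {M : ℝ}
    (hM : ∀ ρ, ‖w ρ‖ ≤ M) {b : ℝ} (hb : ∀ ρ, b < ρ → w ρ = 0) {r : ℝ} (hr : 0 < r) :
    ∫ ξ : Space 3, Complex.exp (Complex.I * ((r * ξ 0 : ℝ) : ℂ)) * w ‖ξ‖ =
      ∫ ρ in Ioi (0 : ℝ), w ρ * ((4 * Real.pi * ρ * (Real.sin (ρ * r) / r) : ℝ) : ℂ) := by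
  have hM0 : 0 ≤ M := (norm_nonneg _).trans (hM 0)
  have hi := (measurePreserving_slice (0 : Fin 3)).integrable_comp_of_integrable
    (integrable_radial hw hM hb (e := fun ξ : Space 3 ↦ Complex.exp (Complex.I *
      ((r * ξ 0 : ℝ) : ℂ))) (by fun_prop) fun ξ ↦ (norm_exp_I_mul_ofReal _).le)
  rw [← (measurePreserving_slice (0 : Fin 3)).integral_comp']
  refine (integral_prod _ hi).trans ?_
  -- the integral over a plane at distance `|τ|` from the origin
  have hplane : ∀ τ : ℝ, ∫ η : Space 2, w (Real.sqrt (τ ^ 2 + ‖η‖ ^ 2)) =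
      ∫ ρ in Ioi |τ|, ((2 * Real.pi * ρ : ℝ) : ℂ) * w ρ := by
    intro τ
    have h2 := integral_exp_radial_two (w := fun s ↦ w (Real.sqrt (s ^ 2 + |τ| ^ 2)))
      (by fun_prop) (M := M) (fun _ ↦ hM _) (b := |b|) (fun ρ hρ ↦ hb _ ?_) 0
    · rw [integral_Ioi_sqrt_substitution (abs_nonneg τ)]
      refine Eq.trans ?_ (h2.trans ?_)
      · refine integral_congr_ae (Eventually.of_forall fun η ↦ ?_)
        simp [add_comm]
      · refine setIntegral_congr_fun measurableSet_Ioi fun s hs ↦ ?_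
        have hs0 : 0 < Real.sqrt (s ^ 2 + |τ| ^ 2) :=
          Real.sqrt_pos.2 (by have : (0 : ℝ) < s := hs; positivity)
        have hs1 : (Real.sqrt (s ^ 2 + |τ| ^ 2) : ℂ) ≠ 0 := by exact_mod_cast hs0.ne'
        simp only [sphereConst, greenHom, norm_zero, mul_zero, besselJZero_zero, mul_one,
          Complex.real_smul]
        push_cast
        field_simp
    · refine (le_abs_self b).trans_lt (hρ.trans_le ?_)
      exact Real.le_sqrt_of_sq_le (le_add_of_nonneg_right (by positivity))
  have hinner : ∀ τ : ℝ, ∫ η : Space 2, (fun ξ : Space 3 ↦ Complex.exp (Complex.I *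
      ((r * ξ 0 : ℝ) : ℂ)) * w ‖ξ‖) (slice 0 (τ, η)) =
      ∫ ρ in Ioi (0 : ℝ), (Ioi |τ|).indicator (fun ρ ↦
        Complex.exp (Complex.I * ((r * τ : ℝ) : ℂ)) * (((2 * Real.pi * ρ : ℝ) : ℂ) * w ρ)) ρ := by
    intro τ
    simp only [slice_apply_self, norm_slice]
    rw [integral_const_mul, hplane, ← integral_const_mul, setIntegral_indicator measurableSet_Ioi]
    congr 2
    ext ρ
    simp only [mem_Ioi, mem_inter_iff]
    exact ⟨fun h ↦ ⟨(abs_nonneg τ).trans_lt h, h⟩, fun h ↦ h.2⟩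
  refine (integral_congr_ae (Eventually.of_forall hinner)).trans ?_
  have hms : MeasurableSet {p : ℝ × ℝ | |p.1| < p.2} :=
    (isOpen_lt (by fun_prop) (by fun_prop)).measurableSet
  set G : ℝ → ℝ → ℂ := fun τ ρ ↦ (Ioi |τ|).indicator (fun ρ ↦
        Complex.exp (Complex.I * ((r * τ : ℝ) : ℂ)) * (((2 * Real.pi * ρ : ℝ) : ℂ) * w ρ)) ρ with hG
  have hGu : Function.uncurry G = {p : ℝ × ℝ | |p.1| < p.2}.indicator (fun p ↦
      Complex.exp (Complex.I * ((r * p.1 : ℝ) : ℂ)) * (((2 * Real.pi * p.2 : ℝ) : ℂ) * w p.2)) := by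
    ext p
    simp [hG, Function.uncurry, indicator]
  have hGi : Integrable (Function.uncurry G) (volume.prod (volume.restrict (Ioi 0))) := by
    refine integrable_of_bounded_of_support (M := 2 * Real.pi * |b| * M)
      (s := Icc (-|b|) |b| ×ˢ Icc (-|b|) |b|) ?_ (fun p ↦ ?_) ?_ (fun p hp ↦ ?_)
    · rw [hGu]
      exact Measurable.aestronglyMeasurable (Measurable.indicator (by fun_prop) hms)
    · rw [hGu]
      by_cases hp : |p.1| < p.2
      · rw [indicator_of_mem (by exact hp)]
        by_cases hpb : b < p.2
        · rw [hb _ hpb]; simp only [mul_zero, norm_zero]; positivity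
        · rw [norm_mul, norm_exp_I_mul_ofReal, one_mul, norm_mul, Complex.norm_real,
            Real.norm_eq_abs]
          have h1 : 0 ≤ p.2 := (abs_nonneg _).trans hp.le
          rw [abs_of_nonneg (by positivity)]
          have h3 : p.2 ≤ |b| := (not_lt.1 hpb).trans (le_abs_self b)
          gcongr
          exact hM _
      · rw [indicator_of_notMem (by exact hp), norm_zero]; positivity
    · refine lt_of_le_of_lt (Measure.prod_mono le_rfl Measure.restrict_le_self _) ?_
      exact (isCompact_Icc.prod isCompact_Icc).measure_lt_top
    · rw [hGu]
      by_cases h : |p.1| < p.2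
      · rw [indicator_of_mem (by exact h), hb, mul_zero, mul_zero]
        by_contra hcon
        have h3 : p.2 ≤ |b| := (not_lt.1 hcon).trans (le_abs_self b)
        have h4 := abs_le.1 (h.le.trans h3)
        exact hp ⟨h4, by linarith [abs_nonneg p.1, abs_nonneg b], h3⟩
      · rw [indicator_of_notMem (by exact h)]
  -- for fixed `ρ` the remaining integral is that of `e^{i r τ}` over `|τ| < ρ`
  rw [integral_integral_swap hGi]
  refine setIntegral_congr_fun measurableSet_Ioi fun ρ hρ ↦ ?_
  have hρ0 : (0 : ℝ) < ρ := hρ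
  have e1 : (fun τ ↦ G τ ρ) = (Ioo (-ρ) ρ).indicator (fun τ ↦
      Complex.exp (Complex.I * ((r * τ : ℝ) : ℂ)) * (((2 * Real.pi * ρ : ℝ) : ℂ) * w ρ)) := by
    ext τ
    simp [hG, indicator, abs_lt]
  rw [e1, integral_indicator measurableSet_Ioo, integral_mul_const, ← integral_Ioc_eq_integral_Ioo,
    ← intervalIntegral.integral_of_le (by linarith), integral_exp_I_mul r hr.ne']
  push_cast
  ring

theorem integral_exp_radial_three {w : ℝ → ℂ} (hw : Measurable w) {M : ℝ} (hM : ∀ ρ, ‖w ρ‖ ≤ M)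
    {b : ℝ} (hb : ∀ ρ, b < ρ → w ρ = 0) {x : Space 3} (hx : x ≠ 0) :
    ∫ ξ, Complex.exp (Complex.I * (⟪x, ξ⟫_ℝ : ℂ)) * w ‖ξ‖ =
      ∫ ρ in Ioi (0 : ℝ), w ρ * ((sphereConst 3 ρ * greenHom ρ x : ℝ) : ℂ) := by
  -- Rotate `x` to the first coordinate axis.
  set y : Space 3 := EuclideanSpace.single 0 ‖x‖ with hy
  have hxy : ‖x‖ = ‖y‖ := by simp [hy]
  set R := Submodule.reflection (Submodule.span ℝ {x - y})ᗮ with hR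
  have hRx : R x = y := Submodule.reflection_sub hxy
  have hRR : ∀ z, R (R z) = z := Submodule.reflection_reflection _
  rw [← R.measurePreserving.integral_comp R.toHomeomorph.measurableEmbedding]
  have h : ∀ ξ, ⟪x, R ξ⟫_ℝ = ‖x‖ * ξ 0 := fun ξ ↦ by
    rw [← R.inner_map_map, hRR, hRx, hy, EuclideanSpace.inner_single_left]
    simp
  simp only [h, LinearIsometryEquiv.norm_map]
  exact integral_exp_radial_three_aux hw hM hb (norm_pos_iff.2 hx)

/-- The Fourier integral of a radial function in dimension 1, 2, 3. -/
theorem integral_exp_radial (hd : d = 1 ∨ d = 2 ∨ d = 3) {w : ℝ → ℂ} (hw : Measurable w) {M : ℝ}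
    (hM : ∀ ρ, ‖w ρ‖ ≤ M) {b : ℝ} (hb : ∀ ρ, b < ρ → w ρ = 0) {x : Space d} (hx : x ≠ 0) :
    ∫ ξ, Complex.exp (Complex.I * (⟪x, ξ⟫_ℝ : ℂ)) * w ‖ξ‖ =
      ∫ ρ in Ioi (0 : ℝ), w ρ * ((sphereConst d ρ * greenHom ρ x : ℝ) : ℂ) := by
  rcases hd with rfl | rfl | rfl
  · exact integral_exp_radial_one hw hM hb x
  · exact integral_exp_radial_two hw hM hb x
  · exact integral_exp_radial_three hw hM hb hx

theorem abs_greenHom_sub_le (hd : d = 1 ∨ d = 2 ∨ d = 3) (ρ ρ' : ℝ) (x : Space d) :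
    |greenHom ρ x - greenHom ρ' x| ≤ (1 + ‖x‖) * |ρ - ρ'| := by
  have hx := norm_nonneg x
  have h0 : |ρ * ‖x‖ - ρ' * ‖x‖| = |ρ - ρ'| * ‖x‖ := by rw [← sub_mul, abs_mul, abs_norm]
  have h1 : |ρ * ‖x‖ - ρ' * ‖x‖| ≤ (1 + ‖x‖) * |ρ - ρ'| := by
    rw [h0]; nlinarith [abs_nonneg (ρ - ρ')]
  rcases hd with rfl | rfl | rfl
  · exact (abs_cos_sub_cos_le _ _).trans h1
  · exact (abs_besselJZero_sub_le _ _).trans h1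
  · change |Real.sin (ρ * ‖x‖) / ‖x‖ - Real.sin (ρ' * ‖x‖) / ‖x‖| ≤ _
    rw [← sub_div, abs_div, abs_norm]
    rcases hx.eq_or_lt with h | h
    · rw [← h, div_zero]; positivity
    · rw [div_le_iff₀ h]
      have := (abs_sin_sub_sin_le (ρ * ‖x‖) (ρ' * ‖x‖)).trans_eq h0
      nlinarith [abs_nonneg (ρ - ρ'), mul_nonneg (abs_nonneg (ρ - ρ')) (mul_nonneg hx hx)]

theorem abs_greenHom_le (hd : d = 1 ∨ d = 2 ∨ d = 3) (ρ : ℝ) (x : Space d) :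
    |greenHom ρ x| ≤ 1 + |ρ| := by
  have hx := norm_nonneg x
  rcases hd with rfl | rfl | rfl
  · exact (Real.abs_cos_le_one _).trans (by linarith [abs_nonneg ρ])
  · exact (abs_besselJZero_le _).trans (by linarith [abs_nonneg ρ])
  · change |Real.sin (ρ * ‖x‖) / ‖x‖| ≤ _
    rw [abs_div, abs_norm]
    refine div_le_of_le_mul₀ hx (by positivity) ((Real.abs_sin_le_abs).trans ?_)
    rw [abs_mul, abs_norm]
    nlinarith [abs_nonneg ρ]

theorem measurable_besselJZero : Measurable besselJZero := by
  have : LipschitzWith 1 besselJZero := LipschitzWith.of_dist_le_mul fun x y ↦ by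
    simpa [Real.dist_eq] using abs_besselJZero_sub_le x y
  exact this.continuous.measurable

theorem measurable_greenHom (hd : d = 1 ∨ d = 2 ∨ d = 3) :
    Measurable (fun p : ℝ × Space d ↦ greenHom p.1 p.2) := by
  have := measurable_besselJZero
  rcases hd with rfl | rfl | rfl <;> (unfold greenHom; fun_prop)

/-! ### The integral of a Fourier transform over a sphere -/

/-- The integral of `ξ ↦ ψ̂(-ξ)` over the sphere of radius `ρ`, written as a pairing of `ψ` with the
solution `G^{ρ,0}` of the homogeneous equation. -/
def sphereMean (ψ : Space d → ℂ) (ρ : ℝ) : ℂ :=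
  ∫ x, ((sphereConst d ρ * greenHom ρ x : ℝ) : ℂ) * ψ x

theorem abs_sphereConst_le (hd : d = 1 ∨ d = 2 ∨ d = 3) (ρ : ℝ) :
    |sphereConst d ρ| ≤ 4 * Real.pi * (1 + |ρ|) := by
  have h := Real.pi_gt_three
  have hρ := abs_nonneg ρ
  rcases hd with rfl | rfl | rfl <;> simp only [sphereConst, abs_mul, Nat.abs_ofNat,
    abs_of_pos Real.pi_pos] <;> nlinarith

theorem abs_sphereConst_sub_le (hd : d = 1 ∨ d = 2 ∨ d = 3) (ρ ρ' : ℝ) :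
    |sphereConst d ρ - sphereConst d ρ'| ≤ 4 * Real.pi * |ρ - ρ'| := by
  have h := Real.pi_gt_three
  have hρ := abs_nonneg (ρ - ρ')
  rcases hd with rfl | rfl | rfl <;> simp only [sphereConst, ← mul_sub, abs_mul,
    Nat.abs_ofNat, abs_of_pos Real.pi_pos, sub_self, abs_zero] <;> nlinarith

theorem measurable_sphereConst (hd : d = 1 ∨ d = 2 ∨ d = 3) : Measurable (sphereConst d) := by
  rcases hd with rfl | rfl | rfl <;> (unfold sphereConst; fun_prop)

theorem abs_sphereConst_mul_greenHom_sub_le (hd : d = 1 ∨ d = 2 ∨ d = 3) {R ρ ρ' : ℝ}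
    (hρ : |ρ| ≤ R) (hρ' : |ρ'| ≤ R) (x : Space d) :
    |sphereConst d ρ * greenHom ρ x - sphereConst d ρ' * greenHom ρ' x| ≤
      8 * Real.pi * (1 + R) * (1 + ‖x‖) * |ρ - ρ'| := by
  have hx := norm_nonneg x
  have hπ := Real.pi_pos
  have hr := abs_nonneg (ρ - ρ')
  have hR : 0 ≤ R := (abs_nonneg ρ).trans hρ
  have e : sphereConst d ρ * greenHom ρ x - sphereConst d ρ' * greenHom ρ' x =
      sphereConst d ρ * (greenHom ρ x - greenHom ρ' x) +
        (sphereConst d ρ - sphereConst d ρ') * greenHom ρ' x := by ring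
  rw [e]
  refine (abs_add_le _ _).trans ?_
  rw [abs_mul, abs_mul]
  calc _ ≤ 4 * Real.pi * (1 + R) * ((1 + ‖x‖) * |ρ - ρ'|) + 4 * Real.pi * |ρ - ρ'| * (1 + R) := by
        gcongr
        · exact (abs_sphereConst_le hd ρ).trans (by gcongr)
        · exact abs_greenHom_sub_le hd ρ ρ' x
        · exact abs_sphereConst_sub_le hd ρ ρ'
        · exact (abs_greenHom_le hd ρ' x).trans (by gcongr)
    _ ≤ _ := by
        have : 0 ≤ Real.pi * (1 + R) * |ρ - ρ'| * ‖x‖ := by positivity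
        nlinarith

theorem abs_sphereConst_mul_greenHom_le (hd : d = 1 ∨ d = 2 ∨ d = 3) (ρ : ℝ) (x : Space d) :
    |sphereConst d ρ * greenHom ρ x| ≤ 4 * Real.pi * (1 + |ρ|) ^ 2 := by
  rw [abs_mul, sq, ← mul_assoc]
  exact mul_le_mul (abs_sphereConst_le hd ρ) (abs_greenHom_le hd ρ x) (abs_nonneg _)
    (by have := Real.pi_pos; positivity)

theorem measurable_sphereConst_mul_greenHom (hd : d = 1 ∨ d = 2 ∨ d = 3) :
    Measurable (fun p : ℝ × Space d ↦ ((sphereConst d p.1 * greenHom p.1 p.2 : ℝ) : ℂ)) := by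
  have h1 := (measurable_sphereConst hd).comp
    (measurable_fst : Measurable (Prod.fst : ℝ × Space d → ℝ))
  exact Complex.measurable_ofReal.comp (h1.mul (measurable_greenHom hd))

theorem integrable_sphereConst_mul (hd : d = 1 ∨ d = 2 ∨ d = 3) {ψ : Space d → ℂ}
    (hψ : Integrable ψ) (ρ : ℝ) :
    Integrable (fun x ↦ ((sphereConst d ρ * greenHom ρ x : ℝ) : ℂ) * ψ x) := by
  refine hψ.bdd_mul (c := 4 * Real.pi * (1 + |ρ|) ^ 2)
    ((measurable_sphereConst_mul_greenHom hd).comp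
      measurable_prodMk_left).aestronglyMeasurable (Eventually.of_forall fun x ↦ ?_)
  rw [Complex.norm_real]
  exact abs_sphereConst_mul_greenHom_le hd ρ x

theorem norm_sphereMean_sub_le (hd : d = 1 ∨ d = 2 ∨ d = 3) {ψ : Space d → ℂ}
    (hψ : Integrable ψ) (hψ' : Integrable (fun x ↦ (1 + ‖x‖) * ‖ψ x‖)) {R ρ ρ' : ℝ}
    (hρ : |ρ| ≤ R) (hρ' : |ρ'| ≤ R) :
    ‖sphereMean ψ ρ - sphereMean ψ ρ'‖ ≤
      8 * Real.pi * (1 + R) * (∫ x, (1 + ‖x‖) * ‖ψ x‖) * |ρ - ρ'| := by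
  rw [sphereMean, sphereMean, ← integral_sub (integrable_sphereConst_mul hd hψ ρ)
    (integrable_sphereConst_mul hd hψ ρ')]
  refine (norm_integral_le_of_norm_le (hψ'.const_mul (8 * Real.pi * (1 + R) * |ρ - ρ'|))
    (Eventually.of_forall fun x ↦ ?_)).trans_eq ?_
  · rw [← sub_mul, norm_mul, ← Complex.ofReal_sub, Complex.norm_real, Real.norm_eq_abs]
    refine (mul_le_mul_of_nonneg_right (abs_sphereConst_mul_greenHom_sub_le hd hρ hρ' x)
      (norm_nonneg _)).trans_eq (by ring)
  · rw [integral_const_mul]; ring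

theorem ft_neg (ψ : Space d → ℂ) (ξ : Space d) :
    ft ψ (-ξ) = ∫ x, Complex.exp (Complex.I * (⟪x, ξ⟫_ℝ : ℂ)) * ψ x := by
  simp [ft]

/-- Integration in polar coordinates of a Fourier transform against a radial function. -/
theorem integral_ft_mul_radial (hd : d = 1 ∨ d = 2 ∨ d = 3) {ψ : Space d → ℂ} (hψ : Integrable ψ)
    {w : ℝ → ℂ} (hw : Measurable w) {M : ℝ} (hM : ∀ ρ, ‖w ρ‖ ≤ M) {b : ℝ}
    (hb : ∀ ρ, b < ρ → w ρ = 0) :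
    ∫ ξ : Space d, ft ψ (-ξ) * w ‖ξ‖ = ∫ ρ in Ioi (0 : ℝ), w ρ * sphereMean ψ ρ := by
  have hM0 : 0 ≤ M := (norm_nonneg _).trans (hM 0)
  have hwi : Integrable (fun ξ : Space d ↦ w ‖ξ‖) := by
    simpa using integrable_radial (d := d) hw hM hb (e := fun _ ↦ 1) (by fun_prop) (by simp)
  have h1 : Integrable (Function.uncurry fun (ξ x : Space d) ↦
      Complex.exp (Complex.I * (⟪x, ξ⟫_ℝ : ℂ)) * ψ x * w ‖ξ‖) (volume.prod volume) := by
    have := (hwi.mul_prod hψ).bdd_mul (c := 1)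
      (f := fun p : Space d × Space d ↦ Complex.exp (Complex.I * (⟪p.2, p.1⟫_ℝ : ℂ)))
      (Continuous.aestronglyMeasurable (by fun_prop))
      (Eventually.of_forall fun p ↦ (norm_exp_I_mul_ofReal _).le)
    refine this.congr (Eventually.of_forall fun p ↦ ?_)
    simp only [Function.uncurry]
    ring
  have h2 : Integrable (Function.uncurry fun (x : Space d) (ρ : ℝ) ↦
      ψ x * (w ρ * ((sphereConst d ρ * greenHom ρ x : ℝ) : ℂ)))
      (volume.prod (volume.restrict (Ioi 0))) := by
    have hw' : Integrable (fun ρ ↦ ((4 * Real.pi * (1 + |ρ|) ^ 2 : ℝ) : ℂ) * w ρ)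
        (volume.restrict (Ioi (0 : ℝ))) := by
      refine Integrable.congr (f := (Ioi (0 : ℝ)).indicator
        (fun ρ ↦ ((4 * Real.pi * (1 + |ρ|) ^ 2 : ℝ) : ℂ) * w ρ))
        (integrable_of_bounded_of_support (M := 4 * Real.pi * (1 + |b|) ^ 2 * M)
        (s := Icc 0 b) ?_ (fun ρ ↦ ?_) ?_ ?_) ?_
      · exact (Measurable.indicator (by fun_prop) measurableSet_Ioi).aestronglyMeasurable
      · by_cases hρ : ρ ∈ Ioi (0 : ℝ)
        · rw [indicator_of_mem hρ]
          by_cases hρb : b < ρ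
          · rw [hb _ hρb, mul_zero, norm_zero]; have := Real.pi_pos; positivity
          · rw [norm_mul, Complex.norm_real, Real.norm_eq_abs, abs_of_nonneg
              (by have := Real.pi_pos; positivity), abs_of_pos hρ]
            have : ρ ≤ |b| := (not_lt.1 hρb).trans (le_abs_self b)
            have := Real.pi_pos
            have : 0 < ρ := hρ
            gcongr
            exact hM _
        · rw [indicator_of_notMem hρ, norm_zero]; have := Real.pi_pos; positivity
      · exact (Measure.restrict_le_self _).trans_lt isCompact_Icc.measure_lt_top
      · intro ρ hρ
        by_cases h : ρ ∈ Ioi (0 : ℝ)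
        · rw [indicator_of_mem h, hb ρ, mul_zero]
          by_contra hc
          exact hρ ⟨le_of_lt h, not_lt.1 hc⟩
        · rw [indicator_of_notMem h]
      · filter_upwards [ae_restrict_mem measurableSet_Ioi] with ρ hρ
        rw [indicator_of_mem hρ]
    refine (hψ.mul_prod hw').mono ?_ (Eventually.of_forall fun p ↦ ?_)
    · refine hψ.aestronglyMeasurable.comp_fst.mul ?_
      exact ((hw.comp measurable_snd).mul ((measurable_sphereConst_mul_greenHom hd).comp
        measurable_swap)).aestronglyMeasurable
    · have h := abs_sphereConst_mul_greenHom_le hd p.2 p.1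
      simp only [Function.uncurry]
      rw [norm_mul, norm_mul, norm_mul, norm_mul, Complex.norm_real, Complex.norm_real,
        mul_comm ‖w p.2‖]
      gcongr
      exact h.trans (le_abs_self _)
  calc ∫ ξ : Space d, ft ψ (-ξ) * w ‖ξ‖
      = ∫ ξ : Space d, ∫ x, Complex.exp (Complex.I * (⟪x, ξ⟫_ℝ : ℂ)) * ψ x * w ‖ξ‖ := by
        simp only [ft_neg, integral_mul_const]
    _ = ∫ x, ∫ ξ : Space d, Complex.exp (Complex.I * (⟪x, ξ⟫_ℝ : ℂ)) * ψ x * w ‖ξ‖ :=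
        integral_integral_swap h1
    _ = ∫ x, ∫ ρ in Ioi (0 : ℝ), ψ x * (w ρ * ((sphereConst d ρ * greenHom ρ x : ℝ) : ℂ)) := by
        have : Nontrivial (Space d) := by rcases hd with rfl | rfl | rfl <;> infer_instance
        have h0 : ∀ᵐ x : Space d, x ≠ 0 := by simp [ae_iff]
        refine integral_congr_ae (h0.mono fun x hx ↦ ?_)
        simp only
        rw [integral_const_mul, ← integral_exp_radial hd hw hM hb hx, ← integral_const_mul]
        congr 1; ext ξ; ring
    _ = ∫ ρ in Ioi (0 : ℝ), ∫ x, ψ x * (w ρ * ((sphereConst d ρ * greenHom ρ x : ℝ) : ℂ)) :=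
        integral_integral_swap h2
    _ = ∫ ρ in Ioi (0 : ℝ), w ρ * sphereMean ψ ρ := by
        refine integral_congr_ae (Eventually.of_forall fun ρ ↦ ?_)
        simp only [sphereMean]
        rw [← integral_const_mul]
        congr 1; ext x; ring

/-! ### The singularity of the resolvent symbol -/

/-- The function `(1 + ρ²)^t / (ρ^{2α} - k^{2α})` of `ρ = |ξ|`. -/
def resolventSymbol (α t k ρ : ℝ) : ℝ := (1 + ρ ^ 2) ^ t / (ρ ^ (2 * α) - k ^ (2 * α))

/-- The residue of `resolventSymbol` at `ρ = k`. -/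
def resolventResidue (α t k : ℝ) : ℝ := (1 + k ^ 2) ^ t / (2 * α * k ^ (2 * α - 1))

/-- If `D` vanishes to first order, `D = a x + O(x²)`, and `q = q' + O(x)`, then `q / D` differs
from the pole `q' / (a x)` by a bounded amount, with an explicit constant. -/
theorem abs_div_sub_div_le {c C₁ C₂ Q a D x q q' : ℝ} (hc : 0 < c) (hx : x ≠ 0) (ha : c ≤ a)
    (hD : c * |x| ≤ |D|) (hT : |D - a * x| ≤ C₂ * x ^ 2) (hq : |q - q'| ≤ C₁ * |x|)
    (hq' : |q'| ≤ Q) : |q / D - q' / a / x| ≤ C₁ / c + Q * (C₂ / c ^ 2) := by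
  have hx' : 0 < |x| := abs_pos.2 hx
  have hD0 : 0 < |D| := (mul_pos hc hx').trans_le hD
  have ha0 : 0 < a := hc.trans_le ha
  have hDne : D ≠ 0 := abs_pos.1 hD0
  have hQ : 0 ≤ Q := (abs_nonneg _).trans hq'
  have hC₁ : 0 ≤ C₁ := nonneg_of_mul_nonneg_left ((abs_nonneg _).trans hq) hx'
  have hC₂ : 0 ≤ C₂ := nonneg_of_mul_nonneg_left ((abs_nonneg _).trans hT) (by positivity)
  have e : q / D - q' / a / x = (q - q') / D + q' * ((a * x - D) / (D * (a * x))) := by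
    field_simp; ring
  rw [e]
  refine (abs_add_le _ _).trans (add_le_add ?_ ?_)
  · rw [abs_div, div_le_div_iff₀ hD0 hc]
    nlinarith [mul_le_mul_of_nonneg_left hD hC₁]
  · rw [abs_mul, abs_div, abs_mul, abs_mul]
    refine mul_le_mul hq' ?_ (by positivity) hQ
    rw [abs_sub_comm, abs_of_pos ha0, div_le_div_iff₀ (by positivity) (by positivity)]
    have h1 : c * |x| * (c * |x|) ≤ |D| * (a * |x|) := by gcongr
    have h2 : x ^ 2 = |x| * |x| := by rw [← sq, sq_abs]
    calc |D - a * x| * c ^ 2 ≤ C₂ * (|x| * |x|) * c ^ 2 := by rw [← h2]; gcongr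
      _ = C₂ * (c * |x| * (c * |x|)) := by ring
      _ ≤ C₂ * (|D| * (a * |x|)) := by gcongr

/-- Near `ρ = k` the resolvent symbol is a simple pole up to a bounded remainder, locally uniformly
in `k`. -/
theorem exists_resolventSymbol_near (α t k₀ k₁ : ℝ) (hα : 0 < α) (hk₀ : 0 < k₀) :
    ∃ C : ℝ, ∀ k ∈ Icc k₀ k₁, |resolventResidue α t k| ≤ C ∧
      ∀ ρ, |ρ - k| < k / 2 → ρ ≠ k →
        |resolventSymbol α t k ρ - resolventResidue α t k / (ρ - k)| ≤ C := by
  set I := Icc (k₀ / 2) (3 * k₁ / 2) with hI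
  have hIc : IsCompact I := isCompact_Icc
  have hI0 : ∀ x ∈ I, 0 < x := fun x hx ↦ by linarith [hx.1]
  have hcr : ∀ s : ℝ, ContinuousOn (fun x : ℝ ↦ x ^ s) I := fun s ↦
    continuousOn_id.rpow_const fun x hx ↦ Or.inl (hI0 x hx).ne'
  have hcq : ∀ s : ℝ, Continuous (fun x : ℝ ↦ (1 + x ^ 2) ^ s) := fun s ↦
    Continuous.rpow_const (by fun_prop) fun x ↦ Or.inl (by positivity)
  obtain ⟨B, hB⟩ := hIc.exists_bound_of_continuousOn (f := fun x : ℝ ↦ (2 * α * x ^ (2 * α - 1))⁻¹)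
    ((continuousOn_const.mul (hcr _)).inv₀ fun x hx ↦ by
      exact (mul_pos (by positivity) (Real.rpow_pos_of_pos (hI0 x hx) (2 * α - 1))).ne')
  obtain ⟨C₂, hC₂⟩ := hIc.exists_bound_of_continuousOn
    (f := fun x : ℝ ↦ 2 * α * ((2 * α - 1) * x ^ (2 * α - 1 - 1)))
    (continuousOn_const.mul (continuousOn_const.mul (hcr _)))
  obtain ⟨Q, hQ⟩ := hIc.exists_bound_of_continuousOn (hcq t).continuousOn
  obtain ⟨C₁, hC₁⟩ := hIc.exists_bound_of_continuousOn
    (f := fun x : ℝ ↦ 2 * x * t * (1 + x ^ 2) ^ (t - 1))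
    (Continuous.continuousOn (by have := hcq (t - 1); fun_prop))
  set c := (max B 1)⁻¹ with hcdef
  have hc : 0 < c := by positivity
  have hlow : ∀ x ∈ I, c ≤ 2 * α * x ^ (2 * α - 1) := fun x hx ↦ by
    have h0 : 0 < 2 * α * x ^ (2 * α - 1) := by
      have := Real.rpow_pos_of_pos (hI0 x hx) (2 * α - 1); positivity
    have h1 := (le_abs_self _).trans (hB x hx)
    rw [hcdef, inv_le_comm₀ (by positivity) h0]
    exact h1.trans (le_max_left _ _)
  have hp : ∀ x ∈ I, HasDerivAt (fun x : ℝ ↦ x ^ (2 * α)) (2 * α * x ^ (2 * α - 1)) x :=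
    fun x hx ↦ Real.hasDerivAt_rpow_const (Or.inl (hI0 x hx).ne')
  have hp' : ∀ x ∈ I, HasDerivAt (fun x : ℝ ↦ 2 * α * x ^ (2 * α - 1))
      (2 * α * ((2 * α - 1) * x ^ (2 * α - 1 - 1))) x :=
    fun x hx ↦ (Real.hasDerivAt_rpow_const (Or.inl (hI0 x hx).ne')).const_mul _
  have hq : ∀ x ∈ I, HasDerivAt (fun x : ℝ ↦ (1 + x ^ 2) ^ t)
      (2 * x * t * (1 + x ^ 2) ^ (t - 1)) x := fun x hx ↦ by
    have h1 : HasDerivAt (fun x : ℝ ↦ 1 + x ^ 2) (2 * x) x := by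
      simpa using (hasDerivAt_pow 2 x).const_add 1
    exact h1.rpow_const (Or.inl (by positivity : (1 + x ^ 2 : ℝ) ≠ 0))
  have hIx : Convex ℝ I := convex_Icc _ _
  refine ⟨max (Q * c⁻¹) (C₁ / c + Q * (C₂ / c ^ 2)), fun k hk ↦ ?_⟩
  have hk0 : 0 < k := hk₀.trans_le hk.1
  have hkI : k ∈ I := ⟨by linarith [hk.1], by linarith [hk.2]⟩
  refine ⟨?_, fun ρ hρ hρk ↦ ?_⟩
  · refine le_max_of_le_left ?_
    rw [resolventResidue, div_eq_mul_inv, abs_mul]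
    have h1 := hQ k hkI
    have h0 := hlow k hkI
    rw [abs_of_pos (inv_pos.2 (hc.trans_le h0))]
    exact mul_le_mul h1 (inv_anti₀ hc h0) (inv_pos.2 (hc.trans_le h0)).le
      ((norm_nonneg _).trans h1)
  · refine le_max_of_le_right ?_
    have hρI : ρ ∈ I := by
      have := abs_lt.1 hρ
      exact ⟨by linarith [hk.1], by linarith [hk.2]⟩
    have hsub : ∀ ξ ∈ uIcc k ρ, ξ ∈ I := fun ξ hξ ↦
      hIx.ordConnected.uIcc_subset hkI hρI hξ
    refine abs_div_sub_div_le hc (sub_ne_zero.2 hρk) (hlow k hkI) ?_ ?_ ?_ (hQ k hkI)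
    · -- The mean value inequality from below.
      have key : ∀ x ∈ I, ∀ y ∈ I, x ≤ y → c * (y - x) ≤ y ^ (2 * α) - x ^ (2 * α) := by
        refine hIx.mul_sub_le_image_sub_of_le_deriv (hcr _)
          (fun x hx ↦ ((hp x (interior_subset hx)).differentiableAt).differentiableWithinAt)
          fun x hx ↦ ?_
        rw [(hp x (interior_subset hx)).deriv]
        exact hlow x (interior_subset hx)
      rcases le_total k ρ with h | h
      · rw [abs_of_nonneg (sub_nonneg.2 h)]
        exact (key k hkI ρ hρI h).trans (le_abs_self _)
      · rw [abs_of_nonpos (sub_nonpos.2 h), abs_sub_comm, neg_sub]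
        exact (key ρ hρI k hkI h).trans (le_abs_self _)
    · have hd1 : ∀ ξ ∈ uIcc k ρ, ‖2 * α * ξ ^ (2 * α - 1) - 2 * α * k ^ (2 * α - 1)‖ ≤
          C₂ * |ρ - k| := fun ξ hξ ↦ by
        have h1 := hIx.norm_image_sub_le_of_norm_hasDerivWithin_le
          (fun x hx ↦ (hp' x hx).hasDerivWithinAt) hC₂ hkI (hsub ξ hξ)
        refine h1.trans ?_
        have hC0 : 0 ≤ C₂ := (norm_nonneg _).trans (hC₂ k hkI)
        exact mul_le_mul_of_nonneg_left (abs_sub_left_of_mem_uIcc hξ) hC0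
      have h2 := (convex_uIcc k ρ).norm_image_sub_le_of_norm_hasDerivWithin_le
        (f := fun x : ℝ ↦ x ^ (2 * α) - 2 * α * k ^ (2 * α - 1) * x)
        (fun x hx ↦ ((hp x (hsub x hx)).sub
          ((hasDerivAt_id x).const_mul (2 * α * k ^ (2 * α - 1)))).hasDerivWithinAt)
        (C := C₂ * |ρ - k|) (fun x hx ↦ by simpa using hd1 x hx) left_mem_uIcc right_mem_uIcc
      simp only [Real.norm_eq_abs] at h2
      calc _ = |ρ ^ (2 * α) - 2 * α * k ^ (2 * α - 1) * ρ -
            (k ^ (2 * α) - 2 * α * k ^ (2 * α - 1) * k)| := by congr 1; ring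
        _ ≤ C₂ * |ρ - k| * |ρ - k| := h2
        _ = _ := by rw [mul_assoc, ← sq, sq_abs]
    · exact hIx.norm_image_sub_le_of_norm_hasDerivWithin_le
        (fun x hx ↦ (hq x hx).hasDerivWithinAt) hC₁ hkI hρI

/-- Away from `ρ = k` the resolvent symbol is bounded: the growth `ρ^{2t}` of the numerator at
infinity is compensated by the denominator since `t ≤ α`. -/
theorem exists_resolventSymbol_far (α t k₀ k₁ : ℝ) (hα : 0 < α) (ht : 0 ≤ t) (htα : t ≤ α)
    (hk₀ : 0 < k₀) :
    ∃ C : ℝ, ∀ k ∈ Icc k₀ k₁, ∀ ρ, 0 ≤ ρ → k / 2 ≤ |ρ - k| → |resolventSymbol α t k ρ| ≤ C := by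
  set c₁ : ℝ := 1 - (1 / 2) ^ (2 * α) with hc₁
  set c₂ : ℝ := 1 - (2 / 3) ^ (2 * α) with hc₂
  have h1 : 0 < c₁ := sub_pos.2 (Real.rpow_lt_one (by norm_num) (by norm_num) (by positivity))
  have h2 : 0 < c₂ := sub_pos.2 (Real.rpow_lt_one (by norm_num) (by norm_num) (by positivity))
  refine ⟨max ((1 + k₁ ^ 2) ^ t / (k₀ ^ (2 * α) * c₁))
    ((1 + 1 / k₀ ^ 2) ^ t * k₀ ^ (2 * t - 2 * α) / c₂), fun k hk ρ hρ hρk ↦ ?_⟩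
  have hk0 : 0 < k := hk₀.trans_le hk.1
  rw [resolventSymbol, abs_div, abs_of_pos (Real.rpow_pos_of_pos (by positivity) t)]
  rcases le_total ρ k with h | h
  · rw [abs_of_nonpos (sub_nonpos.2 h)] at hρk
    have hρ2 : ρ ≤ k / 2 := by linarith
    refine le_max_of_le_left ?_
    have hD : k₀ ^ (2 * α) * c₁ ≤ |ρ ^ (2 * α) - k ^ (2 * α)| := by
      rw [abs_sub_comm]
      refine le_trans ?_ (le_abs_self _)
      have e1 : ρ ^ (2 * α) ≤ k ^ (2 * α) * (1 / 2) ^ (2 * α) := by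
        rw [← Real.mul_rpow hk0.le (by norm_num)]
        exact Real.rpow_le_rpow hρ (by linarith) (by positivity)
      have e2 : k₀ ^ (2 * α) ≤ k ^ (2 * α) := Real.rpow_le_rpow hk₀.le hk.1 (by positivity)
      have e3 := mul_le_mul_of_nonneg_right e2 h1.le
      have e4 : k ^ (2 * α) * c₁ = k ^ (2 * α) - k ^ (2 * α) * (1 / 2) ^ (2 * α) := by
        rw [hc₁]; ring
      linarith
    have : 0 < k₀ ^ (2 * α) := Real.rpow_pos_of_pos hk₀ _
    have hρ1 : ρ ≤ k₁ := h.trans hk.2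
    gcongr
  · rw [abs_of_nonneg (sub_nonneg.2 h)] at hρk
    have hρ2 : k ≤ ρ * (2 / 3) := by linarith
    have hρ0 : 0 < ρ := hk0.trans_le h
    refine le_max_of_le_right ?_
    have hD : ρ ^ (2 * α) * c₂ ≤ |ρ ^ (2 * α) - k ^ (2 * α)| := by
      refine le_trans ?_ (le_abs_self _)
      have e1 : k ^ (2 * α) ≤ ρ ^ (2 * α) * (2 / 3) ^ (2 * α) := by
        rw [← Real.mul_rpow hρ (by norm_num)]
        exact Real.rpow_le_rpow hk0.le hρ2 (by positivity)
      have e4 : ρ ^ (2 * α) * c₂ = ρ ^ (2 * α) - ρ ^ (2 * α) * (2 / 3) ^ (2 * α) := by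
        rw [hc₂]; ring
      linarith
    have hkρ : k₀ ≤ ρ := hk.1.trans h
    have hN : (1 + ρ ^ 2) ^ t ≤ (1 + 1 / k₀ ^ 2) ^ t * k₀ ^ (2 * t - 2 * α) * ρ ^ (2 * α) := by
      have e1 : 1 + ρ ^ 2 ≤ (1 + 1 / k₀ ^ 2) * ρ ^ 2 := by
        have : 1 ≤ 1 / k₀ ^ 2 * ρ ^ 2 := by
          rw [one_div, inv_mul_eq_div, one_le_div (by positivity)]
          gcongr
        linarith
      have e2 : ρ ^ (2 * t - 2 * α) ≤ k₀ ^ (2 * t - 2 * α) :=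
        Real.rpow_le_rpow_of_nonpos hk₀ hkρ (by linarith)
      calc (1 + ρ ^ 2) ^ t ≤ ((1 + 1 / k₀ ^ 2) * ρ ^ 2) ^ t :=
            Real.rpow_le_rpow (by positivity) e1 ht
        _ = (1 + 1 / k₀ ^ 2) ^ t * (ρ ^ (2 * t - 2 * α) * ρ ^ (2 * α)) := by
            rw [Real.mul_rpow (by positivity) (by positivity), ← Real.rpow_add hρ0,
              ← Real.rpow_natCast ρ 2, ← Real.rpow_mul hρ]
            congr 2
            push_cast; ring
        _ ≤ (1 + 1 / k₀ ^ 2) ^ t * (k₀ ^ (2 * t - 2 * α) * ρ ^ (2 * α)) := by gcongr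
        _ = _ := by ring
    have : 0 < ρ ^ (2 * α) := Real.rpow_pos_of_pos hρ0 _
    rw [div_le_div_iff₀ ((mul_pos this h2).trans_le hD) h2]
    calc (1 + ρ ^ 2) ^ t * c₂ ≤
          (1 + 1 / k₀ ^ 2) ^ t * k₀ ^ (2 * t - 2 * α) * ρ ^ (2 * α) * c₂ := by gcongr
      _ = (1 + 1 / k₀ ^ 2) ^ t * k₀ ^ (2 * t - 2 * α) * (ρ ^ (2 * α) * c₂) := by ring
      _ ≤ _ := by gcongr

/-! ### The principal value -/

open Classical in
/-- The kernel `1 / (ρ - k)`, truncated to `r < |ρ - k| < k / 2`. -/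
def pvKernel (k r ρ : ℝ) : ℂ := if r < |ρ - k| ∧ |ρ - k| < k / 2 then (((ρ - k)⁻¹ : ℝ) : ℂ) else 0

open Classical in
/-- The symbol `resolventSymbol` without its singular part near `ρ = k`. -/
def regularPart (α t k ρ : ℝ) : ℝ :=
  resolventSymbol α t k ρ - if |ρ - k| < k / 2 then resolventResidue α t k / (ρ - k) else 0

theorem measurable_pvKernel (k r : ℝ) : Measurable (pvKernel k r) := by
  have h1 : MeasurableSet {ρ : ℝ | r < |ρ - k|} :=
    (isOpen_lt (by fun_prop) (by fun_prop)).measurableSet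
  have h2 : MeasurableSet {ρ : ℝ | |ρ - k| < k / 2} :=
    (isOpen_lt (by fun_prop) (by fun_prop)).measurableSet
  exact Measurable.ite (h1.inter h2) (by fun_prop) measurable_const

theorem norm_pvKernel_le {k r : ℝ} (hr : 0 < r) (ρ : ℝ) : ‖pvKernel k r ρ‖ ≤ r⁻¹ := by
  rw [pvKernel]
  split_ifs with h
  · rw [Complex.norm_real, norm_inv]
    exact inv_anti₀ hr h.1.le
  · rw [norm_zero]; positivity

theorem pvKernel_eq_zero {k r ρ : ℝ} (h : k / 2 ≤ |ρ - k|) : pvKernel k r ρ = 0 :=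
  if_neg fun h' ↦ absurd h'.2 h.not_gt

theorem norm_pvKernel_mul_abs_le (k r ρ : ℝ) : ‖pvKernel k r ρ‖ * |ρ - k| ≤ 1 := by
  rw [pvKernel]
  split_ifs with h
  · rw [Complex.norm_real, norm_inv, Real.norm_eq_abs]
    exact inv_mul_le_one
  · simp

/-- The truncation is symmetric about `k`, so the odd kernel has mean zero. -/
theorem integral_pvKernel (k r : ℝ) : ∫ ρ, pvKernel k r ρ = 0 := by
  have h : ∀ ρ, pvKernel k r (2 * k - ρ) = -pvKernel k r ρ := fun ρ ↦ by
    have e : 2 * k - ρ - k = -(ρ - k) := by ring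
    simp only [pvKernel, e, abs_neg]
    split_ifs
    · rw [inv_neg]; simp
    · simp
  have := integral_sub_left_eq_self (fun ρ ↦ pvKernel k r ρ) volume (2 * k)
  simp only [h, integral_neg] at this
  exact self_eq_neg.1 this.symm

/-- The residue and the regular part are bounded, locally uniformly in `k`. -/
theorem exists_regularPart_bound (α t k₀ k₁ : ℝ) (hα : 0 < α) (ht : 0 ≤ t) (htα : t ≤ α)
    (hk₀ : 0 < k₀) :
    ∃ C : ℝ, 0 ≤ C ∧ ∀ k ∈ Icc k₀ k₁, |resolventResidue α t k| ≤ C ∧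
      ∀ ρ, 0 ≤ ρ → |regularPart α t k ρ| ≤ C := by
  obtain ⟨C, hC⟩ := exists_resolventSymbol_near α t k₀ k₁ hα hk₀
  obtain ⟨C', hC'⟩ := exists_resolventSymbol_far α t k₀ k₁ hα ht htα hk₀
  refine ⟨max (max C C') 0, le_max_right _ _, fun k hk ↦ ⟨(hC k hk).1.trans
    ((le_max_left _ _).trans (le_max_left _ _)), fun ρ hρ ↦ ?_⟩⟩
  rw [regularPart]
  split_ifs with h
  · by_cases hρk : ρ = k
    · simp [hρk, resolventSymbol]
    · exact ((hC k hk).2 ρ h hρk).trans ((le_max_left _ _).trans (le_max_left _ _))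
  · rw [sub_zero]
    exact (hC' k hk ρ hρ (not_lt.1 h)).trans ((le_max_right _ _).trans (le_max_left _ _))

theorem measurable_regularPart (α t k : ℝ) : Measurable (regularPart α t k) := by
  have h : MeasurableSet {ρ : ℝ | |ρ - k| < k / 2} :=
    (isOpen_lt (by fun_prop) (by fun_prop)).measurableSet
  exact Measurable.sub (by unfold resolventSymbol; fun_prop)
    (Measurable.ite h (by fun_prop) measurable_const)

/-- Splitting a truncated integral against the resolvent symbol into a regular part and a part with
the singularity `1 / (ρ - k)`. -/
theorem setIntegral_resolventSymbol {α t k r C : ℝ} (hr : 0 < r)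
    (hC : ∀ ρ, 0 ≤ ρ → |regularPart α t k ρ| ≤ C) {G : Space d → ℂ} (hG : Integrable G) :
    ∫ ξ in {ξ : Space d | r < |‖ξ‖ - k|}, G ξ * ((resolventSymbol α t k ‖ξ‖ : ℝ) : ℂ) =
      (∫ ξ in {ξ : Space d | r < |‖ξ‖ - k|}, G ξ * ((regularPart α t k ‖ξ‖ : ℝ) : ℂ)) +
        resolventResidue α t k * ∫ ξ, G ξ * pvKernel k r ‖ξ‖ := by
  have hms : MeasurableSet {ξ : Space d | r < |‖ξ‖ - k|} :=
    (isOpen_lt (by fun_prop) (by fun_prop)).measurableSet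
  have hi1 : Integrable (fun ξ ↦ G ξ * ((regularPart α t k ‖ξ‖ : ℝ) : ℂ)) :=
    hG.mul_bdd (c := C) (Complex.measurable_ofReal.comp ((measurable_regularPart α t k).comp
      measurable_norm)).aestronglyMeasurable (Eventually.of_forall fun ξ ↦ by
        rw [Complex.norm_real]; exact hC _ (norm_nonneg _))
  have hi2 : Integrable (fun ξ ↦ G ξ * pvKernel k r ‖ξ‖) :=
    hG.mul_bdd (c := r⁻¹) ((measurable_pvKernel k r).comp measurable_norm).aestronglyMeasurable
      (Eventually.of_forall fun ξ ↦ norm_pvKernel_le hr _)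
  have hres : ∫ ξ, G ξ * pvKernel k r ‖ξ‖ =
      ∫ ξ in {ξ : Space d | r < |‖ξ‖ - k|}, G ξ * pvKernel k r ‖ξ‖ := by
    rw [setIntegral_eq_integral_of_forall_compl_eq_zero]
    intro ξ hξ
    rw [pvKernel, if_neg (fun h ↦ hξ h.1), mul_zero]
  rw [hres, ← integral_const_mul, ← integral_add hi1.integrableOn
    (hi2.const_mul _).integrableOn]
  refine setIntegral_congr_fun hms fun ξ hξ ↦ ?_
  have hξ' : r < |‖ξ‖ - k| := hξ
  simp only [regularPart, pvKernel, hξ', true_and]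
  split_ifs
  · push_cast; ring
  · push_cast; ring

section

open FourierTransform

/-! ### The Fourier transform of Schwartz functions -/

/-- The scaling `ξ ↦ ξ / 2π` relating `ft` to Mathlib's Fourier transform. -/
def twoPiScaling : Space d ≃L[ℝ] Space d :=
  ContinuousLinearEquiv.smulLeft (Units.mk0 (2 * Real.pi)⁻¹ (by have := Real.pi_pos; positivity) :
    ℝˣ)

/-- The Fourier transform `ft` as an operator on the Schwartz space. -/
def ftS : 𝓢(Space d, ℂ) →L[ℂ] 𝓢(Space d, ℂ) :=
  SchwartzMap.compCLMOfContinuousLinearEquiv ℂ twoPiScaling ∘L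
    FourierTransform.fourierCLM ℂ 𝓢(Space d, ℂ)

theorem ftS_eq_fourier (ψ : 𝓢(Space d, ℂ)) (ξ : Space d) :
    ftS ψ ξ = 𝓕 ψ ((2 * Real.pi)⁻¹ • ξ) := rfl

theorem ftS_apply (ψ : 𝓢(Space d, ℂ)) (ξ : Space d) : ftS ψ ξ = ft ψ ξ := by
  rw [ftS_eq_fourier, SchwartzMap.fourier_coe, Real.fourier_eq', ft]
  congr 1
  ext x
  rw [inner_smul_right, smul_eq_mul]
  congr 2
  have := Real.pi_ne_zero
  push_cast
  have : (Real.pi : ℂ) ≠ 0 := by exact_mod_cast this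
  field_simp

theorem integrable_ft_neg (ψ : 𝓢(Space d, ℂ)) : Integrable (fun ξ ↦ ft ψ (-ξ)) := by
  have h : Integrable fun ξ ↦ ftS ψ (-ξ) :=
    (ftS ψ).integrable (μ := (volume : Measure (Space d))).comp_neg
  simpa only [ftS_apply] using h

theorem integrable_one_add_norm_mul (ψ : 𝓢(Space d, ℂ)) :
    Integrable (fun x ↦ (1 + ‖x‖) * ‖ψ x‖) := by
  refine (ψ.integrable.norm.add (ψ.integrable_pow_mul volume 1)).congr
    (Eventually.of_forall fun x ↦ ?_)
  simp [add_mul]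

/-! ### The Green's function as a tempered distribution -/

/-- The truncation to `r < ||ξ| - k|` of the integral defining the principal value. -/
def greenTrunc (α k r : ℝ) (ψ : 𝓢(Space d, ℂ)) : ℂ :=
  ∫ ξ in {ξ : Space d | r < |‖ξ‖ - k|}, ft ψ (-ξ) / ((‖ξ‖ ^ (2 * α) - k ^ (2 * α) : ℝ) : ℂ)

theorem greenTrunc_eq {α t k r C : ℝ} (hr : 0 < r)
    (hC : ∀ ρ, 0 ≤ ρ → |regularPart α t k ρ| ≤ C) {G : Space d → ℂ} (hG : Integrable G)
    {ψ : 𝓢(Space d, ℂ)} (h : ∀ ξ, ft ψ (-ξ) = (((1 + ‖ξ‖ ^ 2) ^ t : ℝ) : ℂ) * G ξ) :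
    greenTrunc α k r ψ =
      (∫ ξ in {ξ : Space d | r < |‖ξ‖ - k|}, G ξ * ((regularPart α t k ‖ξ‖ : ℝ) : ℂ)) +
        resolventResidue α t k * ∫ ξ, G ξ * pvKernel k r ‖ξ‖ := by
  rw [← setIntegral_resolventSymbol hr hC hG, greenTrunc]
  congr 1
  ext ξ
  rw [h, resolventSymbol]
  push_cast
  ring

theorem one_add_rpow_zero_mul (ψ : 𝓢(Space d, ℂ)) (ξ : Space d) :
    ft ψ (-ξ) = (((1 + ‖ξ‖ ^ 2) ^ (0 : ℝ) : ℝ) : ℂ) * ft ψ (-ξ) := by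
  rw [Real.rpow_zero, Complex.ofReal_one, one_mul]

theorem norm_setIntegral_regularPart_le {α t k r C : ℝ}
    (hC : ∀ ρ, 0 ≤ ρ → |regularPart α t k ρ| ≤ C) {G : Space d → ℂ} (hG : Integrable G) :
    ‖∫ ξ in {ξ : Space d | r < |‖ξ‖ - k|}, G ξ * ((regularPart α t k ‖ξ‖ : ℝ) : ℂ)‖ ≤
      C * ∫ ξ, ‖G ξ‖ := by
  have hC0 : 0 ≤ C := (abs_nonneg _).trans (hC 0 le_rfl)
  refine (norm_integral_le_of_norm_le (g := fun ξ ↦ C * ‖G ξ‖) (hG.norm.const_mul C).integrableOn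
    (Eventually.of_forall fun ξ ↦ ?_)).trans ?_
  · rw [norm_mul, mul_comm, Complex.norm_real]
    exact mul_le_mul_of_nonneg_right (hC _ (norm_nonneg _)) (norm_nonneg _)
  · rw [← integral_const_mul]
    exact setIntegral_le_integral (hG.norm.const_mul C)
      (Eventually.of_forall fun ξ ↦ by positivity)

/-- In polar coordinates the singular part of the truncated integral becomes one-dimensional, and
since `pvKernel` has mean zero the value of the spherical mean at `ρ = k` can be subtracted. -/
theorem integral_ft_mul_pvKernel (hd : d = 1 ∨ d = 2 ∨ d = 3) {k r : ℝ} (hk : 0 < k) (hr : 0 < r)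
    (ψ : 𝓢(Space d, ℂ)) : ∫ ξ, ft ψ (-ξ) * pvKernel k r ‖ξ‖ =
      ∫ ρ, pvKernel k r ρ * (sphereMean ψ ρ - sphereMean ψ k) := by
  have hsupp : ∀ ρ, ρ ∉ Icc (k / 2) (3 * k / 2) → pvKernel k r ρ = 0 := fun ρ hρ ↦ by
    refine pvKernel_eq_zero (not_lt.1 fun h ↦ hρ ?_)
    rw [abs_lt] at h
    exact ⟨by linarith [h.1], by linarith [h.2]⟩
  have hpi : Integrable (pvKernel k r) := integrable_of_bounded_of_support
    (measurable_pvKernel k r).aestronglyMeasurable (norm_pvKernel_le hr)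
    isCompact_Icc.measure_lt_top hsupp
  have hlip : Continuous (sphereMean ψ) := by
    have h1 := integrable_one_add_norm_mul ψ
    rw [continuous_iff_continuousAt]
    intro ρ
    refine Metric.continuousAt_iff'.2 fun ε hε ↦ ?_
    set K := 8 * Real.pi * (1 + (|ρ| + 1)) * (∫ x, (1 + ‖x‖) * ‖ψ x‖) with hK
    have hK0 : 0 ≤ K := mul_nonneg (by have := Real.pi_pos; positivity)
      (integral_nonneg fun x ↦ by positivity)
    filter_upwards [Metric.ball_mem_nhds ρ (show 0 < min 1 (ε / (K + 1)) by positivity)] with ρ' hρ'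
    rw [Metric.mem_ball, Real.dist_eq, lt_min_iff] at hρ'
    rw [dist_eq_norm]
    have h2 : |ρ'| ≤ |ρ| + 1 := by
      have := abs_sub_abs_le_abs_sub ρ' ρ; linarith [hρ'.1]
    refine (norm_sphereMean_sub_le hd ψ.integrable h1 h2 (by linarith)).trans_lt ?_
    rw [← hK]
    have := hρ'.2
    rw [lt_div_iff₀ (by positivity)] at this
    nlinarith [abs_nonneg (ρ' - ρ)]
  rw [integral_ft_mul_radial hd ψ.integrable (measurable_pvKernel k r) (norm_pvKernel_le hr)
    (b := 3 * k / 2) (fun ρ hρ ↦ hsupp ρ fun h ↦ absurd h.2 hρ.not_ge)]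
  rw [setIntegral_eq_integral_of_forall_compl_eq_zero (fun ρ hρ ↦ ?_)]
  · have hi : Integrable fun ρ ↦ pvKernel k r ρ * sphereMean ψ ρ := by
      obtain ⟨B, hB⟩ := (isCompact_Icc (a := k / 2) (b := 3 * k / 2)).exists_bound_of_continuousOn
        hlip.continuousOn
      refine integrable_of_bounded_of_support (M := r⁻¹ * |B|)
        ((measurable_pvKernel k r).mul hlip.measurable).aestronglyMeasurable (fun ρ ↦ ?_)
        isCompact_Icc.measure_lt_top fun ρ hρ ↦ by rw [hsupp ρ hρ, zero_mul]
      by_cases hρ : ρ ∈ Icc (k / 2) (3 * k / 2)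
      · rw [norm_mul]
        exact mul_le_mul (norm_pvKernel_le hr ρ) ((hB ρ hρ).trans (le_abs_self B)) (norm_nonneg _)
          (by positivity)
      · rw [hsupp ρ hρ, zero_mul, norm_zero]; positivity
    simp only [mul_sub]
    rw [integral_sub hi (hpi.mul_const _), integral_mul_const, integral_pvKernel, zero_mul,
      sub_zero]
  · rw [hsupp, zero_mul]
    exact fun h ↦ hρ (lt_of_lt_of_le (by positivity) h.1)

/-- The product of the kernel with a function vanishing to order `γ` at `k` has a majorant which is
independent of the truncation, and integrable for `γ > 0`. -/
theorem norm_pvKernel_mul_le {k r L : ℝ} (hk : 0 < k) {g : ℝ → ℂ} {γ : ℝ}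
    (hg : ∀ ρ, |ρ - k| < k / 2 → ‖g ρ‖ ≤ L * |ρ - k| ^ γ) (ρ : ℝ) :
    ‖pvKernel k r ρ * g ρ‖ ≤ (Metric.ball k (k / 2)).indicator
      (fun ρ ↦ L * |ρ - k| ^ (γ - 1)) ρ := by
  have hL : 0 ≤ L := by
    have := (norm_nonneg _).trans (hg (k + k / 4) (by
      rw [add_sub_cancel_left, abs_of_pos (by positivity)]; linarith))
    rw [add_sub_cancel_left] at this
    exact nonneg_of_mul_nonneg_left this (Real.rpow_pos_of_pos (by positivity) _)
  by_cases h : |ρ - k| < k / 2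
  · rw [indicator_of_mem (by simpa [Metric.mem_ball, Real.dist_eq] using h), norm_mul]
    rcases (abs_nonneg (ρ - k)).eq_or_lt with h0 | h0
    · have : pvKernel k r ρ = 0 := by
        have hz : ρ - k = 0 := abs_eq_zero.1 h0.symm
        simp [pvKernel, hz]
      rw [this, norm_zero, zero_mul]; positivity
    · have h1 := norm_pvKernel_mul_abs_le k r ρ
      rw [← le_div_iff₀ h0] at h1
      calc _ ≤ 1 / |ρ - k| * (L * |ρ - k| ^ γ) := by gcongr; exact hg ρ h
        _ = _ := by rw [Real.rpow_sub_one h0.ne']; ring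
  · rw [indicator_of_notMem (by simpa [Metric.mem_ball, Real.dist_eq] using h), norm_mul,
      pvKernel_eq_zero (not_lt.1 h), norm_zero, zero_mul]

theorem integrableOn_abs_sub_rpow {γ : ℝ} (hγ : 0 < γ) (k a : ℝ) :
    IntegrableOn (fun ρ : ℝ ↦ |ρ - k| ^ (γ - 1)) (Metric.ball k a) := by
  have h0 : IntegrableOn (fun ρ : ℝ ↦ |ρ| ^ (γ - 1)) (Metric.ball 0 a) := by
    have h1 : IntegrableOn (fun ρ : ℝ ↦ ρ ^ (γ - 1)) (Ioo 0 a) := by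
      have := intervalIntegral.intervalIntegrable_rpow' (a := 0) (b := a) (r := γ - 1) (by linarith)
      exact (this.1).mono_set Ioo_subset_Ioc_self
    have h2 : IntegrableOn (fun ρ : ℝ ↦ |ρ| ^ (γ - 1)) (Ioo 0 a) :=
      h1.congr_fun (fun ρ hρ ↦ by simp only [abs_of_pos hρ.1]) measurableSet_Ioo
    have h3 : IntegrableOn (fun ρ : ℝ ↦ |ρ| ^ (γ - 1)) (Ioo (-a) 0) := by
      have := h2.comp_neg
      simpa using this
    refine ((h3.union h2).union (integrableOn_singleton (x := (0 : ℝ)) (by simp)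
      (by simp))).mono_set ?_
    intro ρ hρ
    rw [Real.ball_eq_Ioo, zero_sub, zero_add] at hρ
    rcases lt_trichotomy ρ 0 with h | h | h
    · exact Or.inl (Or.inl ⟨hρ.1, h⟩)
    · exact Or.inr h
    · exact Or.inl (Or.inr ⟨h, hρ.2⟩)
  have h1 : Integrable ((Metric.ball 0 a).indicator fun ρ : ℝ ↦ |ρ| ^ (γ - 1)) :=
    (integrable_indicator_iff measurableSet_ball).2 h0
  refine (integrable_indicator_iff measurableSet_ball).1 ((h1.comp_sub_right k).congr
    (Eventually.of_forall fun ρ ↦ ?_))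
  simp [indicator, Real.dist_eq]

/-- The principal value at the sphere `|ξ| = k` exists. -/
theorem exists_tendsto_greenTrunc (hd : d = 1 ∨ d = 2 ∨ d = 3) {α k : ℝ} (hα : 0 < α) (hk : 0 < k)
    (ψ : 𝓢(Space d, ℂ)) :
    ∃ L, Tendsto (fun r ↦ greenTrunc α k r ψ) (𝓝[>] (0 : ℝ)) (𝓝 L) := by
  obtain ⟨C, hC0, hC⟩ := exists_regularPart_bound α 0 k k hα le_rfl hα.le hk
  have hC := (hC k (by simp)).2
  have hG := integrable_ft_neg ψ
  have h1 := integrable_one_add_norm_mul ψ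
  set K := 8 * Real.pi * (1 + 2 * k) * (∫ x, (1 + ‖x‖) * ‖ψ x‖) with hK
  have hΦ : ∀ ρ, |ρ - k| < k / 2 → ‖sphereMean ψ ρ - sphereMean ψ k‖ ≤ K * |ρ - k| := fun ρ hρ ↦ by
    refine norm_sphereMean_sub_le hd ψ.integrable h1 ?_ ?_
    · have := abs_sub_abs_le_abs_sub ρ k
      rw [abs_of_pos hk] at this
      linarith
    · rw [abs_of_pos hk]; linarith
  have hi : Integrable fun ξ : Space d ↦ ft ψ (-ξ) * ((regularPart α 0 k ‖ξ‖ : ℝ) : ℂ) :=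
    hG.mul_bdd (c := C) (Complex.measurable_ofReal.comp ((measurable_regularPart α 0 k).comp
      measurable_norm)).aestronglyMeasurable (Eventually.of_forall fun ξ ↦ by
        rw [Complex.norm_real]; exact hC _ (norm_nonneg _))
  have hms : ∀ r, MeasurableSet {ξ : Space d | r < |‖ξ‖ - k|} := fun r ↦
    (isOpen_lt (by fun_prop) (by fun_prop)).measurableSet
  have hms' : MeasurableSet {ξ : Space d | 0 < |‖ξ‖ - k|} := hms 0
  -- The regular part is integrable, and the removed shells shrink to a null set.
  have lim1 : Tendsto (fun r ↦ ∫ ξ in {ξ : Space d | r < |‖ξ‖ - k|},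
      ft ψ (-ξ) * ((regularPart α 0 k ‖ξ‖ : ℝ) : ℂ)) (𝓝[>] (0 : ℝ))
      (𝓝 (∫ ξ in {ξ : Space d | 0 < |‖ξ‖ - k|},
        ft ψ (-ξ) * ((regularPart α 0 k ‖ξ‖ : ℝ) : ℂ))) := by
    simp only [← integral_indicator (hms _)]
    refine tendsto_integral_filter_of_dominated_convergence
      (fun ξ ↦ ‖ft ψ (-ξ) * ((regularPart α 0 k ‖ξ‖ : ℝ) : ℂ)‖)
      (Eventually.of_forall fun r ↦ hi.aestronglyMeasurable.indicator (hms r))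
      (Eventually.of_forall fun r ↦ Eventually.of_forall fun ξ ↦ norm_indicator_le_norm_self _ _)
      hi.norm (Eventually.of_forall fun ξ ↦ ?_)
    by_cases h : 0 < |‖ξ‖ - k|
    · refine tendsto_const_nhds.congr' ?_
      filter_upwards [Ioo_mem_nhdsGT h] with r hr
      rw [indicator_of_mem (by exact h), indicator_of_mem (by exact hr.2)]
    · refine tendsto_const_nhds.congr' ?_
      filter_upwards [self_mem_nhdsWithin] with r hr
      rw [indicator_of_notMem (by exact h), indicator_of_notMem]
      exact fun h' ↦ h (lt_trans hr h')
  -- The spherical mean is Lipschitz continuous, which cancels the pole.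
  have lim2 : Tendsto (fun r ↦ ∫ ρ, pvKernel k r ρ * (sphereMean ψ ρ - sphereMean ψ k))
      (𝓝[>] (0 : ℝ)) (𝓝 (∫ ρ, pvKernel k 0 ρ * (sphereMean ψ ρ - sphereMean ψ k))) := by
    have hmeas : AEStronglyMeasurable (fun ρ ↦ sphereMean ψ ρ - sphereMean ψ k) := by
      have hm : StronglyMeasurable (sphereMean ψ) := by
        refine StronglyMeasurable.integral_prod_right (f := fun ρ x ↦
          ((sphereConst d ρ * greenHom ρ x : ℝ) : ℂ) * ψ x) ?_
        exact ((measurable_sphereConst_mul_greenHom hd).mul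
          (ψ.continuous.measurable.comp measurable_snd)).stronglyMeasurable
      exact (hm.sub stronglyMeasurable_const).aestronglyMeasurable
    refine tendsto_integral_filter_of_dominated_convergence
      ((Metric.ball k (k / 2)).indicator (fun ρ ↦ K * |ρ - k| ^ ((1 : ℝ) - 1)))
      (Eventually.of_forall fun r ↦
        (measurable_pvKernel k r).aestronglyMeasurable.mul hmeas)
      (Eventually.of_forall fun r ↦ Eventually.of_forall fun ρ ↦
        norm_pvKernel_mul_le (γ := 1) hk
          (fun ρ hρ ↦ (hΦ ρ hρ).trans_eq (by rw [Real.rpow_one])) ρ)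
      ((integrable_indicator_iff measurableSet_ball).2
        ((integrableOn_abs_sub_rpow one_pos k _).const_mul K))
      (Eventually.of_forall fun ρ ↦ ?_)
    by_cases h : 0 < |ρ - k|
    · refine tendsto_const_nhds.congr' ?_
      filter_upwards [Ioo_mem_nhdsGT h] with r hr
      simp only [pvKernel, h, hr.2, true_and]
    · have hz : ρ - k = 0 := abs_eq_zero.1 (le_antisymm (not_lt.1 h) (abs_nonneg _))
      have h0 : ∀ r, pvKernel k r ρ = 0 := fun r ↦ by simp [pvKernel, hz]
      simp only [h0, zero_mul]
      exact tendsto_const_nhds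
  refine ⟨_, (lim1.add (lim2.const_mul (resolventResidue α 0 k : ℂ))).congr' ?_⟩
  filter_upwards [self_mem_nhdsWithin] with r hr
  rw [greenTrunc_eq hr hC hG (one_add_rpow_zero_mul _), integral_ft_mul_pvKernel hd hk hr]

theorem tendsto_greenTrunc (hd : d = 1 ∨ d = 2 ∨ d = 3) {α k : ℝ} (hα : 0 < α) (hk : 0 < k)
    (ψ : 𝓢(Space d, ℂ)) : Tendsto (fun r ↦ greenTrunc α k r ψ) (𝓝[>] (0 : ℝ))
      (𝓝 (limUnder (𝓝[>] (0 : ℝ)) fun r ↦ greenTrunc α k r ψ)) :=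
  tendsto_nhds_limUnder (exists_tendsto_greenTrunc hd hα hk ψ)

/-- A bound for the principal value which is uniform in the truncation. -/
theorem exists_norm_greenTrunc_le (hd : d = 1 ∨ d = 2 ∨ d = 3) {α k : ℝ} (hα : 0 < α)
    (hk : 0 < k) : ∃ C, 0 ≤ C ∧ ∀ (ψ : 𝓢(Space d, ℂ)) (r : ℝ), 0 < r →
      ‖greenTrunc α k r ψ‖ ≤ C * ((∫ ξ, ‖ft ψ (-ξ)‖) + ∫ x, (1 + ‖x‖) * ‖ψ x‖) := by
  obtain ⟨C, hC0, hC⟩ := exists_regularPart_bound α 0 k k hα le_rfl hα.le hk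
  have hC := (hC k (by simp)).2
  set A := 8 * Real.pi * (1 + 2 * k) with hA
  have hA0 : 0 ≤ A := by have := Real.pi_pos; positivity
  set I := ∫ ρ in Metric.ball k (k / 2), |ρ - k| ^ ((1 : ℝ) - 1) with hI
  have hI0 : 0 ≤ I := integral_nonneg fun ρ ↦ by positivity
  refine ⟨max C (‖(resolventResidue α 0 k : ℂ)‖ * (A * I)), le_max_of_le_left hC0,
    fun ψ r hr ↦ ?_⟩
  have h1 := integrable_one_add_norm_mul ψ
  set N := ∫ x, (1 + ‖x‖) * ‖ψ x‖ with hN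
  have hN0 : 0 ≤ N := integral_nonneg fun x ↦ by positivity
  have hΦ : ∀ ρ, |ρ - k| < k / 2 →
      ‖sphereMean ψ ρ - sphereMean ψ k‖ ≤ A * N * |ρ - k| ^ (1 : ℝ) := fun ρ hρ ↦ by
    rw [Real.rpow_one]
    refine norm_sphereMean_sub_le hd ψ.integrable h1 ?_ ?_
    · have := abs_sub_abs_le_abs_sub ρ k
      rw [abs_of_pos hk] at this
      linarith
    · rw [abs_of_pos hk]; linarith
  rw [greenTrunc_eq hr hC (integrable_ft_neg ψ) (one_add_rpow_zero_mul _),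
    integral_ft_mul_pvKernel hd hk hr,
    mul_add]
  refine (norm_add_le _ _).trans (add_le_add ?_ ?_)
  · exact (norm_setIntegral_regularPart_le hC (integrable_ft_neg ψ)).trans
      (mul_le_mul_of_nonneg_right (le_max_left _ _) (integral_nonneg fun ξ ↦ norm_nonneg _))
  · rw [norm_mul]
    have h2 : ‖∫ ρ, pvKernel k r ρ * (sphereMean ψ ρ - sphereMean ψ k)‖ ≤ A * N * I := by
      refine (norm_integral_le_of_norm_le ((integrable_indicator_iff measurableSet_ball).2
        ((integrableOn_abs_sub_rpow one_pos k _).const_mul (A * N)))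
        (Eventually.of_forall (norm_pvKernel_mul_le hk hΦ))).trans_eq ?_
      rw [integral_indicator measurableSet_ball, integral_const_mul]
    calc _ ≤ ‖(resolventResidue α 0 k : ℂ)‖ * (A * N * I) := by gcongr
      _ = ‖(resolventResidue α 0 k : ℂ)‖ * (A * I) * N := by ring
      _ ≤ _ := by gcongr; exact le_max_right _ _

theorem greenPV_eq (α k : ℝ) (ψ : 𝓢(Space d, ℂ)) : greenPV α k ψ =
    (((2 * Real.pi) ^ d : ℝ) : ℂ)⁻¹ *
      limUnder (𝓝[>] (0 : ℝ)) (fun r ↦ greenTrunc α k r ψ) := rfl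

theorem integrable_greenHom_mul (hd : d = 1 ∨ d = 2 ∨ d = 3) {ψ : Space d → ℂ}
    (hψ : Integrable ψ) (k : ℝ) : Integrable (fun x ↦ (greenHom k x : ℂ) * ψ x) := by
  refine hψ.bdd_mul (c := 1 + |k|) (Complex.measurable_ofReal.comp
    ((measurable_greenHom hd).comp measurable_prodMk_left)).aestronglyMeasurable
    (Eventually.of_forall fun x ↦ ?_)
  rw [Complex.norm_real]
  exact abs_greenHom_le hd k x

theorem greenTrunc_add {α k r : ℝ} (hα : 0 < α) (hk : 0 < k)
    (hr : 0 < r) (ψ φ : 𝓢(Space d, ℂ)) :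
    greenTrunc α k r (ψ + φ) = greenTrunc α k r ψ + greenTrunc α k r φ := by
  obtain ⟨C, hC0, hC⟩ := exists_regularPart_bound α 0 k k hα le_rfl hα.le hk
  have hC := (hC k (by simp)).2
  have h : ∀ ξ, ft (ψ + φ : 𝓢(Space d, ℂ)) (-ξ) = ft ψ (-ξ) + ft φ (-ξ) := fun ξ ↦ by
    rw [← ftS_apply, ← ftS_apply, ← ftS_apply, map_add]; rfl
  rw [greenTrunc_eq hr hC (integrable_ft_neg (ψ + φ)) (one_add_rpow_zero_mul _),
    greenTrunc_eq hr hC (integrable_ft_neg ψ) (one_add_rpow_zero_mul _),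
    greenTrunc_eq hr hC (integrable_ft_neg φ) (one_add_rpow_zero_mul _)]
  have hi1 : ∀ ψ : 𝓢(Space d, ℂ), Integrable (fun ξ ↦ ft ψ (-ξ) *
      ((regularPart α 0 k ‖ξ‖ : ℝ) : ℂ)) := fun ψ ↦
    (integrable_ft_neg ψ).mul_bdd (c := C) (Complex.measurable_ofReal.comp
      ((measurable_regularPart α 0 k).comp measurable_norm)).aestronglyMeasurable
      (Eventually.of_forall fun ξ ↦ by rw [Complex.norm_real]; exact hC _ (norm_nonneg _))
  have hi2 : ∀ ψ : 𝓢(Space d, ℂ), Integrable (fun ξ ↦ ft ψ (-ξ) * pvKernel k r ‖ξ‖) := fun ψ ↦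
    (integrable_ft_neg ψ).mul_bdd (c := r⁻¹)
      ((measurable_pvKernel k r).comp measurable_norm).aestronglyMeasurable
      (Eventually.of_forall fun ξ ↦ norm_pvKernel_le hr _)
  simp only [h, add_mul]
  rw [integral_add (hi1 ψ).integrableOn (hi1 φ).integrableOn, integral_add (hi2 ψ) (hi2 φ)]
  ring

theorem greenTrunc_smul {α k r : ℝ} (c : ℂ) (ψ : 𝓢(Space d, ℂ)) :
    greenTrunc α k r (c • ψ) = c * greenTrunc α k r ψ := by
  have h : ∀ ξ, ft (c • ψ : 𝓢(Space d, ℂ)) (-ξ) = c * ft ψ (-ξ) := fun ξ ↦ by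
    rw [← ftS_apply, ← ftS_apply, map_smul]; rfl
  simp only [greenTrunc, h, mul_div_assoc, integral_const_mul]

/-- The radiating Green's function is a tempered distribution. -/
theorem exists_temperedDistribution_green (hd : d = 1 ∨ d = 2 ∨ d = 3) {α k : ℝ} (hα : 0 < α)
    (hk : 0 < k) : ∃ T : 𝓢'(Space d, ℂ), ∀ ψ, T ψ = green α k ψ := by
  have hlim := tendsto_greenTrunc hd hα hk
  let L : 𝓢(Space d, ℂ) →ₗ[ℂ] ℂ :=
    { toFun := green α k
      map_add' := fun ψ φ ↦ by
        have h1 : limUnder (𝓝[>] (0 : ℝ)) (fun r ↦ greenTrunc α k r (ψ + φ)) =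
            limUnder (𝓝[>] (0 : ℝ)) (fun r ↦ greenTrunc α k r ψ) +
            limUnder (𝓝[>] (0 : ℝ)) (fun r ↦ greenTrunc α k r φ) := by
          refine Tendsto.limUnder_eq (((hlim ψ).add (hlim φ)).congr' ?_)
          filter_upwards [self_mem_nhdsWithin] with r hr
          rw [greenTrunc_add hα hk hr]
        have h2 : ∫ x, (greenHom k x : ℂ) * (ψ + φ) x =
            (∫ x, (greenHom k x : ℂ) * ψ x) + ∫ x, (greenHom k x : ℂ) * φ x := by
          rw [← integral_add (integrable_greenHom_mul hd ψ.integrable k)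
            (integrable_greenHom_mul hd φ.integrable k)]
          simp only [add_apply, mul_add]
        simp only [green, greenPV_eq, h1, h2]
        ring
      map_smul' := fun c ψ ↦ by
        have h1 : limUnder (𝓝[>] (0 : ℝ)) (fun r ↦ greenTrunc α k r (c • ψ)) =
            c * limUnder (𝓝[>] (0 : ℝ)) (fun r ↦ greenTrunc α k r ψ) := by
          refine Tendsto.limUnder_eq (((hlim ψ).const_mul c).congr fun r ↦ ?_)
          rw [greenTrunc_smul]
        have h2 : ∫ x, (greenHom k x : ℂ) * (c • ψ) x = c * ∫ x, (greenHom k x : ℂ) * ψ x := by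
          rw [← integral_const_mul]
          congr 1; ext x
          simp only [smul_apply, smul_eq_mul]
          ring
        simp only [green, greenPV_eq, h1, h2, RingHom.id_apply, smul_eq_mul]
        ring }
  obtain ⟨C, hC0, hC⟩ := exists_norm_greenTrunc_le hd hα hk
  have hb : ∀ ψ : 𝓢(Space d, ℂ), ‖L ψ‖ ≤
      (‖(((2 * Real.pi) ^ d : ℝ) : ℂ)⁻¹‖ * C + ‖greenConst d α k‖ * (1 + |k|)) *
        (‖SchwartzMap.toLpCLM ℂ ℂ 1 volume (ftS ψ)‖ +
          2 * ‖SchwartzMap.toLpCLM ℂ ℂ 1 volume (SchwartzMap.smulLeftCLM ℂ (weight 1) ψ)‖) := by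
    intro ψ
    have n1 : ‖SchwartzMap.toLpCLM ℂ ℂ 1 volume (ftS ψ)‖ = ∫ ξ, ‖ft ψ (-ξ)‖ := by
      rw [L1.norm_eq_integral_norm, integral_neg_eq_self (fun ξ ↦ ‖ft ψ ξ‖)]
      refine integral_congr_ae ?_
      filter_upwards [(ftS ψ).coeFn_toLp 1 volume] with ξ hξ
      rw [← ftS_apply, ← hξ]; rfl
    have n2 : ∫ x, (1 + ‖x‖) * ‖ψ x‖ ≤
        2 * ‖SchwartzMap.toLpCLM ℂ ℂ 1 volume (SchwartzMap.smulLeftCLM ℂ (weight 1) ψ)‖ := by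
      rw [L1.norm_eq_integral_norm, ← integral_const_mul]
      have e : ∀ᵐ x, ‖SchwartzMap.toLpCLM ℂ ℂ 1 volume
          (SchwartzMap.smulLeftCLM ℂ (weight 1) ψ) x‖ = bracket x * ‖ψ x‖ := by
        filter_upwards [(SchwartzMap.smulLeftCLM ℂ (weight 1) ψ).coeFn_toLp 1 volume] with x hx
        rw [SchwartzMap.toLpCLM_apply, hx,
          SchwartzMap.smulLeftCLM_apply_apply (weight_hasTemperateGrowth 1), norm_smul,
          norm_weight, Real.rpow_one]
      refine integral_mono_ae (integrable_one_add_norm_mul ψ)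
        ((L1.integrable_coeFn _).norm.const_mul 2) ?_
      filter_upwards [e] with x hx
      rw [hx, ← mul_assoc]
      gcongr
      have h1 : ‖x‖ ≤ bracket x := Real.le_sqrt_of_sq_le (by linarith)
      linarith [one_le_bracket x]
    set N₁ := ‖SchwartzMap.toLpCLM ℂ ℂ 1 volume (ftS ψ)‖
    set N₂ := 2 * ‖SchwartzMap.toLpCLM ℂ ℂ 1 volume (SchwartzMap.smulLeftCLM ℂ (weight 1) ψ)‖
    have hN₂ : 0 ≤ N₂ := by positivity
    have b1 : ‖limUnder (𝓝[>] (0 : ℝ)) fun r ↦ greenTrunc α k r ψ‖ ≤ C * (N₁ + N₂) := by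
      refine le_of_tendsto (hlim ψ).norm ?_
      filter_upwards [self_mem_nhdsWithin] with r hr
      refine (hC ψ r hr).trans ?_
      rw [n1]
      gcongr
    have b2 : ‖∫ x, (greenHom k x : ℂ) * ψ x‖ ≤ (1 + |k|) * (N₁ + N₂) := by
      refine (norm_integral_le_of_norm_le ((integrable_one_add_norm_mul ψ).const_mul (1 + |k|))
        (Eventually.of_forall fun x ↦ ?_)).trans ?_
      · rw [norm_mul, Complex.norm_real]
        refine mul_le_mul (abs_greenHom_le hd k x) ?_ (norm_nonneg _) (by positivity)
        exact le_mul_of_one_le_left (norm_nonneg _) (by linarith [norm_nonneg x])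
      · rw [integral_const_mul]
        gcongr
        exact n2.trans (le_add_of_nonneg_left (norm_nonneg _))
    change ‖green α k ψ‖ ≤ _
    rw [green, greenPV_eq]
    refine (norm_add_le _ _).trans ?_
    rw [norm_mul, norm_mul, add_mul, mul_assoc, mul_assoc]
    gcongr
  have hc : Continuous L := by
    refine continuous_of_continuousAt_zero L ?_
    rw [ContinuousAt, map_zero]
    refine squeeze_zero_norm hb ?_
    have hcont : Continuous fun ψ : 𝓢(Space d, ℂ) ↦
      (‖(((2 * Real.pi) ^ d : ℝ) : ℂ)⁻¹‖ * C + ‖greenConst d α k‖ * (1 + |k|)) *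
        (‖SchwartzMap.toLpCLM ℂ ℂ 1 volume (ftS ψ)‖ +
          2 * ‖SchwartzMap.toLpCLM ℂ ℂ 1 volume (SchwartzMap.smulLeftCLM ℂ (weight 1) ψ)‖) := by
      fun_prop
    have := hcont.tendsto 0
    simp only [map_zero, norm_zero, mul_zero, add_zero] at this
    exact this
  exact ⟨ContinuousLinearMap.toPointwiseConvergenceCLM _ _ _ _ ⟨L, hc⟩, fun ψ ↦ rfl⟩

end

section

open FourierTransform

/-! ### Restriction of a Fourier transform to lines -/

/-- The square `∫ ⟨x⟩^{2s} |a(x)|² dx` of a weighted norm. -/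
def weightedSq (s : ℝ) (a : 𝓢(Space d, ℂ)) : ℝ := ∫ x, bracket x ^ (2 * s) * ‖a x‖ ^ 2

theorem bracket_rpow_mul_norm_sq (s : ℝ) (a : 𝓢(Space d, ℂ)) (x : Space d) :
    bracket x ^ (2 * s) * ‖a x‖ ^ 2 = ‖SchwartzMap.smulLeftCLM ℂ (weight s) a x‖ ^ 2 := by
  rw [SchwartzMap.smulLeftCLM_apply_apply (weight_hasTemperateGrowth s), norm_smul, norm_weight,
    mul_pow, mul_comm 2 s, Real.rpow_mul (bracket_pos x).le]
  norm_num

theorem integrable_norm_sq (a : 𝓢(Space d, ℂ)) : Integrable (fun x ↦ ‖a x‖ ^ 2) :=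
  (memLp_two_iff_integrable_sq_norm a.continuous.aestronglyMeasurable).1 (a.memLp 2 volume)

theorem integrable_weightedSq (s : ℝ) (a : 𝓢(Space d, ℂ)) :
    Integrable (fun x ↦ bracket x ^ (2 * s) * ‖a x‖ ^ 2) := by
  simp only [bracket_rpow_mul_norm_sq]
  exact integrable_norm_sq _

theorem weightedSq_nonneg (s : ℝ) (a : 𝓢(Space d, ℂ)) : 0 ≤ weightedSq s a :=
  integral_nonneg fun x ↦ by have := bracket_pos x; positivity

theorem weightedSq_mono {s s' : ℝ} (h : s ≤ s') (a : 𝓢(Space d, ℂ)) :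
    weightedSq s a ≤ weightedSq s' a :=
  integral_mono (integrable_weightedSq s a) (integrable_weightedSq s' a) fun x ↦
    mul_le_mul_of_nonneg_right (Real.rpow_le_rpow_of_exponent_le (one_le_bracket x) (by linarith))
      (by positivity)

theorem weightedSq_smul (s : ℝ) (c : ℂ) (a : 𝓢(Space d, ℂ)) :
    weightedSq s (c • a) = ‖c‖ ^ 2 * weightedSq s a := by
  rw [weightedSq, weightedSq, ← integral_const_mul]
  congr 1; ext x
  rw [smul_apply, norm_smul]; ring

theorem integrable_ft_mul_ft (a b : 𝓢(Space d, ℂ)) : Integrable fun ξ ↦ ft a ξ * ft b ξ := by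
  have : Integrable fun ξ ↦ ftS a ξ * ftS b ξ := (ftS a).integrable.mul_bdd
    (c := SchwartzMap.seminorm ℂ 0 0 (ftS b)) (ftS b).continuous.aestronglyMeasurable
    (Eventually.of_forall fun ξ ↦ SchwartzMap.norm_le_seminorm ℂ _ _)
  simpa only [ftS_apply] using this

/-- Plancherel's theorem for `ft`. -/
theorem integral_norm_ft_sq (a : 𝓢(Space d, ℂ)) :
    ∫ ξ, ‖ft a ξ‖ ^ 2 = (2 * Real.pi) ^ d * ∫ x, ‖a x‖ ^ 2 := by
  simp only [← ftS_apply, ftS_eq_fourier]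
  rw [Measure.integral_comp_smul volume (fun ξ ↦ ‖𝓕 a ξ‖ ^ 2), SchwartzMap.integral_norm_sq_fourier,
    finrank_euclideanSpace, Fintype.card_fin, smul_eq_mul, abs_of_pos
    (by have := Real.pi_pos; positivity), inv_pow, inv_inv]

theorem integral_norm_ft_sq_le {s : ℝ} (hs : 0 ≤ s) (a : 𝓢(Space d, ℂ)) :
    ∫ ξ, ‖ft a ξ‖ ^ 2 ≤ (2 * Real.pi) ^ d * weightedSq s a := by
  rw [integral_norm_ft_sq]
  refine mul_le_mul_of_nonneg_left ?_ (by have := Real.pi_pos; positivity)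
  refine le_trans (le_of_eq ?_) (weightedSq_mono hs a)
  simp [weightedSq]

/-- The Cauchy–Schwarz inequality in squared form. -/
theorem sq_integral_mul_le {X : Type*} [MeasurableSpace X] {μ : Measure X} {f g : X → ℝ}
    (hf : AEStronglyMeasurable f μ) (hg : AEStronglyMeasurable g μ) (hf0 : ∀ x, 0 ≤ f x)
    (hg0 : ∀ x, 0 ≤ g x) (hf2 : Integrable (fun x ↦ f x ^ 2) μ)
    (hg2 : Integrable (fun x ↦ g x ^ 2) μ) :
    Integrable (fun x ↦ f x * g x) μ ∧
      (∫ x, f x * g x ∂μ) ^ 2 ≤ (∫ x, f x ^ 2 ∂μ) * ∫ x, g x ^ 2 ∂μ := by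
  have h1 : MemLp f 2 μ := (memLp_two_iff_integrable_sq hf).2 hf2
  have h2 : MemLp g 2 μ := (memLp_two_iff_integrable_sq hg).2 hg2
  refine ⟨h1.integrable_mul h2, ?_⟩
  have h := integral_mul_le_Lp_mul_Lq_of_nonneg (μ := μ) (p := 2) (q := 2)
    Real.HolderConjugate.two_two (Eventually.of_forall hf0) (Eventually.of_forall hg0)
    (by simpa using h1) (by simpa using h2)
  simp only [Real.rpow_two, ← Real.sqrt_eq_rpow] at h
  have h0 : 0 ≤ ∫ x, f x * g x ∂μ := integral_nonneg fun x ↦ mul_nonneg (hf0 x) (hg0 x)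
  calc _ ≤ (Real.sqrt (∫ x, f x ^ 2 ∂μ) * Real.sqrt (∫ x, g x ^ 2 ∂μ)) ^ 2 := by gcongr
    _ = _ := by
      rw [mul_pow, Real.sq_sqrt (integral_nonneg fun x ↦ sq_nonneg _),
        Real.sq_sqrt (integral_nonneg fun x ↦ sq_nonneg _)]

theorem slice_add {n : ℕ} (j : Fin (n + 1)) (p q : ℝ × Space n) :
    slice j (p + q) = slice j p + slice j q := by
  ext i
  rcases Fin.eq_self_or_eq_succAbove j i with rfl | ⟨i, rfl⟩
  · simp [slice_apply_self]
  · simp [slice_apply_succAbove]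

theorem slice_smul {n : ℕ} (j : Fin (n + 1)) (c : ℝ) (p : ℝ × Space n) :
    slice j (c • p) = c • slice j p := by
  ext i
  rcases Fin.eq_self_or_eq_succAbove j i with rfl | ⟨i, rfl⟩
  · simp [slice_apply_self]
  · simp [slice_apply_succAbove]

/-- The linear map underlying `slice`. -/
def sliceCLM {n : ℕ} (j : Fin (n + 1)) : ℝ × Space n →L[ℝ] Space (n + 1) :=
  { toFun := slice j
    map_add' := slice_add j
    map_smul' := slice_smul j
    cont := continuous_slice j }

/-- The restriction of a Schwartz function to a hyperplane. -/
def sliceS {n : ℕ} (j : Fin (n + 1)) (σ : ℝ) : 𝓢(Space (n + 1), ℂ) →L[ℂ] 𝓢(Space n, ℂ) :=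
  SchwartzMap.compCLM ℂ (g := fun y ↦ slice j (σ, y))
    (by
      have : (fun y : Space n ↦ slice j (σ, y)) =
          (fun _ : Space n ↦ slice j (σ, 0)) +
            ⇑(sliceCLM j ∘L ContinuousLinearMap.inr ℝ ℝ (Space n)) := by
        ext1 y
        change _ = slice j (σ, 0) + slice j (0, y)
        rw [← slice_add]; simp
      rw [this]
      exact (Function.HasTemperateGrowth.const _).add (ContinuousLinearMap.hasTemperateGrowth _))
    ⟨1, 1, fun y ↦ by
      have h := norm_slice_sq j (σ, y)
      have : ‖y‖ ≤ ‖slice j (σ, y)‖ := abs_le_of_sq_le_sq' (by nlinarith [sq_nonneg σ])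
        (norm_nonneg _) |>.2
      linarith⟩

theorem sliceS_apply {n : ℕ} (j : Fin (n + 1)) (σ : ℝ) (a : 𝓢(Space (n + 1), ℂ)) (y : Space n) :
    sliceS j σ a y = a (slice j (σ, y)) := rfl

/-- The Fourier transform factors into a partial transform in a hyperplane and one along a line. -/
theorem ft_slice {n : ℕ} (j : Fin (n + 1)) (a : 𝓢(Space (n + 1), ℂ)) (τ : ℝ) (η : Space n) :
    ft a (slice j (τ, η)) =
      ∫ σ : ℝ, Complex.exp (-(Complex.I * ((σ * τ : ℝ) : ℂ))) * ft (sliceS j σ a) η := by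
  rw [ft, ← (measurePreserving_slice j).integral_comp']
  have hi : Integrable
      (fun x ↦ Complex.exp (-(Complex.I * (⟪x, slice j (τ, η)⟫_ℝ : ℂ))) * a x) := by
    refine a.integrable.bdd_mul (c := 1) (Continuous.aestronglyMeasurable (by fun_prop))
      (Eventually.of_forall fun x ↦ ?_)
    rw [← mul_neg, ← Complex.ofReal_neg, norm_exp_I_mul_ofReal]
  refine (integral_prod _ ((measurePreserving_slice j).integrable_comp_of_integrable hi)).trans ?_
  congr 1; ext σ
  rw [ft, ← integral_const_mul]
  congr 1; ext y
  rw [Function.comp_apply, inner_slice, sliceS_apply, ← mul_assoc, ← Complex.exp_add]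
  push_cast
  ring_nf

/-- Interpolation between the Lipschitz bound and the trivial bound. -/
theorem norm_exp_sub_exp_le {γ : ℝ} (hγ0 : 0 ≤ γ) (hγ1 : γ ≤ 1) (x y : ℝ) :
    ‖Complex.exp (-(Complex.I * (x : ℂ))) - Complex.exp (-(Complex.I * (y : ℂ)))‖ ≤
      2 * |x - y| ^ γ := by
  have e : Complex.exp (-(Complex.I * (x : ℂ))) - Complex.exp (-(Complex.I * (y : ℂ))) =
      Complex.exp (Complex.I * ((-y : ℝ) : ℂ)) *
        (Complex.exp (Complex.I * ((y - x : ℝ) : ℂ)) - 1) := by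
    rw [mul_sub, ← Complex.exp_add, mul_one]
    push_cast
    ring_nf
  rw [e, norm_mul, norm_exp_I_mul_ofReal, one_mul]
  have h1 : ‖Complex.exp (Complex.I * ((y - x : ℝ) : ℂ)) - 1‖ ≤ |x - y| := by
    rw [abs_sub_comm]; exact Real.norm_exp_I_mul_ofReal_sub_one_le
  rcases le_total |x - y| 1 with h | h
  · refine h1.trans ?_
    have := Real.rpow_le_rpow_of_exponent_ge' (abs_nonneg (x - y)) h hγ0 hγ1
    rw [Real.rpow_one] at this
    linarith [Real.rpow_nonneg (abs_nonneg (x - y)) γ]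
  · have h2 : ‖Complex.exp (Complex.I * ((y - x : ℝ) : ℂ)) - 1‖ ≤ 2 := by
      refine (norm_sub_le _ _).trans ?_
      rw [norm_exp_I_mul_ofReal, norm_one]; norm_num
    linarith [Real.one_le_rpow h hγ0]

/-- The one-dimensional Sobolev embedding: a function of one variable with `⟨σ⟩^s b ∈ L²` has a
bounded and Hölder continuous Fourier transform. -/
theorem sobolev_embedding_line {s γ : ℝ} (hγ0 : 0 ≤ γ) (hγ1 : γ ≤ 1) (hs : 1 / 2 + γ < s)
    {b : ℝ → ℂ} (hb : AEStronglyMeasurable b volume)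
    (hi : Integrable (fun σ ↦ (1 + σ ^ 2) ^ s * ‖b σ‖ ^ 2)) (τ τ' : ℝ) :
    ‖∫ σ : ℝ, Complex.exp (-(Complex.I * ((σ * τ : ℝ) : ℂ))) * b σ‖ ^ 2 ≤
        (∫ σ : ℝ, (1 + σ ^ 2) ^ (γ - s)) * ∫ σ, (1 + σ ^ 2) ^ s * ‖b σ‖ ^ 2 ∧
    ‖(∫ σ : ℝ, Complex.exp (-(Complex.I * ((σ * τ : ℝ) : ℂ))) * b σ) -
        ∫ σ : ℝ, Complex.exp (-(Complex.I * ((σ * τ' : ℝ) : ℂ))) * b σ‖ ^ 2 ≤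
      (2 * |τ - τ'| ^ γ) ^ 2 *
        ((∫ σ : ℝ, (1 + σ ^ 2) ^ (γ - s)) * ∫ σ, (1 + σ ^ 2) ^ s * ‖b σ‖ ^ 2) := by
  have hcr : ∀ r : ℝ, Continuous (fun σ : ℝ ↦ (1 + σ ^ 2) ^ r) := fun r ↦
    Continuous.rpow_const (by fun_prop) fun x ↦ Or.inl (by positivity)
  have hf2 : ∀ σ : ℝ, ((1 + σ ^ 2) ^ ((γ - s) / 2)) ^ 2 = (1 + σ ^ 2) ^ (γ - s) := fun σ ↦ by
    rw [← Real.rpow_natCast, ← Real.rpow_mul (by positivity)]; congr 1; push_cast; ring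
  have hg2 : ∀ σ : ℝ, ((1 + σ ^ 2) ^ (s / 2) * ‖b σ‖) ^ 2 = (1 + σ ^ 2) ^ s * ‖b σ‖ ^ 2 :=
    fun σ ↦ by
    rw [mul_pow, ← Real.rpow_natCast, ← Real.rpow_mul (by positivity)]; congr 2; push_cast; ring
  have hci : Integrable (fun σ : ℝ ↦ (1 + σ ^ 2) ^ (γ - s)) := by
    have := integrable_rpow_neg_one_add_norm_sq (E := ℝ) (μ := volume) (r := 2 * (s - γ))
      (by simp; linarith)
    refine this.congr (Eventually.of_forall fun σ ↦ ?_)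
    simp only [Real.norm_eq_abs, sq_abs]
    congr 1; ring
  -- Split `⟨σ⟩^γ ‖b‖ = ⟨σ⟩^{γ-s} · ⟨σ⟩^s ‖b‖`; the first factor is square integrable as `s - γ >
  -- 1/2`.
  obtain ⟨h1, h2⟩ := sq_integral_mul_le (μ := volume)
    (f := fun σ : ℝ ↦ (1 + σ ^ 2) ^ ((γ - s) / 2))
    (g := fun σ ↦ (1 + σ ^ 2) ^ (s / 2) * ‖b σ‖) (hcr _).aestronglyMeasurable
    ((hcr _).aestronglyMeasurable.mul hb.norm) (fun σ ↦ by positivity) (fun σ ↦ by positivity)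
    (by simpa only [hf2] using hci) (by simpa only [hg2] using hi)
  simp only [hf2, hg2] at h2
  have hprod : ∀ σ : ℝ, (1 + σ ^ 2) ^ ((γ - s) / 2) * ((1 + σ ^ 2) ^ (s / 2) * ‖b σ‖) =
      (1 + σ ^ 2) ^ (γ / 2) * ‖b σ‖ := fun σ ↦ by
    rw [← mul_assoc, ← Real.rpow_add (by positivity)]; congr 2; ring
  simp only [hprod] at h1 h2
  have hone : ∀ σ : ℝ, 1 ≤ (1 + σ ^ 2) ^ (γ / 2) := fun σ ↦
    Real.one_le_rpow (by linarith [sq_nonneg σ]) (by positivity)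
  have hbi : Integrable b := by
    refine h1.mono hb (Eventually.of_forall fun σ ↦ ?_)
    rw [norm_mul, norm_norm]
    exact le_mul_of_one_le_left (norm_nonneg _) ((hone σ).trans (le_abs_self _))
  have hexp : ∀ u : ℝ, ‖Complex.exp (-(Complex.I * (u : ℂ)))‖ = 1 := fun u ↦ by
    rw [← mul_neg, ← Complex.ofReal_neg, norm_exp_I_mul_ofReal]
  have hei : ∀ τ : ℝ, Integrable fun σ : ℝ ↦
      Complex.exp (-(Complex.I * ((σ * τ : ℝ) : ℂ))) * b σ := fun τ ↦
    hbi.bdd_mul (c := 1) (Continuous.aestronglyMeasurable (by fun_prop))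
      (Eventually.of_forall fun σ ↦ (hexp _).le)
  constructor
  · refine le_trans (pow_le_pow_left₀ (norm_nonneg _) ?_ 2) h2
    refine norm_integral_le_of_norm_le h1 (Eventually.of_forall fun σ ↦ ?_)
    rw [norm_mul, hexp, one_mul]
    exact le_mul_of_one_le_left (norm_nonneg _) (hone σ)
  · refine le_trans (pow_le_pow_left₀ (norm_nonneg _) (b := 2 * |τ - τ'| ^ γ *
      ∫ σ, (1 + σ ^ 2) ^ (γ / 2) * ‖b σ‖) ?_ 2) ?_
    · rw [← integral_sub (hei τ) (hei τ')]
      refine (norm_integral_le_of_norm_le (h1.const_mul (2 * |τ - τ'| ^ γ))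
        (Eventually.of_forall fun σ ↦ ?_)).trans_eq (integral_const_mul _ _)
      rw [← sub_mul, norm_mul, ← mul_assoc]
      refine mul_le_mul_of_nonneg_right ?_ (norm_nonneg _)
      refine (norm_exp_sub_exp_le hγ0 hγ1 _ _).trans ?_
      rw [← mul_sub, abs_mul, Real.mul_rpow (abs_nonneg _) (abs_nonneg _), mul_assoc,
        mul_comm (|σ| ^ γ)]
      have h3 : |σ| ^ γ ≤ (1 + σ ^ 2) ^ (γ / 2) := by
        have : |σ| ^ γ = (σ ^ 2) ^ (γ / 2) := by
          rw [← sq_abs, ← Real.rpow_natCast, ← Real.rpow_mul (abs_nonneg _)]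
          congr 1; push_cast; ring
        rw [this]
        exact Real.rpow_le_rpow (sq_nonneg _) (by linarith) (by positivity)
      gcongr
    · rw [mul_pow]
      gcongr

/-- The restrictions of the Fourier transform of `a` to lines are Hölder continuous, with constants
which are square integrable over the family of parallel lines. -/
theorem exists_slice_bound {n : ℕ} {s γ : ℝ} (hγ0 : 0 ≤ γ) (hγ1 : γ ≤ 1) (hs : 1 / 2 + γ < s)
    (j : Fin (n + 1)) : ∃ C, 0 ≤ C ∧ ∀ a : 𝓢(Space (n + 1), ℂ), ∃ M : Space n → ℝ,
      Integrable M ∧ (∀ η, 0 ≤ M η) ∧ ∫ η, M η ≤ C * weightedSq s a ∧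
      ∀ᵐ η, ∀ τ τ', ‖ft a (slice j (τ, η))‖ ^ 2 ≤ M η ∧
        ‖ft a (slice j (τ, η)) - ft a (slice j (τ', η))‖ ^ 2 ≤ (2 * |τ - τ'| ^ γ) ^ 2 * M η := by
  set c := ∫ σ : ℝ, (1 + σ ^ 2) ^ (γ - s) with hc
  have hc0 : 0 ≤ c := integral_nonneg fun σ ↦ by positivity
  refine ⟨c * (2 * Real.pi) ^ n, by have := Real.pi_pos; positivity, fun a ↦ ?_⟩
  set f : ℝ × Space n → ℝ := fun p ↦ (1 + p.1 ^ 2) ^ s * ‖ft (sliceS j p.1 a) p.2‖ ^ 2 with hf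
  have hcr : Continuous (fun σ : ℝ ↦ (1 + σ ^ 2) ^ s) :=
    Continuous.rpow_const (by fun_prop) fun x ↦ Or.inl (by positivity)
  have hftm : StronglyMeasurable fun p : ℝ × Space n ↦ ft (sliceS j p.1 a) p.2 := by
    have h := continuous_slice j
    refine StronglyMeasurable.integral_prod_right (ν := (volume : Measure (Space n)))
      (f := fun (p : ℝ × Space n) (y : Space n) ↦
      Complex.exp (-(Complex.I * (⟪y, p.2⟫_ℝ : ℂ))) * a (slice j (p.1, y))) ?_
    exact Continuous.stronglyMeasurable (by simp only [Function.uncurry_def]; fun_prop)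
  have hfm : AEStronglyMeasurable f (volume.prod volume) :=
    ((hcr.comp continuous_fst).stronglyMeasurable.mul (hftm.norm.pow 2)).aestronglyMeasurable
  have hW : Integrable (fun p : ℝ × Space n ↦ (1 + p.1 ^ 2) ^ s * ‖a (slice j p)‖ ^ 2)
      (volume.prod volume) ∧ ∫ p : ℝ × Space n, (1 + p.1 ^ 2) ^ s * ‖a (slice j p)‖ ^ 2
        ∂(volume.prod volume) ≤ weightedSq s a := by
    have h1 := (measurePreserving_slice j).integrable_comp_of_integrable (integrable_weightedSq s a)
    have h3 : ∀ p : ℝ × Space n, (1 + p.1 ^ 2) ^ s * ‖a (slice j p)‖ ^ 2 ≤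
        bracket (slice j p) ^ (2 * s) * ‖a (slice j p)‖ ^ 2 := fun p ↦ by
      rw [bracket_rpow, norm_slice_sq, mul_div_cancel_left₀ s two_ne_zero]
      gcongr
      · linarith
      · exact le_add_of_nonneg_right (by positivity)
    have h2 : Integrable (fun p : ℝ × Space n ↦ (1 + p.1 ^ 2) ^ s * ‖a (slice j p)‖ ^ 2)
        (volume.prod volume) := by
      refine h1.mono' (Continuous.aestronglyMeasurable ?_) (Eventually.of_forall fun p ↦ ?_)
      · exact (hcr.comp continuous_fst).mul
          ((a.continuous.comp (continuous_slice j)).norm.pow 2)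
      · rw [Real.norm_of_nonneg (by positivity)]
        exact h3 p
    refine ⟨h2, (integral_mono h2 h1 h3).trans_eq ?_⟩
    exact (measurePreserving_slice j).integral_comp' (fun x ↦ bracket x ^ (2 * s) * ‖a x‖ ^ 2)
  have hin : ∀ σ : ℝ, ∫ η, f (σ, η) =
      (2 * Real.pi) ^ n * ∫ y, (1 + σ ^ 2) ^ s * ‖a (slice j (σ, y))‖ ^ 2 := fun σ ↦ by
    simp only [hf, integral_const_mul, integral_norm_ft_sq, sliceS_apply]
    ring
  have hfi : Integrable f (volume.prod volume) := by
    rw [integrable_prod_iff hfm]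
    constructor
    · refine Eventually.of_forall fun σ ↦ ?_
      change Integrable fun η ↦ (1 + σ ^ 2) ^ s * ‖ft (sliceS j σ a) η‖ ^ 2
      refine Integrable.const_mul ?_ _
      simpa only [ftS_apply] using integrable_norm_sq (ftS (sliceS j σ a))
    · have e : (fun σ ↦ ∫ η, ‖f (σ, η)‖) = fun σ ↦
          (2 * Real.pi) ^ n * ∫ y, (1 + σ ^ 2) ^ s * ‖a (slice j (σ, y))‖ ^ 2 := by
        ext σ
        rw [← hin]
        congr 1; ext η
        exact Real.norm_of_nonneg (by positivity)
      rw [e]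
      exact hW.1.integral_prod_left.const_mul _
  -- The constant for the line through `η` is the weighted `L²` norm along that line of the partial
  -- Fourier transform; by Plancherel in the hyperplane these add up to the weighted norm of `a`.
  refine ⟨fun η ↦ c * ∫ σ, f (σ, η), hfi.integral_prod_right.const_mul c,
    fun η ↦ mul_nonneg hc0 (integral_nonneg fun σ ↦ by positivity), ?_, ?_⟩
  · rw [integral_const_mul, mul_assoc]
    refine mul_le_mul_of_nonneg_left ?_ hc0
    rw [← integral_prod_symm f hfi, integral_prod f hfi]
    simp only [hin]
    rw [integral_const_mul, ← integral_prod _ hW.1]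
    exact mul_le_mul_of_nonneg_left hW.2 (by have := Real.pi_pos; positivity)
  · filter_upwards [hfi.prod_left_ae] with η hη τ τ'
    have := sobolev_embedding_line hγ0 hγ1 hs
      (hftm.comp_measurable measurable_prodMk_right).aestronglyMeasurable hη τ τ'
    rw [ft_slice, ft_slice]
    exact this

end

/-! ### Integrals over spheres as integrals over lines -/

theorem abs_sqrt_sub_sqrt_le (x y : ℝ) :
    |Real.sqrt x - Real.sqrt y| ≤ Real.sqrt |x - y| := by
  have key : ∀ x y : ℝ, y ≤ x → Real.sqrt x ≤ Real.sqrt y + Real.sqrt (x - y) := fun x y h ↦ by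
    refine Real.sqrt_le_iff.2 ⟨by positivity, ?_⟩
    have h1 : y ≤ Real.sqrt y ^ 2 := by
      rcases le_total 0 y with h0 | h0
      · rw [Real.sq_sqrt h0]
      · exact h0.trans (sq_nonneg _)
    have h2 := Real.sq_sqrt (sub_nonneg.2 h)
    nlinarith [mul_nonneg (Real.sqrt_nonneg y) (Real.sqrt_nonneg (x - y))]
  rcases le_total y x with h | h
  · rw [abs_of_nonneg (sub_nonneg.2 (Real.sqrt_le_sqrt h)), abs_of_nonneg (sub_nonneg.2 h)]
    linarith [key x y h]
  · rw [abs_of_nonpos (sub_nonpos.2 (Real.sqrt_le_sqrt h)), abs_of_nonpos (sub_nonpos.2 h), neg_sub,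
      neg_sub]
    linarith [key y x h]

/-- The density with respect to `dρ` of the part of an integral over a line at distance `b` from the
origin which lies on the sphere of radius `ρ`, weighted by the squared cosine of the angle between
the line and the normal of the sphere. The density vanishes if the sphere does not meet the line. -/
def lineDensity (b : ℝ) (P : ℝ → ℂ) (ρ : ℝ) : ℂ :=
  ((Real.sqrt (ρ ^ 2 - b ^ 2) / ρ : ℝ) : ℂ) *
    (P (Real.sqrt (ρ ^ 2 - b ^ 2)) + P (-Real.sqrt (ρ ^ 2 - b ^ 2)))

theorem sqrt_sq_sub_sq_le {b ρ : ℝ} (hρ : 0 ≤ ρ) : Real.sqrt (ρ ^ 2 - b ^ 2) ≤ ρ :=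
  (Real.sqrt_le_sqrt (by linarith [sq_nonneg b])).trans_eq (Real.sqrt_sq hρ)

theorem norm_lineDensity_le {b M ρ : ℝ} {P : ℝ → ℂ} (hP : ∀ τ, ‖P τ‖ ≤ M) (hρ : 0 < ρ) :
    ‖lineDensity b P ρ‖ ≤ 2 * M := by
  have hM : 0 ≤ M := (norm_nonneg _).trans (hP 0)
  rw [lineDensity, norm_mul, Complex.norm_real, Real.norm_of_nonneg (by positivity)]
  have h1 : Real.sqrt (ρ ^ 2 - b ^ 2) / ρ ≤ 1 := (div_le_one hρ).2 (sqrt_sq_sub_sq_le hρ.le)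
  calc _ ≤ 1 * (M + M) := by
        gcongr
        exact (norm_add_le _ _).trans (add_le_add (hP _) (hP _))
    _ = _ := by ring

/-- If `P` is Hölder continuous of order `γ` then its `lineDensity` is Hölder continuous of order
`γ / 2`, uniformly in `b`; half of the order is lost at tangential intersections. -/
theorem exists_lineDensity_holder {κ K γ : ℝ} (hκ : 0 < κ) (hκK : κ ≤ K) (hγ0 : 0 ≤ γ)
    (hγ1 : γ ≤ 1) : ∃ C, 2 ≤ C ∧ ∀ (b M : ℝ) (P : ℝ → ℂ), (∀ τ, ‖P τ‖ ≤ M) →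
      (∀ τ τ', ‖P τ - P τ'‖ ≤ 4 * |τ - τ'| ^ γ * M) →
      ∀ ρ ∈ Icc κ K, ∀ ρ' ∈ Icc κ K,
        ‖lineDensity b P ρ - lineDensity b P ρ'‖ ≤ C * M * |ρ - ρ'| ^ (γ / 2) := by
  have hK : 0 < K := hκ.trans_le hκK
  set c₁ := (Real.sqrt (2 * K) * K ^ (1 / 2 - γ / 2) + K ^ (1 - γ / 2)) / κ with hc₁
  have hc₁0 : 0 ≤ c₁ := by positivity
  set c₂ := (2 * K) ^ (γ / 2) with hc₂
  have hc₂0 : 0 ≤ c₂ := by positivity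
  refine ⟨2 + 2 * c₁ + 8 * c₂, by linarith, fun b M P hP hP' ρ hρ ρ' hρ' ↦ ?_⟩
  have hM : 0 ≤ M := (norm_nonneg _).trans (hP 0)
  have hρ0 : 0 < ρ := hκ.trans_le hρ.1
  have hρ0' : 0 < ρ' := hκ.trans_le hρ'.1
  set u := Real.sqrt (ρ ^ 2 - b ^ 2) with hu
  set u' := Real.sqrt (ρ' ^ 2 - b ^ 2) with hu'
  set Δ := |ρ - ρ'| with hΔ
  have hΔ0 : 0 ≤ Δ := abs_nonneg _
  have hΔK : Δ ≤ K := abs_le.2 ⟨by linarith [hρ.1, hρ'.2], by linarith [hρ.2, hρ'.1]⟩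
  have hu0 : 0 ≤ u := Real.sqrt_nonneg _
  have hu0' : 0 ≤ u' := Real.sqrt_nonneg _
  have huu : |u - u'| ≤ Real.sqrt (2 * K) * Δ ^ (1 / 2 : ℝ) := by
    refine (abs_sqrt_sub_sqrt_le _ _).trans ?_
    rw [← Real.sqrt_eq_rpow, ← Real.sqrt_mul (by positivity)]
    refine Real.sqrt_le_sqrt ?_
    have : ρ ^ 2 - b ^ 2 - (ρ' ^ 2 - b ^ 2) = (ρ + ρ') * (ρ - ρ') := by ring
    rw [this, abs_mul, abs_of_pos (by positivity)]
    gcongr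
    linarith [hρ.2, hρ'.2]
  have hsplit : ∀ p : ℝ, γ / 2 ≤ p → Δ ^ p ≤ Δ ^ (γ / 2) * K ^ (p - γ / 2) := fun p hp ↦ by
    have : p = γ / 2 + (p - γ / 2) := by ring
    conv_lhs => rw [this]
    rw [Real.rpow_add_of_nonneg hΔ0 (by positivity) (by linarith)]
    gcongr
  have hγu : |u - u'| ^ γ ≤ c₂ * Δ ^ (γ / 2) := by
    refine (Real.rpow_le_rpow (abs_nonneg _) huu hγ0).trans_eq ?_
    rw [Real.mul_rpow (by positivity) (by positivity), Real.sqrt_eq_rpow, ← Real.rpow_mul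
      (by positivity), ← Real.rpow_mul hΔ0, hc₂]
    congr 2 <;> ring
  have hq : |u / ρ - u' / ρ'| ≤ c₁ * Δ ^ (γ / 2) := by
    have e : u / ρ - u' / ρ' = (u - u') / ρ + u' / ρ' * ((ρ' - ρ) / ρ) := by field_simp; ring
    have h1 : |u' / ρ'| ≤ 1 := by
      rw [abs_of_nonneg (by positivity)]
      exact (div_le_one hρ0').2 (sqrt_sq_sub_sq_le hρ0'.le)
    have h3 : |u / ρ - u' / ρ'| ≤ (|u - u'| + Δ) / κ := by
      rw [e]
      refine (abs_add_le _ _).trans ?_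
      have e1 : |(u - u') / ρ| = |u - u'| / ρ := by rw [abs_div, abs_of_pos hρ0]
      have e2 : |(ρ' - ρ) / ρ| = Δ / ρ := by rw [abs_div, abs_of_pos hρ0, abs_sub_comm ρ' ρ]
      rw [abs_mul, e1, e2, add_div]
      gcongr
      · exact hρ.1
      · calc |u' / ρ'| * (Δ / ρ) ≤ 1 * (Δ / κ) := by gcongr; exact hρ.1
          _ = _ := one_mul _
    refine h3.trans ?_
    rw [hc₁, div_mul_eq_mul_div]
    gcongr
    have h4 := hsplit (1 / 2) (by linarith)
    have h5 := hsplit 1 (by linarith)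
    rw [Real.rpow_one] at h5
    have h6 := mul_le_mul_of_nonneg_left h4 (Real.sqrt_nonneg (2 * K))
    nlinarith
  have e : lineDensity b P ρ - lineDensity b P ρ' =
      ((u / ρ - u' / ρ' : ℝ) : ℂ) * (P u + P (-u)) +
        ((u' / ρ' : ℝ) : ℂ) * ((P u - P u') + (P (-u) - P (-u'))) := by
    simp only [lineDensity]
    push_cast
    ring
  rw [e]
  refine (norm_add_le _ _).trans ?_
  rw [norm_mul, norm_mul, Complex.norm_real, Complex.norm_real]
  have h1 : ‖u' / ρ'‖ ≤ 1 := by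
    rw [Real.norm_of_nonneg (by positivity)]
    exact (div_le_one hρ0').2 (sqrt_sq_sub_sq_le hρ0'.le)
  have h2 : ‖P u + P (-u)‖ ≤ M + M := (norm_add_le _ _).trans (add_le_add (hP _) (hP _))
  have h3 : ‖P u - P u'‖ ≤ 4 * (c₂ * Δ ^ (γ / 2)) * M := (hP' _ _).trans (by gcongr)
  have h4 : ‖P (-u) - P (-u')‖ ≤ 4 * (c₂ * Δ ^ (γ / 2)) * M := by
    refine (hP' _ _).trans ?_
    rw [neg_sub_neg, abs_sub_comm]
    gcongr
  calc _ ≤ c₁ * Δ ^ (γ / 2) * (M + M) +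
        1 * (4 * (c₂ * Δ ^ (γ / 2)) * M + 4 * (c₂ * Δ ^ (γ / 2)) * M) := by
        gcongr
        · exact hq
        · exact (norm_add_le _ _).trans (add_le_add h3 h4)
    _ = (2 * c₁ + 8 * c₂) * M * Δ ^ (γ / 2) := by ring
    _ ≤ _ := by gcongr; linarith

/-- A function `w` supported in `[κ, K]` whose pairing with Hölder continuous functions of order `β`
is bounded with constant `L`. -/
structure IsHolderDual (κ K β L : ℝ) (w : ℝ → ℂ) : Prop where
  measurable : Measurable w
  bounded : ∃ B, ∀ ρ, ‖w ρ‖ ≤ B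
  eq_zero : ∀ ρ, ρ ∉ Icc κ K → w ρ = 0
  pairing : ∀ g : ℝ → ℂ, Measurable g → ∀ M, (∀ ρ ∈ Icc κ K, ‖g ρ‖ ≤ M) →
    (∀ ρ ∈ Icc κ K, ∀ ρ' ∈ Icc κ K, ‖g ρ - g ρ'‖ ≤ M * |ρ - ρ'| ^ β) →
    ‖∫ ρ, w ρ * g ρ‖ ≤ L * M

/-- The substitution `ρ = √(τ² + b²)` on a line at distance `b` from the origin. The factor `τ² /
(τ² + b²)` cancels the singularity of the Jacobian `ρ / τ` at tangential intersections. -/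
theorem integral_line_eq {κ K B M b : ℝ} {w P : ℝ → ℂ} (hκ : 0 < κ) (hw : Measurable w)
    (hB : ∀ ρ, ‖w ρ‖ ≤ B) (h0 : ∀ ρ, ρ ∉ Icc κ K → w ρ = 0) (hb : 0 ≤ b) (hPm : Measurable P)
    (hP : ∀ τ, ‖P τ‖ ≤ M) :
    ∫ τ : ℝ, P τ * (w (Real.sqrt (τ ^ 2 + b ^ 2)) * ((τ ^ 2 / (τ ^ 2 + b ^ 2) : ℝ) : ℂ)) =
      ∫ ρ, w ρ * lineDensity b P ρ := by
  have hM : 0 ≤ M := (norm_nonneg _).trans (hP 0)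
  have hB0 : 0 ≤ B := (norm_nonneg _).trans (hB 0)
  have hi : Integrable fun τ : ℝ ↦
      P τ * (w (Real.sqrt (τ ^ 2 + b ^ 2)) * ((τ ^ 2 / (τ ^ 2 + b ^ 2) : ℝ) : ℂ)) := by
    refine integrable_of_bounded_of_support (M := M * (B * 1)) (s := Icc (-K) K)
      (by fun_prop) (fun τ ↦ ?_) isCompact_Icc.measure_lt_top fun τ hτ ↦ ?_
    · rw [norm_mul, norm_mul, Complex.norm_real, Real.norm_of_nonneg (by positivity)]
      have : τ ^ 2 / (τ ^ 2 + b ^ 2) ≤ 1 := div_le_one_of_le₀ (by nlinarith [sq_nonneg b])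
        (by positivity)
      gcongr
      · exact hP τ
      · exact hB _
    · rw [h0, zero_mul, mul_zero]
      rintro ⟨-, h⟩
      refine hτ (abs_le.1 (le_trans ?_ h))
      rw [← Real.sqrt_sq_eq_abs]
      exact Real.sqrt_le_sqrt (by nlinarith [sq_nonneg b])
  have hR : ∫ ρ, w ρ * lineDensity b P ρ = ∫ ρ in Ioi b, w ρ * lineDensity b P ρ := by
    rw [setIntegral_eq_integral_of_forall_compl_eq_zero]
    intro ρ hρ
    have hρb : ρ ≤ b := not_lt.1 hρ
    by_cases hρ0 : 0 ≤ ρ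
    · have : Real.sqrt (ρ ^ 2 - b ^ 2) = 0 := Real.sqrt_eq_zero_of_nonpos (by nlinarith)
      simp [lineDensity, this]
    · rw [h0 ρ (fun h ↦ hρ0 (hκ.le.trans h.1)), zero_mul]
  rw [hR, integral_Ioi_sqrt_substitution hb, integral_eq_integral_Ioi_add_neg hi]
  refine setIntegral_congr_fun measurableSet_Ioi fun τ hτ ↦ ?_
  have hτ0 : (0 : ℝ) < τ := hτ
  have hs : Real.sqrt (τ ^ 2 + b ^ 2) ^ 2 = τ ^ 2 + b ^ 2 := Real.sq_sqrt (by positivity)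
  have hu : Real.sqrt (Real.sqrt (τ ^ 2 + b ^ 2) ^ 2 - b ^ 2) = τ := by
    rw [hs, add_sub_cancel_right, Real.sqrt_sq hτ0.le]
  have hs' : ((Real.sqrt (τ ^ 2 + b ^ 2) : ℝ) : ℂ) ^ 2 = (τ : ℂ) ^ 2 + (b : ℂ) ^ 2 := by
    exact_mod_cast congrArg (fun x : ℝ ↦ (x : ℂ)) hs
  have hs0 : ((Real.sqrt (τ ^ 2 + b ^ 2) : ℝ) : ℂ) ≠ 0 := by
    have : 0 < Real.sqrt (τ ^ 2 + b ^ 2) := Real.sqrt_pos.2 (by positivity)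
    exact_mod_cast this.ne'
  simp only [lineDensity, hu, neg_sq, Complex.real_smul]
  push_cast
  rw [← hs']
  field_simp

/-- Passing from a bound by a sum of squares to a bound by a product, by scaling. -/
theorem le_of_forall_scaling {T C x y : ℝ} (hx : 0 ≤ x) (hy : 0 ≤ y)
    (h : ∀ c : ℝ, 0 < c → T ≤ C * (c ^ 2 * x + (c⁻¹) ^ 2 * y)) :
    T ≤ 2 * C * (Real.sqrt x * Real.sqrt y) := by
  -- Choose `c` with `c² √x = √y`, perturbed to allow for vanishing `x` or `y`.
  have key : ∀ δ : ℝ, 0 < δ → T ≤ C * ((Real.sqrt y + δ) / (Real.sqrt x + δ) * x +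
      (Real.sqrt x + δ) / (Real.sqrt y + δ) * y) := fun δ hδ ↦ by
    have h1 : 0 < Real.sqrt x + δ := by positivity
    have h2 : 0 < Real.sqrt y + δ := by positivity
    have := h (Real.sqrt ((Real.sqrt y + δ) / (Real.sqrt x + δ))) (Real.sqrt_pos.2 (by positivity))
    rwa [inv_pow, Real.sq_sqrt (by positivity), inv_div] at this
  have hlim : ∀ x y : ℝ, 0 ≤ x → 0 ≤ y → Tendsto (fun δ : ℝ ↦
      (Real.sqrt y + δ) / (Real.sqrt x + δ) * x) (𝓝[>] 0) (𝓝 (Real.sqrt y * Real.sqrt x)) := by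
    intro x y hx hy
    rcases hx.eq_or_lt with rfl | hx
    · simp
    · have hx' := Real.sqrt_pos.2 hx
      have hc : ContinuousAt (fun δ : ℝ ↦ (Real.sqrt y + δ) / (Real.sqrt x + δ) * x) 0 := by
        refine ContinuousAt.mul (ContinuousAt.div (by fun_prop) (by fun_prop) ?_) continuousAt_const
        simpa using hx'.ne'
      have e : (Real.sqrt y + 0) / (Real.sqrt x + 0) * x = Real.sqrt y * Real.sqrt x := by
        rw [add_zero, add_zero, div_mul_eq_mul_div, div_eq_iff hx'.ne', mul_assoc,
          Real.mul_self_sqrt hx.le]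
      rw [← e]
      exact hc.tendsto.mono_left nhdsWithin_le_nhds
  have hl := ((hlim x y hx hy).add (hlim y x hy hx)).const_mul C
  have : T ≤ C * (Real.sqrt y * Real.sqrt x + Real.sqrt x * Real.sqrt y) := by
    refine ge_of_tendsto hl ?_
    filter_upwards [self_mem_nhdsWithin] with δ hδ
    exact key δ hδ
  linarith [mul_comm (Real.sqrt y) (Real.sqrt x)]

/-- The trace theorem behind the limiting absorption principle: pairings of radial functions with a
product of Fourier transforms are controlled by weighted norms with a weight of order `s > 1/2`. -/
theorem exists_norm_integral_radial_le {n : ℕ} {s κ K : ℝ} (hs : 1 / 2 < s) (hκ : 0 < κ)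
    (hκK : κ ≤ K) : ∃ β, 0 < β ∧ ∃ C, 0 ≤ C ∧
      ∀ (a b : 𝓢(Space (n + 1), ℂ)) (w : ℝ → ℂ) (L : ℝ), 0 ≤ L → IsHolderDual κ K β L w →
        ‖∫ ξ, ft a ξ * ft b ξ * w ‖ξ‖‖ ≤
          C * L * (Real.sqrt (weightedSq s a) * Real.sqrt (weightedSq s b)) := by
  set γ := min ((s - 1 / 2) / 2) 1 with hγ
  have hγ0 : 0 < γ := lt_min (by linarith) one_pos
  have hγ1 : γ ≤ 1 := min_le_right _ _
  have hγs : 1 / 2 + γ < s := by have := min_le_left ((s - 1 / 2) / 2) 1; linarith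
  choose C hC0 hC using fun j : Fin (n + 1) ↦ exists_slice_bound (n := n) hγ0.le hγ1 hγs j
  obtain ⟨C', hC'2, hC'⟩ := exists_lineDensity_holder hκ hκK hγ0.le hγ1
  refine ⟨γ / 2, by positivity, 2 * ∑ j, C' / 2 * C j,
    mul_nonneg zero_le_two (Finset.sum_nonneg fun j _ ↦ mul_nonneg (by linarith) (hC0 j)), ?_⟩
  -- The estimate with the sum of the squares in place of the product of the norms.
  have main : ∀ (a b : 𝓢(Space (n + 1), ℂ)) (w : ℝ → ℂ) (L : ℝ), 0 ≤ L →
      IsHolderDual κ K (γ / 2) L w → ‖∫ ξ, ft a ξ * ft b ξ * w ‖ξ‖‖ ≤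
        (∑ j, C' / 2 * C j) * L * (weightedSq s a + weightedSq s b) := by
    intro a b w L hL hw
    obtain ⟨B, hB⟩ := hw.bounded
    have hft : ∀ a : 𝓢(Space (n + 1), ℂ), Continuous (ft a) := fun a ↦ by
      have := (ftS a).continuous
      rwa [show ⇑(ftS a) = ft a from funext (ftS_apply a)] at this
    have hPw : Integrable fun ξ ↦ ft a ξ * ft b ξ * w ‖ξ‖ :=
      (integrable_ft_mul_ft a b).mul_bdd (c := B)
        (hw.measurable.comp measurable_norm).aestronglyMeasurable
        (Eventually.of_forall fun ξ ↦ hB _)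
    have hj : ∀ j : Fin (n + 1), Integrable fun ξ : Space (n + 1) ↦
        ft a ξ * ft b ξ * w ‖ξ‖ * ((ξ j ^ 2 / ‖ξ‖ ^ 2 : ℝ) : ℂ) := fun j ↦ by
      have hm : Measurable fun ξ : Space (n + 1) ↦ ξ j := by fun_prop
      refine hPw.mul_bdd (c := 1) (Complex.measurable_ofReal.comp
        ((hm.pow_const 2).div (measurable_norm.pow_const 2))).aestronglyMeasurable
          (Eventually.of_forall fun ξ ↦ ?_)
      rw [Complex.norm_real, Real.norm_of_nonneg (by positivity)]
      refine div_le_one_of_le₀ ?_ (by positivity)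
      rw [EuclideanSpace.norm_sq_eq]
      have := Finset.single_le_sum (f := fun i ↦ ‖ξ i‖ ^ 2) (fun i _ ↦ by positivity)
        (Finset.mem_univ j)
      simpa only [Real.norm_eq_abs, sq_abs] using this
    -- The partition `1 = ∑ ξ_j² / |ξ|²` reduces the integral to integrals over the lines in the
    -- direction of the `j`th coordinate.
    have hsum : ∫ ξ, ft a ξ * ft b ξ * w ‖ξ‖ = ∑ j, ∫ ξ : Space (n + 1),
        ft a ξ * ft b ξ * w ‖ξ‖ * ((ξ j ^ 2 / ‖ξ‖ ^ 2 : ℝ) : ℂ) := by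
      rw [← integral_finsetSum _ fun j _ ↦ hj j]
      congr 1; ext ξ
      rw [← Finset.mul_sum, ← Complex.ofReal_sum, ← Finset.sum_div]
      by_cases hξ : ξ = 0
      · rw [hξ, norm_zero, hw.eq_zero 0 fun h ↦ hκ.not_ge h.1]; simp
      · have : ∑ j, ξ j ^ 2 = ‖ξ‖ ^ 2 := by rw [EuclideanSpace.norm_sq_eq]; simp
        rw [this, div_self (by simpa using hξ), Complex.ofReal_one, mul_one]
    rw [hsum, Finset.sum_mul, Finset.sum_mul]
    refine (norm_sum_le _ _).trans (Finset.sum_le_sum fun j _ ↦ ?_)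
    obtain ⟨Ma, hMai, hMa0, hMaC, hMa⟩ := hC j a
    obtain ⟨Mb, hMbi, hMb0, hMbC, hMb⟩ := hC j b
    rw [← (measurePreserving_slice j).integral_comp']
    refine (congrArg norm (integral_prod_symm _
      ((measurePreserving_slice j).integrable_comp_of_integrable (hj j)))).trans_le ?_
    have hle : ∀ᵐ η : Space n, ‖∫ τ : ℝ, (fun ξ : Space (n + 1) ↦
        ft a ξ * ft b ξ * w ‖ξ‖ * ((ξ j ^ 2 / ‖ξ‖ ^ 2 : ℝ) : ℂ)) (slice j (τ, η))‖ ≤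
        L * (C' * ((Ma η + Mb η) / 2)) := by
      filter_upwards [hMa, hMb] with η hηa hηb
      set P : ℝ → ℂ := fun τ ↦ ft a (slice j (τ, η)) * ft b (slice j (τ, η)) with hPdef
      have hra : ∀ τ, ‖ft a (slice j (τ, η))‖ ≤ Real.sqrt (Ma η) := fun τ ↦
        Real.le_sqrt_of_sq_le (hηa τ τ).1
      have hrb : ∀ τ, ‖ft b (slice j (τ, η))‖ ≤ Real.sqrt (Mb η) := fun τ ↦
        Real.le_sqrt_of_sq_le (hηb τ τ).1
      have hra' : ∀ τ τ', ‖ft a (slice j (τ, η)) - ft a (slice j (τ', η))‖ ≤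
          2 * |τ - τ'| ^ γ * Real.sqrt (Ma η) := fun τ τ' ↦ by
        refine abs_le_of_sq_le_sq' ?_ (by positivity) |>.2
        rw [mul_pow, Real.sq_sqrt (hMa0 η)]
        exact (hηa τ τ').2
      have hrb' : ∀ τ τ', ‖ft b (slice j (τ, η)) - ft b (slice j (τ', η))‖ ≤
          2 * |τ - τ'| ^ γ * Real.sqrt (Mb η) := fun τ τ' ↦ by
        refine abs_le_of_sq_le_sq' ?_ (by positivity) |>.2
        rw [mul_pow, Real.sq_sqrt (hMb0 η)]
        exact (hηb τ τ').2
      have hM : Real.sqrt (Ma η) * Real.sqrt (Mb η) ≤ (Ma η + Mb η) / 2 := by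
        have h1 := Real.sq_sqrt (hMa0 η)
        have h2 := Real.sq_sqrt (hMb0 η)
        nlinarith [sq_nonneg (Real.sqrt (Ma η) - Real.sqrt (Mb η))]
      have hP1 : ∀ τ, ‖P τ‖ ≤ (Ma η + Mb η) / 2 := fun τ ↦ by
        refine le_trans ?_ hM
        rw [norm_mul]
        gcongr
        exacts [hra τ, hrb τ]
      have hP2 : ∀ τ τ', ‖P τ - P τ'‖ ≤ 4 * |τ - τ'| ^ γ * ((Ma η + Mb η) / 2) := fun τ τ' ↦ by
        have e : P τ - P τ' = (ft a (slice j (τ, η)) - ft a (slice j (τ', η))) *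
            ft b (slice j (τ, η)) + ft a (slice j (τ', η)) *
              (ft b (slice j (τ, η)) - ft b (slice j (τ', η))) := by
          simp only [hPdef]; ring
        rw [e]
        refine (norm_add_le _ _).trans ?_
        rw [norm_mul, norm_mul]
        calc _ ≤ 2 * |τ - τ'| ^ γ * Real.sqrt (Ma η) * Real.sqrt (Mb η) +
              Real.sqrt (Ma η) * (2 * |τ - τ'| ^ γ * Real.sqrt (Mb η)) := by
              gcongr
              exacts [hra' τ τ', hrb τ, hra τ', hrb' τ τ']
          _ = 4 * |τ - τ'| ^ γ * (Real.sqrt (Ma η) * Real.sqrt (Mb η)) := by ring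
          _ ≤ _ := by gcongr
      have hPc : Continuous P := by
        have h1 := continuous_slice j
        have h2 := hft a
        have h3 := hft b
        fun_prop
      have e : ∫ τ : ℝ, (fun ξ : Space (n + 1) ↦ ft a ξ * ft b ξ * w ‖ξ‖ *
          ((ξ j ^ 2 / ‖ξ‖ ^ 2 : ℝ) : ℂ)) (slice j (τ, η)) =
          ∫ ρ, w ρ * lineDensity ‖η‖ P ρ := by
        rw [← integral_line_eq hκ hw.measurable hB hw.eq_zero (norm_nonneg η) hPc.measurable hP1]
        congr 1; ext τ
        beta_reduce
        rw [slice_apply_self, norm_slice_sq, norm_slice, mul_assoc]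
      rw [e]
      have hM0 : 0 ≤ (Ma η + Mb η) / 2 := by linarith [hMa0 η, hMb0 η]
      refine hw.pairing _ ?_ _ (fun ρ hρ ↦ ?_) fun ρ hρ ρ' hρ' ↦ hC' _ _ _ hP1 hP2 ρ hρ ρ' hρ'
      · have := hPc.measurable
        unfold lineDensity
        fun_prop
      · exact (norm_lineDensity_le hP1 (hκ.trans_le hρ.1)).trans (by gcongr)
    refine (norm_integral_le_of_norm_le
      ((((hMai.add hMbi).div_const 2).const_mul C').const_mul L) hle).trans ?_
    simp only [integral_const_mul, integral_div, Pi.add_apply]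
    rw [integral_add hMai hMbi]
    calc L * (C' * (((∫ η, Ma η) + ∫ η, Mb η) / 2))
        ≤ L * (C' * ((C j * weightedSq s a + C j * weightedSq s b) / 2)) := by gcongr
      _ = _ := by ring
  intro a b w L hL hw
  have hsc : ∀ c : ℝ, 0 < c → ‖∫ ξ, ft a ξ * ft b ξ * w ‖ξ‖‖ ≤ (∑ j, C' / 2 * C j) * L *
      (c ^ 2 * weightedSq s a + (c⁻¹) ^ 2 * weightedSq s b) := fun c hc ↦ by
    have h := main ((c : ℂ) • a) (((c⁻¹ : ℝ) : ℂ) • b) w L hL hw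
    rw [weightedSq_smul, weightedSq_smul, Complex.norm_real, Complex.norm_real,
      Real.norm_of_nonneg hc.le, Real.norm_of_nonneg (inv_pos.2 hc).le] at h
    refine le_trans (le_of_eq ?_) h
    congr 2; ext ξ
    rw [← ftS_apply ((c : ℂ) • a), ← ftS_apply (((c⁻¹ : ℝ) : ℂ) • b), map_smul, map_smul,
      smul_apply, smul_apply, ftS_apply, ftS_apply, smul_eq_mul, smul_eq_mul, Complex.ofReal_inv]
    have : (c : ℂ) ≠ 0 := by exact_mod_cast hc.ne'
    field_simp
  refine (le_of_forall_scaling (weightedSq_nonneg s a) (weightedSq_nonneg s b) hsc).trans_eq ?_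
  ring

/-! ### The limiting absorption principle -/

/-- An integrable function pairs with bounded functions, hence with Hölder continuous ones. -/
theorem isHolderDual_of_integral_norm_le {κ K β L B : ℝ} {w : ℝ → ℂ} (hw : Measurable w)
    (hB : ∀ ρ, ‖w ρ‖ ≤ B) (h0 : ∀ ρ, ρ ∉ Icc κ K → w ρ = 0) (hκK : κ ≤ K)
    (hL : ∫ ρ, ‖w ρ‖ ≤ L) : IsHolderDual κ K β L w where
  measurable := hw
  bounded := ⟨B, hB⟩
  eq_zero := h0
  pairing g _ M hM _ := by
    have hM0 : 0 ≤ M := (norm_nonneg _).trans (hM κ ⟨le_rfl, hκK⟩)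
    have hi : Integrable w := integrable_of_bounded_of_support hw.aestronglyMeasurable hB
      isCompact_Icc.measure_lt_top h0
    refine (norm_integral_le_of_norm_le (hi.norm.mul_const M)
      (Eventually.of_forall fun ρ ↦ ?_)).trans
      ((integral_mul_const M _).trans_le (mul_le_mul_of_nonneg_right hL hM0))
    rw [norm_mul]
    by_cases hρ : ρ ∈ Icc κ K
    · exact mul_le_mul_of_nonneg_left (hM ρ hρ) (norm_nonneg _)
    · simp [h0 ρ hρ]

theorem pvKernel_eq_zero_of_notMem {k₀ k₁ k : ℝ} (hk : k ∈ Icc k₀ k₁) (r : ℝ) {ρ : ℝ}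
    (hρ : ρ ∉ Icc (k₀ / 2) (3 * k₁ / 2)) : pvKernel k r ρ = 0 := by
  refine pvKernel_eq_zero (not_lt.1 fun h ↦ hρ ?_)
  rw [abs_lt] at h
  exact ⟨by linarith [h.1, hk.1], by linarith [h.2, hk.2]⟩

/-- The truncations of `1 / (ρ - k)` are bounded on Hölder continuous functions, uniformly in the
truncation and locally uniformly in `k`. -/
theorem isHolderDual_pvKernel {k₀ k₁ k r β : ℝ} (hk₀ : 0 < k₀) (hk : k ∈ Icc k₀ k₁) (hr : 0 < r)
    (hβ : 0 < β) : IsHolderDual (k₀ / 2) (3 * k₁ / 2) β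
      (∫ ρ in Metric.ball (0 : ℝ) (k₁ / 2), |ρ| ^ (β - 1)) (pvKernel k r) where
  measurable := measurable_pvKernel k r
  bounded := ⟨r⁻¹, norm_pvKernel_le hr⟩
  eq_zero _ := pvKernel_eq_zero_of_notMem hk r
  pairing g hg M hM hβM := by
    have hk0 : 0 < k := hk₀.trans_le hk.1
    have hkI : k ∈ Icc (k₀ / 2) (3 * k₁ / 2) := ⟨by linarith [hk.1], by linarith [hk.2]⟩
    have hM0 : 0 ≤ M := (norm_nonneg _).trans (hM k hkI)
    have hpi : Integrable (pvKernel k r) := integrable_of_bounded_of_support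
      (measurable_pvKernel k r).aestronglyMeasurable (norm_pvKernel_le hr)
      isCompact_Icc.measure_lt_top fun ρ ↦ pvKernel_eq_zero_of_notMem hk r
    have hpg : Integrable fun ρ ↦ pvKernel k r ρ * g ρ := by
      refine integrable_of_bounded_of_support (M := r⁻¹ * M)
        ((measurable_pvKernel k r).mul hg).aestronglyMeasurable (fun ρ ↦ ?_)
        isCompact_Icc.measure_lt_top fun ρ hρ ↦ by rw [pvKernel_eq_zero_of_notMem hk r hρ, zero_mul]
      by_cases hρ : ρ ∈ Icc (k₀ / 2) (3 * k₁ / 2)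
      · rw [norm_mul]
        exact mul_le_mul (norm_pvKernel_le hr ρ) (hM ρ hρ) (norm_nonneg _) (by positivity)
      · rw [pvKernel_eq_zero_of_notMem hk r hρ, zero_mul, norm_zero]; positivity
    -- The kernel has mean zero, so that the value of `g` at the singularity can be subtracted.
    have e : ∫ ρ, pvKernel k r ρ * g ρ = ∫ ρ, pvKernel k r ρ * (g ρ - g k) := by
      simp only [mul_sub]
      rw [integral_sub hpg (hpi.mul_const _), integral_mul_const, integral_pvKernel, zero_mul,
        sub_zero]
    have hb : ∀ ρ, |ρ - k| < k / 2 → ‖g ρ - g k‖ ≤ M * |ρ - k| ^ β := fun ρ hρ ↦ by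
      rw [abs_lt] at hρ
      exact hβM ρ ⟨by linarith [hρ.1, hk.1], by linarith [hρ.2, hk.2]⟩ k hkI
    have hint := integrableOn_abs_sub_rpow hβ k (k₁ / 2)
    rw [e]
    refine (norm_integral_le_of_norm_le (g := (Metric.ball k (k₁ / 2)).indicator
      (fun ρ ↦ M * |ρ - k| ^ (β - 1))) ((integrable_indicator_iff
        Metric.isOpen_ball.measurableSet).2 (hint.const_mul M))
          (Eventually.of_forall fun ρ ↦ ?_)).trans_eq ?_
    · refine (norm_pvKernel_mul_le hk0 hb ρ).trans ?_
      exact indicator_le_indicator_of_subset (Metric.ball_subset_ball (by linarith [hk.2]))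
        (fun ρ ↦ by positivity) ρ
    · rw [integral_indicator Metric.isOpen_ball.measurableSet, integral_const_mul, mul_comm]
      congr 1
      rw [← integral_indicator Metric.isOpen_ball.measurableSet,
        ← integral_indicator Metric.isOpen_ball.measurableSet,
        ← integral_add_right_eq_self _ k]
      congr 1; ext ρ
      simp [indicator, Metric.mem_ball]

/-- The averaging kernel over the interval of radius `δ` about `k`. -/
def averageKernel (k δ : ℝ) : ℝ → ℂ := (Ioo (k - δ) (k + δ)).indicator fun _ ↦ (((2 * δ)⁻¹ : ℝ) : ℂ)

theorem norm_averageKernel {k δ : ℝ} (hδ : 0 < δ) (ρ : ℝ) :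
    ‖averageKernel k δ ρ‖ = (Ioo (k - δ) (k + δ)).indicator (fun _ ↦ (2 * δ)⁻¹) ρ := by
  rw [averageKernel, norm_indicator_eq_indicator_norm]
  simp only [Complex.norm_real, Real.norm_of_nonneg (show 0 ≤ (2 * δ)⁻¹ by positivity)]

theorem measurable_averageKernel (k δ : ℝ) : Measurable (averageKernel k δ) :=
  measurable_const.indicator measurableSet_Ioo

theorem norm_averageKernel_le {k δ : ℝ} (hδ : 0 < δ) (ρ : ℝ) :
    ‖averageKernel k δ ρ‖ ≤ (2 * δ)⁻¹ := by
  rw [norm_averageKernel hδ]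
  exact indicator_le_self' (fun _ _ ↦ by positivity) ρ

theorem integrable_averageKernel {k δ : ℝ} : Integrable (averageKernel k δ) :=
  (integrable_indicator_iff measurableSet_Ioo).2 (integrableOn_const (by simp))

theorem integral_norm_averageKernel {k δ : ℝ} (hδ : 0 < δ) : ∫ ρ, ‖averageKernel k δ ρ‖ = 1 := by
  simp only [norm_averageKernel hδ]
  rw [integral_indicator measurableSet_Ioo, setIntegral_const, Real.volume_real_Ioo_of_le
    (by linarith), smul_eq_mul]
  field_simp; ring

theorem integral_averageKernel {k δ : ℝ} (hδ : 0 < δ) : ∫ ρ, averageKernel k δ ρ = 1 := by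
  unfold averageKernel
  rw [integral_indicator measurableSet_Ioo, setIntegral_const, Real.volume_real_Ioo_of_le
    (by linarith), Complex.real_smul, ← Complex.ofReal_mul, ← Complex.ofReal_one]
  congr 1
  field_simp; ring

theorem averageKernel_eq_zero {k₀ k₁ k δ : ℝ} (hk : k ∈ Icc k₀ k₁) (hδ : δ < k₀ / 2)
    {ρ : ℝ} (hρ : ρ ∉ Icc (k₀ / 2) (3 * k₁ / 2)) : averageKernel k δ ρ = 0 :=
  indicator_of_notMem (fun h ↦ hρ ⟨by linarith [h.1, hk.1], by linarith [h.2, hk.1, hk.2]⟩) _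

theorem isHolderDual_averageKernel {k₀ k₁ k δ t : ℝ} (β : ℝ) (hk : k ∈ Icc k₀ k₁)
    (hδ0 : 0 < δ) (hδ : δ < k₀ / 2) (ht : 0 ≤ t) :
    IsHolderDual (k₀ / 2) (3 * k₁ / 2) β ((1 + (3 * k₁ / 2) ^ 2) ^ t)
      (fun ρ ↦ (((1 + ρ ^ 2) ^ t : ℝ) : ℂ) * averageKernel k δ ρ) := by
  have hk01 : k₀ ≤ k₁ := hk.1.trans hk.2
  have hA : ∀ ρ, ‖(((1 + ρ ^ 2) ^ t : ℝ) : ℂ) * averageKernel k δ ρ‖ ≤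
      (1 + (3 * k₁ / 2) ^ 2) ^ t * ‖averageKernel k δ ρ‖ := fun ρ ↦ by
    by_cases hρ : ρ ∈ Icc (k₀ / 2) (3 * k₁ / 2)
    · rw [norm_mul, Complex.norm_real, Real.norm_of_nonneg (by positivity)]
      have h0 : 0 ≤ ρ := by linarith [hρ.1]
      have := hρ.2
      gcongr
    · rw [averageKernel_eq_zero hk hδ hρ]; simp
  have hm : Measurable fun ρ : ℝ ↦ (((1 + ρ ^ 2) ^ t : ℝ) : ℂ) * averageKernel k δ ρ :=
    Measurable.mul (by fun_prop) (measurable_averageKernel k δ)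
  refine isHolderDual_of_integral_norm_le (B := (1 + (3 * k₁ / 2) ^ 2) ^ t * (2 * δ)⁻¹) hm
    (fun ρ ↦ (hA ρ).trans ?_) (fun ρ hρ ↦ ?_) (by linarith) ?_
  · exact mul_le_mul_of_nonneg_left (norm_averageKernel_le hδ0 ρ) (by positivity)
  · rw [averageKernel_eq_zero hk hδ hρ, mul_zero]
  · refine (integral_mono_of_nonneg (Eventually.of_forall fun ρ ↦ norm_nonneg _)
      ((integrable_averageKernel (k := k) (δ := δ)).norm.const_mul _)
      (Eventually.of_forall hA)).trans_eq ?_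
    rw [integral_const_mul, integral_norm_averageKernel hδ0, mul_one]

theorem integral_norm_ft_mul_ft_le {s : ℝ} (hs : 0 ≤ s) (a b : 𝓢(Space d, ℂ)) :
    ∫ ξ, ‖ft a ξ * ft b ξ‖ ≤
      (2 * Real.pi) ^ d * (Real.sqrt (weightedSq s a) * Real.sqrt (weightedSq s b)) := by
  have hc : ∀ a : 𝓢(Space d, ℂ), ft a = ftS a := fun a ↦ funext fun ξ ↦ (ftS_apply a ξ).symm
  have hπ : (0 : ℝ) ≤ (2 * Real.pi) ^ d := by have := Real.pi_pos; positivity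
  simp only [norm_mul]
  have h := (sq_integral_mul_le (μ := volume) (f := fun ξ ↦ ‖ft a ξ‖) (g := fun ξ ↦ ‖ft b ξ‖)
    (by rw [hc]; exact (ftS a).continuous.norm.aestronglyMeasurable)
    (by rw [hc]; exact (ftS b).continuous.norm.aestronglyMeasurable) (fun _ ↦ norm_nonneg _)
    (fun _ ↦ norm_nonneg _) (by rw [hc]; exact integrable_norm_sq _)
    (by rw [hc]; exact integrable_norm_sq _)).2
  refine abs_le_of_sq_le_sq' (h.trans ?_) (by positivity) |>.2
  rw [mul_pow (_ ^ d), mul_pow (Real.sqrt _), Real.sq_sqrt (weightedSq_nonneg s a), Real.sq_sqrt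
    (weightedSq_nonneg s b)]
  calc _ ≤ ((2 * Real.pi) ^ d * weightedSq s a) * ((2 * Real.pi) ^ d * weightedSq s b) :=
        mul_le_mul (integral_norm_ft_sq_le hs a) (integral_norm_ft_sq_le hs b)
          (integral_nonneg fun _ ↦ by positivity) (mul_nonneg hπ (weightedSq_nonneg s a))
    _ = _ := by ring

/-- The factor of the homogeneous part in terms of the surface measure factor `sphereConst`, so that
the homogeneous part is bounded by the spherical mean. -/
theorem norm_greenConst_le (hd : d = 1 ∨ d = 2 ∨ d = 3) {α k : ℝ} (hα : 0 < α) (hk : 0 < k) :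
    ‖greenConst d α k‖ ≤ k ^ (1 - 2 * α) / α * sphereConst d k := by
  have hp := Real.rpow_pos_of_pos hk (1 - 2 * α)
  have hπ := Real.pi_gt_three
  have e : k ^ (2 - 2 * α) = k ^ (1 - 2 * α) * k := by
    rw [show (2 : ℝ) - 2 * α = 1 - 2 * α + 1 by ring, Real.rpow_add hk, Real.rpow_one]
  have hb : 0 ≤ k ^ (1 - 2 * α) / α := by positivity
  rcases hd with rfl | rfl | rfl <;> simp only [greenConst, sphereConst, norm_mul, Complex.norm_I,
    one_mul, Complex.norm_real, e]
  · rw [Real.norm_of_nonneg (by positivity), ← div_div, div_right_comm]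
    linarith
  · rw [Real.norm_of_nonneg (by positivity)]
    have : k ^ (1 - 2 * α) * k / (4 * α) = k ^ (1 - 2 * α) / α * (k / 4) := by field_simp
    rw [this]
    refine mul_le_mul_of_nonneg_left ?_ hb
    nlinarith
  · rw [Real.norm_of_nonneg (by positivity)]
    have : k ^ (1 - 2 * α) * k / (4 * Real.pi * α) =
        k ^ (1 - 2 * α) / α * (k / (4 * Real.pi)) := by field_simp
    rw [this]
    refine mul_le_mul_of_nonneg_left ?_ hb
    have : k / (4 * Real.pi) ≤ k := div_le_self hk.le (by linarith)
    nlinarith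

/-- The mean over the sphere `|ξ| = k` is a limit of means over spherical shells. -/
theorem norm_sphereMean_le_of_averageKernel (hd : d = 1 ∨ d = 2 ∨ d = 3) {k δ₀ N : ℝ}
    (hδ₀ : 0 < δ₀) (hk : δ₀ < k) (ψ : 𝓢(Space d, ℂ))
    (h : ∀ δ, 0 < δ → δ < δ₀ → ‖∫ ξ, ft ψ (-ξ) * averageKernel k δ ‖ξ‖‖ ≤ N) :
    ‖sphereMean ψ k‖ ≤ N := by
  have h1 := integrable_one_add_norm_mul ψ
  set K := 8 * Real.pi * (1 + 2 * k) * (∫ x, (1 + ‖x‖) * ‖ψ x‖) with hK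
  have hk0 : 0 < k := hδ₀.trans hk
  have hK0 : 0 ≤ K := mul_nonneg (by have := Real.pi_pos; positivity)
    (integral_nonneg fun x ↦ by positivity)
  -- By Lipschitz continuity the average over a shell of width `2δ` differs from the mean over the
  -- sphere by `O(δ)`.
  have key : ∀ δ, 0 < δ → δ < δ₀ → ‖sphereMean ψ k‖ ≤ N + K * δ := fun δ hδ hδ' ↦ by
    have hz : ∀ ρ, ρ ∉ Ioo (k - δ) (k + δ) → averageKernel k δ ρ = 0 :=
      fun ρ hρ ↦ indicator_of_notMem hρ _
    have hb := h δ hδ hδ'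
    rw [integral_ft_mul_radial hd ψ.integrable (measurable_averageKernel k δ)
      (norm_averageKernel_le hδ) (b := k + δ) (fun ρ hρ ↦ hz ρ fun h ↦ absurd h.2 hρ.not_gt),
      setIntegral_eq_integral_of_forall_compl_eq_zero (fun ρ hρ ↦ by
        rw [hz ρ fun h ↦ hρ ((by linarith : 0 < k - δ).trans h.1), zero_mul])] at hb
    have hlip : ∀ ρ ∈ Ioo (k - δ) (k + δ), ‖sphereMean ψ ρ - sphereMean ψ k‖ ≤ K * δ :=
      fun ρ hρ ↦ by
        have hρ' : |ρ - k| ≤ δ := abs_le.2 ⟨by linarith [hρ.1], by linarith [hρ.2]⟩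
        refine (norm_sphereMean_sub_le hd ψ.integrable h1 (R := 2 * k) ?_ ?_).trans
          (mul_le_mul_of_nonneg_left hρ' hK0)
        · exact abs_le.2 ⟨by linarith [hρ.1], by linarith [hρ.2]⟩
        · rw [abs_of_pos hk0]; linarith
    have hpt : ∀ ρ, ‖averageKernel k δ ρ * (sphereMean ψ ρ - sphereMean ψ k)‖ ≤
        ‖averageKernel k δ ρ‖ * (K * δ) := fun ρ ↦ by
      rw [norm_mul]
      by_cases hρ : ρ ∈ Ioo (k - δ) (k + δ)
      · exact mul_le_mul_of_nonneg_left (hlip ρ hρ) (norm_nonneg _)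
      · simp [hz ρ hρ]
    have hsm : AEStronglyMeasurable (sphereMean ψ) volume :=
      StronglyMeasurable.aestronglyMeasurable (StronglyMeasurable.integral_prod_right'
        ((measurable_sphereConst_mul_greenHom hd).mul
          (ψ.continuous.measurable.comp measurable_snd)).stronglyMeasurable)
    have hi : Integrable fun ρ ↦ averageKernel k δ ρ * (sphereMean ψ ρ - sphereMean ψ k) :=
      (integrable_averageKernel.norm.mul_const (K * δ)).mono'
        (integrable_averageKernel.aestronglyMeasurable.mul (hsm.sub aestronglyMeasurable_const))
        (Eventually.of_forall hpt)
    have e : ∫ ρ, averageKernel k δ ρ * sphereMean ψ ρ =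
        (∫ ρ, averageKernel k δ ρ * (sphereMean ψ ρ - sphereMean ψ k)) + sphereMean ψ k := by
      have : ∀ ρ, averageKernel k δ ρ * sphereMean ψ ρ = averageKernel k δ ρ *
          (sphereMean ψ ρ - sphereMean ψ k) + averageKernel k δ ρ * sphereMean ψ k :=
        fun ρ ↦ by ring
      simp only [this]
      rw [integral_add hi (integrable_averageKernel.mul_const _), integral_mul_const,
        integral_averageKernel hδ, one_mul]
    have hle : ‖∫ ρ, averageKernel k δ ρ * (sphereMean ψ ρ - sphereMean ψ k)‖ ≤ K * δ := by
      refine (norm_integral_le_of_norm_le (integrable_averageKernel.norm.mul_const (K * δ))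
        (Eventually.of_forall hpt)).trans_eq ?_
      rw [integral_mul_const, integral_norm_averageKernel hδ, one_mul]
    have e' := eq_sub_of_add_eq' e.symm
    rw [e']
    exact (norm_sub_le _ _).trans (add_le_add hb hle)
  have hlim : Tendsto (fun δ : ℝ ↦ N + K * δ) (𝓝[>] 0) (𝓝 (N + K * 0)) :=
    ((continuous_const.add (continuous_const.mul continuous_id)).tendsto 0).mono_left
      nhdsWithin_le_nhds
  rw [mul_zero, add_zero] at hlim
  refine ge_of_tendsto hlim ?_
  filter_upwards [Ioo_mem_nhdsGT hδ₀] with δ hδ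
  exact key δ hδ.1 hδ.2

/-- The limiting absorption principle: the Green's function defines a form which is bounded on
`H^{-t}_s` for `s > 1/2`, locally uniformly in the wavenumber. -/
theorem exists_norm_green_le (hd : d = 1 ∨ d = 2 ∨ d = 3) {α t s k₀ : ℝ} (k₁ : ℝ) (hα : 0 < α)
    (ht : 0 ≤ t) (htα : t ≤ α) (hs : 1 / 2 < s) (hk₀ : 0 < k₀) :
    ∃ C, 0 ≤ C ∧ ∀ k ∈ Icc k₀ k₁, ∀ a b ψ : 𝓢(Space d, ℂ),
      (∀ ξ, ft ψ (-ξ) = (((1 + ‖ξ‖ ^ 2) ^ t : ℝ) : ℂ) * (ft a ξ * ft b ξ)) →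
        ‖green α k ψ‖ ≤ C * (Real.sqrt (weightedSq s a) * Real.sqrt (weightedSq s b)) := by
  by_cases hk01 : k₀ ≤ k₁
  swap
  · exact ⟨0, le_rfl, fun k hk ↦ absurd (hk.1.trans hk.2) hk01⟩
  obtain ⟨n, rfl⟩ : ∃ n, d = n + 1 := ⟨d - 1, by omega⟩
  obtain ⟨β, hβ, C, hC0, hC⟩ := exists_norm_integral_radial_le (n := n) (κ := k₀ / 2)
    (K := 3 * k₁ / 2) hs (by positivity) (by linarith)
  obtain ⟨R, hR0, hR⟩ := exists_regularPart_bound α t k₀ k₁ hα ht htα hk₀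
  obtain ⟨Q, hQ⟩ := (isCompact_Icc (a := k₀) (b := k₁)).exists_bound_of_continuousOn
    (f := fun x : ℝ ↦ x ^ (1 - 2 * α) / α) (ContinuousOn.div_const (fun x hx ↦
      (Real.continuousAt_rpow_const x _
        (Or.inl (hk₀.trans_le hx.1).ne')).continuousWithinAt) _)
  have hQ0 : 0 ≤ Q := (norm_nonneg _).trans (hQ k₀ ⟨le_rfl, hk01⟩)
  set I := ∫ ρ in Metric.ball (0 : ℝ) (k₁ / 2), |ρ| ^ (β - 1) with hI
  have hI0 : 0 ≤ I := integral_nonneg fun ρ ↦ by positivity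
  set W := (1 + (3 * k₁ / 2) ^ 2) ^ t with hW
  have hπ := Real.pi_pos
  refine ⟨((2 * Real.pi) ^ (n + 1))⁻¹ * (R * (2 * Real.pi) ^ (n + 1) + R * (C * I)) + Q * (C * W),
    by positivity, fun k hk a b ψ hψ ↦ ?_⟩
  set N := Real.sqrt (weightedSq s a) * Real.sqrt (weightedSq s b) with hN
  have hk0 : 0 < k := hk₀.trans_le hk.1
  have hs0 : 0 ≤ s := by linarith
  have hint := integrable_ft_mul_ft a b
  -- The principal value.
  have hPV : ‖limUnder (𝓝[>] (0 : ℝ)) fun r ↦ greenTrunc α k r ψ‖ ≤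
      R * ((2 * Real.pi) ^ (n + 1) * N) + R * (C * I * N) := by
    refine le_of_tendsto (tendsto_greenTrunc hd hα hk0 ψ).norm ?_
    filter_upwards [self_mem_nhdsWithin] with r hr
    rw [greenTrunc_eq hr (hR k hk).2 hint hψ]
    refine (norm_add_le _ _).trans (add_le_add ?_ ?_)
    · exact (norm_setIntegral_regularPart_le (hR k hk).2 hint).trans
        (mul_le_mul_of_nonneg_left (integral_norm_ft_mul_ft_le hs0 a b) hR0)
    · rw [norm_mul, Complex.norm_real]
      exact mul_le_mul (hR k hk).1 (hC a b _ I hI0 (isHolderDual_pvKernel hk₀ hk hr hβ))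
        (norm_nonneg _) hR0
  -- The homogeneous part.
  have hS : ‖sphereMean ψ k‖ ≤ C * W * N := by
    refine norm_sphereMean_le_of_averageKernel hd (δ₀ := k₀ / 2) (by positivity)
      (by linarith [hk.1]) ψ fun δ hδ hδ' ↦ ?_
    have := hC a b _ W (by positivity) (isHolderDual_averageKernel β hk hδ hδ' ht)
    refine le_of_eq_of_le ?_ this
    congr 2; ext ξ
    rw [hψ]; ring
  have hH : ‖greenConst (n + 1) α k * ∫ x, (greenHom k x : ℂ) * ψ x‖ ≤ Q * (C * W * N) := by
    have e : sphereMean ψ k = sphereConst (n + 1) k * ∫ x, (greenHom k x : ℂ) * ψ x := by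
      rw [sphereMean, ← integral_const_mul]
      congr 1; ext x
      push_cast; ring
    have hsc : 0 ≤ sphereConst (n + 1) k := by
      rcases hd with h | h | h <;> rw [h] <;> simp only [sphereConst] <;> positivity
    rw [norm_mul]
    calc _ ≤ k ^ (1 - 2 * α) / α * sphereConst (n + 1) k *
          ‖∫ x : Space (n + 1), (greenHom k x : ℂ) * ψ x‖ := by
          gcongr; exact norm_greenConst_le hd hα hk0
      _ = k ^ (1 - 2 * α) / α * ‖sphereMean ψ k‖ := by
          rw [e, norm_mul, Complex.norm_real, Real.norm_of_nonneg hsc, mul_assoc]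
      _ ≤ Q * (C * W * N) := by
          gcongr
          exact (le_abs_self _).trans (hQ k hk)
  have hpow : ‖((((2 * Real.pi) ^ (n + 1) : ℝ) : ℂ))⁻¹‖ = ((2 * Real.pi) ^ (n + 1))⁻¹ := by
    rw [norm_inv, Complex.norm_real, Real.norm_of_nonneg (by positivity)]
  rw [green, greenPV_eq]
  refine (norm_add_le _ _).trans ?_
  rw [norm_mul, hpow]
  calc _ ≤ ((2 * Real.pi) ^ (n + 1))⁻¹ * (R * ((2 * Real.pi) ^ (n + 1) * N) + R * (C * I * N)) +
        Q * (C * W * N) := by gcongr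
    _ = _ := by ring

section

open FourierTransform

/-! ### Operations on Schwartz functions and their Fourier transforms -/

theorem ftS_injective : Function.Injective (ftS : 𝓢(Space d, ℂ) → 𝓢(Space d, ℂ)) := fun a b h ↦ by
  have h1 : ∀ ξ, 𝓕 a ξ = 𝓕 b ξ := fun ξ ↦ by
    have := DFunLike.congr_fun h ((2 * Real.pi) • ξ)
    rwa [ftS_eq_fourier, ftS_eq_fourier, smul_smul, inv_mul_cancel₀ (by positivity),
      one_smul] at this
  exact (FourierTransform.fourierCLE ℂ 𝓢(Space d, ℂ)).injective (SchwartzMap.ext h1)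

theorem ft_injective {a b : 𝓢(Space d, ℂ)} (h : ∀ ξ, ft a ξ = ft b ξ) : a = b :=
  ftS_injective (SchwartzMap.ext fun ξ ↦ by rw [ftS_apply, ftS_apply, h])

theorem ft_besselS (s : ℝ) (a : 𝓢(Space d, ℂ)) (ξ : Space d) :
    ft (besselS s a) ξ = weight s ξ * ft a ξ := by
  rw [← ftS_apply, ← ftS_apply, ftS_eq_fourier, ftS_eq_fourier, besselS,
    SchwartzMap.fourierMultiplierCLM_apply, FourierTransform.fourier_fourierInv_eq,
    SchwartzMap.smulLeftCLM_apply_apply (by fun_prop), besselSymbol_eq, smul_smul,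
    mul_inv_cancel₀ (by positivity), one_smul, smul_eq_mul]

theorem ft_translate (a : 𝓢(Space d, ℂ)) (y ξ : Space d) :
    ft (a.compSubConstCLM ℂ y) ξ = Complex.exp (-(Complex.I * (⟪y, ξ⟫_ℝ : ℂ))) * ft a ξ := by
  rw [ft, ft, ← integral_const_mul, ← integral_add_right_eq_self _ y]
  congr 1; ext x
  rw [SchwartzMap.compSubConstCLM_apply, add_sub_cancel_right, inner_add_left, ← mul_assoc,
    ← Complex.exp_add]
  congr 2
  push_cast; ring

theorem besselS_translate (s : ℝ) (a : 𝓢(Space d, ℂ)) (y : Space d) :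
    besselS s (a.compSubConstCLM ℂ y) = (besselS s a).compSubConstCLM ℂ y :=
  ft_injective fun ξ ↦ by rw [ft_besselS, ft_translate, ft_translate, ft_besselS]; ring

/-- The reflection `a(-x)` of a Schwartz function. -/
def negS : 𝓢(Space d, ℂ) →L[ℂ] 𝓢(Space d, ℂ) :=
  SchwartzMap.compCLMOfContinuousLinearEquiv ℂ (ContinuousLinearEquiv.neg ℝ)

@[simp]
theorem negS_apply (a : 𝓢(Space d, ℂ)) (x : Space d) : negS a x = a (-x) := rfl

theorem ft_negS (a : 𝓢(Space d, ℂ)) (ξ : Space d) : ft (negS a) ξ = ft a (-ξ) := by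
  rw [ft, ft, ← integral_neg_eq_self]
  congr 1; ext x
  simp

theorem ft_conv (a b : 𝓢(Space d, ℂ)) (ξ : Space d) : ft (conv a b) ξ = ft a ξ * ft b ξ := by
  rw [← ftS_apply, ← ftS_apply, ← ftS_apply, ftS_eq_fourier, ftS_eq_fourier, ftS_eq_fourier, conv,
    SchwartzMap.fourier_convolution]
  rfl

theorem conv_comm (a b : 𝓢(Space d, ℂ)) : conv a b = conv b a :=
  ft_injective fun ξ ↦ by rw [ft_conv, ft_conv, mul_comm]

theorem integral_fourierMultiplier_mul {m : Space d → ℂ} (hm : m.HasTemperateGrowth)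
    (a b : 𝓢(Space d, ℂ)) : ∫ x, SchwartzMap.fourierMultiplierCLM ℂ m a x * b x =
      ∫ x, a x * SchwartzMap.fourierMultiplierCLM ℂ (fun η ↦ m (-η)) b x := by
  have h := fourierMultiplierCLM_apply_eq hm (a : 𝓢'(Space d, ℂ)) b
  rw [TemperedDistribution.fourierMultiplierCLM_toTemperedDistributionCLM_eq hm] at h
  simpa [mul_comm] using h

theorem integral_besselS_mul (s : ℝ) (a b : 𝓢(Space d, ℂ)) :
    ∫ x, besselS s a x * b x = ∫ x, a x * besselS s b x := by
  have := integral_fourierMultiplier_mul (besselSymbol_hasTemperateGrowth s) a b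
  simp only [besselSymbol_neg_arg] at this
  exact this

/-! ### Duality in weighted `L²` spaces -/

theorem norm_toLp_two (a : 𝓢(Space d, ℂ)) :
    ‖a.toLp 2 volume‖ = Real.sqrt (∫ x, ‖a x‖ ^ 2) := by
  rw [SchwartzMap.norm_toLp' (by norm_num) (by norm_num), Real.sqrt_eq_rpow]
  norm_num

theorem norm_toLp_smulLeft_weight (s : ℝ) (a : 𝓢(Space d, ℂ)) :
    ‖(SchwartzMap.smulLeftCLM ℂ (weight s) a).toLp 2 volume‖ = Real.sqrt (weightedSq s a) := by
  rw [norm_toLp_two, weightedSq]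
  simp only [bracket_rpow_mul_norm_sq]

theorem norm_integral_mul_toLp_le (h : Lp ℂ 2 (volume : Measure (Space d))) (a : 𝓢(Space d, ℂ)) :
    ‖∫ x, h x * a x‖ ≤ ‖h‖ * ‖a.toLp 2 volume‖ := by
  have e : ∫ x, h x * a x = inner ℂ (star h) (a.toLp 2 volume) := by
    rw [L2.inner_def]
    refine integral_congr_ae ?_
    filter_upwards [Lp.coeFn_star h, a.coeFn_toLp 2 volume] with x h1 h2
    rw [h1, h2]
    simp [mul_comm]
  have hn : ‖star h‖ = ‖h‖ := by
    rw [Lp.norm_def, Lp.norm_def, eLpNorm_congr_ae (Lp.coeFn_star h), eLpNorm_star]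
  rw [e, ← hn]
  exact norm_inner_le_norm _ _

/-- The Riesz representation theorem for functionals on Schwartz functions bounded in `L²`. -/
theorem exists_Lp_of_bound (ℓ : 𝓢(Space d, ℂ) →ₗ[ℂ] ℂ) {C : ℝ} (hC : 0 ≤ C)
    (h : ∀ a : 𝓢(Space d, ℂ), ‖ℓ a‖ ≤ C * ‖a.toLp 2 volume‖) :
    ∃ Y : Lp ℂ 2 (volume : Measure (Space d)),
      ‖Y‖ ≤ C ∧ ∀ a : 𝓢(Space d, ℂ), ℓ a = ∫ x, Y x * a x := by
  let e : 𝓢(Space d, ℂ) →ₗ[ℂ] Lp ℂ 2 (volume : Measure (Space d)) :=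
    (SchwartzMap.toLpCLM ℂ ℂ 2 volume : 𝓢(Space d, ℂ) →L[ℂ] _)
  have he : DenseRange e := SchwartzMap.denseRange_toLpCLM (by norm_num)
  have hb : ∀ a, ‖ℓ a‖ ≤ C * ‖e a‖ := h
  let L := ℓ.extendOfNorm e
  have hL : ‖L‖ ≤ C := L.opNorm_le_bound hC (LinearMap.norm_extendOfNorm_apply_le he C hb)
  let y := (InnerProductSpace.toDual ℂ (Lp ℂ 2 (volume : Measure (Space d)))).symm L
  refine ⟨star y, ?_, fun a ↦ ?_⟩
  · rw [Lp.norm_def, eLpNorm_congr_ae (Lp.coeFn_star y), eLpNorm_star, ← Lp.norm_def,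
      LinearIsometryEquiv.norm_map]
    exact hL
  · rw [← LinearMap.extendOfNorm_eq he ⟨C, hb⟩ a]
    change L (e a) = _
    rw [← InnerProductSpace.toDual_symm_apply (y := L), L2.inner_def]
    refine integral_congr_ae ?_
    filter_upwards [Lp.coeFn_star y, a.coeFn_toLp 2 volume] with x h1 h2
    rw [h1, show (e a) x = a x from h2]
    simp [y, mul_comm]

theorem norm_sobolevMap_apply_le (s δ : ℝ) (h : Lp ℂ 2 (volume : Measure (Space d)))
    (ψ : 𝓢(Space d, ℂ)) :
    ‖sobolevMap s δ h ψ‖ ≤ ‖h‖ * Real.sqrt (weightedSq (-δ) (besselS (-s) ψ)) := by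
  rw [sobolevMap_apply, ← norm_toLp_smulLeft_weight]
  convert norm_integral_mul_toLp_le h (SchwartzMap.smulLeftCLM ℂ (weight (-δ)) (besselS (-s) ψ))
    using 4 with x
  rw [SchwartzMap.smulLeftCLM_apply_apply (by fun_prop), smul_eq_mul]

theorem smulLeft_weight_smulLeft_weight (δ δ' : ℝ) (a : 𝓢(Space d, ℂ)) :
    SchwartzMap.smulLeftCLM ℂ (weight δ) (SchwartzMap.smulLeftCLM ℂ (weight δ') a) =
      SchwartzMap.smulLeftCLM ℂ (weight (δ + δ')) a := by
  ext x
  rw [SchwartzMap.smulLeftCLM_apply_apply (by fun_prop),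
    SchwartzMap.smulLeftCLM_apply_apply (by fun_prop),
    SchwartzMap.smulLeftCLM_apply_apply (by fun_prop), smul_smul, smul_eq_mul, smul_eq_mul,
    weight_mul_weight]

theorem smulLeft_weight_zero (a : 𝓢(Space d, ℂ)) :
    SchwartzMap.smulLeftCLM ℂ (weight 0) a = a := by
  ext x
  rw [SchwartzMap.smulLeftCLM_apply_apply (by fun_prop), weight_zero, one_smul]

/-- The dual description of `H^s_δ`. -/
theorem exists_sobolevMap_of_bound (ℓ : 𝓢(Space d, ℂ) →ₗ[ℂ] ℂ) {s δ C : ℝ} (hC : 0 ≤ C)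
    (h : ∀ ψ, ‖ℓ ψ‖ ≤ C * Real.sqrt (weightedSq (-δ) (besselS (-s) ψ))) :
    ∃ Y : Lp ℂ 2 (volume : Measure (Space d)), ‖Y‖ ≤ C ∧ ∀ ψ, ℓ ψ = sobolevMap s δ Y ψ := by
  obtain ⟨Y, hY, hYe⟩ := exists_Lp_of_bound
    (ℓ ∘ₗ (besselS s ∘L SchwartzMap.smulLeftCLM ℂ (weight δ) :
      𝓢(Space d, ℂ) →L[ℂ] 𝓢(Space d, ℂ)).toLinearMap) hC fun a ↦ by
      refine (h _).trans_eq ?_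
      rw [← norm_toLp_smulLeft_weight]
      change _ * ‖(SchwartzMap.smulLeftCLM ℂ (weight (-δ)) (besselS (-s) (besselS s
        (SchwartzMap.smulLeftCLM ℂ (weight δ) a)))).toLp 2 volume‖ = _
      rw [besselS_besselS, neg_add_cancel, besselS_zero, smulLeft_weight_smulLeft_weight,
        neg_add_cancel, smulLeft_weight_zero]
  refine ⟨Y, hY, fun ψ ↦ ?_⟩
  have := hYe (SchwartzMap.smulLeftCLM ℂ (weight (-δ)) (besselS (-s) ψ))
  change ℓ (besselS s (SchwartzMap.smulLeftCLM ℂ (weight δ) (SchwartzMap.smulLeftCLM ℂ (weight (-δ))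
    (besselS (-s) ψ)))) = _ at this
  rw [smulLeft_weight_smulLeft_weight, add_neg_cancel, smulLeft_weight_zero, besselS_besselS,
    add_neg_cancel, besselS_zero] at this
  rw [this, sobolevMap_apply]
  congr 1; ext x
  rw [SchwartzMap.smulLeftCLM_apply_apply (by fun_prop), smul_eq_mul]

theorem weightedSq_negS (s : ℝ) (a : 𝓢(Space d, ℂ)) : weightedSq s (negS a) = weightedSq s a := by
  rw [weightedSq, weightedSq, ← integral_neg_eq_self]
  simp [bracket]

theorem bracket_add_rpow_le {s : ℝ} (hs : 0 ≤ s) {y : Space d} (hy : ‖y‖ ≤ 1) (x : Space d) :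
    bracket (x + y) ^ (2 * -s) ≤ 3 ^ s * bracket x ^ (2 * -s) := by
  rw [bracket_rpow, bracket_rpow, show 2 * -s / 2 = -s by ring]
  have h1 : 1 + ‖x‖ ^ 2 ≤ 3 * (1 + ‖x + y‖ ^ 2) := by
    have h2 : ‖x‖ ≤ ‖x + y‖ + 1 := by
      have := norm_sub_le (x + y) y
      rw [add_sub_cancel_right] at this
      linarith
    nlinarith [norm_nonneg x, norm_nonneg (x + y), sq_nonneg (‖x + y‖ - 1)]
  have h3 := Real.rpow_le_rpow (by positivity) h1 hs
  rw [Real.mul_rpow (by norm_num) (by positivity)] at h3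
  rw [Real.rpow_neg (by positivity), Real.rpow_neg (by positivity), ← div_eq_mul_inv,
    inv_le_comm₀ (by positivity) (by positivity), inv_div, div_le_iff₀ (by positivity)]
  linarith

theorem weightedSq_translate_le {s : ℝ} (hs : 0 ≤ s) {y : Space d} (hy : ‖y‖ ≤ 1)
    (a : 𝓢(Space d, ℂ)) :
    weightedSq (-s) (a.compSubConstCLM ℂ y) ≤ 3 ^ s * weightedSq (-s) a := by
  rw [weightedSq, weightedSq, ← integral_add_right_eq_self _ y, ← integral_const_mul]
  refine integral_mono_of_nonneg (Eventually.of_forall fun x ↦ ?_)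
    ((integrable_weightedSq (-s) a).const_mul _) (Eventually.of_forall fun x ↦ ?_)
  · have := bracket_pos (x + y)
    simp only [Pi.zero_apply]
    positivity
  · simp only [SchwartzMap.compSubConstCLM_apply, add_sub_cancel_right]
    rw [← mul_assoc]
    exact mul_le_mul_of_nonneg_right (bracket_add_rpow_le hs hy x) (by positivity)

/-! ### Mollifiers -/

/-- A symmetric probability density which is smooth and supported in the ball of radius `δ`. -/
structure IsMollifier (δ : ℝ) (ρ : 𝓢(Space d, ℂ)) : Prop where
  eq_norm : ∀ x, ρ x = ‖ρ x‖
  integral_norm : ∫ x, ‖ρ x‖ = 1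
  eq_zero : ∀ x, δ < ‖x‖ → ρ x = 0
  even : ∀ x, ρ (-x) = ρ x

theorem exists_isMollifier {δ : ℝ} (hδ : 0 < δ) : ∃ ρ : 𝓢(Space d, ℂ), IsMollifier δ ρ := by
  let B : ContDiffBump (0 : Space d) := ⟨δ / 2, δ, by positivity, by linarith⟩
  have hc : HasCompactSupport (Complex.ofRealCLM ∘ B.normed volume) :=
    B.hasCompactSupport_normed.comp_left rfl
  have hs : ContDiff ℝ ((⊤ : ℕ∞) : WithTop ℕ∞) (Complex.ofRealCLM ∘ B.normed volume) :=
    Complex.ofRealCLM.contDiff.comp B.contDiff_normed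
  have hn : ∀ x, ‖hc.toSchwartzMap hs x‖ = B.normed volume x := fun x ↦ by
    simp [abs_of_nonneg (B.nonneg_normed x)]
  refine ⟨hc.toSchwartzMap hs, fun x ↦ ?_, ?_, fun x hx ↦ ?_, fun x ↦ ?_⟩
  · rw [hn]; simp
  · simp only [hn, B.integral_normed]
  · rw [← norm_eq_zero, hn, ← Function.notMem_support, B.support_normed_eq]
    simpa [B] using hx.le
  · simp [B.normed_neg]

namespace IsMollifier

variable {δ : ℝ} {ρ : 𝓢(Space d, ℂ)}

theorem hasCompactSupport (h : IsMollifier δ ρ) : HasCompactSupport ρ :=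
  HasCompactSupport.intro (isCompact_closedBall 0 δ) fun x hx ↦
    h.eq_zero x (by simpa using hx)

theorem integral_eq_one (h : IsMollifier δ ρ) : ∫ x, ρ x = 1 := by
  calc ∫ x, ρ x = ∫ x, ((‖ρ x‖ : ℝ) : ℂ) := by congr 1; ext x; exact h.eq_norm x
    _ = 1 := by rw [integral_complex_ofReal, h.integral_norm, Complex.ofReal_one]

theorem norm_integral_mul_le (h : IsMollifier δ ρ) {F : Space d → ℂ} {B : ℝ}
    (hF : ∀ x, ‖x‖ ≤ δ → ‖F x‖ ≤ B) : ‖∫ x, ρ x * F x‖ ≤ B := by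
  refine (norm_integral_le_of_norm_le (ρ.integrable.norm.mul_const B)
    (Eventually.of_forall fun x ↦ ?_)).trans_eq ?_
  · rw [norm_mul]
    by_cases hx : ‖x‖ ≤ δ
    · exact mul_le_mul_of_nonneg_left (hF x hx) (norm_nonneg _)
    · simp [h.eq_zero x (not_le.1 hx)]
  · rw [integral_mul_const, h.integral_norm, one_mul]

theorem norm_integral_mul_sub_le (h : IsMollifier δ ρ) {F : Space d → ℂ} (hFi : LocallyIntegrable F)
    {B : ℝ} {c : ℂ} (hF : ∀ x, ‖x‖ ≤ δ → ‖F x - c‖ ≤ B) : ‖(∫ x, ρ x * F x) - c‖ ≤ B := by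
  have hi : Integrable fun x ↦ ρ x * F x := by
    simpa [mul_comm] using integrable_mul_schwartz hFi h.hasCompactSupport
  have e : (∫ x, ρ x * F x) - c = ∫ x, ρ x * (F x - c) := by
    simp only [mul_sub]
    rw [integral_sub hi (ρ.integrable.mul_const c), integral_mul_const, h.integral_eq_one, one_mul]
  rw [e]
  exact h.norm_integral_mul_le hF

end IsMollifier

theorem continuous_apply_translate (T : 𝓢'(Space d, ℂ)) (a : 𝓢(Space d, ℂ)) :
    Continuous fun ξ ↦ T (a.compSubConstCLM ℂ ξ) :=
  (continuous_temperedDistribution T).comp (continuous_translate a)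

theorem exists_forall_norm_apply_conv_sub_le (T : 𝓢'(Space d, ℂ)) (a : 𝓢(Space d, ℂ)) {ε : ℝ}
    (hε : 0 < ε) : ∃ δ, 0 < δ ∧ ∀ ρ, IsMollifier δ ρ → ‖T (conv a ρ) - T a‖ ≤ ε := by
  obtain ⟨δ, hδ, h⟩ := Metric.continuous_iff.1 (continuous_apply_translate T a) 0 ε hε
  refine ⟨δ / 2, by positivity, fun ρ hρ ↦ ?_⟩
  rw [conv_comm, apply_conv T ρ a hρ.hasCompactSupport]
  refine hρ.norm_integral_mul_sub_le (continuous_apply_translate T a).locallyIntegrable fun x hx ↦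
    ?_
  have := (h x (by rw [dist_zero_right]; linarith)).le
  simpa [dist_eq_norm] using this

end

/-! ### The resolvent on weighted Sobolev spaces -/

/-- The mollification of a distribution of compact support is a test function. -/
theorem exists_schwartz_mollify {f : 𝓢'(Space d, ℂ)} (hK : IsCompact (Distribution.dsupport f))
    {δ : ℝ} {ρ : 𝓢(Space d, ℂ)} (hρ : IsMollifier δ ρ) : ∃ a : 𝓢(Space d, ℂ),
      (∀ x, a x = f (ρ.compSubConstCLM ℂ x)) ∧ HasCompactSupport a ∧
        ∀ x, x ∉ Metric.cthickening δ (Distribution.dsupport f) → a x = 0 := by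
  have hs : ContDiff ℝ ((⊤ : ℕ∞) : WithTop ℕ∞) fun x ↦ f (ρ.compSubConstCLM ℂ x) := by
    simpa [Function.comp_def] using (contDiff_apply_translate f ρ).comp contDiff_neg
  have h0 : ∀ x, x ∉ Metric.cthickening δ (Distribution.dsupport f) →
      f (ρ.compSubConstCLM ℂ x) = 0 := fun x hx ↦ by
    refine apply_eq_zero_of_tsupport_disjoint f _ fun y hy hyK ↦ hx ?_
    have hsub : tsupport (ρ.compSubConstCLM ℂ x) ⊆ Metric.closedBall x δ := by
      refine closure_minimal (fun z hz ↦ ?_) Metric.isClosed_closedBall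
      by_contra hzx
      refine hz (hρ.eq_zero (z - x) ?_)
      rwa [Metric.mem_closedBall, dist_eq_norm, not_le] at hzx
    refine Metric.mem_cthickening_of_dist_le x y δ _ hyK ?_
    rw [dist_comm]
    exact hsub hy
  have hc : HasCompactSupport fun x ↦ f (ρ.compSubConstCLM ℂ x) :=
    HasCompactSupport.intro hK.cthickening h0
  exact ⟨hc.toSchwartzMap hs, fun x ↦ rfl, hc, h0⟩

/-- The bilinear bound of the limiting absorption principle, with constant `C`. -/
def GreenBound (d : ℕ) (α k t s C : ℝ) : Prop := ∀ a b ψ : 𝓢(Space d, ℂ),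
  (∀ ξ, ft ψ (-ξ) = (((1 + ‖ξ‖ ^ 2) ^ t : ℝ) : ℂ) * (ft a ξ * ft b ξ)) →
    ‖green α k ψ‖ ≤ C * (Real.sqrt (weightedSq s a) * Real.sqrt (weightedSq s b))

/-- Mollification is bounded on `H^{-t}_s`. -/
theorem sqrt_weightedSq_mollify_le {t s : ℝ} (hs : 0 ≤ s)
    {h : Lp ℂ 2 (volume : Measure (Space d))}
    (hK : IsCompact (Distribution.dsupport (sobolevMap (-t) s h))) {δ : ℝ} (hδ : δ ≤ 1)
    {ρ a : 𝓢(Space d, ℂ)} (hρ : IsMollifier δ ρ)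
    (ha : ∀ x, a x = sobolevMap (-t) s h (ρ.compSubConstCLM ℂ x))
    (ha0 : ∀ x, x ∉ Metric.cthickening δ (Distribution.dsupport (sobolevMap (-t) s h)) → a x = 0) :
    Real.sqrt (weightedSq s (besselS (-t) a)) ≤ Real.sqrt (3 ^ s) * ‖h‖ := by
  set f := sobolevMap (-t) s h with hf
  set A := besselS (-t) a with hA
  -- Test with the extremal function of the dual norm.
  set φ := SchwartzMap.smulLeftCLM ℂ (weight (2 * s)) (conjTest A) with hφ
  have hφx : ∀ x, φ x = weight (2 * s) x * (starRingEnd ℂ) (A x) := fun x ↦ by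
    rw [hφ, SchwartzMap.smulLeftCLM_apply_apply (by fun_prop)]; rfl
  have hW0 := weightedSq_nonneg s A
  have h1 : ∫ x, A x * φ x = ((weightedSq s A : ℝ) : ℂ) := by
    rw [weightedSq, ← integral_complex_ofReal]
    congr 1; ext x
    rw [hφx, mul_left_comm, Complex.mul_conj, Complex.normSq_eq_norm_sq, weight]
    push_cast; rfl
  have h2 : weightedSq (-s) φ = weightedSq s A := by
    rw [weightedSq, weightedSq]
    congr 1; ext x
    rw [hφx, norm_mul, norm_weight, RCLike.norm_conj, mul_pow, ← mul_assoc]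
    congr 1
    rw [← Real.rpow_natCast (bracket x ^ (2 * s)) 2, ← Real.rpow_mul (bracket_pos x).le,
      ← Real.rpow_add (bracket_pos x)]
    congr 1
    push_cast; ring
  set g := besselS (-t) φ with hg
  have h3 : ∫ x, A x * φ x = ∫ x, a x * g x := integral_besselS_mul _ _ _
  obtain ⟨χ, hχc, -, ⟨V, hV, hKV, hV1⟩, -⟩ := exists_smooth_cutoff
    (hK.cthickening (r := δ)) isOpen_univ (subset_univ _)
  set g' := SchwartzMap.smulLeftCLM ℂ χ g with hg'
  have hg'x : ∀ x, g' x = χ x * g x := schwartz_smulLeft_apply χ g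
  have hg'c : HasCompactSupport g' := hχc.mono' (by
    intro x hx
    refine subset_tsupport _ fun h0 : χ x = 0 ↦ hx ?_
    rw [hg'x, h0, zero_mul])
  have h4 : ∫ x, a x * g x = ∫ x, g' x * f (ρ.compSubConstCLM ℂ x) := by
    congr 1; ext x
    rw [hg'x, ← ha]
    by_cases hx : x ∈ Metric.cthickening δ (Distribution.dsupport f)
    · rw [hV1 x (hKV hx)]; ring
    · rw [ha0 x hx]; ring
  rw [← apply_conv f g' ρ hg'c, conv_comm, apply_conv f ρ g' hρ.hasCompactSupport] at h4
  have h5 : ∀ y : Space d, ‖y‖ ≤ δ → ‖f (g'.compSubConstCLM ℂ y)‖ ≤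
      ‖h‖ * (Real.sqrt (3 ^ s) * Real.sqrt (weightedSq s A)) := fun y hy ↦ by
    have e : f (g'.compSubConstCLM ℂ y) = f (g.compSubConstCLM ℂ y) := by
      refine apply_congr_of_eqOn (V := (fun x ↦ x - y) ⁻¹' V) (hV.preimage (by fun_prop))
        (fun x hx ↦ hKV ?_) fun x hx ↦ ?_
      · refine Metric.mem_cthickening_of_dist_le _ x δ _ hx ?_
        simpa [dist_eq_norm] using hy
      · rw [SchwartzMap.compSubConstCLM_apply, SchwartzMap.compSubConstCLM_apply, hg'x, hV1 _ hx,
          one_mul]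
    rw [e]
    refine (norm_sobolevMap_apply_le _ _ _ _).trans ?_
    rw [besselS_translate, hg, besselS_besselS, ← Real.sqrt_mul (by positivity), ← h2]
    rw [neg_neg, add_neg_cancel, besselS_zero]
    gcongr
    exact weightedSq_translate_le hs (hy.trans hδ) φ
  have h6 := hρ.norm_integral_mul_le h5
  rw [← h4, ← h3, h1, Complex.norm_real, Real.norm_of_nonneg hW0] at h6
  rcases hW0.eq_or_lt with h0 | h0
  · rw [← h0, Real.sqrt_zero]; positivity
  · have h7 : 0 < Real.sqrt (weightedSq s A) := Real.sqrt_pos.2 h0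
    refine le_of_mul_le_mul_right ?_ h7
    rw [Real.mul_self_sqrt hW0]
    linarith

/-- The bound for the pairing of a distribution of compact support in `H^{-t}_s` with the smooth
function `z ↦ ⟨G, ψ(z + ·)⟩`. Mollifying the distribution reduces it to the bound for test
functions. -/
theorem norm_apply_green_le {α k t s C : ℝ} (hs : 0 ≤ s) (hC0 : 0 ≤ C)
    (hC : GreenBound d α k t s C) {G : 𝓢'(Space d, ℂ)} (hG : ∀ ψ, G ψ = green α k ψ)
    {h : Lp ℂ 2 (volume : Measure (Space d))}
    (hK : IsCompact (Distribution.dsupport (sobolevMap (-t) s h))) {V : Set (Space d)}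
    (hV : IsOpen V) (hKV : Distribution.dsupport (sobolevMap (-t) s h) ⊆ V) {ψ η : 𝓢(Space d, ℂ)}
    (hηc : HasCompactSupport η) (hη : ∀ z ∈ V, η z = green α k (ψ.compSubConstCLM ℂ (-z))) :
    ‖sobolevMap (-t) s h η‖ ≤
      C * Real.sqrt (3 ^ s) * ‖h‖ * Real.sqrt (weightedSq s (besselS (-t) ψ)) := by
  refine le_of_forall_pos_le_add fun ε hε ↦ ?_
  -- Mollify `f = sobolevMap (-t) s h` at a scale `δ` at which the mollification still lives in `V`,
  -- then use `⟨f * ρ, η⟩ = ⟨G, negS (f * ρ) * ψ⟩` and the bound for test functions.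
  obtain ⟨δ₁, hδ₁, h1⟩ := exists_forall_norm_apply_conv_sub_le (sobolevMap (-t) s h) η hε
  obtain ⟨δ₂, hδ₂, h2⟩ := hK.exists_cthickening_subset_open hV hKV
  set δ := min δ₁ (min δ₂ 1) with hδ
  have hδ0 : 0 < δ := lt_min hδ₁ (lt_min hδ₂ one_pos)
  obtain ⟨ρ, hρ⟩ := exists_isMollifier (d := d) hδ0
  have hρ₁ : IsMollifier δ₁ ρ :=
    ⟨hρ.1, hρ.2, fun x hx ↦ hρ.3 x ((min_le_left _ _).trans_lt hx), hρ.4⟩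
  have hδ2 : δ ≤ δ₂ := (min_le_right _ _).trans (min_le_left _ _)
  have hδ3 : δ ≤ 1 := (min_le_right _ _).trans (min_le_right _ _)
  obtain ⟨a, ha, hac, ha0⟩ := exists_schwartz_mollify hK hρ
  have hclose := h1 ρ hρ₁
  have hnc : HasCompactSupport (negS a) := by
    have := hac.comp_homeomorph (Homeomorph.neg (Space d))
    exact this
  have e : sobolevMap (-t) s h (conv η ρ) = green α k (conv (negS a) ψ) := by
    rw [apply_conv _ η ρ hηc, ← hG, apply_conv G (negS a) ψ hnc, ← integral_neg_eq_self]
    congr 1; ext x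
    rw [← ha, negS_apply, hG, mul_comm]
    by_cases hx : -x ∈ Metric.cthickening δ (Distribution.dsupport (sobolevMap (-t) s h))
    · rw [hη _ (h2 (Metric.cthickening_mono hδ2 _ hx)), neg_neg]
    · rw [ha0 _ hx, zero_mul, zero_mul]
  have hb : ‖green α k (conv (negS a) ψ)‖ ≤ C * (Real.sqrt (weightedSq s (besselS (-t) a)) *
      Real.sqrt (weightedSq s (negS (besselS (-t) ψ)))) := by
    refine hC _ _ _ fun ξ ↦ ?_
    rw [ft_conv, ft_negS, neg_neg, ft_besselS, ft_negS, ft_besselS]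
    have hw : (((1 + ‖ξ‖ ^ 2) ^ t : ℝ) : ℂ) = weight (2 * t) ξ := by
      rw [weight, bracket_rpow, mul_div_cancel_left₀ t two_ne_zero]
    have hn : weight (-t) (-ξ) = weight (-t) ξ := by simp [weight, bracket]
    have h3 : weight (2 * t) ξ * (weight (-t) ξ * weight (-t) ξ) = 1 := by
      rw [weight_mul_weight, weight_mul_weight]
      convert weight_zero ξ using 2
      ring
    rw [hw, hn]
    linear_combination (-(ft a ξ * ft ψ (-ξ))) * h3
  rw [weightedSq_negS] at hb
  have hm := sqrt_weightedSq_mollify_le hs hK hδ3 hρ ha ha0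
  calc ‖sobolevMap (-t) s h η‖
      = ‖sobolevMap (-t) s h (conv η ρ) - (sobolevMap (-t) s h (conv η ρ) -
          sobolevMap (-t) s h η)‖ := by rw [sub_sub_cancel]
    _ ≤ C * (Real.sqrt (weightedSq s (besselS (-t) a)) *
          Real.sqrt (weightedSq s (besselS (-t) ψ))) + ε :=
        (norm_sub_le _ _).trans (add_le_add (e ▸ hb) hclose)
    _ ≤ C * (Real.sqrt (3 ^ s) * ‖h‖ * Real.sqrt (weightedSq s (besselS (-t) ψ))) + ε := by gcongr
    _ = _ := by ring

/-- The Green convolution of any distribution of compact support exists as a linear functional. -/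
theorem exists_linearMap_green {α k : ℝ} {G : 𝓢'(Space d, ℂ)} (hG : ∀ ψ, G ψ = green α k ψ)
    {f : 𝓢'(Space d, ℂ)} (hK : IsCompact (Distribution.dsupport f)) :
    ∃ ℓ : 𝓢(Space d, ℂ) →ₗ[ℂ] ℂ, ∀ ψ, ∃ η : 𝓢(Space d, ℂ), HasCompactSupport η ∧
      (∃ V : Set (Space d), IsOpen V ∧ Distribution.dsupport f ⊆ V ∧
        ∀ z ∈ V, η z = green α k (ψ.compSubConstCLM ℂ (-z))) ∧ ℓ ψ = f η := by
  have hex : ∀ ψ : 𝓢(Space d, ℂ), ∃ η : 𝓢(Space d, ℂ), HasCompactSupport η ∧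
      ∃ V : Set (Space d), IsOpen V ∧ Distribution.dsupport f ⊆ V ∧
        ∀ z ∈ V, η z = G (ψ.compSubConstCLM ℂ (-z)) := fun ψ ↦
    exists_schwartz_eqOn hK (contDiff_apply_translate G ψ)
  choose η hηc V hV hKV hη using hex
  refine ⟨{ toFun := fun ψ ↦ f (η ψ), map_add' := fun ψ φ ↦ ?_, map_smul' := fun c ψ ↦ ?_ },
    fun ψ ↦ ⟨η ψ, hηc ψ, ⟨V ψ, hV ψ, hKV ψ, fun z hz ↦ by rw [hη ψ z hz, hG]⟩, rfl⟩⟩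
  · rw [← map_add]
    refine apply_congr_of_eqOn (((hV (ψ + φ)).inter (hV ψ)).inter (hV φ))
      (subset_inter (subset_inter (hKV _) (hKV _)) (hKV _)) fun z hz ↦ ?_
    rw [add_apply, hη _ z hz.1.1, hη _ z hz.1.2, hη _ z hz.2, map_add, map_add]
  · rw [RingHom.id_apply, smul_eq_mul, ← smul_eq_mul, ← map_smul]
    refine apply_congr_of_eqOn ((hV (c • ψ)).inter (hV ψ)) (subset_inter (hKV _) (hKV _))
      fun z hz ↦ ?_
    rw [smul_apply, hη _ z hz.1, hη _ z hz.2, map_smul, map_smul]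

/-- The resolvent maps distributions of compact support in `H^{-t}_s` boundedly into `H^t_{-s}`. -/
theorem exists_isGreenConvolution {α k t s C : ℝ} (hs : 0 ≤ s) (hC0 : 0 ≤ C)
    (hC : GreenBound d α k t s C) {G : 𝓢'(Space d, ℂ)} (hG : ∀ ψ, G ψ = green α k ψ)
    {h : Lp ℂ 2 (volume : Measure (Space d))}
    (hK : IsCompact (Distribution.dsupport (sobolevMap (-t) s h))) :
    ∃ Y : Lp ℂ 2 (volume : Measure (Space d)), ‖Y‖ ≤ C * Real.sqrt (3 ^ s) * ‖h‖ ∧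
      IsGreenConvolution α k (sobolevMap (-t) s h) (sobolevMap t (-s) Y) := by
  obtain ⟨ℓ, hℓ⟩ := exists_linearMap_green hG hK
  obtain ⟨Y, hY, hYe⟩ := exists_sobolevMap_of_bound ℓ (s := t) (δ := -s)
    (C := C * Real.sqrt (3 ^ s) * ‖h‖) (by positivity) fun ψ ↦ by
      obtain ⟨η, hηc, ⟨V, hV, hKV, hη⟩, e⟩ := hℓ ψ
      rw [e, neg_neg]
      exact norm_apply_green_le hs hC0 hC hG hK hV hKV hηc hη
  refine ⟨Y, hY, fun ψ ↦ ?_⟩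
  obtain ⟨η, -, hη, e⟩ := hℓ ψ
  exact ⟨η, hη, by rw [← hYe, e]⟩

section

open FourierTransform LineDeriv

/-! ### Commutators of Fourier multipliers with coordinates -/

/-- The `L²` norm of a Schwartz function. -/
def l2Norm (a : 𝓢(Space d, ℂ)) : ℝ := ‖a.toLp 2 volume‖

theorem l2Norm_eq_sqrt (a : 𝓢(Space d, ℂ)) : l2Norm a = Real.sqrt (∫ x, ‖a x‖ ^ 2) :=
  norm_toLp_two a

theorem l2Norm_add_le (a b : 𝓢(Space d, ℂ)) : l2Norm (a + b) ≤ l2Norm a + l2Norm b := by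
  have := norm_add_le (SchwartzMap.toLpCLM ℂ ℂ 2 volume a) (SchwartzMap.toLpCLM ℂ ℂ 2 volume b)
  rwa [← map_add] at this

theorem l2Norm_smul (c : ℂ) (a : 𝓢(Space d, ℂ)) : l2Norm (c • a) = ‖c‖ * l2Norm a := by
  have := norm_smul c (SchwartzMap.toLpCLM ℂ ℂ 2 volume a)
  rwa [← map_smul] at this

theorem l2Norm_le_of_norm_le {C : ℝ} {a b : 𝓢(Space d, ℂ)} (hC : 0 ≤ C)
    (h : ∀ x, ‖a x‖ ≤ C * ‖b x‖) : l2Norm a ≤ C * l2Norm b := by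
  rw [l2Norm_eq_sqrt, l2Norm_eq_sqrt]
  refine Real.sqrt_le_iff.2 ⟨by positivity, ?_⟩
  rw [mul_pow, Real.sq_sqrt (integral_nonneg fun x ↦ by positivity), ← integral_const_mul]
  refine integral_mono (integrable_norm_sq a) ((integrable_norm_sq b).const_mul _) fun x ↦ ?_
  simp only [← mul_pow]
  gcongr
  exact h x

theorem l2Norm_ftS (a : 𝓢(Space d, ℂ)) :
    l2Norm (ftS a) = Real.sqrt ((2 * Real.pi) ^ d) * l2Norm a := by
  have hπ := Real.pi_pos
  rw [l2Norm_eq_sqrt, l2Norm_eq_sqrt, ← Real.sqrt_mul (by positivity), ← integral_norm_ft_sq]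
  simp only [ftS_apply]

theorem l2Norm_le_of_norm_ft_le {C : ℝ} {a b : 𝓢(Space d, ℂ)} (hC : 0 ≤ C)
    (h : ∀ ξ, ‖ft a ξ‖ ≤ C * ‖ft b ξ‖) : l2Norm a ≤ C * l2Norm b := by
  have h1 := l2Norm_le_of_norm_le (a := ftS a) (b := ftS b) hC
    (by simpa only [ftS_apply] using h)
  rw [l2Norm_ftS, l2Norm_ftS, mul_left_comm] at h1
  exact le_of_mul_le_mul_left h1 (Real.sqrt_pos.2 (by have := Real.pi_pos; positivity))

/-- The Fourier multiplier with symbol `b` with respect to the Fourier transform `ft`. -/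
def mult (b : Space d → ℂ) : 𝓢(Space d, ℂ) →L[ℂ] 𝓢(Space d, ℂ) :=
  SchwartzMap.fourierMultiplierCLM ℂ fun η ↦ b ((2 * Real.pi) • η)

theorem ft_mult {b : Space d → ℂ} (hb : b.HasTemperateGrowth) (a : 𝓢(Space d, ℂ)) (ξ : Space d) :
    ft (mult b a) ξ = b ξ * ft a ξ := by
  have hb' : (fun η ↦ b ((2 * Real.pi) • η)).HasTemperateGrowth :=
    hb.comp ((2 * Real.pi) • ContinuousLinearMap.id ℝ (Space d)).hasTemperateGrowth
  rw [← ftS_apply, ← ftS_apply, ftS_eq_fourier, ftS_eq_fourier, mult,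
    SchwartzMap.fourierMultiplierCLM_apply, FourierTransform.fourier_fourierInv_eq,
    SchwartzMap.smulLeftCLM_apply_apply hb', smul_smul,
    mul_inv_cancel₀ (by positivity), one_smul, smul_eq_mul]

/-- Multiplication by the power `x_j ^ i` of a coordinate. -/
def coordPow (j : Fin d) (i : ℕ) : 𝓢(Space d, ℂ) →L[ℂ] 𝓢(Space d, ℂ) :=
  SchwartzMap.smulLeftCLM ℂ fun x ↦ ((x j : ℝ) : ℂ) ^ i

theorem hasTemperateGrowth_coord (j : Fin d) :
    (fun x : Space d ↦ ((x j : ℝ) : ℂ)).HasTemperateGrowth :=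
  (Complex.ofRealCLM.comp (EuclideanSpace.proj j : Space d →L[ℝ] ℝ)).hasTemperateGrowth

theorem coordPow_apply (j : Fin d) (i : ℕ) (a : 𝓢(Space d, ℂ)) (x : Space d) :
    coordPow j i a x = ((x j : ℝ) : ℂ) ^ i * a x := by
  have h : (fun x : Space d ↦ ((x j : ℝ) : ℂ) ^ i).HasTemperateGrowth :=
    (hasTemperateGrowth_coord j).pow i
  rw [coordPow, SchwartzMap.smulLeftCLM_apply_apply h, smul_eq_mul]

theorem coordPow_zero (j : Fin d) (a : 𝓢(Space d, ℂ)) : coordPow j 0 a = a := by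
  ext x; rw [coordPow_apply, pow_zero, one_mul]

theorem coordPow_add (j : Fin d) (i l : ℕ) (a : 𝓢(Space d, ℂ)) :
    coordPow j (i + l) a = coordPow j i (coordPow j l a) := by
  ext x; simp only [coordPow_apply, pow_add]; ring

/-- The derivative of the Fourier transform is the transform of the product with a coordinate. -/
theorem fderiv_ftS_apply (a : 𝓢(Space d, ℂ)) (j : Fin d) (ξ : Space d) :
    fderiv ℝ (ftS a) ξ (EuclideanSpace.single j 1) = -(Complex.I * ft (coordPow j 1 a) ξ) := by
  have h1 : fderiv ℝ (ftS a) ξ = (fderiv ℝ (𝓕 a : 𝓢(Space d, ℂ)) ((2 * Real.pi)⁻¹ • ξ)).comp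
      ((2 * Real.pi)⁻¹ • ContinuousLinearMap.id ℝ (Space d)) := by
    have hg : HasFDerivAt (fun ξ : Space d ↦ (2 * Real.pi)⁻¹ • ξ)
      ((2 * Real.pi)⁻¹ • ContinuousLinearMap.id ℝ (Space d)) ξ :=
      ((2 * Real.pi)⁻¹ • ContinuousLinearMap.id ℝ (Space d)).hasFDerivAt
    exact ((𝓕 a : 𝓢(Space d, ℂ)).differentiableAt.hasFDerivAt.comp ξ hg).fderiv
  have h2 := DFunLike.congr_fun (SchwartzMap.lineDerivOp_fourier_eq a (EuclideanSpace.single j 1))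
    ((2 * Real.pi)⁻¹ • ξ)
  rw [SchwartzMap.lineDerivOp_apply_eq_fderiv] at h2
  rw [h1, ContinuousLinearMap.comp_apply]
  have h3 : SchwartzMap.smulLeftCLM ℂ (fun x : Space d ↦ inner ℝ x (EuclideanSpace.single j 1)) a =
      coordPow j 1 a := by
    have ht : (fun x : Space d ↦
        inner ℝ x (EuclideanSpace.single j (1 : ℝ))).HasTemperateGrowth := by fun_prop
    ext x
    rw [SchwartzMap.smulLeftCLM_apply_apply ht, coordPow_apply]
    simp [EuclideanSpace.inner_single_right]
  rw [h3] at h2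
  simp only [smul_apply, ContinuousLinearMap.id_apply, map_smul, h2]
  rw [← ftS_apply, ftS_eq_fourier]
  have h4 : 𝓕 (-(2 * (Real.pi : ℂ) * Complex.I) • coordPow j 1 a) =
      -(2 * (Real.pi : ℂ) * Complex.I) • 𝓕 (coordPow j 1 a) :=
    (FourierTransform.fourierCLM ℂ 𝓢(Space d, ℂ)).map_smul _ _
  rw [h4, smul_apply, Complex.real_smul, smul_eq_mul]
  have : (Real.pi : ℂ) ≠ 0 := by exact_mod_cast Real.pi_ne_zero
  push_cast
  field_simp

/-- The commutator of a Fourier multiplier with a coordinate is the multiplier with the derivative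
of the symbol. -/
theorem coordPow_one_mult {b b' : Space d → ℂ} (hb : b.HasTemperateGrowth)
    (hb' : b'.HasTemperateGrowth) (j : Fin d)
    (h : ∀ ξ, fderiv ℝ b ξ (EuclideanSpace.single j 1) = b' ξ) (a : 𝓢(Space d, ℂ)) :
    coordPow j 1 (mult b a) = mult b (coordPow j 1 a) + Complex.I • mult b' a := by
  refine ft_injective fun ξ ↦ ?_
  have e : ∀ a b : 𝓢(Space d, ℂ), ft (a + b : 𝓢(Space d, ℂ)) ξ = ft a ξ + ft b ξ := fun a b ↦ by
    rw [← ftS_apply, map_add, add_apply, ftS_apply, ftS_apply]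
  have e' : ∀ (c : ℂ) (a : 𝓢(Space d, ℂ)), ft (c • a : 𝓢(Space d, ℂ)) ξ = c * ft a ξ := fun c a ↦ by
    rw [← ftS_apply, map_smul, smul_apply, ftS_apply, smul_eq_mul]
  rw [e, e', ft_mult hb, ft_mult hb']
  have h1 := fderiv_ftS_apply (mult b a) j ξ
  have h2 := fderiv_ftS_apply a j ξ
  have h3 : ⇑(ftS (mult b a)) = fun ξ ↦ b ξ * ftS a ξ := by
    ext ξ; rw [ftS_apply, ft_mult hb, ftS_apply]
  rw [h3, fderiv_fun_mul (hb.1.differentiable (by simp) ξ) (ftS a).differentiableAt, add_apply,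
    smul_apply, smul_apply, h, h2, ftS_apply, smul_eq_mul, smul_eq_mul] at h1
  have hI := Complex.I_mul_I
  linear_combination -Complex.I * h1 +
    (ft (coordPow j 1 (mult b a)) ξ - b ξ * ft (coordPow j 1 a) ξ) * hI

/-- The span of the symbols `ξ_j^a ⟨ξ⟩^{-t-e}` with `a ≤ e`, which contains the derivatives of
`⟨ξ⟩^{-t}` with respect to `ξ_j`. -/
inductive IsBesselSymbol (t : ℝ) (j : Fin d) : (Space d → ℂ) → Prop
  | base (c : ℂ) (a e : ℕ) (h : a ≤ e) :
      IsBesselSymbol t j fun ξ ↦ c * ((ξ j : ℝ) : ℂ) ^ a * weight (-t - e) ξ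
  | add {b b' : Space d → ℂ} (h : IsBesselSymbol t j b) (h' : IsBesselSymbol t j b') :
      IsBesselSymbol t j fun ξ ↦ b ξ + b' ξ

theorem abs_coord_le_bracket (x : Space d) (j : Fin d) : |x j| ≤ bracket x := by
  have h1 : |x j| ≤ ‖x‖ := by simpa using PiLp.norm_apply_le x j
  refine h1.trans ?_
  rw [bracket]
  exact Real.le_sqrt_of_sq_le (by linarith)

theorem hasFDerivAt_weight (r : ℝ) (ξ : Space d) :
    HasFDerivAt (weight r : Space d → ℂ)
      (((r : ℂ) * weight (r - 2) ξ) • (Complex.ofRealCLM.comp (innerSL ℝ ξ))) ξ := by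
  have h1 : HasFDerivAt (fun x : Space d ↦ 1 + ‖x‖ ^ 2) (2 • innerSL ℝ ξ) ξ :=
    ((hasStrictFDerivAt_norm_sq ξ).hasFDerivAt).const_add 1
  have h2 := (h1.rpow_const (p := r / 2) (Or.inl (by positivity : (1 + ‖ξ‖ ^ 2 : ℝ) ≠ 0)))
  have h3 := Complex.ofRealCLM.hasFDerivAt.comp ξ h2
  have e : (weight r : Space d → ℂ) = Complex.ofRealCLM ∘ fun x ↦ (1 + ‖x‖ ^ 2) ^ (r / 2) := by
    ext x; rw [weight, bracket_rpow]; rfl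
  rw [e]
  refine h3.congr_fderiv ?_
  ext y
  simp only [ContinuousLinearMap.comp_apply, smul_apply, smul_eq_mul, innerSL_apply_apply,
    Complex.ofRealCLM_apply, weight, bracket_rpow, nsmul_eq_mul]
  rw [show r / 2 - 1 = (r - 2) / 2 by ring]
  push_cast
  ring

namespace IsBesselSymbol

variable {t : ℝ} {j : Fin d} {b : Space d → ℂ}

theorem hasTemperateGrowth (h : IsBesselSymbol t j b) : b.HasTemperateGrowth := by
  induction h with
  | base c a e h =>
    exact ((Function.HasTemperateGrowth.const c).mul ((hasTemperateGrowth_coord j).pow a)).mul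
      (weight_hasTemperateGrowth _)
  | add h h' ih ih' => exact ih.add ih'

theorem exists_bound (h : IsBesselSymbol t j b) :
    ∃ C, 0 ≤ C ∧ ∀ ξ, ‖b ξ‖ ≤ C * bracket ξ ^ (-t) := by
  induction h with
  | base c a e h =>
    refine ⟨‖c‖, norm_nonneg _, fun ξ ↦ ?_⟩
    rw [norm_mul, norm_mul, norm_pow, Complex.norm_real, norm_weight, mul_assoc,
      sub_eq_add_neg, Real.rpow_add (bracket_pos ξ), Real.rpow_neg (bracket_pos ξ).le e,
      Real.rpow_natCast]
    refine mul_le_mul_of_nonneg_left ?_ (norm_nonneg _)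
    have hb := bracket_pos ξ
    have h1 : ‖ξ j‖ ^ a ≤ bracket ξ ^ e :=
      (pow_le_pow_left₀ (norm_nonneg _) (abs_coord_le_bracket ξ j) a).trans
        (pow_le_pow_right₀ (one_le_bracket ξ) h)
    calc ‖ξ j‖ ^ a * (bracket ξ ^ (-t) * (bracket ξ ^ e)⁻¹)
        ≤ bracket ξ ^ e * (bracket ξ ^ (-t) * (bracket ξ ^ e)⁻¹) := by gcongr
      _ = _ := by field_simp
  | add h h' ih ih' =>
    obtain ⟨C, hC, hb⟩ := ih
    obtain ⟨C', hC', hb'⟩ := ih'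
    exact ⟨C + C', by positivity, fun ξ ↦ (norm_add_le _ _).trans
      ((add_le_add (hb ξ) (hb' ξ)).trans_eq (by ring))⟩

theorem exists_deriv (h : IsBesselSymbol t j b) : ∃ b', IsBesselSymbol t j b' ∧
    ∀ ξ, fderiv ℝ b ξ (EuclideanSpace.single j 1) = b' ξ := by
  induction h with
  | base c a e h =>
    refine ⟨_, (base (c * a) (a - 1) e (by omega)).add
      (base (c * ((-t - e : ℝ) : ℂ)) (a + 1) (e + 2) (by omega)), fun ξ ↦ ?_⟩
    have h1 : HasFDerivAt (fun ξ : Space d ↦ ((ξ j : ℝ) : ℂ))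
        (Complex.ofRealCLM.comp (EuclideanSpace.proj j : Space d →L[ℝ] ℝ)) ξ :=
      (Complex.ofRealCLM.comp (EuclideanSpace.proj j : Space d →L[ℝ] ℝ)).hasFDerivAt
    have h2 := ((h1.pow a).const_mul c).mul (hasFDerivAt_weight (-t - e) ξ)
    have h3 := h2.fderiv
    rw [show (fun ξ : Space d ↦ c * ((ξ j : ℝ) : ℂ) ^ a * weight (-t - e) ξ) =
      (fun ξ : Space d ↦ c * ((ξ j : ℝ) : ℂ) ^ a) * weight (-t - e) from rfl, h3]
    have e1 : (-t - e - 2 : ℝ) = -t - ((e + 2 : ℕ) : ℝ) := by push_cast; ring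
    simp [e1, EuclideanSpace.inner_single_right]
    ring
  | add h h' ih ih' =>
    obtain ⟨c, hc, hb⟩ := ih
    obtain ⟨c', hc', hb'⟩ := ih'
    refine ⟨_, hc.add hc', fun ξ ↦ ?_⟩
    rw [fderiv_fun_add (h.hasTemperateGrowth.1.differentiable (by simp) ξ)
      (h'.hasTemperateGrowth.1.differentiable (by simp) ξ), add_apply, hb, hb']

end IsBesselSymbol

theorem isBesselSymbol_weight (t : ℝ) (j : Fin d) : IsBesselSymbol t j (weight (-t)) := by
  have := IsBesselSymbol.base (t := t) (j := j) 1 0 0 le_rfl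
  simpa using this

theorem besselS_eq_mult (s : ℝ) (a : 𝓢(Space d, ℂ)) : besselS s a = mult (weight s) a :=
  ft_injective fun ξ ↦ by rw [ft_besselS, ft_mult (by fun_prop)]

/-! ### Weighted bounds for Bessel potentials -/

/-- The weight is controlled by powers of the individual coordinates. -/
theorem bracket_pow_le (K : ℕ) (x : Space d) :
    (bracket x ^ K) ^ 2 ≤ 2 ^ K * (d + 1) ^ K * (1 + ∑ j, (|x j| ^ K) ^ 2) := by
  have h0 : (bracket x ^ K) ^ 2 = (1 + ∑ j, |x j| ^ 2) ^ K := by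
    rw [← pow_mul, mul_comm, pow_mul, bracket, Real.sq_sqrt (by positivity),
      EuclideanSpace.norm_sq_eq]
    simp
  rw [h0]
  rcases K with - | K
  · simp
  have hS : 0 ≤ ∑ j, |x j| ^ 2 := Finset.sum_nonneg fun j _ ↦ by positivity
  have hc : (1 : ℝ) ≤ d + 1 := by linarith [(Nat.cast_nonneg d : (0 : ℝ) ≤ d)]
  have hM : 0 ≤ ∑ j, (|x j| ^ (K + 1)) ^ 2 := Finset.sum_nonneg fun j _ ↦ by positivity
  have h2 : (1 : ℝ) ≤ (d + 1) ^ (K + 1) := one_le_pow₀ hc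
  have h1 : (∑ j, |x j| ^ 2) ^ (K + 1) ≤ (d + 1) ^ (K + 1) * ∑ j, (|x j| ^ (K + 1)) ^ 2 := by
    have h3 := pow_sum_div_card_le_sum_pow (s := Finset.univ) (f := fun j ↦ |x j| ^ 2)
      (fun j _ ↦ by positivity) K
    rw [Finset.card_univ, Fintype.card_fin] at h3
    have e : ∑ j, (|x j| ^ 2) ^ (K + 1) = ∑ j, (|x j| ^ (K + 1)) ^ 2 := by
      congr 1; ext j; rw [← pow_mul, ← pow_mul, mul_comm]
    rw [e] at h3
    rcases Nat.eq_zero_or_pos d with rfl | hd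
    · simp
    · have hd' : (0 : ℝ) < d := by exact_mod_cast hd
      rw [div_le_iff₀ (by positivity), mul_comm] at h3
      refine h3.trans (mul_le_mul_of_nonneg_right ?_ hM)
      calc (d : ℝ) ^ K ≤ (d + 1) ^ K := by gcongr; linarith
        _ ≤ (d + 1) ^ (K + 1) := pow_le_pow_right₀ hc (by omega)
  calc (1 + ∑ j, |x j| ^ 2) ^ (K + 1) ≤
        2 ^ (K + 1 - 1) * (1 ^ (K + 1) + (∑ j, |x j| ^ 2) ^ (K + 1)) :=
        add_pow_le zero_le_one hS (K + 1)
    _ ≤ 2 ^ (K + 1) * ((d + 1) ^ (K + 1) * (1 + ∑ j, (|x j| ^ (K + 1)) ^ 2)) := by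
        refine mul_le_mul (pow_le_pow_right₀ one_le_two (by omega)) ?_ (by positivity)
          (by positivity)
        rw [one_pow]; linarith
    _ = _ := by ring

theorem sqrt_weightedSq_eq (s : ℝ) (a : 𝓢(Space d, ℂ)) :
    Real.sqrt (weightedSq s a) = l2Norm (SchwartzMap.smulLeftCLM ℂ (weight s) a) :=
  (norm_toLp_smulLeft_weight s a).symm

theorem sqrt_weightedSq_le {s C : ℝ} {s' : ℝ} {a b : 𝓢(Space d, ℂ)} (hC : 0 ≤ C)
    (h : ∀ x, bracket x ^ s * ‖a x‖ ≤ C * (bracket x ^ s' * ‖b x‖)) :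
    Real.sqrt (weightedSq s a) ≤ C * Real.sqrt (weightedSq s' b) := by
  rw [sqrt_weightedSq_eq, sqrt_weightedSq_eq]
  refine l2Norm_le_of_norm_le hC fun x ↦ ?_
  rw [SchwartzMap.smulLeftCLM_apply_apply (by fun_prop),
    SchwartzMap.smulLeftCLM_apply_apply (by fun_prop), norm_smul, norm_smul, norm_weight,
      norm_weight]
  exact h x

theorem l2Norm_eq_weightedSq_zero (a : 𝓢(Space d, ℂ)) : l2Norm a = Real.sqrt (weightedSq 0 a) := by
  rw [sqrt_weightedSq_eq, smulLeft_weight_zero]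

/-- Moving `x_j^i` past the multiplier one factor at a time, each commutator is a multiplier of the
same class with one factor `x_j` less. -/
theorem IsBesselSymbol.exists_l2Norm_coordPow_le {t : ℝ} (ht : 0 ≤ t) (j : Fin d) (i : ℕ) :
    ∀ {b : Space d → ℂ}, IsBesselSymbol t j b → ∃ C, 0 ≤ C ∧ ∀ a : 𝓢(Space d, ℂ),
      l2Norm (coordPow j i (mult b a)) ≤ C * Real.sqrt (weightedSq i a) := by
  induction i with
  | zero =>
    intro b hb
    obtain ⟨C, hC, h⟩ := hb.exists_bound
    refine ⟨C, hC, fun a ↦ ?_⟩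
    rw [coordPow_zero, Nat.cast_zero, ← l2Norm_eq_weightedSq_zero]
    refine l2Norm_le_of_norm_ft_le hC fun ξ ↦ ?_
    rw [ft_mult hb.hasTemperateGrowth, norm_mul]
    refine mul_le_mul_of_nonneg_right ((h ξ).trans ?_) (norm_nonneg _)
    exact mul_le_of_le_one_right hC (Real.rpow_le_one_of_one_le_of_nonpos (one_le_bracket ξ)
      (by linarith))
  | succ i ih =>
    intro b hb
    obtain ⟨b', hb', hbb'⟩ := hb.exists_deriv
    obtain ⟨C, hC, h⟩ := ih hb
    obtain ⟨C', hC', h'⟩ := ih hb'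
    refine ⟨C + C', by positivity, fun a ↦ ?_⟩
    rw [coordPow_add, coordPow_one_mult hb.hasTemperateGrowth hb'.hasTemperateGrowth j hbb',
      map_add, map_smul]
    refine (l2Norm_add_le _ _).trans ?_
    rw [l2Norm_smul, Complex.norm_I, one_mul, add_mul]
    have hb1 : ∀ x : Space d, bracket x ^ ((i + 1 : ℕ) : ℝ) = bracket x ^ (i : ℝ) * bracket x :=
      fun x ↦ by rw [Real.rpow_natCast, Real.rpow_natCast, pow_succ]
    refine add_le_add ((h _).trans (mul_le_mul_of_nonneg_left ?_ hC))
      ((h' _).trans (mul_le_mul_of_nonneg_left ?_ hC'))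
    · refine (sqrt_weightedSq_le zero_le_one fun x ↦ ?_).trans_eq (one_mul _)
      have := bracket_pos x
      rw [coordPow_apply, norm_mul, pow_one, Complex.norm_real, one_mul, hb1, ← mul_assoc]
      gcongr
      exact abs_coord_le_bracket x j
    · refine (sqrt_weightedSq_le zero_le_one fun x ↦ ?_).trans_eq (one_mul _)
      have := bracket_pos x
      rw [one_mul, hb1]
      gcongr
      exact le_mul_of_one_le_right (by positivity) (one_le_bracket x)

/-- Bessel potentials of order `t ≥ 0` are bounded on weighted `L²` spaces. -/
theorem exists_weightedSq_besselS_le {t : ℝ} (ht : 0 ≤ t) (K : ℕ) : ∃ C, 0 ≤ C ∧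
    ∀ a : 𝓢(Space d, ℂ), weightedSq K (besselS (-t) a) ≤ C * weightedSq K a := by
  choose C hC h using fun j : Fin d ↦
    IsBesselSymbol.exists_l2Norm_coordPow_le ht j K (isBesselSymbol_weight t j)
  refine ⟨2 ^ K * (d + 1) ^ K * (1 + ∑ j, C j ^ 2),
    mul_nonneg (by positivity) (add_nonneg zero_le_one (Finset.sum_nonneg fun j _ ↦ by positivity)),
    fun a ↦ ?_⟩
  set A := besselS (-t) a with hA
  have hi : ∀ j, Integrable fun x ↦ (|x j| ^ K) ^ 2 * ‖A x‖ ^ 2 := fun j ↦ by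
    refine (integrable_norm_sq (coordPow j K A)).congr (Eventually.of_forall fun x ↦ ?_)
    simp only [coordPow_apply, norm_mul, norm_pow, Complex.norm_real, Real.norm_eq_abs, mul_pow]
  have hj : ∀ j, ∫ x, (|x j| ^ K) ^ 2 * ‖A x‖ ^ 2 ≤ C j ^ 2 * weightedSq K a := fun j ↦ by
    have h1 := h j a
    rw [← besselS_eq_mult, ← hA, l2Norm_eq_sqrt] at h1
    have h2 := (Real.sqrt_le_iff.1 h1).2
    rw [mul_pow, Real.sq_sqrt (weightedSq_nonneg _ _)] at h2
    refine le_trans (le_of_eq ?_) h2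
    congr 1; ext x
    simp only [coordPow_apply, norm_mul, norm_pow, Complex.norm_real, Real.norm_eq_abs, mul_pow]
  have h0 : ∫ x, ‖A x‖ ^ 2 ≤ weightedSq K a := by
    have h1 : l2Norm A ≤ 1 * l2Norm a := l2Norm_le_of_norm_ft_le zero_le_one fun ξ ↦ by
      rw [hA, ft_besselS, norm_mul, norm_weight]
      exact mul_le_mul_of_nonneg_right (Real.rpow_le_one_of_one_le_of_nonpos (one_le_bracket ξ)
        (by linarith)) (norm_nonneg _)
    rw [one_mul, l2Norm_eq_weightedSq_zero a, l2Norm_eq_sqrt] at h1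
    have h2 := (Real.sqrt_le_sqrt_iff (weightedSq_nonneg _ _)).1 h1
    exact h2.trans (weightedSq_mono (Nat.cast_nonneg K) a)
  calc weightedSq K A
      ≤ ∫ x, 2 ^ K * (d + 1) ^ K * (‖A x‖ ^ 2 + ∑ j, (|x j| ^ K) ^ 2 * ‖A x‖ ^ 2) := by
        refine integral_mono (integrable_weightedSq _ _)
          (((integrable_norm_sq A).add (integrable_finsetSum _ fun j _ ↦ hi j)).const_mul _)
          fun x ↦ ?_
        have := bracket_pow_le K x
        rw [mul_comm 2 (K : ℝ), Real.rpow_mul (bracket_pos x).le, Real.rpow_natCast, Real.rpow_two,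
          ← Finset.sum_mul]
        refine (mul_le_mul_of_nonneg_right this (by positivity)).trans_eq ?_
        ring
    _ = 2 ^ K * (d + 1) ^ K * ((∫ x, ‖A x‖ ^ 2) + ∑ j, ∫ x, (|x j| ^ K) ^ 2 * ‖A x‖ ^ 2) := by
        rw [integral_const_mul, integral_add (integrable_norm_sq A)
          (integrable_finsetSum _ fun j _ ↦ hi j), integral_finsetSum _ fun j _ ↦ hi j]
    _ ≤ 2 ^ K * (d + 1) ^ K * (weightedSq K a + ∑ j, C j ^ 2 * weightedSq K a) := by
        gcongr with j
        exact hj j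
    _ = _ := by rw [← Finset.sum_mul]; ring

end

/-! ### Elements of weighted Sobolev spaces as functions -/

theorem Lp_ext_of_integral_mul_eq {Z Z' : Lp ℂ 2 (volume : Measure (Space d))}
    (h : ∀ ψ : 𝓢(Space d, ℂ), ∫ x, Z x * ψ x = ∫ x, Z' x * ψ x) : Z = Z' := by
  have h1 := isRepresentedBy_Lp Z
  have h2 : IsRepresentedBy (Z : 𝓢'(Space d, ℂ)) Z' :=
    ⟨(isRepresentedBy_Lp Z').1, fun ψ hψ ↦ (h1.2 ψ hψ).trans (h ψ)⟩
  exact Lp.ext (h1.ae_eq h2)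

theorem l2Norm_smulLeft_weight_neg (s : ℝ) (a : 𝓢(Space d, ℂ)) :
    Real.sqrt (weightedSq s (SchwartzMap.smulLeftCLM ℂ (weight (-s)) a)) = l2Norm a := by
  rw [sqrt_weightedSq_eq, smulLeft_weight_smulLeft_weight, add_neg_cancel, smulLeft_weight_zero]

theorem integral_Lp_add (Y Y' : Lp ℂ 2 (volume : Measure (Space d))) (a : 𝓢(Space d, ℂ)) :
    ∫ x, (Y + Y') x * a x = (∫ x, Y x * a x) + ∫ x, Y' x * a x := by
  have hi : ∀ Y : Lp ℂ 2 (volume : Measure (Space d)), Integrable fun x ↦ Y x * a x := fun Y ↦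
    (Lp.memLp Y).integrable_mul (a.memLp 2 volume)
  rw [← integral_add (hi Y) (hi Y')]
  refine integral_congr_ae ?_
  filter_upwards [Lp.coeFn_add Y Y'] with x hx
  rw [hx, Pi.add_apply, add_mul]

theorem integral_Lp_smul (c : ℂ) (Y : Lp ℂ 2 (volume : Measure (Space d))) (a : 𝓢(Space d, ℂ)) :
    ∫ x, (c • Y) x * a x = c * ∫ x, Y x * a x := by
  rw [← integral_const_mul]
  refine integral_congr_ae ?_
  filter_upwards [Lp.coeFn_smul c Y] with x hx
  rw [hx, Pi.smul_apply, smul_eq_mul, mul_assoc]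

/-- The elements of `H^t_{-s}` with `t ≥ 0` are functions which are square integrable with a
polynomial weight. -/
theorem exists_isRepresentedBy_sobolevMap {t : ℝ} (ht : 0 ≤ t) (s : ℝ) :
    ∃ (K : ℕ) (A : Lp ℂ 2 (volume : Measure (Space d)) →L[ℂ] Lp ℂ 2 (volume : Measure (Space d))),
      ∀ Y, IsRepresentedBy (sobolevMap t (-s) Y) (fun x ↦ weight K x * A Y x) := by
  obtain ⟨K, hK⟩ := exists_nat_ge s
  obtain ⟨C, hC, hCb⟩ := exists_weightedSq_besselS_le (d := d) ht K
  have hb : ∀ (Y : Lp ℂ 2 (volume : Measure (Space d))) (a : 𝓢(Space d, ℂ)),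
      ‖sobolevMap t (-s) Y (SchwartzMap.smulLeftCLM ℂ (weight (-K)) a)‖ ≤
        Real.sqrt C * ‖Y‖ * ‖a.toLp 2 volume‖ := fun Y a ↦ by
    refine (norm_sobolevMap_apply_le _ _ _ _).trans ?_
    rw [neg_neg, mul_comm (Real.sqrt C), mul_assoc, ← l2Norm, ← l2Norm_smulLeft_weight_neg K a,
      ← Real.sqrt_mul hC]
    gcongr
    exact (weightedSq_mono hK _).trans (hCb _)
  choose A hA hAe using fun Y : Lp ℂ 2 (volume : Measure (Space d)) ↦ exists_Lp_of_bound
    ((sobolevMap t (-s) Y : 𝓢(Space d, ℂ) →ₗ[ℂ] ℂ) ∘ₗ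
      (SchwartzMap.smulLeftCLM ℂ (weight (-K)) : 𝓢(Space d, ℂ) →L[ℂ] 𝓢(Space d, ℂ)).toLinearMap)
    (by positivity) (hb Y)
  have hAe' : ∀ Y (a : 𝓢(Space d, ℂ)), ∫ x, A Y x * a x =
      sobolevMap t (-s) Y (SchwartzMap.smulLeftCLM ℂ (weight (-K)) a) := fun Y a ↦ (hAe Y a).symm
  let L : Lp ℂ 2 (volume : Measure (Space d)) →ₗ[ℂ] Lp ℂ 2 (volume : Measure (Space d)) :=
    { toFun := A
      map_add' := fun Y Y' ↦ Lp_ext_of_integral_mul_eq fun ψ ↦ by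
        rw [integral_Lp_add, hAe', hAe', hAe', map_add, add_apply]
      map_smul' := fun c Y ↦ Lp_ext_of_integral_mul_eq fun ψ ↦ by
        rw [RingHom.id_apply, integral_Lp_smul, hAe', hAe', map_smul, smul_apply, smul_eq_mul] }
  refine ⟨K, L.mkContinuous (Real.sqrt C) hA, fun Y ↦ ⟨?_, fun ψ hψ ↦ ?_⟩⟩
  · have h1 := ((Lp.memLp (A Y)).locallyIntegrable (by norm_num)).smul_continuous
      (weight_continuous (d := d) K)
    simp only [smul_eq_mul, mul_comm (A Y _)] at h1
    exact h1
  · have h1 := hAe' Y (SchwartzMap.smulLeftCLM ℂ (weight K) ψ)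
    rw [smulLeft_weight_smulLeft_weight, neg_add_cancel, smulLeft_weight_zero] at h1
    rw [← h1]
    congr 1; ext x
    rw [SchwartzMap.smulLeftCLM_apply_apply (by fun_prop), smul_eq_mul]
    change A Y x * _ = weight K x * A Y x * _
    ring

theorem coordPow_coordPow (j : Fin d) (i l : ℕ) (a : 𝓢(Space d, ℂ)) :
    coordPow j i (coordPow j l a) = coordPow j (i + l) a := (coordPow_add j i l a).symm

/-- If the products `x_j^l f` belong to `H^{-t}` then `x_j^i` may also be applied after the Bessel
potential: by induction on `i` the coordinates are moved past the multiplier, with commutators in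
the same class of symbols. -/
theorem IsBesselSymbol.exists_norm_apply_le {f : 𝓢'(Space d, ℂ)} {t : ℝ} {j : Fin d} {K : ℕ}
    (h : ∀ l ≤ K, ∃ M, 0 ≤ M ∧ ∀ a, ‖f (coordPow j l (besselS (-t) a))‖ ≤ M * l2Norm a) (i : ℕ) :
    ∀ {b : Space d → ℂ}, IsBesselSymbol t j b → ∀ l, i + l ≤ K →
      ∃ M, 0 ≤ M ∧ ∀ a, ‖f (coordPow j l (mult b (coordPow j i a)))‖ ≤ M * l2Norm a := by
  induction i with
  | zero =>
    intro b hb l hl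
    obtain ⟨M, hM, hMb⟩ := h l (by omega)
    obtain ⟨C, hC, hCb⟩ := hb.exists_bound
    refine ⟨M * C, by positivity, fun a ↦ ?_⟩
    have hw : (fun ξ ↦ weight t ξ * b ξ : Space d → ℂ).HasTemperateGrowth :=
      (weight_hasTemperateGrowth t).mul hb.hasTemperateGrowth
    have e : mult b (coordPow j 0 a) = besselS (-t) (mult (fun ξ ↦ weight t ξ * b ξ) a) :=
      ft_injective fun ξ ↦ by
        rw [coordPow_zero, ft_mult hb.hasTemperateGrowth, ft_besselS, ft_mult hw, ← mul_assoc,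
          ← mul_assoc, weight_mul_weight, neg_add_cancel, weight_zero, one_mul]
    rw [e, mul_assoc]
    refine (hMb _).trans (mul_le_mul_of_nonneg_left ?_ hM)
    refine l2Norm_le_of_norm_ft_le hC fun ξ ↦ ?_
    rw [ft_mult hw, norm_mul, norm_mul, norm_weight]
    refine mul_le_mul_of_nonneg_right ?_ (norm_nonneg _)
    have hp := Real.rpow_pos_of_pos (bracket_pos ξ) t
    calc bracket ξ ^ t * ‖b ξ‖ ≤ bracket ξ ^ t * (C * bracket ξ ^ (-t)) := by
          gcongr; exact hCb ξ
      _ = C := by rw [Real.rpow_neg (bracket_pos ξ).le]; field_simp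
  | succ i ih =>
    intro b hb l hl
    obtain ⟨b', hb', hbb'⟩ := hb.exists_deriv
    obtain ⟨M, hM, hMb⟩ := ih hb (l + 1) (by omega)
    obtain ⟨M', hM', hMb'⟩ := ih hb' l (by omega)
    refine ⟨M + M', by positivity, fun a ↦ ?_⟩
    have e : mult b (coordPow j (i + 1) a) = coordPow j 1 (mult b (coordPow j i a)) -
        Complex.I • mult b' (coordPow j i a) := by
      rw [coordPow_one_mult hb.hasTemperateGrowth hb'.hasTemperateGrowth j hbb', add_comm i 1,
        coordPow_add, add_sub_cancel_right]
    rw [e, map_sub, map_smul, map_sub, map_smul, coordPow_coordPow, add_mul]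
    refine (norm_sub_le _ _).trans (add_le_add (hMb a) ?_)
    rw [norm_smul, Complex.norm_I, one_mul]
    exact hMb' a

/-- A distribution `f` belongs to `H^{-t}_s` if its products with powers of the coordinates belong
to `H^{-t}`. -/
theorem exists_sobolevMap_of_coordPow (hd : 0 < d) {f : 𝓢'(Space d, ℂ)} {t s : ℝ} {K : ℕ}
    (hsK : s ≤ K) (h : ∀ (j : Fin d), ∀ l ≤ K, ∃ M, 0 ≤ M ∧
      ∀ a, ‖f (coordPow j l (besselS (-t) a))‖ ≤ M * l2Norm a) :
    ∃ Y, f = sobolevMap (-t) s Y := by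
  obtain ⟨M, hM, hMb⟩ := h ⟨0, hd⟩ 0 (by omega)
  obtain ⟨F, -, hF⟩ := exists_Lp_of_bound
    ((f : 𝓢(Space d, ℂ) →ₗ[ℂ] ℂ) ∘ₗ (besselS (-t) : 𝓢(Space d, ℂ) →L[ℂ] _).toLinearMap) hM
    (fun a ↦ by have := hMb a; rw [coordPow_zero] at this; exact this)
  have hF : ∀ a, f (besselS (-t) a) = ∫ x, F x * a x := hF
  have hj : ∀ j : Fin d, ∃ Fj : Lp ℂ 2 (volume : Measure (Space d)),
      (fun x ↦ ((x j : ℝ) : ℂ) ^ K * F x) =ᵐ[volume] Fj := fun j ↦ by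
    obtain ⟨M', hM', hMb'⟩ :=
      IsBesselSymbol.exists_norm_apply_le (h j) K (isBesselSymbol_weight t j) 0 (by omega)
    obtain ⟨Fj, -, hFj⟩ := exists_Lp_of_bound
      ((f : 𝓢(Space d, ℂ) →ₗ[ℂ] ℂ) ∘ₗ
        (besselS (-t) ∘L coordPow j K : 𝓢(Space d, ℂ) →L[ℂ] _).toLinearMap) hM'
      (fun a ↦ by have := hMb' a; rw [coordPow_zero, ← besselS_eq_mult] at this; exact this)
    have hFj : ∀ a, f (besselS (-t) (coordPow j K a)) = ∫ x, Fj x * a x := hFj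
    refine ⟨Fj, ?_⟩
    have h1 := isRepresentedBy_Lp Fj
    refine IsRepresentedBy.ae_eq (T := (Fj : 𝓢'(Space d, ℂ))) ⟨?_, fun ψ hψ ↦ ?_⟩ h1
    · have h2 : Continuous fun x : Space d ↦ ((x j : ℝ) : ℂ) ^ K := by fun_prop
      simpa [mul_comm] using ((Lp.memLp F).locallyIntegrable (by norm_num)).smul_continuous h2
    · rw [h1.2 ψ hψ, ← hFj, hF]
      congr 1; ext x
      rw [coordPow_apply]; ring
  -- With `F` the Bessel potential of `f`, all `x_j^K F` are square integrable, hence so is `⟨x⟩^s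
  -- F`.
  choose Fj hFj using hj
  have hm : MemLp (fun x ↦ weight s x * F x) 2 volume := by
    have hS : MemLp (fun x ↦ ‖F x‖ + ∑ j, ‖Fj j x‖) 2 volume :=
      (Lp.memLp F).norm.add (memLp_finsetSum _ fun j _ ↦ (Lp.memLp (Fj j)).norm)
    refine MemLp.of_le_mul (c := Real.sqrt (2 ^ K * (d + 1) ^ K)) hS
      ((weight_continuous s).aestronglyMeasurable.mul (Lp.aestronglyMeasurable F)) ?_
    have hall : ∀ᵐ x : Space d, ∀ j, ((x j : ℝ) : ℂ) ^ K * F x = Fj j x := ae_all_iff.2 hFj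
    filter_upwards [hall] with x hx
    have hb := bracket_pow_le K x
    have hS0 : 0 ≤ ∑ j, ‖Fj j x‖ := Finset.sum_nonneg fun j _ ↦ norm_nonneg _
    rw [norm_mul, norm_weight, Real.norm_of_nonneg (by positivity)]
    refine abs_le_of_sq_le_sq' ?_ (by positivity) |>.2
    have h1 : bracket x ^ s ≤ bracket x ^ K := by
      rw [← Real.rpow_natCast]
      exact Real.rpow_le_rpow_of_exponent_le (one_le_bracket x) hsK
    have hbr := bracket_pos x
    have h2 : ∑ j, (|x j| ^ K) ^ 2 * ‖F x‖ ^ 2 ≤ (∑ j, ‖Fj j x‖) ^ 2 := by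
      calc ∑ j, (|x j| ^ K) ^ 2 * ‖F x‖ ^ 2 = ∑ j, ‖Fj j x‖ ^ 2 := by
            congr 1; ext j
            rw [← hx j, norm_mul, norm_pow, Complex.norm_real, Real.norm_eq_abs, mul_pow]
        _ ≤ _ := Finset.sum_sq_le_sq_sum_of_nonneg fun j _ ↦ norm_nonneg _
    calc (bracket x ^ s * ‖F x‖) ^ 2 ≤ (bracket x ^ K) ^ 2 * ‖F x‖ ^ 2 := by
          rw [mul_pow]; gcongr
      _ ≤ 2 ^ K * (d + 1) ^ K * (1 + ∑ j, (|x j| ^ K) ^ 2) * ‖F x‖ ^ 2 := by gcongr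
      _ = 2 ^ K * (d + 1) ^ K * (‖F x‖ ^ 2 + ∑ j, (|x j| ^ K) ^ 2 * ‖F x‖ ^ 2) := by
          rw [← Finset.sum_mul]; ring
      _ ≤ 2 ^ K * (d + 1) ^ K * (‖F x‖ + ∑ j, ‖Fj j x‖) ^ 2 := by
          gcongr
          nlinarith [norm_nonneg (F x)]
      _ = _ := by rw [mul_pow, Real.sq_sqrt (by positivity)]
  refine ⟨hm.toLp _, ?_⟩
  ext ψ
  have h1 := hF (besselS t ψ)
  rw [besselS_besselS, neg_add_cancel, besselS_zero] at h1
  rw [h1, sobolevMap_apply, neg_neg]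
  refine integral_congr_ae ?_
  filter_upwards [hm.coeFn_toLp] with x hx
  rw [hx]
  have := weight_mul_weight s (-s) x
  rw [add_neg_cancel, weight_zero] at this
  linear_combination (-(F x * besselS t ψ x)) * this

/-! ### The potential operator -/

theorem seminorm_translate_le (ψ : 𝓢(Space d, ℂ)) (k n : ℕ) {R : ℝ} {z : Space d} (hz : ‖z‖ ≤ R) :
    SchwartzMap.seminorm ℂ k n (ψ.compSubConstCLM ℂ (-z)) ≤ (1 + R) ^ k *
      (2 ^ k * ((Finset.Iic (k, n)).sup fun m ↦ SchwartzMap.seminorm ℂ m.1 m.2) ψ) := by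
  have hR : 0 ≤ R := (norm_nonneg z).trans hz
  have h0 : 0 ≤ ((Finset.Iic (k, n)).sup fun m ↦ SchwartzMap.seminorm ℂ m.1 m.2) ψ :=
    apply_nonneg _ _
  refine SchwartzMap.seminorm_le_bound ℂ k n _ (by positivity) fun x ↦ ?_
  have e : iteratedFDeriv ℝ n (ψ.compSubConstCLM ℂ (-z)) x = iteratedFDeriv ℝ n ψ (x + z) := by
    have : (⇑(ψ.compSubConstCLM ℂ (-z)) : Space d → ℂ) = fun x ↦ ψ (x + z) := by ext; simp
    rw [this, iteratedFDeriv_comp_add_right]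
  have h1 := SchwartzMap.one_add_le_sup_seminorm_apply (𝕜 := ℂ) (m := (k, n)) le_rfl le_rfl ψ
    (x + z)
  rw [e]
  refine le_trans ?_ (mul_le_mul_of_nonneg_left h1 (by positivity))
  rw [← mul_assoc, ← mul_pow]
  gcongr
  have h2 : ‖x‖ ≤ ‖x + z‖ + ‖z‖ := by simpa using norm_sub_le (x + z) z
  nlinarith [norm_nonneg (x + z)]

/-- A continuous seminorm-type bound for a tempered distribution, uniform over translations of the
test function by vectors of bounded length. -/
theorem exists_norm_apply_translate_le (T : 𝓢'(Space d, ℂ)) (R : ℝ) :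
    ∃ p : 𝓢(Space d, ℂ) → ℝ, Continuous p ∧ p 0 = 0 ∧
      ∀ (ψ : 𝓢(Space d, ℂ)) (z : Space d), ‖z‖ ≤ R → ‖T (ψ.compSubConstCLM ℂ (-z))‖ ≤ p ψ := by
  obtain ⟨s, C, hC, h⟩ := exists_sum_seminorm_bound T
  refine ⟨fun ψ ↦ C * ∑ m ∈ s, (1 + R) ^ m.1 *
      (2 ^ m.1 * ∑ l ∈ Finset.Iic m, SchwartzMap.seminorm ℂ l.1 l.2 ψ), ?_, by simp, ?_⟩
  · have hs : ∀ l : ℕ × ℕ, Continuous (SchwartzMap.seminorm ℂ l.1 l.2 : 𝓢(Space d, ℂ) → ℝ) :=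
      fun l ↦ (schwartz_withSeminorms ℂ (Space d) ℂ).continuous_seminorm l
    fun_prop
  · intro ψ z hz
    have hR : 0 ≤ R := (norm_nonneg z).trans hz
    refine (h _).trans ?_
    beta_reduce
    gcongr with m hm
    refine (seminorm_translate_le ψ m.1 m.2 hz).trans ?_
    gcongr
    refine Seminorm.finset_sup_apply_le (Finset.sum_nonneg fun _ _ ↦ apply_nonneg _ _)
      fun p hp ↦ ?_
    exact Finset.single_le_sum (f := fun p : ℕ × ℕ ↦ SchwartzMap.seminorm ℂ p.1 p.2 ψ)
      (fun _ _ ↦ apply_nonneg _ _) hp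

/-- The convolution of the Green's function with an integrable function of bounded support. -/
theorem exists_isGreenConvolution_of_integrable {α k : ℝ} {G : 𝓢'(Space d, ℂ)}
    (hG : ∀ ψ, G ψ = green α k ψ) {T : 𝓢'(Space d, ℂ)} {F : Space d → ℂ} (hF : Integrable F)
    (hT : ∀ ψ, T ψ = ∫ x, F x * ψ x) {R : ℝ} (hR : ∀ x, R < ‖x‖ → F x = 0) :
    ∃ v, IsGreenConvolution α k T v ∧ ∀ ψ, v ψ = ∫ z, F z * G (ψ.compSubConstCLM ℂ (-z)) := by
  obtain ⟨p, hpc, hp0, hp⟩ := exists_norm_apply_translate_le G R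
  have hc : ∀ ψ : 𝓢(Space d, ℂ), Continuous fun z ↦ G (ψ.compSubConstCLM ℂ (-z)) := fun ψ ↦
    (contDiff_apply_translate G ψ).continuous
  have hle : ∀ (ψ : 𝓢(Space d, ℂ)) z, ‖F z * G (ψ.compSubConstCLM ℂ (-z))‖ ≤ ‖F z‖ * p ψ := by
    intro ψ z
    rw [norm_mul]
    by_cases hz : ‖z‖ ≤ R
    · gcongr; exact hp ψ z hz
    · rw [hR z (not_le.1 hz)]; simp
  have hi : ∀ ψ : 𝓢(Space d, ℂ), Integrable fun z ↦ F z * G (ψ.compSubConstCLM ℂ (-z)) := fun ψ ↦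
    (hF.norm.mul_const (p ψ)).mono' (hF.1.mul (hc ψ).aestronglyMeasurable)
      (Eventually.of_forall (hle ψ))
  let L : 𝓢(Space d, ℂ) →ₗ[ℂ] ℂ :=
    { toFun := fun ψ ↦ ∫ z, F z * G (ψ.compSubConstCLM ℂ (-z))
      map_add' := fun ψ ψ' ↦ by
        rw [← integral_add (hi ψ) (hi ψ')]; simp [mul_add]
      map_smul' := fun c ψ ↦ by
        rw [RingHom.id_apply, smul_eq_mul, ← integral_const_mul]
        congr 1; ext z; rw [map_smul, map_smul, smul_eq_mul]; ring }
  have hL : Continuous L := by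
    refine continuous_of_continuousAt_zero L ?_
    rw [ContinuousAt, map_zero]
    refine squeeze_zero_norm (a := fun ψ ↦ (∫ z, ‖F z‖) * p ψ) (fun ψ ↦ ?_) ?_
    · rw [← integral_mul_const]
      exact norm_integral_le_of_norm_le (hF.norm.mul_const _) (Eventually.of_forall (hle ψ))
    · have h := (hpc.tendsto 0).const_mul (∫ z, ‖F z‖)
      rwa [hp0, mul_zero] at h
  refine ⟨ContinuousLinearMap.toPointwiseConvergenceCLM _ _ _ _ ⟨L, hL⟩, fun ψ ↦ ?_, fun ψ ↦ rfl⟩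
  obtain ⟨η, hη, V, hV, hKV, hηe⟩ := exists_schwartz_eqOn (isCompact_closedBall (0 : Space d) R)
    (contDiff_apply_translate G ψ)
  refine ⟨η, ⟨V, hV, fun x hx ↦ hKV ?_, fun z hz ↦ by rw [hηe z hz, hG]⟩, ?_⟩
  · by_contra hxR
    refine (Distribution.notMem_dsupport_iff x).2
      ⟨(Metric.closedBall 0 R)ᶜ, fun φ hφ ↦ ?_, Metric.isClosed_closedBall.isOpen_compl, hxR⟩ hx
    rw [hT, ← integral_zero (Space d) ℂ]
    congr 1; ext y
    by_cases hy : ‖y‖ ≤ R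
    · rw [image_eq_zero_of_notMem_tsupport fun h ↦ hφ h (by simpa using hy), mul_zero]
    · rw [hR y (not_le.1 hy), zero_mul]
  · change ∫ z, F z * G (ψ.compSubConstCLM ℂ (-z)) = T η
    rw [hT]
    congr 1; ext z
    by_cases hz : ‖z‖ ≤ R
    · rw [hηe z (hKV (by simpa using hz))]
    · rw [hR z (not_le.1 hz)]; simp

theorem mulFun_apply {q g : Space d → ℂ} {φ : 𝓢'(Space d, ℂ)} (hg : IsRepresentedBy φ g)
    (hi : Integrable fun x ↦ q x * g x) (ψ : 𝓢(Space d, ℂ)) :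
    mulFun q φ ψ = ∫ x, q x * g x * ψ x := by
  have h : ∃ g : Space d → ℂ, IsRepresentedBy φ g ∧ Integrable (fun x ↦ q x * g x) volume :=
    ⟨g, hg, hi⟩
  rw [mulFun, dif_pos h, Lp.toTemperedDistribution_apply]
  refine integral_congr_ae ?_
  filter_upwards [h.choose_spec.2.coeFn_toL1, h.choose_spec.1.ae_eq hg] with x hx hx'
  rw [hx, hx', smul_eq_mul, mul_comm]

/-- The potential operator as a linear operator on `H^t_{-s}`, with the elements of `H^t_{-s}` given
by elements of `L²`. -/
theorem exists_linearMap_potentialOp {α k t s : ℝ} (ht : 0 ≤ t) {G : 𝓢'(Space d, ℂ)}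
    (hG : ∀ ψ, G ψ = green α k ψ) {U : Set (Space d)} {q : Space d → ℂ}
    (hU : Bornology.IsBounded U) (hq : MemLp q 2 volume) (hqU : Function.support q ⊆ U) :
    ∃ L : Lp ℂ 2 (volume : Measure (Space d)) →ₗ[ℂ] 𝓢'(Space d, ℂ),
      ∀ Y, L Y = potentialOp α k q (sobolevMap t (-s) Y) := by
  obtain ⟨K, A, hA⟩ := exists_isRepresentedBy_sobolevMap (d := d) ht s
  obtain ⟨R, hR⟩ := hU.subset_closedBall 0
  have hqR : ∀ x, R < ‖x‖ → q x = 0 := fun x hx ↦ by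
    by_contra h
    exact absurd (hR (hqU h)) (by simpa using hx)
  -- on the support of `q` the weight is bounded
  have hi : ∀ Y, Integrable fun x ↦ q x * (weight K x * A Y x) := fun Y ↦ by
    obtain ⟨B, hB⟩ := (isCompact_closedBall (0 : Space d) R).exists_bound_of_continuousOn
      (weight_continuous (d := d) K).continuousOn
    refine ((hq.integrable_mul (Lp.memLp (A Y))).norm.const_mul B).mono'
      (hq.1.mul ((weight_continuous _).aestronglyMeasurable.mul (Lp.aestronglyMeasurable _)))
      (Eventually.of_forall fun x ↦ ?_)
    by_cases hx : ‖x‖ ≤ R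
    · have := hB x (by simpa using hx)
      rw [Pi.mul_apply, norm_mul, norm_mul, norm_mul]
      calc ‖q x‖ * (‖weight K x‖ * ‖A Y x‖) = ‖weight K x‖ * (‖q x‖ * ‖A Y x‖) := by ring
        _ ≤ _ := by gcongr
    · rw [Pi.mul_apply, hqR x (not_le.1 hx)]; simp
  have hv : ∀ Y, ∀ ψ, potentialOp α k q (sobolevMap t (-s) Y) ψ =
      ∫ z, q z * (weight K z * A Y z) * G (ψ.compSubConstCLM ℂ (-z)) := fun Y ψ ↦ by
    obtain ⟨v, hv, hve⟩ := exists_isGreenConvolution_of_integrable hG (hi Y)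
      (mulFun_apply (hA Y) (hi Y)) (R := R) (fun x hx ↦ by rw [hqR x hx, zero_mul])
    rw [potentialOp, hv.resolventOp_eq, hve]
  have hi' : ∀ Y (ψ : 𝓢(Space d, ℂ)), Integrable fun z ↦
      q z * (weight K z * A Y z) * G (ψ.compSubConstCLM ℂ (-z)) := fun Y ψ ↦ by
    obtain ⟨p, -, -, hp⟩ := exists_norm_apply_translate_le G R
    refine ((hi Y).norm.mul_const (p ψ)).mono' ((hi Y).1.mul
      (contDiff_apply_translate G ψ).continuous.aestronglyMeasurable)
      (Eventually.of_forall fun x ↦ ?_)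
    rw [norm_mul]
    by_cases hx : ‖x‖ ≤ R
    · gcongr; exact hp ψ x hx
    · rw [hqR x (not_le.1 hx)]; simp
  refine ⟨{ toFun := fun Y ↦ potentialOp α k q (sobolevMap t (-s) Y)
            map_add' := fun Y Y' ↦ ?_
            map_smul' := fun c Y ↦ ?_ }, fun Y ↦ rfl⟩
  · ext ψ
    rw [add_apply, hv, hv, hv, ← integral_add (hi' Y ψ) (hi' Y' ψ), map_add]
    refine integral_congr_ae ?_
    filter_upwards [Lp.coeFn_add (A Y) (A Y')] with x hx
    rw [hx, Pi.add_apply]; ring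
  · ext ψ
    rw [RingHom.id_apply, smul_apply, hv, hv, map_smul, smul_eq_mul, ← integral_const_mul]
    refine integral_congr_ae ?_
    filter_upwards [Lp.coeFn_smul c (A Y)] with x hx
    rw [hx, Pi.smul_apply, smul_eq_mul]; ring

/-- The potential operator on `H^t_{-s}` as a contraction of `L²`. -/
theorem exists_potentialOp_eq {α k t s : ℝ} (ht : 0 ≤ t) {G : 𝓢'(Space d, ℂ)}
    (hG : ∀ ψ, G ψ = green α k ψ) {U : Set (Space d)} {q : Space d → ℂ}
    (hU : Bornology.IsBounded U) (hq : MemLp q 2 volume) (hqU : Function.support q ⊆ U)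
    {ρ : ℝ≥0} (hρ : potentialOpNorm α k q t (-s) ≤ ρ) :
    ∃ T : Lp ℂ 2 (volume : Measure (Space d)) →L[ℂ] Lp ℂ 2 (volume : Measure (Space d)),
      ‖T‖ ≤ ρ ∧ ∀ Y, potentialOp α k q (sobolevMap t (-s) Y) = sobolevMap t (-s) (T Y) := by
  obtain ⟨L, hL⟩ := exists_linearMap_potentialOp (s := s) ht hG hU hq hqU
  have h1 : ∀ Y, ‖Y‖ ≤ 1 → sobolevNorm t (-s) (L Y) ≤ ρ := fun Y hY ↦ by
    rw [hL]
    refine le_trans ?_ hρ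
    refine le_iSup₂_of_le (sobolevMap t (-s) Y) ?_ le_rfl
    rw [sobolevNorm_sobolevMap]
    exact (enorm_le_coe (r := 1)).2 hY
  have h2 : ∀ Y, ‖Y‖ ≤ 1 → ∃ Z, L Y = sobolevMap t (-s) Z ∧ ‖Z‖ ≤ ρ := fun Y hY ↦ by
    obtain ⟨Z, hZ⟩ := exists_sobolevMap_of_sobolevNorm_lt_top
      ((h1 Y hY).trans_lt ENNReal.coe_lt_top)
    refine ⟨Z, hZ, ?_⟩
    have := h1 Y hY
    rw [hZ, sobolevNorm_sobolevMap] at this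
    exact_mod_cast (enorm_le_coe.1 this)
  -- The operator norm is a supremum over the unit ball; scale.
  have h3 : ∀ Y, ∃ Z, L Y = sobolevMap t (-s) Z ∧ ‖Z‖ ≤ ρ * ‖Y‖ := fun Y ↦ by
    by_cases hY : Y = 0
    · exact ⟨0, by simp [hY], by simp [hY]⟩
    have hY' : ‖Y‖ ≠ 0 := norm_ne_zero_iff.2 hY
    obtain ⟨Z, hZ, hZn⟩ := h2 (((‖Y‖⁻¹ : ℝ) : ℂ) • Y) (by
      rw [norm_smul, Complex.norm_real, norm_inv, norm_norm, inv_mul_cancel₀ hY'])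
    refine ⟨((‖Y‖ : ℝ) : ℂ) • Z, ?_, ?_⟩
    · rw [map_smul, ← hZ, map_smul, smul_smul, ← Complex.ofReal_mul, mul_inv_cancel₀ hY',
        Complex.ofReal_one, one_smul]
    · rw [norm_smul, Complex.norm_real, norm_norm, mul_comm]
      gcongr
  choose T hT hTn using h3
  let T' : Lp ℂ 2 (volume : Measure (Space d)) →ₗ[ℂ] Lp ℂ 2 (volume : Measure (Space d)) :=
    { toFun := T
      map_add' := fun Y Y' ↦ sobolevMap_injective t (-s) (by
        rw [map_add, ← hT, ← hT, ← hT, map_add])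
      map_smul' := fun c Y ↦ sobolevMap_injective t (-s) (by
        rw [RingHom.id_apply, map_smul, ← hT, ← hT, map_smul]) }
  exact ⟨T'.mkContinuous ρ hTn, T'.mkContinuous_norm_le ρ.2 _, fun Y ↦ by
    rw [← hL, hT]; rfl⟩

/-- The Neumann series: `I + T` is invertible for a contraction `T`. -/
theorem exists_inverse_one_add {T : Lp ℂ 2 (volume : Measure (Space d)) →L[ℂ]
    Lp ℂ 2 (volume : Measure (Space d))} {ρ : ℝ} (hT : ‖T‖ ≤ ρ) (hρ : ρ < 1) :
    ∃ R : Lp ℂ 2 (volume : Measure (Space d)) →L[ℂ] Lp ℂ 2 (volume : Measure (Space d)),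
      (∀ Y, R Y + T (R Y) = Y) ∧ (∀ Y, ‖R Y‖ ≤ (1 - ρ)⁻¹ * ‖Y‖) ∧
      ∀ Y Z, Z + T Z = Y → Z = R Y := by
  have hT1 : ‖-T‖ < 1 := by rw [norm_neg]; exact hT.trans_lt hρ
  set u := Units.oneSub (-T) hT1 with hu
  have hu' : (u : Lp ℂ 2 (volume : Measure (Space d)) →L[ℂ]
      Lp ℂ 2 (volume : Measure (Space d))) = 1 + T := by rw [hu, Units.val_oneSub, sub_neg_eq_add]
  have e1 : ∀ Y, (↑u⁻¹ : _ →L[ℂ] Lp ℂ 2 (volume : Measure (Space d))) Y +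
      T ((↑u⁻¹ : _ →L[ℂ] Lp ℂ 2 (volume : Measure (Space d))) Y) = Y := fun Y ↦ by
    have := congrArg (fun S : _ →L[ℂ] Lp ℂ 2 (volume : Measure (Space d)) ↦ S Y) u.mul_inv
    rw [hu'] at this
    exact this
  have e2 : ∀ Z, (↑u⁻¹ : _ →L[ℂ] Lp ℂ 2 (volume : Measure (Space d))) (Z + T Z) = Z := fun Z ↦ by
    have := congrArg (fun S : _ →L[ℂ] Lp ℂ 2 (volume : Measure (Space d)) ↦ S Z) u.inv_mul
    rw [hu'] at this
    exact this
  refine ⟨(↑u⁻¹ : _ →L[ℂ] Lp ℂ 2 (volume : Measure (Space d))), e1, fun Y ↦ ?_, fun Y Z h ↦ ?_⟩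
  · set Z := (↑u⁻¹ : _ →L[ℂ] Lp ℂ 2 (volume : Measure (Space d))) Y
    have h1 : ‖Z‖ ≤ ‖Y‖ + ρ * ‖Z‖ := by
      calc ‖Z‖ = ‖Y - T Z‖ := congrArg _ (eq_sub_of_add_eq (e1 Y))
        _ ≤ ‖Y‖ + ‖T Z‖ := norm_sub_le _ _
        _ ≤ _ := by gcongr; exact T.le_of_opNorm_le hT Z
    rw [inv_mul_eq_div, le_div_iff₀ (by linarith)]
    linarith
  · rw [← h, e2]

section

open FourierTransform

/-! ### Distributions localised in frequency -/

/-- Fourier inversion. -/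
theorem ft_ftS (θ : 𝓢(Space d, ℂ)) (ξ : Space d) :
    ft (ftS θ) ξ = (((2 * Real.pi) ^ d : ℝ) : ℂ) * θ (-ξ) := by
  have hπ := Real.pi_pos
  have h1 : θ (-ξ) = 𝓕⁻ (𝓕 (θ : Space d → ℂ)) (-ξ) := by
    rw [← SchwartzMap.fourier_coe, ← SchwartzMap.fourierInv_coe,
      FourierTransform.fourierInv_fourier_eq]
  have h2 := Measure.integral_comp_inv_smul_of_nonneg (volume : Measure (Space d))
    (fun y ↦ Complex.exp (((2 * Real.pi * ⟪y, -ξ⟫_ℝ : ℝ) : ℂ) * Complex.I) • 𝓕 (θ : Space d → ℂ) y)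
    (R := 2 * Real.pi) (by positivity)
  rw [finrank_euclideanSpace_fin, ← Real.fourierInv_eq', ← h1, Complex.real_smul] at h2
  rw [← h2, ft]
  congr 1; ext x
  rw [ftS_eq_fourier, SchwartzMap.fourier_coe, smul_eq_mul, real_inner_smul_left, inner_neg_right]
  congr 2
  have : (Real.pi : ℂ) ≠ 0 := by exact_mod_cast hπ.ne'
  push_cast
  field_simp

theorem ftS_surjective : Function.Surjective (ftS : 𝓢(Space d, ℂ) → 𝓢(Space d, ℂ)) := fun b ↦ by
  have hπ := Real.pi_pos
  refine ⟨((((2 * Real.pi) ^ d : ℝ) : ℂ))⁻¹ • negS (ftS b), SchwartzMap.ext fun x ↦ ?_⟩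
  rw [map_smul, smul_apply, ftS_apply, ft_negS, ft_ftS, neg_neg, smul_eq_mul, inv_mul_cancel_left₀]
  exact_mod_cast (by positivity : (2 * Real.pi) ^ d ≠ 0)

theorem weight_neg (s : ℝ) (x : Space d) : weight s (-x) = weight s x := by
  simp [weight, bracket]

theorem ftS_smulLeft_weight (s : ℝ) (θ : 𝓢(Space d, ℂ)) :
    ftS (SchwartzMap.smulLeftCLM ℂ (weight s) θ) = besselS s (ftS θ) := ft_injective fun ξ ↦ by
  rw [ft_ftS, ft_besselS, ft_ftS, SchwartzMap.smulLeftCLM_apply_apply (by fun_prop), weight_neg,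
    smul_eq_mul]
  ring

/-- The test function `g(x) e^{-i x·ξ}`, where the Fourier transform of `κ` is one on the support of
`g`, in a form which makes it a convolution kernel. -/
def modulated (g : Space d → ℂ) (κ : 𝓢(Space d, ℂ)) (ξ : Space d) : 𝓢(Space d, ℂ) :=
  SchwartzMap.smulLeftCLM ℂ g (ftS (κ.compSubConstCLM ℂ ξ))

theorem modulated_apply {g κ : 𝓢(Space d, ℂ)} (hκ : ∀ x, g x ≠ 0 → ftS κ x = 1) (ξ x : Space d) :
    modulated g κ ξ x = g x * Complex.exp (-(Complex.I * (⟪ξ, x⟫_ℝ : ℂ))) := by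
  rw [modulated, schwartz_smulLeft_apply, ftS_apply, ft_translate, ← ftS_apply]
  by_cases h : g x = 0
  · simp [h]
  · rw [hκ x h, mul_one]

/-- The Fourier transform `θ ↦ T(g θ̂)` of the product `g T`. -/
def localFourier (T : 𝓢'(Space d, ℂ)) (g : Space d → ℂ) : 𝓢'(Space d, ℂ) :=
  ContinuousLinearMap.toPointwiseConvergenceCLM _ _ _ _
    ⟨(T : 𝓢(Space d, ℂ) →ₗ[ℂ] ℂ) ∘ₗ
      (SchwartzMap.smulLeftCLM ℂ g ∘L ftS : 𝓢(Space d, ℂ) →L[ℂ] 𝓢(Space d, ℂ)).toLinearMap,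
      (continuous_temperedDistribution T).comp
        (SchwartzMap.smulLeftCLM ℂ g ∘L ftS : 𝓢(Space d, ℂ) →L[ℂ] 𝓢(Space d, ℂ)).continuous⟩

theorem localFourier_apply (T : 𝓢'(Space d, ℂ)) (g : Space d → ℂ) (θ : 𝓢(Space d, ℂ)) :
    localFourier T g θ = T (SchwartzMap.smulLeftCLM ℂ g (ftS θ)) := rfl

theorem continuous_apply_modulated (T : 𝓢'(Space d, ℂ)) (g : Space d → ℂ) (κ : 𝓢(Space d, ℂ)) :
    Continuous fun ξ ↦ T (modulated g κ ξ) :=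
  continuous_apply_translate (localFourier T g) κ

/-- The Fourier transform of `g T` is the function `ξ ↦ T(g e^{-i x·ξ})`. -/
theorem apply_smulLeft_ftS (T : 𝓢'(Space d, ℂ)) {g κ : 𝓢(Space d, ℂ)}
    (hκ : ∀ x, g x ≠ 0 → ftS κ x = 1) {θ : 𝓢(Space d, ℂ)} (hθ : HasCompactSupport θ) :
    T (SchwartzMap.smulLeftCLM ℂ g (ftS θ)) = ∫ ξ, θ ξ * T (modulated g κ ξ) := by
  have h := apply_conv (localFourier T g) θ κ hθ
  simp only [localFourier_apply] at h
  rw [show (fun ξ ↦ θ ξ * T (modulated g κ ξ)) = fun ξ ↦ θ ξ *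
    T (SchwartzMap.smulLeftCLM ℂ g (ftS (κ.compSubConstCLM ℂ ξ))) from rfl, ← h]
  congr 1; ext x
  rw [schwartz_smulLeft_apply, schwartz_smulLeft_apply, ftS_apply _ x, ftS_apply _ x, ft_conv,
    ← ftS_apply κ]
  by_cases hx : g x = 0
  · simp [hx]
  · rw [hκ x hx, mul_one]

/-- If the Fourier transform of `g T` is square integrable with the weight `⟨ξ⟩^{-t}`, then `g T`
belongs to `H^{-t}`. -/
theorem exists_norm_apply_smulLeft_besselS_le {T : 𝓢'(Space d, ℂ)} {g κ : 𝓢(Space d, ℂ)}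
    (hκ : ∀ x, g x ≠ 0 → ftS κ x = 1) {t : ℝ}
    (h : MemLp (fun ξ ↦ weight (-t) ξ * T (modulated g κ ξ)) 2 volume) :
    ∃ M, 0 ≤ M ∧ ∀ a, ‖T (SchwartzMap.smulLeftCLM ℂ g (besselS (-t) a))‖ ≤ M * l2Norm a := by
  have hπ := Real.pi_pos
  have h1 : ∀ θ : 𝓢(Space d, ℂ), HasCompactSupport θ →
      ‖T (SchwartzMap.smulLeftCLM ℂ g (ftS θ))‖ ≤
        ‖h.toLp _‖ * l2Norm (SchwartzMap.smulLeftCLM ℂ (weight t) θ) := fun θ hθ ↦ by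
    rw [apply_smulLeft_ftS T hκ hθ]
    refine le_trans (le_of_eq ?_) (norm_integral_mul_toLp_le (h.toLp _) _)
    congr 1
    refine integral_congr_ae ?_
    filter_upwards [h.coeFn_toLp] with ξ hξ
    have := weight_mul_weight t (-t) ξ
    rw [add_neg_cancel, weight_zero] at this
    rw [hξ, SchwartzMap.smulLeftCLM_apply_apply (by fun_prop), smul_eq_mul]
    linear_combination (-(θ ξ * T (modulated g κ ξ))) * this
  have h2 : ∀ θ : 𝓢(Space d, ℂ), ‖T (SchwartzMap.smulLeftCLM ℂ g (ftS θ))‖ ≤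
        ‖h.toLp _‖ * l2Norm (SchwartzMap.smulLeftCLM ℂ (weight t) θ) := fun θ ↦ by
    obtain ⟨χ, hχ, hlim⟩ := exists_compactSupport_tendsto θ
    have e1 : Continuous fun θ : 𝓢(Space d, ℂ) ↦ ‖T (SchwartzMap.smulLeftCLM ℂ g (ftS θ))‖ :=
      (continuous_temperedDistribution (localFourier T g)).norm
    have e2 : Continuous fun θ : 𝓢(Space d, ℂ) ↦
        ‖h.toLp _‖ * l2Norm (SchwartzMap.smulLeftCLM ℂ (weight t) θ) :=
      continuous_const.mul ((SchwartzMap.toLpCLM ℂ ℂ 2 volume ∘L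
        SchwartzMap.smulLeftCLM ℂ (weight t)).continuous.norm)
    refine le_of_tendsto_of_tendsto' ((e1.tendsto θ).comp hlim) ((e2.tendsto θ).comp hlim)
      fun N ↦ h1 _ ?_
    exact (hχ N).of_isClosed_subset (isClosed_tsupport _)
      ((SchwartzMap.tsupport_smulLeftCLM_subset _ _).trans inter_subset_right)
  refine ⟨‖h.toLp _‖ * (Real.sqrt ((2 * Real.pi) ^ d))⁻¹, by positivity, fun a ↦ ?_⟩
  obtain ⟨θ, hθ⟩ := ftS_surjective (besselS (-t) a)
  have h3 := l2Norm_ftS (SchwartzMap.smulLeftCLM ℂ (weight t) θ)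
  rw [ftS_smulLeft_weight, hθ, besselS_besselS, add_neg_cancel, besselS_zero] at h3
  rw [← hθ, h3, mul_assoc, inv_mul_cancel_left₀ (by positivity)]
  exact h2 θ

/-! ### The second moments of a microlocally isotropic field -/

theorem one_add_norm_le_bracket (x : Space d) : 1 + ‖x‖ ≤ 2 * bracket x := by
  have h : ‖x‖ ≤ bracket x := Real.le_sqrt_of_sq_le (by linarith)
  linarith [one_le_bracket x]

theorem integrable_one_add_norm_rpow_mul (r : ℝ) (a : 𝓢(Space d, ℂ)) :
    Integrable fun η ↦ (1 + ‖η‖) ^ r * ‖a η‖ := by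
  have hc : Continuous fun η : Space d ↦ (1 + ‖η‖) ^ r :=
    (by fun_prop : Continuous fun η : Space d ↦ 1 + ‖η‖).rpow_const
      fun η ↦ Or.inl (by positivity)
  refine ((SchwartzMap.smulLeftCLM ℂ (weight |r|) a).integrable.norm.const_mul (2 ^ |r|)).mono'
    (hc.mul a.continuous.norm).aestronglyMeasurable (Eventually.of_forall fun η ↦ ?_)
  rw [SchwartzMap.smulLeftCLM_apply_apply (by fun_prop), norm_smul, norm_weight, norm_mul,
    norm_norm, Real.norm_of_nonneg (by positivity), ← mul_assoc,
    ← Real.mul_rpow (by norm_num) (bracket_pos η).le]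
  gcongr
  calc (1 + ‖η‖) ^ r ≤ (1 + ‖η‖) ^ |r| :=
        Real.rpow_le_rpow_of_exponent_le (by linarith [norm_nonneg η]) (le_abs_self r)
    _ ≤ _ := Real.rpow_le_rpow (by positivity) (one_add_norm_le_bracket η) (abs_nonneg r)

/-- Peetre's inequality. -/
theorem one_add_norm_add_rpow_le (r : ℝ) (η ξ : Space d) :
    (1 + ‖η + ξ‖) ^ r ≤ (1 + ‖ξ‖) ^ r * (1 + ‖η‖) ^ |r| := by
  have h0 := norm_nonneg η
  have h1 := norm_nonneg ξ
  have h2 := norm_nonneg (η + ξ)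
  rcases le_total 0 r with hr | hr
  · rw [abs_of_nonneg hr, ← Real.mul_rpow (by positivity) (by positivity)]
    refine Real.rpow_le_rpow (by positivity) ?_ hr
    nlinarith [norm_add_le η ξ, mul_nonneg h0 h1]
  · have h3 : ‖ξ‖ ≤ ‖η + ξ‖ + ‖η‖ := by
      have := norm_sub_le (η + ξ) η
      rwa [add_sub_cancel_left] at this
    rw [abs_of_nonpos hr, Real.rpow_neg (by positivity), ← div_eq_mul_inv,
      ← Real.div_rpow (by positivity) (by positivity)]
    refine Real.rpow_le_rpow_of_nonpos (by positivity) ?_ hr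
    rw [div_le_iff₀ (by positivity)]
    nlinarith [mul_nonneg h0 h2]

theorem conjTest_apply (φ : 𝓢(Space d, ℂ)) (x : Space d) :
    conjTest φ x = (starRingEnd ℂ) (φ x) := rfl

variable {Ω : Type*} [MeasurableSpace Ω] {P : Measure Ω} {D : Set (Space d)} {m : ℝ}
  {f : Ω → 𝓢'(Space d, ℂ)}

/-- A bound for second moments, from the covariance operator applied to `conj ψ` and the size of its
symbol. -/
theorem IsGMIGField.exists_integral_norm_sq_le (hf : IsGMIGField P D m f) :
    ∃ C, 0 ≤ C ∧ ∀ ψ : 𝓢(Space d, ℂ), HasCompactSupport ψ → ∫ ω, ‖f ω ψ‖ ^ 2 ∂P ≤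
      C * ((∫ η, (1 + ‖η‖) ^ (-m) * ‖ft (conjTest ψ) η‖) * ∫ x, ‖ψ x‖) := by
  have hπ := Real.pi_pos
  obtain ⟨σ, ⟨⟨-, hσ⟩, -⟩, hcov⟩ := hf.covariance
  obtain ⟨C, hC⟩ := hσ 0 0
  have hσ' : ∀ x ξ, ‖σ x ξ‖ ≤ |C| * (1 + ‖ξ‖) ^ (-m) := fun x ξ ↦ by
    have := hC x ξ
    rw [norm_iteratedFDeriv_zero, norm_iteratedFDeriv_zero, Nat.cast_zero, sub_zero] at this
    exact this.trans (by gcongr; exact le_abs_self C)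
  refine ⟨((2 * Real.pi) ^ d)⁻¹ * |C|, by positivity, fun ψ hψ ↦ ?_⟩
  set I := ∫ η, (1 + ‖η‖) ^ (-m) * ‖ft (conjTest ψ) η‖ with hI
  have hi : Integrable fun η ↦ (1 + ‖η‖) ^ (-m) * ‖ft (conjTest ψ) η‖ := by
    simpa only [ftS_apply] using integrable_one_add_norm_rpow_mul (-m) (ftS (conjTest ψ))
  have hpd : ∀ x, ‖pseudoDiff σ (conjTest ψ) x‖ ≤ ((2 * Real.pi) ^ d)⁻¹ * |C| * I := fun x ↦ by
    rw [pseudoDiff, norm_mul, norm_inv, Complex.norm_real, Real.norm_of_nonneg (by positivity),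
      mul_assoc, hI, ← integral_const_mul]
    gcongr
    refine norm_integral_le_of_norm_le (hi.const_mul _) (Eventually.of_forall fun η ↦ ?_)
    have e : ‖Complex.exp (Complex.I * (⟪x, η⟫_ℝ : ℂ))‖ = 1 := by
      rw [mul_comm]; exact Complex.norm_exp_ofReal_mul_I _
    rw [norm_mul, norm_mul, e, one_mul, ← mul_assoc]
    gcongr
    exact hσ' x η
  have hcc : HasCompactSupport (conjTest ψ) := hψ.comp_left (g := starRingEnd ℂ) (map_zero _)
  have h1 := hcov (conjTest ψ) ψ hcc hψ
  have e1 : conjTest (conjTest ψ) = ψ := SchwartzMap.ext fun x ↦ by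
    rw [conjTest_apply, conjTest_apply, Complex.conj_conj]
  have e2 : ∫ ω, (starRingEnd ℂ) (f ω (conjTest (conjTest ψ))) * f ω ψ ∂P =
      ((∫ ω, ‖f ω ψ‖ ^ 2 ∂P : ℝ) : ℂ) := by
    rw [← integral_complex_ofReal]
    congr 1; ext ω
    rw [e1, Complex.conj_mul']; push_cast; rfl
  have h2 : ∫ ω, ‖f ω ψ‖ ^ 2 ∂P = ‖∫ x, pseudoDiff σ (conjTest ψ) x * ψ x‖ := by
    rw [← h1, e2, Complex.norm_real, Real.norm_of_nonneg (integral_nonneg fun ω ↦ by positivity)]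
  rw [h2, ← mul_assoc, ← integral_const_mul]
  refine norm_integral_le_of_norm_le (ψ.integrable.norm.const_mul _)
    (Eventually.of_forall fun x ↦ ?_)
  rw [norm_mul]
  gcongr
  exact hpd x

theorem ft_conjTest_modulated {g κ : 𝓢(Space d, ℂ)} (hκ : ∀ x, g x ≠ 0 → ftS κ x = 1)
    (ξ η : Space d) : ft (conjTest (modulated g κ ξ)) η = ft (conjTest g) (η - ξ) := by
  rw [ft, ft]
  congr 1; ext x
  rw [conjTest_apply, conjTest_apply, modulated_apply hκ, map_mul, ← Complex.exp_conj, map_neg,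
    map_mul, Complex.conj_I, Complex.conj_ofReal, mul_left_comm, ← Complex.exp_add, mul_comm,
    inner_sub_right, real_inner_comm x ξ]
  congr 2
  push_cast; ring

/-- The second moments of the Fourier transform of the localised field decay like `⟨ξ⟩^{-m}`:
conjugating with the exponential shifts the frequency by `ξ`, and Peetre's inequality moves the
shift out of the integral. -/
theorem IsGMIGField.exists_integral_modulated_le (hf : IsGMIGField P D m f) {g κ : 𝓢(Space d, ℂ)}
    (hg : HasCompactSupport g) (hκ : ∀ x, g x ≠ 0 → ftS κ x = 1) :
    ∃ C, 0 ≤ C ∧ ∀ ξ, ∫ ω, ‖f ω (modulated g κ ξ)‖ ^ 2 ∂P ≤ C * (1 + ‖ξ‖) ^ (-m) := by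
  obtain ⟨C, hC, h⟩ := hf.exists_integral_norm_sq_le
  have hi : ∀ r : ℝ, Integrable fun η ↦ (1 + ‖η‖) ^ r * ‖ft (conjTest g) η‖ := fun r ↦ by
    simpa only [ftS_apply] using integrable_one_add_norm_rpow_mul r (ftS (conjTest g))
  set I := ∫ η, (1 + ‖η‖) ^ |(-m)| * ‖ft (conjTest g) η‖ with hI
  have hI0 : 0 ≤ I := integral_nonneg fun η ↦ by positivity
  refine ⟨C * (I * ∫ x, ‖g x‖), by positivity, fun ξ ↦ (h _ ?_).trans ?_⟩
  · exact hg.of_isClosed_subset (isClosed_tsupport _)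
      ((SchwartzMap.tsupport_smulLeftCLM_subset _ _).trans inter_subset_right)
  have e1 : ∫ x, ‖modulated g κ ξ x‖ = ∫ x, ‖g x‖ := by
    congr 1; ext x
    rw [modulated_apply hκ, norm_mul, ← mul_neg, mul_comm Complex.I, ← Complex.ofReal_neg,
      Complex.norm_exp_ofReal_mul_I, mul_one]
  have e2 : ∫ η, (1 + ‖η‖) ^ (-m) * ‖ft (conjTest (modulated g κ ξ)) η‖ ≤
      (1 + ‖ξ‖) ^ (-m) * I := by
    rw [← integral_add_right_eq_self _ ξ, hI, ← integral_const_mul]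
    refine integral_mono_of_nonneg (Eventually.of_forall fun η ↦ by beta_reduce; positivity)
      ((hi _).const_mul _) (Eventually.of_forall fun η ↦ ?_)
    beta_reduce
    rw [ft_conjTest_modulated hκ, add_sub_cancel_right, ← mul_assoc]
    gcongr
    exact one_add_norm_add_rpow_le _ _ _
  rw [e1]
  calc C * ((∫ η, (1 + ‖η‖) ^ (-m) * ‖ft (conjTest (modulated g κ ξ)) η‖) * ∫ x, ‖g x‖)
      ≤ C * (((1 + ‖ξ‖) ^ (-m) * I) * ∫ x, ‖g x‖) := by gcongr
    _ = _ := by ring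

/-- A random continuous function, which for each argument is a random variable, is jointly
measurable after it has been set to zero on a null set. -/
theorem exists_measurable_uncurry_indicator {H : Space d → Ω → ℂ}
    (hc : ∀ ω, Continuous fun ξ ↦ H ξ ω) (hm : ∀ ξ, AEMeasurable (H ξ) P) :
    ∃ N, MeasurableSet N ∧ P N = 0 ∧ Measurable (Function.uncurry fun ξ ↦ Nᶜ.indicator (H ξ)) := by
  -- outside a null set `H` agrees on a countable dense set with measurable functions
  have h1 : ∀ᵐ ω ∂P, ∀ n, H (TopologicalSpace.denseSeq (Space d) n) ω =
      (hm (TopologicalSpace.denseSeq (Space d) n)).mk _ ω :=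
    ae_all_iff.2 fun n ↦ (hm _).ae_eq_mk
  obtain ⟨N, hN, hNm, hN0⟩ := exists_measurable_superset_of_null (ae_iff.1 h1)
  have hNω : ∀ ω, ω ∉ N → ∀ n, H (TopologicalSpace.denseSeq (Space d) n) ω =
      (hm (TopologicalSpace.denseSeq (Space d) n)).mk _ ω := fun ω hω ↦ by
    by_contra h; exact hω (hN h)
  let H' : Space d → Ω → ℂ := fun ξ ↦ Nᶜ.indicator (H ξ)
  have hc' : ∀ ω, Continuous fun ξ ↦ H' ξ ω := fun ω ↦ by
    by_cases hω : ω ∈ N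
    · simpa [H', hω] using continuous_const
    · simpa [H', hω] using hc ω
  have hmd : ∀ n, Measurable (H' (TopologicalSpace.denseSeq (Space d) n)) := fun n ↦ by
    have : H' (TopologicalSpace.denseSeq (Space d) n) =
        Nᶜ.indicator ((hm (TopologicalSpace.denseSeq (Space d) n)).mk _) := by
      ext ω
      by_cases hω : ω ∈ N
      · simp [H', hω]
      · simp [H', hω, hNω ω hω n]
    rw [this]
    exact (hm _).measurable_mk.indicator hNm.compl
  have hm' : ∀ ξ, Measurable (H' ξ) := fun ξ ↦ by
    obtain ⟨x, hx, hlim⟩ := mem_closure_iff_seq_limit.1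
      (TopologicalSpace.denseRange_denseSeq (Space d) ξ)
    choose n hn using hx
    refine measurable_of_tendsto_metrizable (f := fun j ↦ H' (x j)) (fun j ↦ ?_)
      (tendsto_pi_nhds.2 fun ω ↦ ((hc' ω).tendsto ξ).comp hlim)
    rw [← hn j]; exact hmd _
  exact ⟨N, hNm, hN0, measurable_uncurry_of_continuous_of_measurable hc' hm'⟩

/-- A random continuous function whose second moments are bounded by an integrable function is
almost surely square integrable. -/
theorem ae_memLp_two_of_continuous [SFinite P] {H : Space d → Ω → ℂ}
    (hc : ∀ ω, Continuous fun ξ ↦ H ξ ω) (hm : ∀ ξ, AEMeasurable (H ξ) P) {w : Space d → ℝ}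
    (hw : Integrable w) (hb : ∀ ξ, ∫⁻ ω, ‖H ξ ω‖ₑ ^ 2 ∂P ≤ ENNReal.ofReal (w ξ)) :
    ∀ᵐ ω ∂P, MemLp (fun ξ ↦ H ξ ω) 2 volume := by
  obtain ⟨N, hNm, hN0, hu⟩ := exists_measurable_uncurry_indicator hc hm
  have hfin : ∫⁻ ω, ∫⁻ ξ, ‖Nᶜ.indicator (H ξ) ω‖ₑ ^ 2 ∂volume ∂P < ∞ := by
    rw [lintegral_lintegral_swap (f := fun ω ξ ↦ ‖Nᶜ.indicator (H ξ) ω‖ₑ ^ 2)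
      ((hu.comp measurable_swap).enorm.pow_const 2).aemeasurable]
    refine lt_of_le_of_lt (lintegral_mono fun ξ ↦ ?_) (hw.lintegral_lt_top)
    refine (lintegral_mono fun ω ↦ ?_).trans (hb ξ)
    by_cases hω : ω ∈ N
    · simp [hω]
    · simp [hω]
  have hme : Measurable fun ω ↦ ∫⁻ ξ, ‖Nᶜ.indicator (H ξ) ω‖ₑ ^ 2 ∂volume :=
    Measurable.lintegral_prod_right ((hu.comp measurable_swap).enorm.pow_const 2)
  filter_upwards [ae_lt_top hme hfin.ne, measure_eq_zero_iff_ae_notMem.1 hN0] with ω hω hωN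
  refine (memLp_two_iff_integrable_sq_norm (hc ω).aestronglyMeasurable).2
    ⟨(hc ω).norm.pow 2 |>.aestronglyMeasurable, ?_⟩
  refine lt_of_eq_of_lt (lintegral_congr fun ξ ↦ ?_) hω
  rw [enorm_pow, enorm_norm, indicator_of_mem (mem_compl hωN)]

end

variable {Ω : Type*} [MeasurableSpace Ω] {P : Measure Ω} {D : Set (Space d)} {m : ℝ}
  {f : Ω → 𝓢'(Space d, ℂ)}

/-- Almost surely `⟨ξ⟩^{-t}` times the Fourier transform of `g f` is square integrable, since its
expected square is `O(⟨ξ⟩^{-2t-m})` with `2t + m > d`. -/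
theorem IsGMIGField.ae_memLp_modulated [IsProbabilityMeasure P] (hf : IsGMIGField P D m f)
    {g κ : 𝓢(Space d, ℂ)} (hg : HasCompactSupport g) (hκ : ∀ x, g x ≠ 0 → ftS κ x = 1) {t : ℝ}
    (ht : 0 ≤ t) (htm : (d : ℝ) < 2 * t + m) :
    ∀ᵐ ω ∂P, MemLp (fun ξ ↦ weight (-t) ξ * f ω (modulated g κ ξ)) 2 volume := by
  obtain ⟨C, hC, hCb⟩ := hf.exists_integral_modulated_le hg hκ
  have hmc : ∀ ξ, HasCompactSupport (modulated g κ ξ) := fun ξ ↦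
    hg.of_isClosed_subset (isClosed_tsupport _)
      ((SchwartzMap.tsupport_smulLeftCLM_subset _ _).trans inter_subset_right)
  have hw : Integrable fun ξ : Space d ↦ 2 ^ (2 * t) * C * (1 + ‖ξ‖) ^ (-(2 * t + m)) :=
    (integrable_one_add_norm (by rwa [finrank_euclideanSpace_fin])).const_mul _
  refine ae_memLp_two_of_continuous
    (fun ω ↦ (weight_continuous _).mul (continuous_apply_modulated (f ω) g κ))
    (fun ξ ↦ (hf.gaussian _ (hmc ξ)).aemeasurable.const_mul _) hw fun ξ ↦ ?_
  have h2 := (hf.gaussian _ (hmc ξ)).memLp_two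
  have hi : Integrable (fun ω ↦ ‖weight (-t) ξ * f ω (modulated g κ ξ)‖ ^ 2) P :=
    (memLp_two_iff_integrable_sq_norm (h2.1.const_mul _)).1 (h2.const_mul _)
  have e : ∫⁻ ω, ‖weight (-t) ξ * f ω (modulated g κ ξ)‖ₑ ^ 2 ∂P =
      ENNReal.ofReal (∫ ω, ‖weight (-t) ξ * f ω (modulated g κ ξ)‖ ^ 2 ∂P) := by
    rw [ofReal_integral_eq_lintegral_ofReal hi (Eventually.of_forall fun ω ↦ by positivity)]
    refine lintegral_congr fun ω ↦ ?_
    rw [ENNReal.ofReal_pow (norm_nonneg _), ofReal_norm]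
  rw [e]
  refine ENNReal.ofReal_le_ofReal ?_
  have hb := bracket_pos ξ
  have h1 : bracket ξ ^ (-t) ≤ 2 ^ t * (1 + ‖ξ‖) ^ (-t) := by
    rw [Real.rpow_neg hb.le, Real.rpow_neg (by positivity), ← div_eq_mul_inv,
      ← Real.div_rpow (by norm_num) (by positivity), ← Real.inv_rpow hb.le]
    refine Real.rpow_le_rpow (by positivity) ?_ ht
    rw [inv_eq_one_div, div_le_div_iff₀ hb (by positivity), one_mul]
    exact one_add_norm_le_bracket ξ
  simp only [norm_mul, norm_weight, mul_pow]
  rw [integral_const_mul]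
  calc (bracket ξ ^ (-t)) ^ 2 * ∫ ω, ‖f ω (modulated g κ ξ)‖ ^ 2 ∂P
      ≤ (2 ^ t * (1 + ‖ξ‖) ^ (-t)) ^ 2 * (C * (1 + ‖ξ‖) ^ (-m)) := by
        gcongr; exact hCb ξ
    _ = (2 ^ t * 2 ^ t) * C * (((1 + ‖ξ‖) ^ (-t) * (1 + ‖ξ‖) ^ (-t)) * (1 + ‖ξ‖) ^ (-m)) := by ring
    _ = _ := by
        rw [← Real.rpow_add (by norm_num), ← Real.rpow_add (by positivity),
          ← Real.rpow_add (by positivity)]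
        congr 2 <;> ring_nf

/-- A microlocally isotropic field of order `-m` with compact support almost surely belongs to
`H^{-t}_s` for every `t > (d - m) / 2` and every `s`. -/
theorem IsGMIGField.ae_exists_sobolevMap [IsProbabilityMeasure P] (hf : IsGMIGField P D m f)
    (hd : 0 < d) (hD : Bornology.IsBounded D) (hfD : ∀ᵐ ω ∂P, Distribution.dsupport (f ω) ⊆ D)
    {t : ℝ} (ht : 0 ≤ t) (htm : (d : ℝ) < 2 * t + m) (s : ℝ) :
    ∀ᵐ ω ∂P, ∃ Y, f ω = sobolevMap (-t) s Y := by
  obtain ⟨K, hK⟩ := exists_nat_ge s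
  -- `χ` is one near `D`, and the Fourier transform of `κ` is one near the support of `χ`.
  obtain ⟨χ, hχ, -, ⟨V, hV, hDV, hV1⟩, -⟩ := exists_smooth_cutoff hD.isCompact_closure isOpen_univ
    (subset_univ _)
  obtain ⟨χ', -, -, ⟨V', -, hV', hV1'⟩, -⟩ := exists_smooth_cutoff hχ.isCompact isOpen_univ
    (subset_univ _)
  obtain ⟨κ, hκ⟩ := ftS_surjective χ'
  have hg : ∀ (j : Fin d) (l : ℕ), HasCompactSupport (coordPow j l χ) := fun j l ↦
    hasCompactSupport_smulLeft hχ
  have hgκ : ∀ (j : Fin d) (l : ℕ) x, coordPow j l χ x ≠ 0 → ftS κ x = 1 := fun j l x hx ↦ by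
    rw [hκ]
    refine hV1' x (hV' (subset_tsupport _ fun h ↦ hx ?_))
    rw [coordPow_apply, h, mul_zero]
  have hall : ∀ᵐ ω ∂P, ∀ (j : Fin d) (l : ℕ),
      MemLp (fun ξ ↦ weight (-t) ξ * f ω (modulated (coordPow j l χ) κ ξ)) 2 volume :=
    ae_all_iff.2 fun j ↦ ae_all_iff.2 fun l ↦ hf.ae_memLp_modulated (hg j l) (hgκ j l) ht htm
  filter_upwards [hall, hfD] with ω hω hωD
  refine exists_sobolevMap_of_coordPow hd hK fun j l _ ↦ ?_
  obtain ⟨M, hM, h⟩ := exists_norm_apply_smulLeft_besselS_le (hgκ j l) (hω j l)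
  refine ⟨M, hM, fun a ↦ ?_⟩
  rw [apply_congr_of_eqOn hV ((hωD.trans subset_closure).trans hDV) (φ' :=
    SchwartzMap.smulLeftCLM ℂ (coordPow j l χ) (besselS (-t) a)) fun x hx ↦ by
      rw [coordPow_apply, schwartz_smulLeft_apply, coordPow_apply, hV1 x hx, mul_one]]
  exact h a

section

open scoped Convolution

/-! ### Measurable versions of random square integrable functions -/

variable {Ω : Type*} [MeasurableSpace Ω] {P : Measure Ω}

theorem integral_mul_eq_inner (Z : Lp ℂ 2 (volume : Measure (Space d))) (a : 𝓢(Space d, ℂ)) :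
    ∫ x, Z x * a x = inner ℂ ((conjTest a).toLp 2 volume) Z := by
  rw [L2.inner_def]
  refine integral_congr_ae ?_
  filter_upwards [(conjTest a).coeFn_toLp 2 volume] with x h
  rw [h, conjTest_apply, RCLike.inner_apply, Complex.conj_conj]

theorem conjTest_conjTest (a : 𝓢(Space d, ℂ)) : conjTest (conjTest a) = a :=
  SchwartzMap.ext fun x ↦ by rw [conjTest_apply, conjTest_apply, Complex.conj_conj]

/-- Since Schwartz functions are dense, measurability of the pairings with them gives weak
measurability in `L²`. -/
theorem aemeasurable_inner {Y : Ω → Lp ℂ 2 (volume : Measure (Space d))}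
    (hY : ∀ a : 𝓢(Space d, ℂ), AEMeasurable (fun ω ↦ ∫ x, Y ω x * a x) P)
    (b : Lp ℂ 2 (volume : Measure (Space d))) : AEMeasurable (fun ω ↦ inner ℂ b (Y ω)) P := by
  obtain ⟨x, hx, hlim⟩ := mem_closure_iff_seq_limit.1
    (SchwartzMap.denseRange_toLpCLM (F := ℂ) (p := 2) (μ := (volume : Measure (Space d)))
      ENNReal.ofNat_ne_top b)
  choose a ha using hx
  refine aemeasurable_of_tendsto_metrizable_ae atTop (f := fun n ω ↦ inner ℂ (x n) (Y ω))
    (fun n ↦ ?_) (Eventually.of_forall fun ω ↦ hlim.inner tendsto_const_nhds)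
  refine (hY (conjTest (a n))).congr (Eventually.of_forall fun ω ↦ ?_)
  beta_reduce
  rw [integral_mul_eq_inner, conjTest_conjTest, ← ha]
  rfl

/-- Weak measurability is preserved by bounded operators. -/
theorem aemeasurable_integral_apply {Y : Ω → Lp ℂ 2 (volume : Measure (Space d))}
    (hY : ∀ a : 𝓢(Space d, ℂ), AEMeasurable (fun ω ↦ ∫ x, Y ω x * a x) P)
    (B : Lp ℂ 2 (volume : Measure (Space d)) →L[ℂ] Lp ℂ 2 (volume : Measure (Space d)))
    (a : 𝓢(Space d, ℂ)) : AEMeasurable (fun ω ↦ ∫ x, B (Y ω) x * a x) P := by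
  refine (aemeasurable_inner hY (ContinuousLinearMap.adjoint B ((conjTest a).toLp 2 volume))).congr
    (Eventually.of_forall fun ω ↦ ?_)
  beta_reduce
  rw [ContinuousLinearMap.adjoint_inner_left, integral_mul_eq_inner]

/-- A weakly measurable random element of `L²` has a jointly measurable version: the limit of its
mollifications. -/
theorem exists_measurable_uncurry_ae_eq {Z : Ω → Lp ℂ 2 (volume : Measure (Space d))}
    (hZ : ∀ a : 𝓢(Space d, ℂ), AEMeasurable (fun ω ↦ ∫ x, Z ω x * a x) P) :
    ∃ z : Space d → Ω → ℂ, Measurable (Function.uncurry z) ∧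
      ∀ᵐ ω ∂P, (fun x ↦ z x ω) =ᵐ[volume] Z ω := by
  let B : ℕ → ContDiffBump (0 : Space d) := fun n ↦
    ⟨((n : ℝ) + 1)⁻¹ / 2, ((n : ℝ) + 1)⁻¹, by positivity, half_lt_self (by positivity)⟩
  have hc : ∀ n, HasCompactSupport (Complex.ofRealCLM ∘ (B n).normed volume) := fun n ↦
    (B n).hasCompactSupport_normed.comp_left rfl
  have hs : ∀ n, ContDiff ℝ ((⊤ : ℕ∞) : WithTop ℕ∞) (Complex.ofRealCLM ∘ (B n).normed volume) :=
    fun n ↦ Complex.ofRealCLM.contDiff.comp (B n).contDiff_normed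
  let β : ℕ → 𝓢(Space d, ℂ) := fun n ↦ (hc n).toSchwartzMap (hs n)
  let H : ℕ → Space d → Ω → ℂ := fun n x ω ↦ ∫ y, Z ω y * (β n).compSubConstCLM ℂ x y
  have hHc : ∀ n ω, Continuous fun x ↦ H n x ω := fun n ω ↦ by
    refine (continuous_apply_translate (Z ω : 𝓢'(Space d, ℂ)) (β n)).congr fun x ↦ ?_
    rw [Lp.toTemperedDistribution_apply]
    simp only [H, smul_eq_mul, mul_comm]
  choose N hNm hN0 hN using fun n ↦
    exists_measurable_uncurry_indicator (hHc n) fun x ↦ hZ ((β n).compSubConstCLM ℂ x)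
  refine ⟨fun x ω ↦ limUnder atTop fun n ↦ (N n)ᶜ.indicator (H n x) ω,
    (StronglyMeasurable.limUnder (l := atTop) fun n ↦ (hN n).stronglyMeasurable).measurable, ?_⟩
  have hN' : ∀ᵐ ω ∂P, ∀ n, ω ∉ N n :=
    ae_all_iff.2 fun n ↦ measure_eq_zero_iff_ae_notMem.1 (hN0 n)
  filter_upwards [hN'] with ω hω
  have hlim := ContDiffBump.ae_convolution_tendsto_right_of_locallyIntegrable (φ := B) (l := atTop)
    (K := 2) (μ := (volume : Measure (Space d))) (g := Z ω)
    (by simpa [B] using tendsto_one_div_add_atTop_nhds_zero_nat (𝕜 := ℝ))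
    (Eventually.of_forall fun n ↦ by simp only [B]; linarith)
    ((Lp.memLp (Z ω)).locallyIntegrable (by norm_num))
  filter_upwards [hlim] with x hx
  refine (hx.congr fun n ↦ ?_).limUnder_eq
  rw [indicator_of_mem (mem_compl (hω n)), convolution_eq_swap]
  congr 1; ext y
  have e : (β n) (y - x) = ((B n).normed volume (x - y) : ℂ) := by
    rw [← neg_sub y x, (B n).normed_neg]; rfl
  rw [SchwartzMap.compSubConstCLM_apply, e, mul_comm]
  simp

/-! ### The Lippmann–Schwinger equation -/

/-- The pairings of `∫ G^k(· - z) f(z) dz` with test functions are random variables. -/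
theorem IsGMIGField.aemeasurable_integral_mul {D : Set (Space d)} {m : ℝ}
    {f : Ω → 𝓢'(Space d, ℂ)} (hf : IsGMIGField P D m f) (hD : Bornology.IsBounded D)
    (hfD : ∀ᵐ ω ∂P, Distribution.dsupport (f ω) ⊆ D) {α k t s : ℝ} {G : 𝓢'(Space d, ℂ)}
    (hG : ∀ ψ, G ψ = green α k ψ) {Y : Ω → Lp ℂ 2 (volume : Measure (Space d))}
    (hY : ∀ᵐ ω ∂P, IsGreenConvolution α k (f ω) (sobolevMap t (-s) (Y ω))) (a : 𝓢(Space d, ℂ)) :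
    AEMeasurable (fun ω ↦ ∫ x, Y ω x * a x) P := by
  set ψ := besselS t (SchwartzMap.smulLeftCLM ℂ (weight (-s)) a) with hψ
  obtain ⟨η, hη, V, hV, hDV, hηV⟩ := exists_schwartz_eqOn hD.isCompact_closure
    (contDiff_apply_translate G ψ)
  refine (hf.gaussian η hη).aemeasurable.congr ?_
  filter_upwards [hY, hfD] with ω hω hωD
  have e : ∫ x, Y ω x * a x = sobolevMap t (-s) (Y ω) ψ := by
    rw [sobolevMap_apply, hψ, besselS_besselS, neg_add_cancel, besselS_zero, neg_neg]
    congr 1; ext x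
    have := weight_mul_weight s (-s) x
    rw [add_neg_cancel, weight_zero] at this
    rw [SchwartzMap.smulLeftCLM_apply_apply (by fun_prop), smul_eq_mul]
    linear_combination (-(Y ω x * a x)) * this
  obtain ⟨η', ⟨V', hV', hfV', hη'⟩, e'⟩ := hω ψ
  rw [e, e']
  refine apply_congr_of_eqOn (hV.inter hV')
    (subset_inter ((hωD.trans subset_closure).trans hDV) hfV') fun x hx ↦ ?_
  rw [hηV x hx.1, hη' x hx.2, hG]

/-- The Lippmann–Schwinger equation with a contraction `T` and the right-hand side in terms of
elements of `L²`. -/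
theorem isLippmannSchwingerSolution_iff {α k t s : ℝ} {q : Space d → ℂ}
    {T R : Lp ℂ 2 (volume : Measure (Space d)) →L[ℂ] Lp ℂ 2 (volume : Measure (Space d))}
    (hT : ∀ Y, potentialOp α k q (sobolevMap t (-s) Y) = sobolevMap t (-s) (T Y))
    (hR : ∀ Y, R Y + T (R Y) = Y) (hR' : ∀ Y Z, Z + T Z = Y → Z = R Y)
    {f : 𝓢'(Space d, ℂ)} {Y : Lp ℂ 2 (volume : Measure (Space d))}
    (hf : resolventOp α k f = sobolevMap t (-s) Y) (w : 𝓢'(Space d, ℂ)) :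
    IsLippmannSchwingerSolution α k q t (-s) f w ↔ w = sobolevMap t (-s) (R Y) := by
  constructor
  · rintro ⟨hw, hwe⟩
    obtain ⟨W, rfl⟩ := exists_sobolevMap_of_sobolevNorm_lt_top hw
    rw [hT, hf, ← map_add] at hwe
    rw [hR' Y W (sobolevMap_injective _ _ hwe)]
  · rintro rfl
    refine ⟨by rw [sobolevNorm_sobolevMap]; exact enorm_lt_top, ?_⟩
    rw [hT, hf, ← map_add, hR]

end

end FracHelmholtz

end

theorem mainTheorem4 (d : ℕ) (hd : d = 1 ∨ d = 2 ∨ d = 3) (α : ℝ) (hα : α ∈ Ioo (0 : ℝ) 1)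
    (m : ℝ) (hm : m ∈ Ioo ((d : ℝ) - 2 * α) (d : ℝ))
    (t : ℝ) (ht : t ∈ Ioo (((d : ℝ) - m) / 2) α) (ε : ℝ) (hε : 0 < ε)
    (k₀ k₁ : ℝ) (hk₀ : 0 < k₀) (ρ : ℝ≥0∞) (hρ : ρ < 1) :
    ∃ C : ℝ≥0,
      ∀ k ∈ Icc k₀ k₁,
      ∀ (U : Set (Space d)) (q : Space d → ℂ), IsOpen U → Bornology.IsBounded U →
        MemLp q 2 volume → Function.support q ⊆ U →
        potentialOpNorm α k q t (-1 / 2 - ε) ≤ ρ →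
      ∀ (Ω : Type*) [MeasurableSpace Ω] (P : Measure Ω) [IsProbabilityMeasure P]
        (D : Set (Space d)) (f : Ω → 𝓢'(Space d, ℂ)), IsOpen D → Bornology.IsBounded D →
        IsGMIGField P D m f → (∀ᵐ ω ∂P, Distribution.dsupport (f ω) ⊆ D) →
        ∃ u : Space d → Ω → ℂ, Measurable (Function.uncurry u) ∧
          ∀ᵐ ω ∂P, ∃ v : 𝓢'(Space d, ℂ),
            IsRepresentedBy v (fun x ↦ u x ω) ∧
            IsLippmannSchwingerSolution α k q t (-1 / 2 - ε) (f ω) v ∧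
            (∀ w : 𝓢'(Space d, ℂ),
              IsLippmannSchwingerSolution α k q t (-1 / 2 - ε) (f ω) w → w = v) ∧
            sobolevNorm (-t) (1 / 2 + ε) (f ω) < ∞ ∧
            sobolevNorm t (-1 / 2 - ε) v ≤ C * sobolevNorm (-t) (1 / 2 + ε) (f ω) := by
  have hd0 : 0 < d := by omega
  have ht0 : 0 < t := by
    have h1 := ht.1
    have h2 := hm.2
    linarith
  have htm : (d : ℝ) < 2 * t + m := by linarith [ht.1]
  set s : ℝ := 1 / 2 + ε with hs
  have hs0 : 0 ≤ s := by positivity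
  rw [show -1 / 2 - ε = -s by rw [hs]; ring]
  lift ρ to ℝ≥0 using hρ.ne_top
  have hρ1 : (ρ : ℝ) < 1 := by exact_mod_cast hρ
  obtain ⟨C, hC, hCb⟩ := exists_norm_green_le hd (s := s) k₁ hα.1 ht0.le ht.2.le
    (by rw [hs]; linarith) hk₀
  have hCρ : 0 ≤ (1 - (ρ : ℝ))⁻¹ := inv_nonneg.2 (by linarith)
  refine ⟨((1 - (ρ : ℝ))⁻¹ * (C * Real.sqrt (3 ^ s))).toNNReal, ?_⟩
  intro k hk U q _ hU hq hqU hKρ Ω _ P _ D f _ hD hf hfD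
  obtain ⟨G, hG⟩ := exists_temperedDistribution_green hd hα.1 (hk₀.trans_le hk.1)
  obtain ⟨T, hTρ, hT⟩ := exists_potentialOp_eq ht0.le hG hU hq hqU hKρ
  obtain ⟨R, hR, hRn, hR'⟩ := exists_inverse_one_add hTρ hρ1
  obtain ⟨K, A, hA⟩ := exists_isRepresentedBy_sobolevMap (d := d) ht0.le s
  -- almost surely `f` belongs to `H^{-t}_s`, and `H_k f` is bounded in `H^t_{-s}`
  have hfY : ∀ᵐ ω ∂P, ∃ Y Y₀, f ω = sobolevMap (-t) s Y₀ ∧ ‖Y‖ ≤ C * Real.sqrt (3 ^ s) * ‖Y₀‖ ∧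
      IsGreenConvolution α k (f ω) (sobolevMap t (-s) Y) := by
    filter_upwards [hf.ae_exists_sobolevMap hd0 hD hfD ht0.le htm s, hfD] with ω ⟨Y₀, hY₀⟩ hωD
    have hc := isCompact_dsupport (hD.subset hωD)
    rw [hY₀] at hc ⊢
    obtain ⟨Y, hY, hYG⟩ := exists_isGreenConvolution hs0 hC (hCb k hk) hG hc
    exact ⟨Y, Y₀, rfl, hY, hYG⟩
  -- A choice of `H_k f` for each `ω`. It is weakly measurable because its pairings with test
  -- functions do not depend on the choice.
  classical
  let Y : Ω → Lp ℂ 2 (volume : Measure (Space d)) := fun ω ↦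
    if h : ∃ Y Y₀, f ω = sobolevMap (-t) s Y₀ ∧ ‖Y‖ ≤ C * Real.sqrt (3 ^ s) * ‖Y₀‖ ∧
      IsGreenConvolution α k (f ω) (sobolevMap t (-s) Y) then h.choose else 0
  have hY : ∀ᵐ ω ∂P, ∃ Y₀, f ω = sobolevMap (-t) s Y₀ ∧ ‖Y ω‖ ≤ C * Real.sqrt (3 ^ s) * ‖Y₀‖ ∧
      IsGreenConvolution α k (f ω) (sobolevMap t (-s) (Y ω)) := by
    filter_upwards [hfY] with ω hω
    simp only [Y, dif_pos hω]
    exact hω.choose_spec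
  have hYm := hf.aemeasurable_integral_mul (t := t) (s := s) hD hfD hG
    (hY.mono fun ω ⟨_, _, _, h⟩ ↦ h)
  obtain ⟨z, hzm, hz⟩ := exists_measurable_uncurry_ae_eq (aemeasurable_integral_apply hYm (A ∘L R))
  refine ⟨fun x ω ↦ weight K x * z x ω,
    ((weight_continuous (K : ℝ)).measurable.comp measurable_fst).mul hzm, ?_⟩
  filter_upwards [hY, hz] with ω ⟨Y₀, hY₀, hYn, hYG⟩ hzω
  have hsol := isLippmannSchwingerSolution_iff hT hR hR' hYG.resolventOp_eq
  refine ⟨sobolevMap t (-s) (R (Y ω)), (hA (R (Y ω))).congr_ae ?_, (hsol _).2 rfl,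
    fun w hw ↦ (hsol w).1 hw, ?_, ?_⟩
  · filter_upwards [hzω] with x hx
    rw [hx]
    rfl
  · rw [hY₀, sobolevNorm_sobolevMap]
    exact enorm_lt_top
  · rw [hY₀, sobolevNorm_sobolevMap, sobolevNorm_sobolevMap, enorm_eq_nnnorm, enorm_eq_nnnorm,
      ← ENNReal.coe_mul, ENNReal.coe_le_coe, ← NNReal.coe_le_coe,
      NNReal.coe_mul, Real.coe_toNNReal _ (by positivity), coe_nnnorm, coe_nnnorm, mul_assoc]
    exact (hRn _).trans (mul_le_mul_of_nonneg_left hYn hCρ)
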